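/- Let $\Omega\subset\mathbb R^2$ be a bounded polygonal domain, and consider the Dirichlet problem $$-\nabla\cdot(\alpha\nabla u)+\boldsymbol\beta\cdot\nabla u+cu=f\ \text{ in }\Omega,\qquad u=g\ \text{ on }\partial\Omega ,\tag{1}$$ with $f\in L^2(\Omega)$, $\alpha\in C^1(\bar\Omega)$, $\boldsymbol\beta\in C^1(\bar\Omega)^2$, $c\in L^\infty(\Omega)$, and $$c-\tfrac12\nabla\cdot\boldsymbol\beta\ge 0,\qquad \alpha\ge\alpha_0>0\quad\text{in }\Omega .$$ (The differential equation is understood weakly, the boundary condition in the sense of traces.) *Partitions.* Let $\mathcal T_h$ be a finite partition of $\bar\Omega$ into closed simple polygons $T$ with disjoint interiors, such that every edge of every $T$ lies on $\partial\Omega$ or is also an edge of another polygon of the partition (consecutive edges of a polygon may be collinear). Write $h_T$ for the diameter of $T$ and $h=\max_T h_T$. The partition is shape regular with parameter $\varrho>0$ if every $T$ is star-shaped with respect to all points of some disc of radius $\varrho h_T$ and all edges of $T$ have length at least $\varrho h_T$. *Simplified weak Galerkin scheme.* For $T$ with edges $e_1,\dots,e_N$, midpoints $M_i$ and unit outward normals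 $\mathbf n_i$, and for a function $v_b$ on $\partial T$ with constant values $v_{b,i}$ on $e_i$, let $$\nabla_w v_b=\frac1{|T|}\sum_{i=1}^N v_{b,i}|e_i|\mathbf n_i ,$$ and let $\mathfrak s(v_b)\in P_1(T)$ be given by $\sum_{i=1}^N(\mathfrak s(v_b)(M_i)-v_{b,i})\,\phi(M_i)\,|e_i|=0$ for all $\phi\in P_1(T)$. Let $W_h$ be the space of functions that are constant on each edge and single-valued on common edges, and $W_h^0$ its subspace of functions vanishing on the boundary edges. For a fixed $\kappa>0$, $u_b\in W_h$ is a solution of the scheme if on each boundary edge $u_b$ equals the average of $g$ over that edge and, for all $v_b\in W_h^0$, $$\kappa\sum_T h^{-1}\sum_{i}(\mathfrak s(u_b)(M_i)-u_{b,i})(\mathfrak s(v_b)(M_i)-v_{b,i})|e_i|+\sum_T\big[(\alpha\nabla_w u_b,\nabla_w v_b)_T+(\boldsymbol\beta\cdot\nabla_w u_b,\mathfrak s(v_b))_T+(c\,\mathfrak s(u_b),\mathfrak s(v_b))_T\big]=\sum_T(f,\mathfrak s(v_b))_T .$$ *Regularity assumption.* For every $\chi\in L^2(\Omega)$ the adjoint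 problem $$-\nabla\cdot(\alpha\nabla\Phi)-\nabla\cdot(\boldsymbol\beta\Phi)+c\Phi=\chi\ \text{ in }\Omega,\qquad \Phi=0\ \text{ on }\partial\Omega$$ has a weak solution $\Phi\in H_0^1(\Omega)\cap H^2(\Omega)$ with $\|\Phi\|_2\le C_{\rm reg}\|\chi\|$, where $C_{\rm reg}$ does not depend on $\chi$. **Theorem.** Under these assumptions there are constants $h_0>0$ and $C>0$, depending only on $\Omega,\alpha,\boldsymbol\beta,c,\kappa$ and $\varrho$, such that for every partition $\mathcal T_h$ that is shape regular with parameter $\varrho$ and satisfies $h\le h_0$, for all data $f,g$ for which the solution $u$ of (1) is in $H^2(\Omega)$, and for every solution $u_b\in W_h$ of the scheme, $$\|u-\mathfrak s(u_b)\|\le C\,h^2\,\|u\|_2 .$$ Here $\|\cdot\|$ is the norm of $L^2(\Omega)$ and $\|\cdot\|_2$ that of $H^2(\Omega)$. -/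

import Mathlib

open MeasureTheory Filter Topology Set
open scoped ContDiff

namespace SWG

noncomputable section

/-- The Euclidean plane. -/
abbrev E : Type := EuclideanSpace ℝ (Fin 2)

/-! ### Function spaces on a plane open set -/

/-- The classical partial derivative `∂φ/∂xᵢ`. -/
def pderiv (i : Fin 2) (φ : E → ℝ) (x : E) : ℝ :=
  fderiv ℝ φ x (EuclideanSpace.single i 1)

/-- Test functions: smooth with compact support inside `Ω`. -/
def IsTest (Ω : Set E) (φ : E → ℝ) : Prop :=
  ContDiff ℝ ∞ φ ∧ HasCompactSupport φ ∧ tsupport φ ⊆ Ω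

/-- `w` is a square integrable weak partial derivative `∂u/∂xᵢ` on `Ω`. -/
def IsWeakPartial (Ω : Set E) (i : Fin 2) (u w : E → ℝ) : Prop :=
  MemLp w 2 (volume.restrict Ω) ∧
    ∀ φ : E → ℝ, IsTest Ω φ →
      ∫ x in Ω, u x * pderiv i φ x = - ∫ x in Ω, w x * φ x

/-- The Sobolev space `H¹(Ω)`. -/
def MemH1 (Ω : Set E) (u : E → ℝ) : Prop :=
  MemLp u 2 (volume.restrict Ω) ∧ ∀ i, ∃ w, IsWeakPartial Ω i u w

open Classical in
/-- The weak partial derivative `∂u/∂xᵢ` (unique up to null sets when it exists; `0` otherwise). -/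
def weakPartial (Ω : Set E) (i : Fin 2) (u : E → ℝ) : E → ℝ :=
  if h : ∃ w, IsWeakPartial Ω i u w then h.choose else 0

/-- The Sobolev space `H²(Ω)`. -/
def MemH2 (Ω : Set E) (u : E → ℝ) : Prop :=
  MemH1 Ω u ∧ ∀ i, MemH1 Ω (weakPartial Ω i u)

/-- The norm of `L²(S)` (for `f ∈ L²(S)`). -/
def l2Norm (S : Set E) (f : E → ℝ) : ℝ := √(∫ x in S, f x ^ 2)

/-- The norm of `H²(Ω)` (for `u ∈ H²(Ω)`). -/
def h2Norm (Ω : Set E) (u : E → ℝ) : ℝ :=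
  √(l2Norm Ω u ^ 2 + ∑ i, l2Norm Ω (weakPartial Ω i u) ^ 2
    + ∑ i, ∑ j, l2Norm Ω (weakPartial Ω j (weakPartial Ω i u)) ^ 2)

/-- The functions `w n` (with classical partial derivatives) converge to `u` in `H¹(Ω)`. -/
def TendstoH1 (Ω : Set E) (w : ℕ → E → ℝ) (u : E → ℝ) : Prop :=
  Tendsto (fun n => eLpNorm (fun x => w n x - u x) 2 (volume.restrict Ω)) atTop (𝓝 0) ∧
    ∀ i, Tendsto (fun n => eLpNorm (fun x => pderiv i (w n) x - weakPartial Ω i u x) 2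
      (volume.restrict Ω)) atTop (𝓝 0)

/-- The space `H₀¹(Ω)`: the closure of the test functions in `H¹(Ω)`. -/
def MemH10 (Ω : Set E) (u : E → ℝ) : Prop :=
  MemH1 Ω u ∧ ∃ w : ℕ → E → ℝ, (∀ n, IsTest Ω (w n)) ∧ TendstoH1 Ω w u

/-- `u = g` on `∂Ω` in the sense of traces: `(u, g)` is a limit, in `H¹(Ω) × L²(∂Ω)`, of
pairs `(w, w|_{∂Ω})` with `w` smooth on the plane. -/
def HasTrace (Ω : Set E) (u g : E → ℝ) : Prop :=
  MemH1 Ω u ∧ MemLp g 2 ((Measure.hausdorffMeasure 1).restrict (frontier Ω)) ∧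
    ∃ w : ℕ → E → ℝ, (∀ n, ContDiff ℝ ∞ (w n)) ∧ TendstoH1 Ω w u ∧
      Tendsto (fun n => eLpNorm (fun x => w n x - g x) 2
        ((Measure.hausdorffMeasure 1).restrict (frontier Ω))) atTop (𝓝 0)

/-- `f ∈ C¹(Ω̄)` for a bounded open set `Ω`: `f` is `C¹` in `Ω`, and `f` and its derivative extend
continuously to the (compact) closure. -/
def IsC1Closure {F : Type*} [NormedAddCommGroup F] [NormedSpace ℝ F]
    (Ω : Set E) (f : E → F) : Prop :=
  ContDiffOn ℝ 1 f Ω ∧ UniformContinuousOn f Ω ∧ UniformContinuousOn (fderiv ℝ f) Ω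

/-- The divergence of a vector field. -/
def divergence (β : E → E) (x : E) : ℝ :=
  ∑ i, (fderiv ℝ β x (EuclideanSpace.single i 1)) i

/-! ### The boundary value problem and its adjoint -/

/-- `-∇·(α∇u) + β·∇u + cu = f` in `Ω`, for `u ∈ H¹(Ω)`. -/
def SolvesPDE (Ω : Set E) (α : E → ℝ) (β : E → E) (c f u : E → ℝ) : Prop :=
  ∀ φ : E → ℝ, IsTest Ω φ →
    ∫ x in Ω, (α x * ∑ i, weakPartial Ω i u x * pderiv i φ x
      + (∑ i, β x i * weakPartial Ω i u x) * φ x + c x * u x * φ x)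
      = ∫ x in Ω, f x * φ x

/-- `-∇·(α∇Φ) - ∇·(βΦ) + cΦ = χ` in `Ω`, for `Φ ∈ H¹(Ω)`. -/
def SolvesAdjoint (Ω : Set E) (α : E → ℝ) (β : E → E) (c χ Φ : E → ℝ) : Prop :=
  ∀ φ : E → ℝ, IsTest Ω φ →
    ∫ x in Ω, (α x * ∑ i, weakPartial Ω i Φ x * pderiv i φ x
      + Φ x * ∑ i, β x i * pderiv i φ x + c x * Φ x * φ x)
      = ∫ x in Ω, χ x * φ x

/-- The adjoint Dirichlet problem is `H²`-regular: for every `χ ∈ L²(Ω)` it has a solution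
`Φ ∈ H₀¹(Ω) ∩ H²(Ω)` with `‖Φ‖₂ ≤ C ‖χ‖`, the constant `C` not depending on `χ`. -/
def AdjointH2Regular (Ω : Set E) (α : E → ℝ) (β : E → E) (c : E → ℝ) : Prop :=
  ∃ C : ℝ, ∀ χ : E → ℝ, MemLp χ 2 (volume.restrict Ω) →
    ∃ Φ : E → ℝ, MemH10 Ω Φ ∧ MemH2 Ω Φ ∧ SolvesAdjoint Ω α β c χ Φ ∧
      h2Norm Ω Φ ≤ C * l2Norm Ω χ

/-! ### Polygons and polygonal partitions -/

/-- A bounded polygonal domain: a nonempty bounded connected open set that is the interior of its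
closure (no cracks), with boundary contained in a finite union of segments. -/
def IsPolygonalDomain (Ω : Set E) : Prop :=
  IsOpen Ω ∧ IsConnected Ω ∧ Bornology.IsBounded Ω ∧ interior (closure Ω) = Ω ∧
    ∃ s : Finset (E × E), frontier Ω ⊆ ⋃ p ∈ s, segment ℝ p.1 p.2

/-- A closed polygon `T`: its vertices, listed counterclockwise along a simple closed polygonal
curve, and the compact region bounded by this curve. Consecutive edges may be collinear, so that
a vertex of a neighbouring polygon may lie inside a side of `T`. -/
structure Poly where
  /-- the number `N` of edges -/
  N : ℕ
  three_le : 3 ≤ N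
  /-- the cyclic list of vertices -/
  vert : Polygon E N
  injective : Function.Injective vert.vertices
  /-- two distinct edges meet at most in a common endpoint of consecutive edges -/
  simple : ∀ i j, i ≠ j → ∀ x ∈ vert.edgeSet ℝ i ∩ vert.edgeSet ℝ j,
    (j = finRotate N i ∧ x = vert j) ∨ (i = finRotate N j ∧ x = vert i)
  /-- counterclockwise orientation: the signed area is positive -/
  ccw : 0 < ∑ i, (vert i 0 * vert (finRotate N i) 1 - vert (finRotate N i) 0 * vert i 1)
  /-- the region `T` -/
  carrier : Set E
  isCompact : IsCompact carrier
  interior_nonempty : (interior carrier).Nonempty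
  frontier_eq : frontier carrier = vert.boundary ℝ

namespace Poly

variable (T : Poly)

/-- The edge `eᵢ`, as a closed segment. -/
def edge (i : Fin T.N) : Set E := T.vert.edgeSet ℝ i

/-- The length `|eᵢ|`. -/
def len (i : Fin T.N) : ℝ := dist (T.vert i) (T.vert (finRotate T.N i))

/-- The midpoint `Mᵢ` of `eᵢ`. -/
def mid (i : Fin T.N) : E := midpoint ℝ (T.vert i) (T.vert (finRotate T.N i))

/-- The unit outward normal `nᵢ` on `eᵢ`: the unit tangent turned clockwise by a right angle. -/
def normal (i : Fin T.N) : E :=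
  (T.len i)⁻¹ • !₂[T.vert (finRotate T.N i) 1 - T.vert i 1,
    T.vert i 0 - T.vert (finRotate T.N i) 0]

/-- The area `|T|`. -/
def area : ℝ := volume.real T.carrier

/-- The diameter `h_T`. -/
def diam : ℝ := Metric.diam T.carrier

/-- The weak gradient `∇_w v = |T|⁻¹ ∑ᵢ vᵢ |eᵢ| nᵢ` of a piecewise constant function on `∂T`. -/
def weakGrad (v : Fin T.N → ℝ) : E :=
  T.area⁻¹ • ∑ i, (v i * T.len i) • T.normal i

/-- `p ∈ P₁(T)` is a weighted least-squares fit of the edge values `v` at the edge midpoints. -/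
def IsLinExt (v : Fin T.N → ℝ) (p : E →ᵃ[ℝ] ℝ) : Prop :=
  ∀ φ : E →ᵃ[ℝ] ℝ, ∑ i, (p (T.mid i) - v i) * φ (T.mid i) * T.len i = 0

theorem exists_isLinExt (v : Fin T.N → ℝ) : ∃ p : E →ᵃ[ℝ] ℝ, T.IsLinExt v p := by
  let L : (E →ᵃ[ℝ] ℝ) →ₗ[ℝ] EuclideanSpace ℝ (Fin T.N) :=
    { toFun := fun φ => WithLp.toLp 2 fun i => √(T.len i) * φ (T.mid i)
      map_add' := by intro a b; ext i; simp [mul_add]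
      map_smul' := by intro a b; ext i; simp [mul_left_comm] }
  let y : EuclideanSpace ℝ (Fin T.N) := WithLp.toLp 2 fun i => √(T.len i) * v i
  obtain ⟨p, hp⟩ : (LinearMap.range L).starProjection y ∈ LinearMap.range L :=
    Submodule.starProjection_apply_mem _ _
  refine ⟨p, fun φ => ?_⟩
  have h := Submodule.starProjection_inner_eq_zero (K := LinearMap.range L) y (L φ) ⟨φ, rfl⟩
  rw [← hp, PiLp.inner_apply] at h
  rw [← neg_eq_zero, ← h, ← Finset.sum_neg_distrib]
  refine Finset.sum_congr rfl fun i _ => ?_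
  have hl : √(T.len i) * √(T.len i) = T.len i := Real.mul_self_sqrt dist_nonneg
  simp only [L, y, LinearMap.coe_mk, AddHom.coe_mk, PiLp.sub_apply, RCLike.inner_apply, conj_trivial]
  linear_combination (v i - p (T.mid i)) * φ (T.mid i) * (-hl)

/-- The linear extension `𝔰(v) ∈ P₁(T)` of the edge values `v`. -/
def ext (v : Fin T.N → ℝ) : E →ᵃ[ℝ] ℝ := (T.exists_isLinExt v).choose

/-- The average of `g` over the edge `eᵢ`, with respect to arc length. -/
def edgeAvg (g : E → ℝ) (i : Fin T.N) : ℝ :=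
  ⨍ x in T.edge i, g x ∂(Measure.hausdorffMeasure 1)

/-- Shape regularity with parameter `ρ`: `T` is star-shaped with respect to every point of a disc of
radius `ρ h_T`, and every edge has length at least `ρ h_T`. -/
def ShapeRegular (ρ : ℝ) : Prop :=
  (∃ x₀ : E, ∀ y ∈ Metric.ball x₀ (ρ * T.diam), StarConvex ℝ y T.carrier) ∧
    ∀ i, ρ * T.diam ≤ T.len i

end Poly

/-- A finite partition of `Ω` into non-overlapping closed polygons; every edge lies on `∂Ω` or is an
edge of a second polygon of the partition. -/
structure PolyMesh (Ω : Set E) where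
  card : ℕ
  elem : Fin card → Poly
  cover : ⋃ t, (elem t).carrier = closure Ω
  nonoverlapping : ∀ t t', t ≠ t' →
    Disjoint (interior (elem t).carrier) (interior (elem t').carrier)
  conforming : ∀ t i, (elem t).edge i ⊆ frontier Ω ∨
    ∃ t' i', t' ≠ t ∧ (elem t').edge i' = (elem t).edge i

namespace PolyMesh

variable {Ω : Set E} (M : PolyMesh Ω)

/-- The mesh size `h = max_T h_T`. -/
def meshSize : ℝ := ⨆ t, (M.elem t).diam

/-- Every element is shape regular with the parameter `ρ`. -/
def ShapeRegular (ρ : ℝ) : Prop := ∀ t, (M.elem t).ShapeRegular ρ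

/-- Edge values: one real number for each edge of each element. -/
abbrev EdgeFun : Type := ∀ t, Fin (M.elem t).N → ℝ

/-- The space `W_h` of edge values that are single-valued on common edges. -/
def Wh : Set M.EdgeFun :=
  {v | ∀ t i t' i', (M.elem t).edge i = (M.elem t').edge i' → v t i = v t' i'}

/-- The space `W_h⁰` of functions in `W_h` that vanish on the boundary edges. -/
def Wh0 : Set M.EdgeFun :=
  {v | v ∈ M.Wh ∧ ∀ t i, (M.elem t).edge i ⊆ frontier Ω → v t i = 0}

/-- The stabilizer `S(u, v) = ∑_T h⁻¹ ∑ᵢ (𝔰(u)(Mᵢ) - uᵢ)(𝔰(v)(Mᵢ) - vᵢ)|eᵢ|`. -/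
def stab (u v : M.EdgeFun) : ℝ :=
  ∑ t, M.meshSize⁻¹ * ∑ i,
    ((M.elem t).ext (u t) ((M.elem t).mid i) - u t i) *
      ((M.elem t).ext (v t) ((M.elem t).mid i) - v t i) * (M.elem t).len i

/-- `ℬ(u, v) = ∑_T (α∇_w u, ∇_w v)_T + (β·∇_w u, 𝔰(v))_T + (c𝔰(u), 𝔰(v))_T`. -/
def bform (α : E → ℝ) (β : E → E) (c : E → ℝ) (u v : M.EdgeFun) : ℝ :=
  ∑ t, ((∫ x in (M.elem t).carrier,
        α x * inner ℝ ((M.elem t).weakGrad (u t)) ((M.elem t).weakGrad (v t)))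
    + (∫ x in (M.elem t).carrier,
        inner ℝ (β x) ((M.elem t).weakGrad (u t)) * (M.elem t).ext (v t) x)
    + ∫ x in (M.elem t).carrier,
        c x * (M.elem t).ext (u t) x * (M.elem t).ext (v t) x)

/-- `u` solves the simplified weak Galerkin scheme with stabilization parameter `κ`, right-hand side
`f` and Dirichlet data `g`. -/
def IsSWGSolution (κ : ℝ) (α : E → ℝ) (β : E → E) (c f g : E → ℝ) (u : M.EdgeFun) : Prop :=
  u ∈ M.Wh ∧
    (∀ t i, (M.elem t).edge i ⊆ frontier Ω → u t i = (M.elem t).edgeAvg g i) ∧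
    ∀ v ∈ M.Wh0, κ * M.stab u v + M.bform α β c u v
      = ∑ t, ∫ x in (M.elem t).carrier, f x * (M.elem t).ext (v t) x

/-- The error `‖u - 𝔰(u_b)‖` in `L²(Ω)`, where `𝔰(u_b)` is defined element by element. -/
def l2Error (u : E → ℝ) (ub : M.EdgeFun) : ℝ :=
  √(∑ t, ∫ x in (M.elem t).carrier, (u x - (M.elem t).ext (ub t) x) ^ 2)

end PolyMesh

end

end SWG

/-!
# Second order convergence of the simplified weak Galerkin scheme

The discrete error is compared with an interpolant of `u` in the discrete space, and a duality
argument of Schatz type gains the second order. The interpolant consists of the averages of `u` over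
the edges. It is defined without trace theory: for a triangle with apex `x₀` and base `e`, the radial
formula expresses the average of a smooth `W` over `e` through an integral of `2 W + ∇W · (x - x₀)`
over the triangle, and this integral makes sense for every `W` with a square integrable weak gradient
(`SWG.edgeMean`). Weak differentiability is used in the form `SWG.HasWeakGrad` of local approximation
by `C¹` functions, which is stable under products with the coefficients. Smooth approximation shows
that the edge averages from the two sides of an interior edge agree (`HasWeakGrad.edgeMean_eq`), and
that on boundary edges they are the averages of the trace (`edgeMean_eq_edgeAvg`).

On a shape regular polygon `T`, all edges are seen counterclockwise from the centre
(`StarAbout.dblArea_pos`), so `T` is, up to a null set, the disjoint union of the triangles spanned by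
the centre and the edges. Summation over these triangles gives the divergence theorem
(`StarAbout.setIntegral_grad`): the integral of `∂ⱼW` over `T` is the sum of `|eᵢ| nᵢⱼ` times the edge
averages. Three local facts rest on it.

* The weak gradient of the edge averages of `u` is the mean of `∇u`
  (`Poly.Regular.weakGrad_edgeMean`).
* The affine extension of the edge averages differs from `u` by a multiple of `h_T²` times the norm of
  the second derivatives, and the stabilizer of the edge averages is of matching size
  (`Poly.Regular.l2Norm_sub_ext_edgeMean_le`). This uses the Poincaré inequality on star-shaped sets
  (`HasWeakGrad.poincare`) for `u - ℓ`, where `ℓ` is affine with the mean value and mean gradient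
  of `u`.
* For a flux `W` and edge values `v`, the sum `∫ ∂ⱼW 𝔰(v) + ∫ W (∇_w v)ⱼ` over `T` equals
  `∑ |eᵢ| nᵢⱼ vᵢ` times the edge averages of `W`, up to a quantity of size
  `h ‖∇W‖ (‖∇_w v‖ + stabilizer)` (`Poly.Regular.abs_consistency_le`).

In the sum over the elements the edge terms cancel, because the normals on the two sides of an
interior edge are opposite and `v` vanishes on the boundary (`PolyMesh.sum_edges_eq_zero`). This is
the first order consistency of the scheme, both for the equation and for its adjoint.

The rest is an argument in Hilbert space. Let `e` be the interpolant minus the discrete solution.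
Testing with `e` gives `|e| ≤ C (h ‖u‖₂ + ‖𝔰(e)‖)` in the energy norm (`Discretization.energy_le`).
The adjoint problem with right-hand side `𝔰(e)` has a solution `Φ` with `‖Φ‖₂ ≤ C ‖𝔰(e)‖`, and testing
with `Φ` and its interpolant gives `‖𝔰(e)‖ ≤ C h (h ‖u‖₂ + |e| + ‖𝔰(e)‖)`
(`Discretization.error_le`). The terms that look like first order only, such as
`(α (∇_w q - ∇u), ∇Φ)` for the interpolant `q` of `u`, are of second order because `∇_w q` is the
piecewise mean of `∇u`, so that `∇_w q - ∇u` is orthogonal to piecewise constants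
(`PolyMesh.abs_inner_means_sub_le`). For small `h` the energy estimate is inserted and the term
`C h ‖𝔰(e)‖` is absorbed.
-/

namespace SWG

noncomputable section

open scoped Convolution

/-! ### Weakly differentiable functions as local limits of `C¹` functions -/

/-- Convolution with a normed bump function does not increase the `L²` norm. -/
theorem eLpNorm_normed_convolution_le (φ : ContDiffBump (0 : E)) {f : E → ℝ}
    (hf : MemLp f 2 volume) :
    eLpNorm (φ.normed volume ⋆[ContinuousLinearMap.lsmul ℝ ℝ, volume] f) 2 volume
      ≤ eLpNorm f 2 volume := by
  set η := φ.normed volume with hη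
  have hηc : Continuous η := φ.continuous_normed
  have hη0 : ∀ t, 0 ≤ η t := fun t => φ.nonneg_normed t
  have hηI : ∫⁻ t, ENNReal.ofReal (η t) = 1 := by
    rw [← ofReal_integral_eq_lintegral_ofReal φ.integrable_normed (ae_of_all _ hη0),
      φ.integral_normed, ENNReal.ofReal_one]
  have hfm : AEMeasurable f volume := hf.1.aemeasurable
  -- pointwise, by the Cauchy–Schwarz inequality for the probability density `η`
  have hpt : ∀ x, ‖(η ⋆[ContinuousLinearMap.lsmul ℝ ℝ, volume] f) x‖ₑ ^ (2 : ℝ)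
      ≤ ∫⁻ t, ENNReal.ofReal (η t) * ‖f (x - t)‖ₑ ^ (2 : ℝ) := by
    intro x
    have hfx : AEMeasurable (fun t => ‖f (x - t)‖ₑ) volume :=
      (hfm.comp_quasiMeasurePreserving
        (quasiMeasurePreserving_sub_left_of_right_invariant volume x)).enorm
    have h1 : ‖(η ⋆[ContinuousLinearMap.lsmul ℝ ℝ, volume] f) x‖ₑ
        ≤ ∫⁻ t, ENNReal.ofReal (η t) ^ (1 / 2 : ℝ) *
            (ENNReal.ofReal (η t) ^ (1 / 2 : ℝ) * ‖f (x - t)‖ₑ) := by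
      refine (enorm_integral_le_lintegral_enorm _).trans (lintegral_mono fun t => ?_)
      rw [← mul_assoc, ← ENNReal.rpow_add_of_nonneg _ _ (by norm_num) (by norm_num)]
      simp only [ContinuousLinearMap.lsmul_apply, enorm_smul]
      rw [Real.enorm_of_nonneg (hη0 t)]
      norm_num
    have hm : AEMeasurable (fun t => ENNReal.ofReal (η t) ^ (1 / 2 : ℝ)) volume :=
      (hηc.measurable.ennreal_ofReal.pow_const _).aemeasurable
    have h2 := ENNReal.lintegral_mul_le_Lp_mul_Lq (μ := volume) Real.HolderConjugate.two_two
      hm (hm.mul hfx)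
    have h3 : ∀ a : ENNReal, (a ^ (1 / 2 : ℝ)) ^ (2 : ℝ) = a := fun a => by
      rw [← ENNReal.rpow_mul]; norm_num
    have h4 := ENNReal.rpow_le_rpow (h1.trans h2) (z := 2) (by norm_num)
    refine h4.trans ?_
    simp only [Pi.mul_apply, h3, ENNReal.mul_rpow_of_nonneg _ _ (show (0 : ℝ) ≤ 2 by norm_num), hηI,
      one_mul, le_refl]
  have h2 : (2 : ENNReal) ≠ 0 := by norm_num
  -- the translation invariance of the measure after exchanging the integrals
  have key : ∫⁻ x, ‖(η ⋆[ContinuousLinearMap.lsmul ℝ ℝ, volume] f) x‖ₑ ^ (2 : ℝ)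
      ≤ ∫⁻ x, ‖f x‖ₑ ^ (2 : ℝ) := by
    calc _ ≤ ∫⁻ x, ∫⁻ t, ENNReal.ofReal (η t) * ‖f (x - t)‖ₑ ^ (2 : ℝ) := lintegral_mono hpt
      _ = ∫⁻ t, ∫⁻ x, ENNReal.ofReal (η t) * ‖f (x - t)‖ₑ ^ (2 : ℝ) := by
          refine lintegral_lintegral_swap ?_
          refine AEMeasurable.mul
            (hηc.measurable.ennreal_ofReal.comp measurable_snd).aemeasurable ?_
          exact ((hfm.comp_quasiMeasurePreserving
            (quasiMeasurePreserving_sub_of_right_invariant volume volume)).enorm).pow_const _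
      _ = ∫⁻ t, ENNReal.ofReal (η t) * ∫⁻ x, ‖f x‖ₑ ^ (2 : ℝ) := by
          refine lintegral_congr fun t => ?_
          rw [lintegral_const_mul' _ _ ENNReal.ofReal_ne_top,
            lintegral_sub_right_eq_self (fun x => ‖f x‖ₑ ^ (2 : ℝ)) t]
      _ = _ := by
          rw [lintegral_mul_const _ hηc.measurable.ennreal_ofReal, hηI, one_mul]
  rw [eLpNorm_eq_lintegral_rpow_enorm_toReal h2 (by norm_num),
    eLpNorm_eq_lintegral_rpow_enorm_toReal h2 (by norm_num)]
  simp only [ENNReal.toReal_ofNat]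
  exact ENNReal.rpow_le_rpow key (by norm_num)

/-- Bump functions at the origin whose supports shrink to a point. -/
def shrinkingBump (n : ℕ) : ContDiffBump (0 : E) :=
  ⟨1 / (2 * (n + 1)), 1 / (n + 1), by positivity, by
    rw [div_lt_div_iff₀ (by positivity) (by positivity)]; nlinarith⟩

theorem tendsto_shrinkingBump_rOut :
    Tendsto (fun n => (shrinkingBump n).rOut) atTop (𝓝 0) :=
  tendsto_one_div_add_atTop_nhds_zero_nat

/-- The mollification of `f` with the `n`-th shrinking bump function. -/
def mollify (n : ℕ) (f : E → ℝ) : E → ℝ :=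
  (shrinkingBump n).normed volume ⋆[ContinuousLinearMap.lsmul ℝ ℝ, volume] f

/-- Mollifications converge in `L²` on compact sets. The function is replaced by a continuous one
with compact support, for which the convergence is uniform. -/
theorem tendsto_eLpNorm_mollify_sub {f : E → ℝ} (hf : MemLp f 2 volume) {K : Set E}
    (hK : IsCompact K) :
    Tendsto (fun n => eLpNorm (mollify n f - f) 2 (volume.restrict K)) atTop (𝓝 0) := by
  have h12 : (1 : ENNReal) ≤ 2 := by norm_num
  rw [ENNReal.tendsto_atTop_zero]
  intro ε hε
  obtain ⟨δ, hδ0, hδ⟩ : ∃ δ : ENNReal, 0 < δ ∧ δ + δ + δ ≤ ε :=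
    ⟨ε / 3, ENNReal.div_pos hε.ne' (by norm_num), (ENNReal.add_thirds ε).le⟩
  obtain ⟨g, hgs, hgδ, hgc, hgL⟩ :=
    hf.exists_hasCompactSupport_eLpNorm_sub_le (by norm_num) hδ0.ne'
  have hgu : UniformContinuous g := hgs.uniformContinuous_of_continuous hgc
  -- uniform closeness of the mollification of `g` on `K`
  obtain ⟨r, hr0, hr⟩ : ∃ r : ℝ, 0 < r ∧
      volume K ^ (1 / 2 : ℝ) * ENNReal.ofReal r ≤ δ := by
    have hfin : volume K ^ (1 / 2 : ℝ) ≠ ⊤ :=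
      ENNReal.rpow_ne_top_of_nonneg (by norm_num) hK.measure_lt_top.ne
    have ht : Tendsto (fun r : ℝ => volume K ^ (1 / 2 : ℝ) * ENNReal.ofReal r) (𝓝[>] 0) (𝓝 0) := by
      have : Tendsto (fun r : ℝ => ENNReal.ofReal r) (𝓝[>] 0) (𝓝 0) := by
        have := (ENNReal.continuous_ofReal.tendsto 0).mono_left (nhdsWithin_le_nhds (s := Ioi 0))
        simpa using this
      have := ENNReal.Tendsto.const_mul this (Or.inr hfin)
      simpa using this
    obtain ⟨r, hr⟩ := ((ht.eventually (Iic_mem_nhds hδ0)).and self_mem_nhdsWithin).exists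
    exact ⟨r, hr.2, hr.1⟩
  obtain ⟨d, hd0, hd⟩ := Metric.uniformContinuous_iff.1 hgu r hr0
  obtain ⟨N, hN⟩ := ((tendsto_shrinkingBump_rOut).eventually
    (Iio_mem_nhds hd0)).exists_forall_of_atTop
  refine ⟨N, fun n hn => ?_⟩
  have hli : LocallyIntegrable f volume := hf.locallyIntegrable h12
  have hlg : LocallyIntegrable g volume := hgL.locallyIntegrable h12
  have hmol : mollify n f - f = mollify n (f - g) + (mollify n g - g) + (g - f) := by
    have : mollify n f = mollify n (f - g) + mollify n g := by
      have hex : ∀ q : E → ℝ, LocallyIntegrable q volume →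
          ConvolutionExists ((shrinkingBump n).normed volume) q
            (ContinuousLinearMap.lsmul ℝ ℝ) volume := fun q hq =>
        (shrinkingBump n).hasCompactSupport_normed.convolutionExists_left _
          (shrinkingBump n).continuous_normed hq
      rw [mollify, mollify, mollify, ← ConvolutionExists.distrib_add (hex _ (hli.sub hlg))
        (hex _ hlg)]
      simp
    rw [this]; abel
  have hcm : ∀ q : E → ℝ, LocallyIntegrable q volume → Continuous (mollify n q) := fun q hq =>
    ((shrinkingBump n).hasCompactSupport_normed.contDiff_convolution_left (n := 0) _
      (shrinkingBump n).contDiff_normed hq).continuous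
  have m1 := (hcm _ (hli.sub hlg)).aestronglyMeasurable (μ := volume.restrict K)
  have m2 := (hcm _ hlg).aestronglyMeasurable (μ := volume.restrict K)
  have m3 := hgc.aestronglyMeasurable (μ := volume.restrict K)
  have m4 : AEStronglyMeasurable f (volume.restrict K) := hf.1.restrict
  have b1 : eLpNorm (mollify n (f - g)) 2 (volume.restrict K) ≤ δ :=
    ((eLpNorm_mono_measure _ Measure.restrict_le_self).trans
      (eLpNorm_normed_convolution_le _ (hf.sub hgL))).trans hgδ
  have b3 : eLpNorm (g - f) 2 (volume.restrict K) ≤ δ := by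
    rw [eLpNorm_sub_comm]
    exact (eLpNorm_mono_measure _ Measure.restrict_le_self).trans hgδ
  have b2 : eLpNorm (mollify n g - g) 2 (volume.restrict K) ≤ δ := by
    have := eLpNorm_le_of_ae_bound (p := 2) (μ := volume.restrict K) (f := mollify n g - g) (C := r)
      (ae_of_all _ fun x => by
        have := (shrinkingBump n).dist_normed_convolution_le (μ := volume) (x₀ := x) (ε := r)
          hgc.aestronglyMeasurable (fun y hy => (hd ((Metric.mem_ball.1 hy).trans (hN n hn))).le)
        rw [dist_eq_norm] at this
        exact this)
    refine this.trans ?_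
    simpa using hr
  rw [hmol]
  refine (eLpNorm_add_le (m1.add (m2.sub m3)) (m3.sub m4) h12).trans ?_
  refine le_trans (add_le_add ((eLpNorm_add_le m1 (m2.sub m3) h12).trans (add_le_add b1 b2)) b3) hδ

/-- `D` is the gradient of `W` in `L²(Ω)`, in the sense that the pair `(W, D)` is square integrable
on `Ω` and is, on each compact subset of `Ω`, the `L²` limit of one sequence of `C¹` functions and
their gradients. This form of weak differentiability is inherited by products with `C¹` functions
that are defined on `Ω` only. -/
structure HasWeakGrad (Ω : Set E) (W : E → ℝ) (D : Fin 2 → E → ℝ) : Prop where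
  memLp : MemLp W 2 (volume.restrict Ω)
  memLp_grad : ∀ i, MemLp (D i) 2 (volume.restrict Ω)
  approx : ∃ w : ℕ → E → ℝ, (∀ n, ContDiffOn ℝ 1 (w n) Ω) ∧ ∀ K, IsCompact K → K ⊆ Ω →
    Tendsto (fun n => eLpNorm (w n - W) 2 (volume.restrict K)) atTop (𝓝 0) ∧
    ∀ i, Tendsto (fun n => eLpNorm (pderiv i (w n) - D i) 2 (volume.restrict K)) atTop (𝓝 0)

/-- Mollification commutes with weak derivatives at points whose distance from the complement of
`Ω` exceeds the radius of the mollifier. -/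
theorem pderiv_mollify_indicator {Ω : Set E} (hΩ : IsOpen Ω) {W D : E → ℝ} {i : Fin 2}
    (hW : MemLp W 2 (volume.restrict Ω)) (hD : IsWeakPartial Ω i W D) {n : ℕ} {x : E}
    (hx : Metric.closedBall x (shrinkingBump n).rOut ⊆ Ω) :
    pderiv i (mollify n (Ω.indicator W)) x = mollify n (Ω.indicator D) x := by
  have hWI : MemLp (Ω.indicator W) 2 volume := (memLp_indicator_iff_restrict hΩ.measurableSet).2 hW
  set η := (shrinkingBump n).normed (volume : Measure E) with hη
  have hηs : HasCompactSupport η := (shrinkingBump n).hasCompactSupport_normed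
  have hηd : ContDiff ℝ ∞ η := (shrinkingBump n).contDiff_normed
  have hd := hηs.hasFDerivAt_convolution_left (ContinuousLinearMap.lsmul ℝ ℝ) (hηd.of_le (by simp))
    (hWI.locallyIntegrable (by norm_num)) x
  have hint : Integrable (fun t => (ContinuousLinearMap.precompL E (ContinuousLinearMap.lsmul ℝ ℝ))
      (fderiv ℝ η t) (Ω.indicator W (x - t))) volume :=
    (hηs.fderiv ℝ).convolutionExists_left _ (hηd.continuous_fderiv (by simp))
      (hWI.locallyIntegrable (by norm_num)) x
  rw [pderiv, mollify, hd.fderiv, convolution_def, ContinuousLinearMap.integral_apply hint]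
  have h1 : ∀ t, ((ContinuousLinearMap.precompL E (ContinuousLinearMap.lsmul ℝ ℝ))
      (fderiv ℝ η t) (Ω.indicator W (x - t))) (EuclideanSpace.single i 1)
      = pderiv i η t * Ω.indicator W (x - t) := by
    intro t
    simp [ContinuousLinearMap.precompL_apply, pderiv]
  simp only [h1]
  -- substitute `y = x - t`
  have h2 : ∫ t, pderiv i η t * Ω.indicator W (x - t)
      = ∫ y, pderiv i η (x - y) * Ω.indicator W y := by
    rw [← integral_sub_left_eq_self (fun t => pderiv i η t * Ω.indicator W (x - t)) volume x]
    simp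
  have htest : IsTest Ω (fun y => η (x - y)) := by
    have hts : tsupport (fun y => η (x - y)) ⊆ Metric.closedBall x (shrinkingBump n).rOut := by
      refine closure_minimal (fun y hy => ?_) Metric.isClosed_closedBall
      have : x - y ∈ Function.support η := hy
      rw [hη, (shrinkingBump n).support_normed_eq] at this
      have h := (Metric.mem_ball.1 this).le
      rw [dist_zero_right, ← dist_eq_norm, dist_comm] at h
      exact h
    refine ⟨hηd.comp (contDiff_const.sub contDiff_id), ?_, hts.trans hx⟩
    exact HasCompactSupport.intro' (isCompact_closedBall x (shrinkingBump n).rOut)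
      Metric.isClosed_closedBall fun y hy => by
        by_contra h
        exact hy (hts (subset_tsupport _ h))
  have h3 : ∀ y, pderiv i (fun y => η (x - y)) y = - pderiv i η (x - y) := by
    intro y
    have h : HasFDerivAt (fun y => η (x - y)) (- fderiv ℝ η (x - y)) y := by
      have := ((hηd.differentiable (by simp) (x - y)).hasFDerivAt).comp y
        ((hasFDerivAt_id y).const_sub x)
      convert! this using 1
      ext v; simp
    rw [pderiv, h.fderiv]; simp [pderiv]
  have h4 := hD.2 _ htest
  simp only [h3] at h4
  rw [h2, mollify, convolution_def]
  simp only [ContinuousLinearMap.lsmul_apply, smul_eq_mul]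
  rw [← integral_sub_left_eq_self (fun t => η t * Ω.indicator D (x - t)) volume x]
  have e1 : ∀ y, pderiv i η (x - y) * Ω.indicator W y
      = Ω.indicator (fun y => W y * pderiv i η (x - y)) y := fun y => by
    by_cases hy : y ∈ Ω <;> simp [hy, mul_comm]
  have e2 : ∀ y, η (x - y) * Ω.indicator D (x - (x - y))
      = Ω.indicator (fun y => D y * η (x - y)) y := fun y => by
    by_cases hy : y ∈ Ω <;> simp [hy, mul_comm]
  simp only [e1, e2, integral_indicator hΩ.measurableSet]
  simp only [mul_neg, integral_neg, neg_inj] at h4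
  exact h4

/-- Weak partial derivatives in the distributional sense are locally limits of classical ones. -/
theorem HasWeakGrad.of_isWeakPartial {Ω : Set E} (hΩ : IsOpen Ω) {W : E → ℝ}
    {D : Fin 2 → E → ℝ} (hW : MemLp W 2 (volume.restrict Ω)) (hD : ∀ i, IsWeakPartial Ω i W (D i)) :
    HasWeakGrad Ω W D := by
  have hext : ∀ q : E → ℝ, MemLp q 2 (volume.restrict Ω) → MemLp (Ω.indicator q) 2 volume :=
    fun q hq => (memLp_indicator_iff_restrict hΩ.measurableSet).2 hq
  refine ⟨hW, fun i => (hD i).1, fun n => mollify n (Ω.indicator W), fun n => ?_, ?_⟩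
  · exact ((shrinkingBump n).hasCompactSupport_normed.contDiff_convolution_left (n := 1) _
      (shrinkingBump n).contDiff_normed
      ((hext W hW).locallyIntegrable (by norm_num))).contDiffOn
  intro K hK hKΩ
  have hcongr : ∀ q : E → ℝ, q =ᵐ[volume.restrict K] Ω.indicator q := fun q =>
    (ae_restrict_iff' hK.measurableSet).2 (ae_of_all _ fun x hx => by simp [hKΩ hx])
  refine ⟨?_, fun i => ?_⟩
  · refine (tendsto_eLpNorm_mollify_sub (hext W hW) hK).congr fun n => ?_
    refine eLpNorm_congr_ae ?_
    filter_upwards [hcongr W] with x hx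
    simp [← hx]
  · obtain ⟨δ, hδ0, hδ⟩ := hK.exists_cthickening_subset_open hΩ hKΩ
    refine (tendsto_eLpNorm_mollify_sub (hext (D i) (hD i).1) hK).congr' ?_
    filter_upwards [tendsto_shrinkingBump_rOut.eventually (Iio_mem_nhds hδ0)] with n hn
    refine eLpNorm_congr_ae ?_
    filter_upwards [hcongr (D i), ae_restrict_mem hK.measurableSet] with x hx hxK
    simp only [Pi.sub_apply]
    rw [← hx, pderiv_mollify_indicator hΩ hW (hD i)]
    refine (Metric.closedBall_subset_closedBall hn.le).trans
      ((Metric.closedBall_subset_cthickening hxK δ).trans hδ)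

/-! ### Integrals of products of square integrable functions -/

section L2

variable {X : Type*} [MeasurableSpace X] {μ : Measure X}

theorem integral_mul_eq_inner_toLp {f g : X → ℝ} (hf : MemLp f 2 μ) (hg : MemLp g 2 μ) :
    ∫ x, f x * g x ∂μ = inner ℝ (hg.toLp g) (hf.toLp f) := by
  rw [L2.inner_def]
  refine integral_congr_ae ?_
  filter_upwards [hf.coeFn_toLp, hg.coeFn_toLp] with x h1 h2
  simp [h1, h2]

theorem norm_toLp_eq_sqrt {f : X → ℝ} (hf : MemLp f 2 μ) : ‖hf.toLp f‖ = √(∫ x, f x ^ 2 ∂μ) := by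
  rw [norm_eq_sqrt_real_inner, ← integral_mul_eq_inner_toLp hf hf]
  simp [pow_two]

theorem abs_integral_mul_le {f g : X → ℝ} (hf : MemLp f 2 μ) (hg : MemLp g 2 μ) :
    |∫ x, f x * g x ∂μ| ≤ √(∫ x, f x ^ 2 ∂μ) * √(∫ x, g x ^ 2 ∂μ) := by
  rw [integral_mul_eq_inner_toLp hf hg, ← norm_toLp_eq_sqrt hf, ← norm_toLp_eq_sqrt hg, mul_comm]
  exact abs_real_inner_le_norm _ _

theorem tendsto_integral_mul {f g : ℕ → X → ℝ} {F G : X → ℝ} (hf : ∀ n, MemLp (f n) 2 μ)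
    (hg : ∀ n, MemLp (g n) 2 μ) (hF : MemLp F 2 μ) (hG : MemLp G 2 μ)
    (hfF : Tendsto (fun n => eLpNorm (f n - F) 2 μ) atTop (𝓝 0))
    (hgG : Tendsto (fun n => eLpNorm (g n - G) 2 μ) atTop (𝓝 0)) :
    Tendsto (fun n => ∫ x, f n x * g n x ∂μ) atTop (𝓝 (∫ x, F x * G x ∂μ)) := by
  have h1 := (Lp.tendsto_Lp_iff_tendsto_eLpNorm'' f hf F hF).2 hfF
  have h2 := (Lp.tendsto_Lp_iff_tendsto_eLpNorm'' g hg G hG).2 hgG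
  simp only [fun n => integral_mul_eq_inner_toLp (hf n) (hg n), integral_mul_eq_inner_toLp hF hG]
  exact h2.inner h1

theorem tendsto_integral_mul_const {f : ℕ → X → ℝ} {F G : X → ℝ} (hf : ∀ n, MemLp (f n) 2 μ)
    (hF : MemLp F 2 μ) (hG : MemLp G 2 μ)
    (hfF : Tendsto (fun n => eLpNorm (f n - F) 2 μ) atTop (𝓝 0)) :
    Tendsto (fun n => ∫ x, f n x * G x ∂μ) atTop (𝓝 (∫ x, F x * G x ∂μ)) :=
  tendsto_integral_mul hf (fun _ => hG) hF hG hfF (by simp)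

theorem tendsto_integral_sq {f : ℕ → X → ℝ} {F : X → ℝ} (hf : ∀ n, MemLp (f n) 2 μ)
    (hF : MemLp F 2 μ) (hfF : Tendsto (fun n => eLpNorm (f n - F) 2 μ) atTop (𝓝 0)) :
    Tendsto (fun n => ∫ x, f n x ^ 2 ∂μ) atTop (𝓝 (∫ x, F x ^ 2 ∂μ)) := by
  simp only [pow_two]
  exact tendsto_integral_mul hf hf hF hF hfF hfF

theorem tendsto_integral_of_tendsto_eLpNorm_two [IsFiniteMeasure μ] {f : ℕ → X → ℝ} {F : X → ℝ}
    (hf : ∀ n, MemLp (f n) 2 μ) (hF : MemLp F 2 μ)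
    (hfF : Tendsto (fun n => eLpNorm (f n - F) 2 μ) atTop (𝓝 0)) :
    Tendsto (fun n => ∫ x, f n x ∂μ) atTop (𝓝 (∫ x, F x ∂μ)) := by
  simpa using tendsto_integral_mul_const hf hF (memLp_const (1 : ℝ)) hfF

/-- Integrals over sets that fill up `P` converge to the integral over `P`. -/
theorem tendsto_setIntegral_of_eventually_mem {P : Set X} {Q : ℕ → Set X}
    (hP : MeasurableSet P) (hQ : ∀ k, MeasurableSet (Q k)) (hQP : ∀ k, Q k ⊆ P)
    (hlim : ∀ᵐ x ∂μ, x ∈ P → ∀ᶠ k in atTop, x ∈ Q k) {F : X → ℝ}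
    (hF : IntegrableOn F P μ) :
    Tendsto (fun k => ∫ x in Q k, F x ∂μ) atTop (𝓝 (∫ x in P, F x ∂μ)) := by
  simp only [← integral_indicator hP, fun k => (integral_indicator (f := F) (μ := μ) (hQ k)).symm]
  have hI := (integrable_indicator_iff hP).2 hF
  refine tendsto_integral_of_dominated_convergence (fun x => ‖P.indicator F x‖) (fun k => ?_)
    hI.norm (fun k => ae_of_all _ fun x => ?_) ?_
  · exact ((integrable_indicator_iff (hQ k)).2 (hF.mono_set (hQP k))).1
  · by_cases hx : x ∈ Q k
    · simp [hx, hQP k hx]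
    · simp [hx]
  · filter_upwards [hlim] with x hx
    by_cases hxP : x ∈ P
    · refine tendsto_const_nhds.congr' ?_
      filter_upwards [hx hxP] with k hk
      simp [hk, hxP]
    · have : ∀ k, x ∉ Q k := fun k h => hxP (hQP k h)
      simp [hxP, this]

end L2

theorem l2Norm_nonneg (S : Set E) (f : E → ℝ) : 0 ≤ l2Norm S f := Real.sqrt_nonneg _

theorem l2Norm_sq (S : Set E) (f : E → ℝ) : l2Norm S f ^ 2 = ∫ x in S, f x ^ 2 :=
  Real.sq_sqrt (integral_nonneg fun _ => sq_nonneg _)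

theorem abs_setIntegral_mul_le {S : Set E} {f g : E → ℝ} (hf : MemLp f 2 (volume.restrict S))
    (hg : MemLp g 2 (volume.restrict S)) :
    |∫ x in S, f x * g x| ≤ l2Norm S f * l2Norm S g :=
  abs_integral_mul_le hf hg

theorem l2Norm_abs (S : Set E) (f : E → ℝ) : l2Norm S (fun x => |f x|) = l2Norm S f := by
  simp [l2Norm]

theorem setIntegral_abs_le {S : Set E} (hS : volume S ≠ ⊤) {f : E → ℝ}
    (hf : MemLp f 2 (volume.restrict S)) :
    ∫ x in S, |f x| ≤ √(volume.real S) * l2Norm S f := by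
  have : IsFiniteMeasure (volume.restrict S) := ⟨by simpa using hS.lt_top⟩
  have := abs_setIntegral_mul_le hf.abs (memLp_const (μ := volume.restrict S) (p := 2) (1 : ℝ))
  have h2 : l2Norm S (fun _ => (1 : ℝ)) = √(volume.real S) := by simp [l2Norm]
  rw [show (l2Norm S fun x => (1 : ℝ)) = √(volume.real S) from h2] at this
  have h3 : l2Norm S |f| = l2Norm S f := l2Norm_abs S f
  rw [h3, mul_comm] at this
  simpa using (le_abs_self _).trans this

/-! ### Calculus of weak gradients -/

theorem pderiv_mul {f g : E → ℝ} {x : E} (i : Fin 2) (hf : DifferentiableAt ℝ f x)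
    (hg : DifferentiableAt ℝ g x) :
    pderiv i (fun y => f y * g y) x = f x * pderiv i g x + g x * pderiv i f x := by
  simp [pderiv, fderiv_fun_mul hf hg]

theorem fderiv_eq_sum_pderiv (f : E → ℝ) (x v : E) :
    fderiv ℝ f x v = ∑ i, pderiv i f x * v i := by
  have h : v = ∑ i, v i • EuclideanSpace.single i (1 : ℝ) := by
    ext j
    fin_cases j <;> simp
  conv_lhs => rw [h]
  simp [pderiv, mul_comm]

theorem continuousOn_pderiv {Ω : Set E} (hΩ : IsOpen Ω) {f : E → ℝ} (hf : ContDiffOn ℝ 1 f Ω)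
    (i : Fin 2) : ContinuousOn (pderiv i f) Ω :=
  (hf.continuousOn_fderiv_of_isOpen hΩ le_rfl).clm_apply continuousOn_const

theorem memLp_of_continuousOn {Ω : Set E} {f : E → ℝ} (hf : ContinuousOn f Ω) {K S : Set E}
    (hK : IsCompact K) (hKΩ : K ⊆ Ω) (hS : S ⊆ K) : MemLp f 2 (volume.restrict S) := by
  have : IsFiniteMeasure (volume.restrict K) := ⟨by simpa using hK.measure_lt_top⟩
  obtain ⟨C, hC⟩ := hK.exists_bound_of_continuousOn (hf.mono hKΩ)
  have : MemLp f 2 (volume.restrict K) :=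
    MemLp.of_bound ((hf.mono hKΩ).aestronglyMeasurable hK.measurableSet) C
      ((ae_restrict_iff' hK.measurableSet).2 (ae_of_all _ hC))
  exact this.mono_measure (Measure.restrict_mono_set _ hS)

/-- Products of a square integrable function with a bounded measurable one. -/
theorem memLp_bdd_mul {S : Set E} (hS : MeasurableSet S) {a W : E → ℝ} {A : ℝ}
    (ha : AEStronglyMeasurable a (volume.restrict S)) (hA : ∀ x ∈ S, |a x| ≤ A)
    (hW : MemLp W 2 (volume.restrict S)) :
    MemLp (fun x => a x * W x) 2 (volume.restrict S) :=
  hW.of_le_mul (c := A) (ha.mul hW.1) ((ae_restrict_iff' hS).2 (ae_of_all _ fun x hx => by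
    rw [norm_mul]
    exact mul_le_mul_of_nonneg_right (hA x hx) (norm_nonneg _)))

/-- The approximation property of weak gradients on a subset of a compact set, together with the
integrability of all functions involved. -/
theorem HasWeakGrad.exists_approx {Ω : Set E} (hΩ : IsOpen Ω) {W : E → ℝ} {D : Fin 2 → E → ℝ}
    (h : HasWeakGrad Ω W D) :
    ∃ w : ℕ → E → ℝ, (∀ n, ContDiffOn ℝ 1 (w n) Ω) ∧ ∀ K S, IsCompact K → K ⊆ Ω → S ⊆ K →
      (∀ n, MemLp (w n) 2 (volume.restrict S)) ∧
      (∀ i n, MemLp (pderiv i (w n)) 2 (volume.restrict S)) ∧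
      Tendsto (fun n => eLpNorm (w n - W) 2 (volume.restrict S)) atTop (𝓝 0) ∧
      ∀ i, Tendsto (fun n => eLpNorm (pderiv i (w n) - D i) 2 (volume.restrict S)) atTop (𝓝 0) := by
  obtain ⟨w, hw, hlim⟩ := h.approx
  refine ⟨w, hw, fun K S hK hKΩ hSK => ⟨fun n => ?_, fun i n => ?_, ?_, fun i => ?_⟩⟩
  · exact memLp_of_continuousOn (hw n).continuousOn hK hKΩ hSK
  · exact memLp_of_continuousOn (continuousOn_pderiv hΩ (hw n) i) hK hKΩ hSK
  · exact tendsto_of_tendsto_of_tendsto_of_le_of_le tendsto_const_nhds (hlim K hK hKΩ).1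
      (fun _ => zero_le) fun n => eLpNorm_mono_measure _ (Measure.restrict_mono_set _ hSK)
  · exact tendsto_of_tendsto_of_tendsto_of_le_of_le tendsto_const_nhds ((hlim K hK hKΩ).2 i)
      (fun _ => zero_le) fun n => eLpNorm_mono_measure _ (Measure.restrict_mono_set _ hSK)

/-- The product rule for a weakly differentiable function and a bounded `C¹` function with bounded
derivatives. -/
theorem HasWeakGrad.mul {Ω : Set E} (hΩ : IsOpen Ω) {W : E → ℝ} {D : Fin 2 → E → ℝ}
    (h : HasWeakGrad Ω W D) {a : E → ℝ} (ha : ContDiffOn ℝ 1 a Ω) {A : ℝ}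
    (hA : ∀ x ∈ Ω, |a x| ≤ A) (hA' : ∀ i, ∀ x ∈ Ω, |pderiv i a x| ≤ A) :
    HasWeakGrad Ω (fun x => a x * W x) (fun i x => a x * D i x + pderiv i a x * W x) := by
  have ham : AEStronglyMeasurable a (volume.restrict Ω) :=
    ha.continuousOn.aestronglyMeasurable hΩ.measurableSet
  have ham' : ∀ i, AEStronglyMeasurable (pderiv i a) (volume.restrict Ω) := fun i =>
    (continuousOn_pderiv hΩ ha i).aestronglyMeasurable hΩ.measurableSet
  -- multiplication by a bounded function preserves convergence to zero
  have key : ∀ (b : E → ℝ) (K : Set E) (q : ℕ → E → ℝ), MeasurableSet K → K ⊆ Ω →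
      (∀ x ∈ Ω, |b x| ≤ A) →
      Tendsto (fun n => eLpNorm (q n) 2 (volume.restrict K)) atTop (𝓝 0) →
      Tendsto (fun n => eLpNorm (fun x => b x * q n x) 2 (volume.restrict K)) atTop (𝓝 0) := by
    intro b K q hK hKΩ hb hq
    have h2 := ENNReal.Tendsto.const_mul hq (Or.inr (ENNReal.ofReal_ne_top (r := A)))
    rw [mul_zero] at h2
    refine tendsto_of_tendsto_of_tendsto_of_le_of_le tendsto_const_nhds h2
      (fun _ => zero_le) fun n => ?_
    refine eLpNorm_le_mul_eLpNorm_of_ae_le_mul ((ae_restrict_iff' hK).2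
      (ae_of_all _ fun x hx => ?_)) 2
    rw [norm_mul]
    exact mul_le_mul_of_nonneg_right (hb x (hKΩ hx)) (norm_nonneg _)
  refine ⟨memLp_bdd_mul hΩ.measurableSet ham hA h.memLp, fun i =>
    (memLp_bdd_mul hΩ.measurableSet ham hA (h.memLp_grad i)).add
      (memLp_bdd_mul hΩ.measurableSet (ham' i) (hA' i) h.memLp), ?_⟩
  obtain ⟨w, hw, hlim⟩ := h.exists_approx hΩ
  refine ⟨fun n x => a x * w n x, fun n => ha.mul (hw n), fun K hK hKΩ => ?_⟩
  obtain ⟨h1, h2, h3, h4⟩ := hlim K K hK hKΩ subset_rfl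
  have hKm := hK.measurableSet
  refine ⟨?_, fun i => ?_⟩
  · refine (key a K _ hKm hKΩ hA h3).congr fun n => ?_
    congr 1; ext x; simp; ring
  · have t1 := key a K _ hKm hKΩ hA (h4 i)
    have t2 := key (pderiv i a) K _ hKm hKΩ (hA' i) h3
    have t3 := t1.add t2
    rw [add_zero] at t3
    refine tendsto_of_tendsto_of_tendsto_of_le_of_le tendsto_const_nhds t3
      (fun _ => zero_le) fun n => ?_
    have hmW : MemLp W 2 (volume.restrict K) :=
      h.memLp.mono_measure (Measure.restrict_mono_set _ hKΩ)
    have hmD : MemLp (D i) 2 (volume.restrict K) :=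
      (h.memLp_grad i).mono_measure (Measure.restrict_mono_set _ hKΩ)
    have m1 : AEStronglyMeasurable (fun x => a x * (pderiv i (w n) - D i) x) (volume.restrict K) :=
      (ham.mono_measure (Measure.restrict_mono_set _ hKΩ)).mul ((h2 i n).sub hmD).1
    have m2 : AEStronglyMeasurable (fun x => pderiv i a x * (w n - W) x) (volume.restrict K) :=
      ((ham' i).mono_measure (Measure.restrict_mono_set _ hKΩ)).mul ((h1 n).sub hmW).1
    refine le_trans (le_of_eq ?_) (eLpNorm_add_le m1 m2 (by norm_num))
    refine eLpNorm_congr_ae ((ae_restrict_iff' hKm).2 (ae_of_all _ fun x hx => ?_))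
    have da := (ha.contDiffAt (hΩ.mem_nhds (hKΩ hx))).differentiableAt (by simp)
    have dw := ((hw n).contDiffAt (hΩ.mem_nhds (hKΩ hx))).differentiableAt (by simp)
    simp only [Pi.sub_apply, Pi.add_apply]
    rw [pderiv_mul i da dw]
    ring

theorem HasWeakGrad.sub {Ω : Set E} (hΩ : IsOpen Ω) {W V : E → ℝ} {D F : Fin 2 → E → ℝ}
    (h : HasWeakGrad Ω W D) (h' : HasWeakGrad Ω V F) :
    HasWeakGrad Ω (fun x => W x - V x) (fun i x => D i x - F i x) := by
  refine ⟨h.memLp.sub h'.memLp, fun i => (h.memLp_grad i).sub (h'.memLp_grad i), ?_⟩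
  obtain ⟨w, hw, hlim⟩ := h.exists_approx hΩ
  obtain ⟨v, hv, hlim'⟩ := h'.exists_approx hΩ
  refine ⟨fun n x => w n x - v n x, fun n => (hw n).sub (hv n), fun K hK hKΩ => ?_⟩
  obtain ⟨h1, h2, h3, h4⟩ := hlim K K hK hKΩ subset_rfl
  obtain ⟨k1, k2, k3, k4⟩ := hlim' K K hK hKΩ subset_rfl
  have hres := Measure.restrict_mono_set (volume : Measure E) hKΩ
  refine ⟨?_, fun i => ?_⟩
  · have t3 := h3.add k3
    rw [add_zero] at t3
    refine tendsto_of_tendsto_of_tendsto_of_le_of_le tendsto_const_nhds t3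
      (fun _ => zero_le) fun n => ?_
    refine le_trans (le_of_eq ?_) (eLpNorm_sub_le ((h1 n).sub (h.memLp.mono_measure hres)).1
      ((k1 n).sub (h'.memLp.mono_measure hres)).1 (by norm_num))
    congr 1; ext x; simp; ring
  · have t3 := (h4 i).add (k4 i)
    rw [add_zero] at t3
    refine tendsto_of_tendsto_of_tendsto_of_le_of_le tendsto_const_nhds t3
      (fun _ => zero_le) fun n => ?_
    refine le_trans (le_of_eq ?_) (eLpNorm_sub_le
      ((h2 i n).sub ((h.memLp_grad i).mono_measure hres)).1
      ((k2 i n).sub ((h'.memLp_grad i).mono_measure hres)).1 (by norm_num))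
    refine eLpNorm_congr_ae ((ae_restrict_iff' hK.measurableSet).2 (ae_of_all _ fun x hx => ?_))
    have da := ((hw n).contDiffAt (hΩ.mem_nhds (hKΩ hx))).differentiableAt (by simp)
    have dv := ((hv n).contDiffAt (hΩ.mem_nhds (hKΩ hx))).differentiableAt (by simp)
    simp only [Pi.sub_apply]
    have : pderiv i (fun x => w n x - v n x) x = pderiv i (w n) x - pderiv i (v n) x := by
      simp [pderiv, fderiv_fun_sub da dv]
    rw [this]; ring

theorem HasWeakGrad.of_contDiff {Ω : Set E} (hb : Bornology.IsBounded Ω) {w : E → ℝ}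
    (hw : ContDiff ℝ 1 w) : HasWeakGrad Ω w (fun i => pderiv i w) := by
  have hK : IsCompact (closure Ω) := hb.isCompact_closure
  refine ⟨memLp_of_continuousOn (Ω := univ) hw.continuous.continuousOn hK (subset_univ _)
    subset_closure, fun i => memLp_of_continuousOn (Ω := univ) ?_ hK (subset_univ _)
    subset_closure, fun _ => w, fun _ => hw.contDiffOn, fun K _ _ => ?_⟩
  · exact continuousOn_pderiv isOpen_univ hw.contDiffOn i
  · simp

/-- Integration by parts against a test function. -/
theorem HasWeakGrad.integral_mul_pderiv {Ω : Set E} (hΩ : IsOpen Ω) {W : E → ℝ}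
    {D : Fin 2 → E → ℝ} (h : HasWeakGrad Ω W D) {φ : E → ℝ} (hφ : IsTest Ω φ) (i : Fin 2) :
    ∫ x in Ω, W x * pderiv i φ x = - ∫ x in Ω, D i x * φ x := by
  obtain ⟨w, hw, hlim⟩ := h.exists_approx hΩ
  obtain ⟨hφc, hφs, hφΩ⟩ := hφ
  set K := tsupport φ with hKdef
  have hK : IsCompact K := hφs
  obtain ⟨h1, h2, h3, h4⟩ := hlim K K hK hφΩ subset_rfl
  have hres := Measure.restrict_mono_set (volume : Measure E) hφΩ
  have hφz : ∀ x, x ∉ K → φ x = 0 := fun x hx => image_eq_zero_of_notMem_tsupport hx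
  have hφz' : ∀ x, x ∉ K → pderiv i φ x = 0 := fun x hx => by
    have : fderiv ℝ φ x = 0 := image_eq_zero_of_notMem_tsupport
      (fun h => hx (tsupport_fderiv_subset ℝ h))
    simp [pderiv, this]
  have cφ : ContDiff ℝ 1 φ := hφc.of_le (by simp)
  have m1 : MemLp φ 2 (volume.restrict K) :=
    memLp_of_continuousOn (Ω := univ) cφ.continuous.continuousOn hK (subset_univ _) subset_rfl
  have m2 : MemLp (pderiv i φ) 2 (volume.restrict K) :=
    memLp_of_continuousOn (Ω := univ) (continuousOn_pderiv isOpen_univ cφ.contDiffOn i) hK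
      (subset_univ _) subset_rfl
  -- only the support `K` of `φ` matters, where the approximating `C¹` functions converge
  have e1 : ∫ x in Ω, W x * pderiv i φ x = ∫ x in K, W x * pderiv i φ x :=
    (setIntegral_eq_of_subset_of_forall_sdiff_eq_zero hΩ.measurableSet hφΩ
      fun x hx => by simp [hφz' x hx.2])
  have e2 : ∫ x in Ω, D i x * φ x = ∫ x in K, D i x * φ x :=
    (setIntegral_eq_of_subset_of_forall_sdiff_eq_zero hΩ.measurableSet hφΩ
      fun x hx => by simp [hφz x hx.2])
  rw [e1, e2]
  have t1 := tendsto_integral_mul_const h1 (h.memLp.mono_measure hres) m2 h3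
  have t2 := (tendsto_integral_mul_const (h2 i) ((h.memLp_grad i).mono_measure hres) m1 (h4 i)).neg
  refine tendsto_nhds_unique t1 (t2.congr fun n => ?_)
  have g1 : ∫ x in K, w n x * pderiv i φ x = ∫ x, w n x * pderiv i φ x :=
    setIntegral_eq_integral_of_forall_compl_eq_zero fun x hx => by simp [hφz' x hx]
  have g2 : ∫ x in K, pderiv i (w n) x * φ x = ∫ x, pderiv i (w n) x * φ x :=
    setIntegral_eq_integral_of_forall_compl_eq_zero fun x hx => by simp [hφz x hx]
  have hI : ∀ q : E → ℝ, ContinuousOn q Ω → ∀ ψ : E → ℝ, Continuous ψ →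
      (∀ x, x ∉ K → ψ x = 0) → Integrable (fun x => q x * ψ x) volume := by
    intro q hq ψ hψ hz
    refine (integrableOn_iff_integrable_of_support_subset (s := K) fun x hx => ?_).1
      (((hq.mono hφΩ).mul hψ.continuousOn).integrableOn_compact hK)
    by_contra hxK
    exact hx (by simp [hz x hxK])
  have cpφ : Continuous (pderiv i φ) :=
    continuousOn_univ.1 (continuousOn_pderiv isOpen_univ cφ.contDiffOn i)
  rw [g1, g2]
  symm
  exact integral_mul_fderiv_eq_neg_fderiv_mul_of_integrable
    (hI _ (continuousOn_pderiv hΩ (hw n) i) _ cφ.continuous hφz)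
    (hI _ (hw n).continuousOn _ cpφ hφz') (hI _ (hw n).continuousOn _ cφ.continuous hφz)
    (fun x hx => ((hw n).contDiffAt (hΩ.mem_nhds (hφΩ hx))).differentiableAt (by simp))
    (fun x _ => cφ.differentiable (by simp) x)

/-! ### Integration over triangles -/

/-- The cross product of plane vectors. -/
def cross (x y : E) : ℝ := x 0 * y 1 - x 1 * y 0

theorem continuous_cross {X : Type*} [TopologicalSpace X] {f g : X → E} (hf : Continuous f)
    (hg : Continuous g) : Continuous fun x => cross (f x) (g x) := by
  unfold cross
  fun_prop

/-- The open triangle with vertices `x₀, a, b` in counterclockwise order, as the set of points that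
see every side counterclockwise. -/
def tri (x₀ a b : E) : Set E :=
  {x | 0 < cross (a - x) (b - x) ∧ 0 < cross (b - x) (x₀ - x) ∧ 0 < cross (x₀ - x) (a - x)}

theorem tri_rotate (x₀ a b : E) : tri a b x₀ = tri x₀ a b := by
  ext x; simp only [tri, mem_ofPred_eq]; tauto

theorem isOpen_tri (x₀ a b : E) : IsOpen (tri x₀ a b) := by
  have h : ∀ p q : E, IsOpen {x : E | 0 < cross (p - x) (q - x)} := fun p q =>
    isOpen_lt continuous_const
      (continuous_cross (continuous_const.sub continuous_id) (continuous_const.sub continuous_id))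
  exact (h a b).inter ((h b x₀).inter (h x₀ a))

theorem measurableSet_tri (x₀ a b : E) : MeasurableSet (tri x₀ a b) :=
    (isOpen_tri x₀ a b).measurableSet

/-- The areas of the subtriangles spanned by a point and the sides add up. -/
theorem cross_add_cross_add_cross (x₀ a b x : E) :
    cross (a - x) (b - x) + cross (b - x) (x₀ - x) + cross (x₀ - x) (a - x)
      = cross (a - x₀) (b - x₀) := by
  simp only [cross, PiLp.sub_apply]; ring

/-- Barycentric coordinates as ratios of areas. -/
theorem cross_smul_eq (x₀ a b x : E) :
    cross (a - x₀) (b - x₀) • x = cross (a - x) (b - x) • x₀ + cross (b - x) (x₀ - x) • a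
      + cross (x₀ - x) (a - x) • b := by
  ext j
  fin_cases j <;> simp [cross] <;> ring

theorem tri_subset_convexHull {x₀ a b : E} : tri x₀ a b ⊆ convexHull ℝ {x₀, a, b} := by
  rintro x ⟨h1, h2, h3⟩
  have hs := cross_add_cross_add_cross x₀ a b x
  have hx := cross_smul_eq x₀ a b x
  set D := cross (a - x₀) (b - x₀) with hD
  have hD0 : 0 < D := by linarith
  have hc := convex_convexHull ℝ ({x₀, a, b} : Set E)
  have h := hc.sum_mem (t := Finset.univ)
    (w := ![cross (a - x) (b - x) / D, cross (b - x) (x₀ - x) / D, cross (x₀ - x) (a - x) / D])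
    (z := ![x₀, a, b]) ?_ ?_ ?_
  · have e : x = D⁻¹ • (D • x) := (inv_smul_smul₀ hD0.ne' x).symm
    rw [e, hx]
    simpa [Fin.sum_univ_three, smul_add, smul_smul, div_eq_inv_mul] using h
  · intro i _
    fin_cases i
    · exact (div_pos h1 hD0).le
    · exact (div_pos h2 hD0).le
    · exact (div_pos h3 hD0).le
  · simp only [Fin.sum_univ_three]
    simp only [Matrix.cons_val_zero, Matrix.cons_val_one, Matrix.cons_val]
    rw [← add_div, ← add_div, hs, div_self hD0.ne']
  · intro i _
    fin_cases i <;> exact subset_convexHull _ _ (by simp)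

/-- The polar parametrization `(s, t) ↦ x₀ + t (a + s (b - a) - x₀)` of a triangle. -/
def triParam (x₀ a b : E) (z : E) : E := x₀ + z 1 • (AffineMap.lineMap a b (z 0) - x₀)

theorem triParam_apply (x₀ a b z : E) (j : Fin 2) :
    triParam x₀ a b z j = x₀ j + z 1 * (a j + z 0 * (b j - a j) - x₀ j) := by
  simp only [triParam, AffineMap.lineMap_apply, PiLp.add_apply, PiLp.smul_apply, PiLp.sub_apply,
    vsub_eq_sub, vadd_eq_add, smul_eq_mul]
  ring

/-- The open unit square of the parameter plane. -/
def unitSq : Set E := {z | (0 < z 0 ∧ z 0 < 1) ∧ (0 < z 1 ∧ z 1 < 1)}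

theorem det_smulRight_add_smulRight (u w : E) :
    ((EuclideanSpace.proj 0 : E →L[ℝ] ℝ).smulRight u
      + (EuclideanSpace.proj 1 : E →L[ℝ] ℝ).smulRight w).det = cross u w := by
  rw [ContinuousLinearMap.det,
    ← LinearMap.det_toMatrix (EuclideanSpace.basisFun (Fin 2) ℝ).toBasis, Matrix.det_fin_two]
  simp [LinearMap.toMatrix_apply, cross]
  ring

theorem hasFDerivAt_triParam (x₀ a b z : E) :
    HasFDerivAt (triParam x₀ a b) ((EuclideanSpace.proj 0 : E →L[ℝ] ℝ).smulRight (z 1 • (b - a))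
      + (EuclideanSpace.proj 1 : E →L[ℝ] ℝ).smulRight (AffineMap.lineMap a b (z 0) - x₀)) z := by
  have h0 : HasFDerivAt (fun z : E => z 0) (EuclideanSpace.proj 0 : E →L[ℝ] ℝ) z :=
    (EuclideanSpace.proj 0 : E →L[ℝ] ℝ).hasFDerivAt
  have h1 : HasFDerivAt (fun z : E => z 1) (EuclideanSpace.proj 1 : E →L[ℝ] ℝ) z :=
    (EuclideanSpace.proj 1 : E →L[ℝ] ℝ).hasFDerivAt
  have h2 : HasFDerivAt (fun z : E => (AffineMap.lineMap a b (z 0) : E) - x₀)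
      ((EuclideanSpace.proj 0 : E →L[ℝ] ℝ).smulRight (b - a)) z := by
    have := ((h0.smul_const (b - a)).add_const a).sub_const x₀
    simpa [AffineMap.lineMap_apply] using this
  have h3 := (h1.smul h2).const_add x₀
  convert! h3 using 1
  ext v j
  simp
  ring

/-- The polar parametrization maps the open square onto the open triangle; the preimage of a point
is read off from its three signed areas. -/
theorem tri_eq_image {x₀ a b : E} (hD : 0 < cross (a - x₀) (b - x₀)) :
    triParam x₀ a b '' unitSq = tri x₀ a b := by
  set D := cross (a - x₀) (b - x₀) with hDdef
  ext x
  constructor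
  · rintro ⟨z, ⟨⟨hs0, hs1⟩, ht0, ht1⟩, rfl⟩
    have e1 : cross (a - triParam x₀ a b z) (b - triParam x₀ a b z) = (1 - z 1) * D := by
      simp only [cross, PiLp.sub_apply, triParam_apply, hDdef]; ring
    have e2 : cross (b - triParam x₀ a b z) (x₀ - triParam x₀ a b z) = z 1 * (1 - z 0) * D := by
      simp only [cross, PiLp.sub_apply, triParam_apply, hDdef]; ring
    have e3 : cross (x₀ - triParam x₀ a b z) (a - triParam x₀ a b z) = z 1 * z 0 * D := by
      simp only [cross, PiLp.sub_apply, triParam_apply, hDdef]; ring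
    refine ⟨?_, ?_, ?_⟩
    · rw [e1]; exact mul_pos (by linarith) hD
    · rw [e2]; exact mul_pos (mul_pos ht0 (by linarith)) hD
    · rw [e3]; exact mul_pos (mul_pos ht0 hs0) hD
  · rintro ⟨h1, h2, h3⟩
    have hs := cross_add_cross_add_cross x₀ a b x
    have hx := cross_smul_eq x₀ a b x
    rw [← hDdef] at hs hx
    set c0 := cross (a - x) (b - x)
    set ca := cross (b - x) (x₀ - x)
    set cb := cross (x₀ - x) (a - x)
    -- the signed areas `c0`, `ca`, `cb` are the barycentric coordinates of `x`, up to the factor `D`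
    have hab : 0 < ca + cb := by linarith
    refine ⟨!₂[cb / (ca + cb), (ca + cb) / D], ⟨⟨?_, ?_⟩, ?_, ?_⟩, ?_⟩
    · simpa using div_pos h3 hab
    · simpa using (div_lt_one hab).2 (by linarith)
    · simpa using div_pos hab hD
    · simpa using (div_lt_one hD).2 (by linarith)
    · ext j
      have hj := congrArg (fun y : E => y j) hx
      simp only [PiLp.smul_apply, PiLp.add_apply, smul_eq_mul] at hj
      rw [triParam_apply]
      simp
      field_simp
      have hc0 : c0 = D - ca - cb := by linarith
      rw [hc0] at hj
      linarith

theorem injOn_triParam {x₀ a b : E} (hD : 0 < cross (a - x₀) (b - x₀)) :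
    InjOn (triParam x₀ a b) unitSq := by
  have key : ∀ z : E, cross (a - triParam x₀ a b z) (b - triParam x₀ a b z)
        = (1 - z 1) * cross (a - x₀) (b - x₀) ∧
      cross (x₀ - triParam x₀ a b z) (a - triParam x₀ a b z)
        = z 1 * z 0 * cross (a - x₀) (b - x₀) := by
    intro z
    constructor <;> simp only [cross, PiLp.sub_apply, triParam_apply] <;> ring
  rintro z ⟨_, hz, _⟩ w _ h
  have h1 := (key z).1
  have h2 := (key z).2
  rw [h] at h1 h2
  rw [(key w).1] at h1
  rw [(key w).2] at h2
  have e1 : z 1 = w 1 := by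
    have := mul_right_cancel₀ hD.ne' h1
    linarith
  have e2 := mul_right_cancel₀ hD.ne' h2
  rw [e1] at e2
  have e3 : w 0 = z 0 := mul_left_cancel₀ (e1 ▸ hz.ne') e2
  ext j
  fin_cases j
  · exact e3.symm
  · exact e1

theorem measurableSet_unitSq : MeasurableSet unitSq := by
  have h : ∀ j : Fin 2, Measurable fun z : E => z j := fun j => by fun_prop
  exact ((measurableSet_lt measurable_const (h 0)).inter (measurableSet_lt
    (h 0) measurable_const)).inter
    ((measurableSet_lt measurable_const (h 1)).inter (measurableSet_lt (h 1) measurable_const))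

theorem setIntegral_tri {x₀ a b : E} (hD : 0 < cross (a - x₀) (b - x₀)) (F : E → ℝ) :
    ∫ x in tri x₀ a b, F x
      = cross (a - x₀) (b - x₀) * ∫ z in unitSq, z 1 * F (triParam x₀ a b z) := by
  rw [← tri_eq_image hD, integral_image_eq_integral_abs_det_fderiv_smul volume measurableSet_unitSq
    (fun z _ => (hasFDerivAt_triParam x₀ a b z).hasFDerivWithinAt) (injOn_triParam hD),
    ← integral_const_mul]
  refine setIntegral_congr_fun measurableSet_unitSq fun z hz => ?_
  have : cross (z 1 • (b - a)) (AffineMap.lineMap a b (z 0) - x₀)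
      = - (z 1 * cross (a - x₀) (b - x₀)) := by
    simp [cross, AffineMap.lineMap_apply]; ring
  simp only [det_smulRight_add_smulRight, this, abs_neg, abs_mul, abs_of_pos hD, abs_of_pos hz.2.1,
    smul_eq_mul]
  ring

/-- Fubini's theorem on the parameter square. -/
theorem setIntegral_unitSq {G : ℝ → ℝ → ℝ}
    (hG : ContinuousOn (Function.uncurry G) (Icc 0 1 ×ˢ Icc 0 1)) :
    ∫ z in unitSq, G (z 0) (z 1) = ∫ s in (0 : ℝ)..1, ∫ t in (0 : ℝ)..1, G s t := by
  have hmp : MeasurePreserving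
      (((MeasurableEquiv.toLp 2 (Fin 2 → ℝ)).symm).trans MeasurableEquiv.finTwoArrow) volume
        volume :=
    (EuclideanSpace.volume_preserving_symm_measurableEquiv_toLp (Fin 2)).trans
      (volume_preserving_finTwoArrow ℝ)
  have hpre : unitSq = (((MeasurableEquiv.toLp 2 (Fin 2 → ℝ)).symm).trans
      MeasurableEquiv.finTwoArrow) ⁻¹' (Ioo 0 1 ×ˢ Ioo 0 1) := by
    ext z
    simp [unitSq, MeasurableEquiv.finTwoArrow]
  have h1 := hmp.setIntegral_preimage_emb (MeasurableEquiv.measurableEmbedding _)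
    (Function.uncurry G) (Ioo 0 1 ×ˢ Ioo 0 1)
  rw [← hpre] at h1
  have h2 : ∫ z in unitSq, G (z 0) (z 1) = ∫ y in Ioo (0 : ℝ) 1 ×ˢ Ioo (0 : ℝ) 1,
    Function.uncurry G y := by
    rw [← h1]
    rfl
  rw [h2]
  have hint : IntegrableOn (Function.uncurry G) (Ioo (0 : ℝ) 1 ×ˢ Ioo (0 : ℝ) 1)
    (volume.prod volume) :=
    (hG.integrableOn_compact (isCompact_Icc.prod isCompact_Icc)).mono_set
      (prod_mono Ioo_subset_Icc_self Ioo_subset_Icc_self)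
  rw [Measure.volume_eq_prod, setIntegral_prod _ hint, intervalIntegral.integral_of_le zero_le_one,
    integral_Ioc_eq_integral_Ioo]
  refine setIntegral_congr_fun measurableSet_Ioo fun s _ => ?_
  simp only [Function.uncurry]
  rw [intervalIntegral.integral_of_le zero_le_one, integral_Ioc_eq_integral_Ioo]

/-- The average of `W` over the segment from `a` to `b`. -/
def segAvg (W : E → ℝ) (a b : E) : ℝ := ∫ s in (0 : ℝ)..1, W (AffineMap.lineMap a b s)

theorem segAvg_symm (W : E → ℝ) (a b : E) : segAvg W a b = segAvg W b a := by
  have h := intervalIntegral.integral_comp_sub_left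
    (a := 0) (b := 1) (fun s => W (AffineMap.lineMap b a s)) (1 : ℝ)
  simp only [AffineMap.lineMap_apply_one_sub, sub_self, sub_zero] at h
  exact h

theorem lineMap_triangle_mem {x₀ a b : E} {s t : ℝ} (hs : s ∈ Icc (0 : ℝ) 1)
    (ht : t ∈ Icc (0 : ℝ) 1) :
    x₀ + t • (AffineMap.lineMap a b s - x₀) ∈ convexHull ℝ {x₀, a, b} := by
  have hc := convex_convexHull ℝ ({x₀, a, b} : Set E)
  have h0 : x₀ ∈ convexHull ℝ {x₀, a, b} := subset_convexHull _ _ (by simp)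
  have ha : a ∈ convexHull ℝ {x₀, a, b} := subset_convexHull _ _ (by simp)
  have hb : b ∈ convexHull ℝ {x₀, a, b} := subset_convexHull _ _ (by simp)
  exact hc.add_smul_sub_mem h0 (hc.lineMap_mem ha hb hs) ht

/-- The radial formula: the divergence of `W (x - x₀)` integrates to the flux through the side
opposite to `x₀`, since the flux through the two sides at `x₀` vanishes. -/
theorem setIntegral_tri_radial {x₀ a b : E} (hD : 0 < cross (a - x₀) (b - x₀)) {U : Set E}
    (hU : IsOpen U) (hsub : convexHull ℝ {x₀, a, b} ⊆ U) {W : E → ℝ} (hW : ContDiffOn ℝ 1 W U) :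
    ∫ x in tri x₀ a b, (2 * W x + fderiv ℝ W x (x - x₀))
      = cross (a - x₀) (b - x₀) * segAvg W a b := by
  rw [setIntegral_tri hD]
  congr 1
  set γ : ℝ → E := fun s => AffineMap.lineMap a b s with hγ
  have hγc : Continuous γ := AffineMap.lineMap_continuous
  set G : ℝ → ℝ → ℝ := fun s t => t * (2 * W (x₀ + t • (γ s - x₀))
    + fderiv ℝ W (x₀ + t • (γ s - x₀)) (x₀ + t • (γ s - x₀) - x₀)) with hG
  have hmem : ∀ s ∈ Icc (0 : ℝ) 1, ∀ t ∈ Icc (0 : ℝ) 1, x₀ + t • (γ s - x₀) ∈ U :=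
    fun s hs t ht => hsub (lineMap_triangle_mem hs ht)
  have hmaps : MapsTo (fun y : ℝ × ℝ => x₀ + y.2 • (γ y.1 - x₀)) (Icc 0 1 ×ˢ Icc 0 1) U :=
    fun y hy => hmem y.1 hy.1 y.2 hy.2
  have hmc : Continuous (fun y : ℝ × ℝ => x₀ + y.2 • (γ y.1 - x₀)) := by fun_prop
  have hWc : ContinuousOn (fun y : ℝ × ℝ => W (x₀ + y.2 • (γ y.1 - x₀))) (Icc 0 1 ×ˢ Icc 0 1) :=
    hW.continuousOn.comp hmc.continuousOn hmaps
  have hDc : ContinuousOn (fun y : ℝ × ℝ => fderiv ℝ W (x₀ + y.2 • (γ y.1 - x₀)))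
      (Icc 0 1 ×ˢ Icc 0 1) :=
    (hW.continuousOn_fderiv_of_isOpen hU le_rfl).comp hmc.continuousOn hmaps
  have hGc : ContinuousOn (Function.uncurry G) (Icc 0 1 ×ˢ Icc 0 1) :=
    continuousOn_snd.mul ((continuousOn_const.mul hWc).add
      (hDc.clm_apply (hmc.continuousOn.sub continuousOn_const)))
  have h1 : ∫ z in unitSq, z 1 * (2 * W (triParam x₀ a b z)
      + fderiv ℝ W (triParam x₀ a b z) (triParam x₀ a b z - x₀))
      = ∫ z in unitSq, G (z 0) (z 1) := rfl
  rw [h1, setIntegral_unitSq hGc, segAvg]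
  refine intervalIntegral.integral_congr fun s hs => ?_
  rw [uIcc_of_le zero_le_one] at hs
  -- the radial integrand is the derivative of `t² W`
  have hder : ∀ t ∈ uIcc (0 : ℝ) 1,
      HasDerivAt (fun t : ℝ => t ^ 2 * W (x₀ + t • (γ s - x₀))) (G s t) t := by
    intro t ht
    rw [uIcc_of_le zero_le_one] at ht
    have hl : HasDerivAt (fun t : ℝ => x₀ + t • (γ s - x₀)) (γ s - x₀) t := by
      simpa using ((hasDerivAt_id t).smul_const (γ s - x₀)).const_add x₀
    have hWd : HasFDerivAt W (fderiv ℝ W (x₀ + t • (γ s - x₀))) (x₀ + t • (γ s - x₀)) :=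
      ((hW.contDiffAt (hU.mem_nhds (hmem s hs t ht))).differentiableAt (by simp)).hasFDerivAt
    have h2 := (hasDerivAt_pow 2 t).mul (hWd.comp_hasDerivAt t hl)
    convert! h2 using 1
    simp [hG]
    ring
  have hint : IntervalIntegrable (G s) volume 0 1 := by
    refine ContinuousOn.intervalIntegrable ?_
    rw [uIcc_of_le zero_le_one]
    exact hGc.comp (Continuous.prodMk_right s).continuousOn fun t ht => ⟨hs, ht⟩
  have := intervalIntegral.integral_eq_sub_of_hasDerivAt hder hint
  rw [show (∫ t in (0 : ℝ)..1, G s t) = _ from this]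
  simp [hγ]

theorem isCompact_triangle (x₀ a b : E) : IsCompact (convexHull ℝ ({x₀, a, b} : Set E)) :=
  (Set.toFinite _).isCompact_convexHull ℝ

/-- The divergence theorem on a triangle, for the field `W v` with a constant vector `v`. -/
theorem setIntegral_tri_fderiv {x₀ a b : E} (hD : 0 < cross (a - x₀) (b - x₀)) {U : Set E}
    (hU : IsOpen U) (hsub : convexHull ℝ {x₀, a, b} ⊆ U) {W : E → ℝ} (hW : ContDiffOn ℝ 1 W U)
    (v : E) :
    ∫ x in tri x₀ a b, fderiv ℝ W x v = cross v (b - a) * segAvg W a b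
      - cross v (b - x₀) * segAvg W x₀ b + cross v (a - x₀) * segAvg W x₀ a := by
  set D := cross (a - x₀) (b - x₀) with hDdef
  have hfc := hW.continuousOn_fderiv_of_isOpen hU le_rfl
  have hcomp := isCompact_triangle x₀ a b
  have hint : ∀ F : E → ℝ, ContinuousOn F U → IntegrableOn F (tri x₀ a b) := fun F hF =>
    ((hF.mono hsub).integrableOn_compact hcomp).mono_set tri_subset_convexHull
  have hradI : ∀ p : E, IntegrableOn (fun x => 2 * W x + fderiv ℝ W x (x - p)) (tri x₀ a b) :=
    fun p => hint _ ((continuousOn_const.mul hW.continuousOn).add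
      (hfc.clm_apply (continuousOn_id.sub continuousOn_const)))
  -- the radial formula with each of the three vertices as centre
  have r0 := setIntegral_tri_radial hD hU hsub hW
  have ra : ∫ x in tri x₀ a b, (2 * W x + fderiv ℝ W x (x - a)) = D * segAvg W b x₀ := by
    have hDa : cross (b - a) (x₀ - a) = D := by
      simp only [hDdef, cross, PiLp.sub_apply]; ring
    have := setIntegral_tri_radial (x₀ := a) (a := b) (b := x₀) (hDa ▸ hD) hU
      (by rwa [show ({a, b, x₀} : Set E) = {x₀, a, b} by ext y; simp; tauto]) hW
    rwa [tri_rotate, hDa] at this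
  have rb : ∫ x in tri x₀ a b, (2 * W x + fderiv ℝ W x (x - b)) = D * segAvg W x₀ a := by
    have hDb : cross (x₀ - b) (a - b) = D := by
      simp only [hDdef, cross, PiLp.sub_apply]; ring
    have := setIntegral_tri_radial (x₀ := b) (a := x₀) (b := a) (hDb ▸ hD) hU
      (by rwa [show ({b, x₀, a} : Set E) = {x₀, a, b} by ext y; simp; tauto]) hW
    rwa [← tri_rotate, hDb] at this
  have da : ∫ x in tri x₀ a b, fderiv ℝ W x (a - x₀) = D * segAvg W a b - D * segAvg W b x₀ := by
    rw [← r0, ← ra, ← integral_sub (hradI _) (hradI _)]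
    refine integral_congr_ae (ae_of_all _ fun x => ?_)
    simp only [map_sub]; ring
  have db : ∫ x in tri x₀ a b, fderiv ℝ W x (b - x₀) = D * segAvg W a b - D * segAvg W x₀ a := by
    rw [← r0, ← rb, ← integral_sub (hradI _) (hradI _)]
    refine integral_congr_ae (ae_of_all _ fun x => ?_)
    simp only [map_sub]; ring
  have hv : v = (cross v (b - x₀) / D) • (a - x₀) + (cross (a - x₀) v / D) • (b - x₀) := by
    have hne : D ≠ 0 := hD.ne'
    have : D • v = cross v (b - x₀) • (a - x₀) + cross (a - x₀) v • (b - x₀) := by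
      ext j
      fin_cases j <;> simp [hDdef, cross] <;> ring
    rw [div_eq_inv_mul, div_eq_inv_mul, mul_smul, mul_smul, ← smul_add, ← this,
      inv_smul_smul₀ hne]
  have e : ∀ x, fderiv ℝ W x v = cross v (b - x₀) / D * fderiv ℝ W x (a - x₀)
      + cross (a - x₀) v / D * fderiv ℝ W x (b - x₀) := fun x => by
    conv_lhs => rw [hv]
    rw [map_add, map_smul, map_smul]; rfl
  simp only [e]
  rw [integral_add ((hint _ (hfc.clm_apply continuousOn_const)).const_mul _)
    ((hint _ (hfc.clm_apply continuousOn_const)).const_mul _), integral_const_mul,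
    integral_const_mul, da, db, segAvg_symm W b x₀]
  have hne : D ≠ 0 := hD.ne'
  have c1 : cross v (b - a) = cross v (b - x₀) - cross v (a - x₀) := by
    simp only [cross, PiLp.sub_apply]; ring
  have c2 : cross (a - x₀) v = - cross v (a - x₀) := by
    simp only [cross, PiLp.sub_apply]; ring
  rw [c1, c2]
  field_simp
  ring

/-! ### The Poincaré inequality on star-shaped sets -/

/-- Change of variables under a homothety. -/
theorem lintegral_comp_smul_add {G : E → ENNReal} (hG : Measurable G) {t : ℝ} (ht : 0 < t) (c : E) :
    ∫⁻ x, G (t • x + c) = ENNReal.ofReal ((t ^ 2)⁻¹) * ∫⁻ x, G x := by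
  have h1 : ∫⁻ x, G (t • x + c) = ∫⁻ z, G (z + c) ∂(Measure.map (t • ·) (volume : Measure E)) := by
    rw [lintegral_map (f := fun z => G (z + c)) (hG.comp (measurable_id.add_const c))
      (measurable_const_smul t)]
  rw [h1, Measure.map_addHaar_smul _ ht.ne', lintegral_smul_measure, lintegral_add_right_eq_self]
  simp [abs_of_pos ht]

/-- A convex combination of two points covers each of the two factors of a product with bounded
density: one of the two weights is at least one half. -/
theorem lintegral_lintegral_comp_segment_le {G : E → ENNReal} (hG : Measurable G) (P B : Set E)
    (t : ℝ) :
    ∫⁻ y in B, ∫⁻ x in P, G (t • x + (1 - t) • y)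
      ≤ 4 * (volume B + volume P) * ∫⁻ z, G z := by
  have hfour : ∀ s : ℝ, 1 / 2 ≤ s → ENNReal.ofReal ((s ^ 2)⁻¹) ≤ 4 := by
    intro s hs
    have : (s ^ 2)⁻¹ ≤ 4 := by
      rw [inv_le_comm₀ (by positivity) (by norm_num)]; nlinarith
    calc _ ≤ ENNReal.ofReal 4 := ENNReal.ofReal_le_ofReal this
      _ = 4 := by simp
  rcases le_total (1 / 2) t with h | h
  · calc _ ≤ ∫⁻ _ in B, 4 * ∫⁻ z, G z := by
          refine lintegral_mono fun y => ?_
          calc _ ≤ ∫⁻ x, G (t • x + (1 - t) • y) := setLIntegral_le_lintegral _ _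
            _ = _ := lintegral_comp_smul_add hG (by linarith) _
            _ ≤ _ := by gcongr; exact hfour t h
      _ = 4 * volume B * ∫⁻ z, G z := by simp; ring
      _ ≤ _ := by gcongr; simp
  · rw [lintegral_lintegral_swap]
    · calc _ ≤ ∫⁻ _ in P, 4 * ∫⁻ z, G z := by
            refine lintegral_mono fun x => ?_
            calc _ ≤ ∫⁻ y, G (t • x + (1 - t) • y) := setLIntegral_le_lintegral _ _
              _ = ∫⁻ y, G ((1 - t) • y + t • x) := by simp only [add_comm]
              _ = _ := lintegral_comp_smul_add hG (by linarith) _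
              _ ≤ _ := by gcongr; exact hfour (1 - t) (by linarith)
        _ = 4 * volume P * ∫⁻ z, G z := by simp; ring
        _ ≤ _ := by gcongr; simp
    · refine (hG.comp ?_).aemeasurable
      fun_prop

/-- The Poincaré inequality for `C¹` functions on a set that is star-shaped with respect to the
points of a disc. The increment between `x ∈ P` and `y` in the disc is estimated by the gradient
along the segment; the average over all pairs `(x, y)` is controlled by
`lintegral_lintegral_comp_segment_le`. -/
theorem exists_integral_sub_sq_le_of_contDiffOn {P U : Set E} {x₀ : E} {r R : ℝ} (hr : 0 < r)
    (hP : IsCompact P) (hBP : Metric.ball x₀ r ⊆ P)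
    (hstar : ∀ y ∈ Metric.ball x₀ r, StarConvex ℝ y P)
    (hdiam : ∀ x ∈ P, ∀ y ∈ P, dist x y ≤ R) (hU : IsOpen U) (hPU : P ⊆ U) {W : E → ℝ}
    (hW : ContDiffOn ℝ 1 W U) :
    ∃ k : ℝ, ∫ x in P, (W x - k) ^ 2
      ≤ 4 * R ^ 2 * (1 + volume.real P / (Real.pi * r ^ 2)) * ∫ x in P, ∑ i, pderiv i W x ^ 2 := by
  set B := Metric.ball x₀ r with hB
  have hPm := hP.measurableSet
  have hgc : ContinuousOn (fun x => ∑ i, pderiv i W x ^ 2) U :=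
    continuousOn_finsetSum _ fun i _ => (continuousOn_pderiv hU hW i).pow 2
  set g : E → ℝ := fun x => ∑ i, pderiv i W x ^ 2 with hg
  have hg0 : ∀ x, 0 ≤ g x := fun x => Finset.sum_nonneg fun i _ => sq_nonneg _
  -- a measurable representative of the squared gradient on `P`
  set G : E → ENNReal := P.indicator fun x => ENNReal.ofReal (g x) with hGdef
  have hGm : Measurable G := by
    have h1 : Measurable (P.indicator g) := by
      classical
      rw [← piecewise_eq_indicator]
      exact ContinuousOn.measurable_piecewise (hgc.mono hPU) continuousOn_const hPm
    have : G = fun x => ENNReal.ofReal (P.indicator g x) := by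
      ext x; by_cases hx : x ∈ P <;> simp [hGdef, hx]
    rw [this]; exact h1.ennreal_ofReal
  -- the pointwise estimate along a segment
  have hpt : ∀ x ∈ P, ∀ y ∈ B, ENNReal.ofReal ((W x - W y) ^ 2)
      ≤ ENNReal.ofReal (R ^ 2) * ∫⁻ t in Ioc (0 : ℝ) 1, G (t • x + (1 - t) • y) := by
    intro x hx y hy
    have hseg : ∀ t ∈ Icc (0 : ℝ) 1, t • x + (1 - t) • y ∈ P := fun t ht => by
      rw [add_comm]
      exact hstar y hy hx (by linarith [ht.2]) ht.1 (by ring)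
    set p : ℝ → E := fun t => t • x + (1 - t) • y with hp
    have hpc : Continuous p := by fun_prop
    have hpU : MapsTo p (Icc 0 1) U := fun t ht => hPU (hseg t ht)
    have hd : ∀ t ∈ uIcc (0 : ℝ) 1, HasDerivAt (fun t => W (p t)) (fderiv ℝ W (p t) (x - y)) t := by
      intro t ht
      rw [uIcc_of_le zero_le_one] at ht
      have hl : HasDerivAt p (x - y) t := by
        have := ((hasDerivAt_id t).smul_const x).add (((hasDerivAt_id t).const_sub 1).smul_const y)
        convert! this using 1
        simp [sub_eq_add_neg]
      exact ((hW.contDiffAt (hU.mem_nhds (hpU ht))).differentiableAt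
        (by simp)).hasFDerivAt.comp_hasDerivAt t hl
    have hqc : ContinuousOn (fun t => fderiv ℝ W (p t) (x - y)) (Icc 0 1) :=
      ((hW.continuousOn_fderiv_of_isOpen hU le_rfl).comp hpc.continuousOn hpU).clm_apply
        continuousOn_const
    have hftc := intervalIntegral.integral_eq_sub_of_hasDerivAt hd
      (ContinuousOn.intervalIntegrable (by rwa [uIcc_of_le zero_le_one]))
    rw [intervalIntegral.integral_of_le zero_le_one] at hftc
    have hp1 : p 1 = x := by simp [hp]
    have hp0 : p 0 = y := by simp [hp]
    rw [hp1, hp0] at hftc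
    have hqL : MemLp (fun t => fderiv ℝ W (p t) (x - y)) 2 (volume.restrict (Ioc (0 : ℝ) 1)) := by
      obtain ⟨C, hC⟩ := isCompact_Icc.exists_bound_of_continuousOn hqc
      exact MemLp.of_bound ((hqc.mono Ioc_subset_Icc_self).aestronglyMeasurable measurableSet_Ioc) C
        ((ae_restrict_iff' measurableSet_Ioc).2
          (ae_of_all _ fun t ht => hC t (Ioc_subset_Icc_self ht)))
    have hcs := abs_integral_mul_le hqL
      (memLp_const (μ := volume.restrict (Ioc (0 : ℝ) 1)) (p := 2) (1 : ℝ))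
    simp only [mul_one, one_pow, integral_const, MeasurableSet.univ, measureReal_restrict_apply,
      univ_inter, Real.volume_real_Ioc_of_le zero_le_one, sub_zero, smul_eq_mul, Real.sqrt_one]
      at hcs
    rw [hftc] at hcs
    have hsq : (W x - W y) ^ 2 ≤ ∫ t in Ioc (0 : ℝ) 1, fderiv ℝ W (p t) (x - y) ^ 2 := by
      rw [← sq_abs, ← Real.sq_sqrt (integral_nonneg fun t => sq_nonneg
        (fderiv ℝ W (p t) (x - y)) : 0 ≤ ∫ t in Ioc (0 : ℝ) 1, fderiv ℝ W (p t) (x - y) ^ 2)]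
      exact pow_le_pow_left₀ (abs_nonneg _) hcs 2
    have hxy : dist x y ≤ R := hdiam x hx y (hBP hy)
    have hgp : ∀ t, fderiv ℝ W (p t) (x - y) ^ 2 ≤ R ^ 2 * g (p t) := by
      intro t
      have hn : dist x y ^ 2 = (x - y) 0 ^ 2 + (x - y) 1 ^ 2 := by
        rw [dist_eq_norm, EuclideanSpace.norm_sq_eq]; simp
      have : dist x y ^ 2 ≤ R ^ 2 := pow_le_pow_left₀ dist_nonneg hxy 2
      rw [fderiv_eq_sum_pderiv]
      simp only [hg, Fin.sum_univ_two] at *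
      nlinarith [sq_nonneg (pderiv 0 W (p t) * (x - y) 1 - pderiv 1 W (p t) * (x - y) 0),
        mul_le_mul_of_nonneg_right this
          (add_nonneg (sq_nonneg (pderiv 0 W (p t))) (sq_nonneg (pderiv 1 W (p t))))]
    calc ENNReal.ofReal ((W x - W y) ^ 2)
        ≤ ENNReal.ofReal (∫ t in Ioc (0 : ℝ) 1, fderiv ℝ W (p t) (x - y) ^ 2) :=
          ENNReal.ofReal_le_ofReal hsq
      _ = ∫⁻ t in Ioc (0 : ℝ) 1, ENNReal.ofReal (fderiv ℝ W (p t) (x - y) ^ 2) :=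
          ofReal_integral_eq_lintegral_ofReal hqL.integrable_sq (ae_of_all _ fun t => sq_nonneg _)
      _ ≤ ∫⁻ t in Ioc (0 : ℝ) 1, ENNReal.ofReal (R ^ 2) * G (p t) := by
          refine setLIntegral_mono' measurableSet_Ioc fun t ht => ?_
          have hm := hseg t (Ioc_subset_Icc_self ht)
          rw [hGdef, indicator_of_mem hm, ← ENNReal.ofReal_mul (sq_nonneg _)]
          exact ENNReal.ofReal_le_ofReal (hgp t)
      _ = _ := lintegral_const_mul' _ _ ENNReal.ofReal_ne_top
  have hBm : MeasurableSet B := Metric.isOpen_ball.measurableSet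
  have hjm : Measurable fun q : E × E × ℝ => G (q.2.2 • q.2.1 + (1 - q.2.2) • q.1) :=
    hGm.comp (by fun_prop)
  have hWP : ContinuousOn W P := hW.continuousOn.mono hPU
  have hGI : ∫⁻ z, G z = ENNReal.ofReal (∫ x in P, g x) := by
    rw [hGdef, lintegral_indicator hPm, ofReal_integral_eq_lintegral_ofReal
      ((hgc.mono hPU).integrableOn_compact hP) (ae_of_all _ hg0)]
  -- the average over the disc
  have hdouble : ∫⁻ y in B, ∫⁻ x in P, ENNReal.ofReal ((W x - W y) ^ 2)
      ≤ ENNReal.ofReal (R ^ 2) * (4 * (volume B + volume P) * ∫⁻ z, G z) := by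
    calc _ ≤ ∫⁻ y in B, ∫⁻ x in P, ENNReal.ofReal (R ^ 2) *
          ∫⁻ t in Ioc (0 : ℝ) 1, G (t • x + (1 - t) • y) :=
          setLIntegral_mono' hBm fun y hy => setLIntegral_mono' hPm fun x hx => hpt x hx y hy
      _ = ENNReal.ofReal (R ^ 2) * ∫⁻ t in Ioc (0 : ℝ) 1, ∫⁻ y in B, ∫⁻ x in P,
          G (t • x + (1 - t) • y) := by
          simp only [lintegral_const_mul' _ _ (ENNReal.ofReal_ne_top (r := R ^ 2))]
          congr 1
          have h1 : ∀ y, ∫⁻ x in P, ∫⁻ t in Ioc (0 : ℝ) 1, G (t • x + (1 - t) • y)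
              = ∫⁻ t in Ioc (0 : ℝ) 1, ∫⁻ x in P, G (t • x + (1 - t) • y) := fun y =>
            lintegral_lintegral_swap
              (hjm.comp (measurable_const.prodMk
                (measurable_fst.prodMk measurable_snd))).aemeasurable
          simp only [h1]
          refine lintegral_lintegral_swap (Measurable.aemeasurable ?_)
          exact Measurable.lintegral_prod_right' (f := fun q : (E × ℝ) × E =>
            G (q.1.2 • q.2 + (1 - q.1.2) • q.1.1)) (hGm.comp (by fun_prop))
      _ ≤ ENNReal.ofReal (R ^ 2) * ∫⁻ _ in Ioc (0 : ℝ) 1, 4 *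
        (volume B + volume P) * ∫⁻ z, G z := by
          refine mul_le_mul_right ?_ _
          exact setLIntegral_mono' measurableSet_Ioc fun t _ =>
            lintegral_lintegral_comp_segment_le hGm P B t
      _ = _ := by simp
  have hBvol : volume B = ENNReal.ofReal (Real.pi * r ^ 2) := by
    rw [hB, EuclideanSpace.volume_ball_fin_two, ENNReal.ofReal_mul Real.pi_pos.le,
      ENNReal.ofReal_pow hr.le, mul_comm, NNReal.coe_real_pi.symm, ENNReal.ofReal_coe_nnreal]
  have hB0 : volume B ≠ 0 := by
    rw [hBvol]; simp only [ne_eq, ENNReal.ofReal_eq_zero, not_le]; positivity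
  have hBt : volume B ≠ ⊤ := by rw [hBvol]; exact ENNReal.ofReal_ne_top
  have hmeasure : AEMeasurable (fun y => ∫⁻ x in P, ENNReal.ofReal ((W x - W y) ^ 2))
      (volume.restrict B) := by
    have hWm : AEMeasurable W (volume.restrict P) := hWP.aemeasurable hPm
    have hWB : AEMeasurable W (volume.restrict B) := (hWP.mono hBP).aemeasurable hBm
    have : AEMeasurable (fun q : E × E => ENNReal.ofReal ((W q.2 - W q.1) ^ 2))
        ((volume.restrict B).prod (volume.restrict P)) :=
      ((hWm.comp_snd.sub hWB.comp_fst).pow_const 2).ennreal_ofReal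
    exact this.lintegral_prod_right'
  -- some `y` in the disc does at least as well as the average; its value is the constant
  obtain ⟨y, hyB, hy⟩ := exists_le_setLAverage hB0 hBt hmeasure
  refine ⟨W y, ?_⟩
  have h1 : ENNReal.ofReal (∫ x in P, (W x - W y) ^ 2)
      = ∫⁻ x in P, ENNReal.ofReal ((W x - W y) ^ 2) :=
    ofReal_integral_eq_lintegral_ofReal
      (((hWP.sub continuousOn_const).pow 2).integrableOn_compact hP)
      (ae_of_all _ fun x => sq_nonneg _)
  rw [setLAverage_eq] at hy
  have hPt : volume P = ENNReal.ofReal (volume.real P) := by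
    rw [Measure.real, ENNReal.ofReal_toReal hP.measure_lt_top.ne]
  have hpi : 0 < Real.pi * r ^ 2 := by positivity
  have h2 : ENNReal.ofReal (∫ x in P, (W x - W y) ^ 2) ≤ ENNReal.ofReal
      (R ^ 2 * (4 * (Real.pi * r ^ 2 + volume.real P) * ∫ x in P, g x) / (Real.pi * r ^ 2)) := by
    rw [h1]
    refine hy.trans ?_
    rw [ENNReal.ofReal_div_of_pos hpi, ← hBvol]
    refine ENNReal.div_le_div_right (hdouble.trans (le_of_eq ?_)) _
    rw [hGI, ENNReal.ofReal_mul (sq_nonneg _), ENNReal.ofReal_mul (by positivity),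
      ENNReal.ofReal_mul (by norm_num), ENNReal.ofReal_add hpi.le measureReal_nonneg, ← hBvol,
        ← hPt]
    simp
  have hI0 : 0 ≤ ∫ x in P, g x := integral_nonneg hg0
  have h3 := (ENNReal.ofReal_le_ofReal_iff (by positivity)).1 h2
  refine h3.trans (le_of_eq ?_)
  field_simp

/-- A set that is star-shaped with respect to a disc contains, with each point, the convex hull of
the point and the disc. -/
theorem ball_lineMap_subset {P : Set E} {x₀ p : E} {r lam : ℝ}
    (hstar : ∀ y ∈ Metric.ball x₀ r, StarConvex ℝ y P) (hp : p ∈ P) (h0 : 0 ≤ lam) (h1 : lam < 1) :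
    Metric.ball (AffineMap.lineMap x₀ p lam) ((1 - lam) * r) ⊆ P := by
  intro z hz
  have hl : 0 < 1 - lam := by linarith
  set y : E := (1 - lam)⁻¹ • (z - lam • p) with hy
  have hzy : (1 - lam) • y + lam • p = z := by
    rw [hy, smul_inv_smul₀ hl.ne']; abel
  have hyB : y ∈ Metric.ball x₀ r := by
    rw [Metric.mem_ball, dist_eq_norm] at hz ⊢
    have : z - AffineMap.lineMap x₀ p lam = (1 - lam) • (y - x₀) := by
      rw [← hzy, AffineMap.lineMap_apply_module]; module
    rw [this, norm_smul, Real.norm_of_nonneg hl.le] at hz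
    exact lt_of_mul_lt_mul_left hz hl.le
  rw [← hzy]
  exact hstar y hyB hp hl.le h0 (by ring)

/-- Contraction towards the centre maps a star-shaped set into its interior. -/
theorem lineMap_mem_interior {P : Set E} {x₀ p : E} {r lam : ℝ} (hr : 0 < r)
    (hstar : ∀ y ∈ Metric.ball x₀ r, StarConvex ℝ y P) (hp : p ∈ P) (h0 : 0 ≤ lam) (h1 : lam < 1) :
    AffineMap.lineMap x₀ p lam ∈ interior P :=
  mem_interior.2 ⟨_, ball_lineMap_subset hstar hp h0 h1, Metric.isOpen_ball,
    Metric.mem_ball_self (mul_pos (by linarith) hr)⟩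

theorem eventually_homothety_mem {U : Set E} (hU : IsOpen U) {x : E} (hx : x ∈ U) (c : E)
    {lam : ℕ → ℝ} (hlam : Tendsto lam atTop (𝓝 1)) :
    ∀ᶠ k in atTop, AffineMap.lineMap c x (lam k)⁻¹ ∈ U := by
  have hc : Tendsto (fun k => AffineMap.lineMap c x (lam k)⁻¹) atTop
      (𝓝 (AffineMap.lineMap c x (1 : ℝ))) :=
    (AffineMap.lineMap_continuous (p := c) (q := x)).continuousAt.tendsto.comp
      (by simpa using hlam.inv₀ one_ne_zero)
  rw [AffineMap.lineMap_apply_one] at hc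
  exact hc.eventually (hU.mem_nhds hx)

/-- A sequence of factors in `[1/2, 1)` that increases to `1`. -/
def dilationFactor (k : ℕ) : ℝ := 1 - 1 / (k + 2)

theorem dilationFactor_lt_one (k : ℕ) : dilationFactor k < 1 := by
  have : (0 : ℝ) < 1 / (k + 2) := by positivity
  unfold dilationFactor; linarith

theorem half_le_dilationFactor (k : ℕ) : 1 / 2 ≤ dilationFactor k := by
  have : (1 : ℝ) / (k + 2) ≤ 1 / 2 := by
    apply one_div_le_one_div_of_le <;> [norm_num; skip]
    have : (0 : ℝ) ≤ k := Nat.cast_nonneg k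
    linarith
  unfold dilationFactor; linarith

theorem dilationFactor_pos (k : ℕ) : 0 < dilationFactor k := by
  have := half_le_dilationFactor k; linarith

theorem tendsto_dilationFactor : Tendsto dilationFactor atTop (𝓝 1) := by
  have h : Tendsto (fun k : ℕ => (1 : ℝ) / (k + 2)) atTop (𝓝 0) := by
    have := (tendsto_one_div_add_atTop_nhds_zero_nat (𝕜 := ℝ)).comp (tendsto_add_atTop_nat 1)
    refine this.congr fun k => ?_
    simp only [Function.comp_apply, Nat.cast_add, Nat.cast_one]
    congr 1; ring
  have := h.const_sub 1
  rw [sub_zero] at this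
  exact this

/-- The mean value minimizes the mean square deviation. -/
theorem integral_sq_sub_le {P : Set E} (hP : volume P ≠ ⊤) {W : E → ℝ}
    (hW : MemLp W 2 (volume.restrict P)) (k : ℝ) :
    (∫ x in P, W x ^ 2) - (∫ x in P, W x) ^ 2 / volume.real P ≤ ∫ x in P, (W x - k) ^ 2 := by
  have : IsFiniteMeasure (volume.restrict P) := ⟨by simpa using hP.lt_top⟩
  have hI : Integrable W (volume.restrict P) := hW.integrable (by norm_num)
  have e : ∫ x in P, (W x - k) ^ 2
      = (∫ x in P, W x ^ 2) - 2 * k * (∫ x in P, W x) + volume.real P * k ^ 2 := by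
    have : ∀ x, (W x - k) ^ 2 = W x ^ 2 - 2 * k * W x + k ^ 2 := fun x => by ring
    simp only [this]
    rw [integral_add (f := fun x => W x ^ 2 - 2 * k * W x) (hW.integrable_sq.sub (hI.const_mul _))
      (integrable_const _),
      integral_sub hW.integrable_sq (hI.const_mul _), integral_const_mul]
    simp
  rw [e]
  rcases (measureReal_nonneg (μ := volume) (s := P)).eq_or_lt with h0 | h0
  · have : volume P = 0 := by
      rcases (ENNReal.toReal_eq_zero_iff _).1 h0.symm with h | h
      · exact h
      · exact absurd h hP
    simp only [Measure.restrict_eq_zero.2 this, integral_zero_measure, ← h0]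
    simp
  · have : 0 ≤ ((∫ x in P, W x) - volume.real P * k) ^ 2 / volume.real P := by positivity
    have e2 : ((∫ x in P, W x) - volume.real P * k) ^ 2 / volume.real P
        = (∫ x in P, W x) ^ 2 / volume.real P - 2 * k * (∫ x in P, W x)
          + volume.real P * k ^ 2 := by
      field_simp
      ring
    linarith

/-- The Poincaré inequality for weakly differentiable functions on a star-shaped set, written with
the variance. It follows from the smooth case on slightly contracted copies of the set, which are
compact subsets of `Ω`. -/
theorem HasWeakGrad.poincare {Ω : Set E} (hΩ : IsOpen Ω) {W : E → ℝ} {D : Fin 2 → E → ℝ}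
    (h : HasWeakGrad Ω W D) {P : Set E} {x₀ : E} {r R : ℝ} (hr : 0 < r)
    (hP : IsCompact P) (hBP : Metric.ball x₀ r ⊆ P)
    (hstar : ∀ y ∈ Metric.ball x₀ r, StarConvex ℝ y P)
    (hdiam : ∀ x ∈ P, ∀ y ∈ P, dist x y ≤ R) (hPΩ : interior P ⊆ Ω)
    (hfr : volume (frontier P) = 0) :
    (∫ x in P, W x ^ 2) - (∫ x in P, W x) ^ 2 / volume.real P
      ≤ 4 * R ^ 2 * (1 + 4 * volume.real P / (Real.pi * r ^ 2)) * ∫ x in P, ∑ i, D i x ^ 2 := by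
  have hPm := hP.measurableSet
  have hae : (interior P : Set E) =ᵐ[volume] P := by
    refine interior_subset.eventuallyLE.antisymm ?_
    rw [ae_le_set, hP.isClosed.frontier_eq.symm]; exact hfr
  have hres : (volume : Measure E).restrict P ≤ volume.restrict Ω := by
    rw [← Measure.restrict_congr_set hae]; exact Measure.restrict_mono_set _ hPΩ
  have : IsFiniteMeasure (volume.restrict P) := ⟨by simpa using hP.measure_lt_top⟩
  have hWP := h.memLp.mono_measure hres
  have hDP := fun i => (h.memLp_grad i).mono_measure hres
  have hx₀ : x₀ ∈ P := hBP (Metric.mem_ball_self hr)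
  obtain ⟨w, hw, hlim⟩ := h.exists_approx hΩ
  set C := 4 * R ^ 2 * (1 + 4 * volume.real P / (Real.pi * r ^ 2)) with hC
  -- the contracted copies of `P`
  set Q : ℕ → Set E := fun k => (fun x => AffineMap.lineMap x₀ x (dilationFactor k)) '' P with hQ
  have hlc : ∀ lam : ℝ, Continuous fun x : E => (AffineMap.lineMap x₀ x lam : E) := fun lam => by
    simp only [AffineMap.lineMap_apply_module]; fun_prop
  have hQc : ∀ k, IsCompact (Q k) := fun k => hP.image (hlc _)
  have hQi : ∀ k, Q k ⊆ interior P := by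
    rintro k _ ⟨p, hp, rfl⟩
    exact lineMap_mem_interior hr hstar hp (dilationFactor_pos k).le (dilationFactor_lt_one k)
  have hQP : ∀ k, Q k ⊆ P := fun k => (hQi k).trans interior_subset
  have hQΩ : ∀ k, Q k ⊆ Ω := fun k => (hQi k).trans hPΩ
  have hQlim : ∀ᵐ x, x ∈ P → ∀ᶠ k in atTop, x ∈ Q k := by
    filter_upwards [hae.mem_iff] with x hx hxP
    filter_upwards [eventually_homothety_mem isOpen_interior (hx.2 hxP) x₀ tendsto_dilationFactor]
      with k hk
    refine ⟨_, interior_subset hk, ?_⟩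
    simp only [AffineMap.lineMap_apply, vsub_eq_sub, vadd_eq_add, add_sub_cancel_right, smul_smul]
    rw [mul_inv_cancel₀ (dilationFactor_pos k).ne']; simp
  have hQv : ∀ k, IsFiniteMeasure (volume.restrict (Q k)) := fun k =>
    ⟨by simpa using (hQc k).measure_lt_top⟩
  -- the inequality on a contracted copy
  have hk : ∀ k, (∫ x in Q k, W x ^ 2) - (∫ x in Q k, W x) ^ 2 / volume.real (Q k)
      ≤ C * ∫ x in Q k, ∑ i, D i x ^ 2 := by
    intro k
    set lam := dilationFactor k
    have hl0 : 0 < lam := dilationFactor_pos k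
    have hl1 : lam < 1 := dilationFactor_lt_one k
    have hlh : 1 / 2 ≤ lam := half_le_dilationFactor k
    obtain ⟨a1, a2, a3, a4⟩ := hlim (Q k) (Q k) (hQc k) (hQΩ k) subset_rfl
    have hresk : (volume : Measure E).restrict (Q k) ≤ volume.restrict P :=
      Measure.restrict_mono_set _ (hQP k)
    have t1 := tendsto_integral_sq a1 (hWP.mono_measure hresk) a3
    have t2 := (tendsto_integral_of_tendsto_eLpNorm_two a1 (hWP.mono_measure hresk) a3)
    have t3 : Tendsto (fun n => ∫ x in Q k, ∑ i, pderiv i (w n) x ^ 2) atTop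
        (𝓝 (∫ x in Q k, ∑ i, D i x ^ 2)) := by
      have e1 : ∫ x in Q k, ∑ i, D i x ^ 2 = ∑ i, ∫ x in Q k, D i x ^ 2 :=
        integral_finsetSum _ fun i _ => ((hDP i).mono_measure hresk).integrable_sq
      have e2 : ∀ n, ∫ x in Q k, ∑ i, pderiv i (w n) x ^ 2
          = ∑ i, ∫ x in Q k, pderiv i (w n) x ^ 2 := fun n =>
        integral_finsetSum _ fun i _ => (a2 i n).integrable_sq
      rw [e1]
      simp only [e2]
      exact tendsto_finsetSum _ fun i _ =>
        tendsto_integral_sq (a2 i) ((hDP i).mono_measure hresk) (a4 i)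
    refine le_of_tendsto_of_tendsto (t1.sub ((t2.pow 2).div_const _)) (t3.const_mul C)
      (Eventually.of_forall fun n => ?_)
    have hball : ∀ y ∈ Metric.ball x₀ (lam * r), ∃ y' ∈ Metric.ball x₀ r,
        AffineMap.lineMap x₀ y' lam = y := by
      intro y hy
      refine ⟨AffineMap.lineMap x₀ y lam⁻¹, ?_, ?_⟩
      · rw [Metric.mem_ball, dist_lineMap_left, norm_inv, Real.norm_of_nonneg hl0.le,
          inv_mul_lt_iff₀ hl0, dist_comm]
        exact hy
      · simp [AffineMap.lineMap_apply, smul_smul, mul_inv_cancel₀ hl0.ne']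
    -- the contracted copy is star-shaped with respect to the contracted disc
    have hstark : ∀ y ∈ Metric.ball x₀ (lam * r), StarConvex ℝ y (Q k) := by
      intro y hy
      obtain ⟨y', hy', rfl⟩ := hball y hy
      rintro _ ⟨p, hp, rfl⟩ s t hs ht hst
      refine ⟨s • y' + t • p, hstar y' hy' hp hs ht hst, ?_⟩
      have : s = 1 - t := by linarith
      subst this
      simp only [AffineMap.lineMap_apply_module]
      module
    obtain ⟨c, hc⟩ := exists_integral_sub_sq_le_of_contDiffOn (mul_pos hl0 hr) (hQc k)
      (fun y hy => by
        obtain ⟨y', hy', rfl⟩ := hball y hy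
        exact ⟨y', hBP hy', rfl⟩) hstark
      (fun x hx y hy => hdiam x (hQP k hx) y (hQP k hy)) hΩ (hQΩ k) (hw n)
    refine (integral_sq_sub_le (hQc k).measure_lt_top.ne (a1 n) c).trans (hc.trans ?_)
    refine mul_le_mul_of_nonneg_right ?_
      (integral_nonneg fun x => Finset.sum_nonneg fun i _ => sq_nonneg _)
    rw [hC]
    gcongr 4 * R ^ 2 * (1 + ?_)
    have hv : volume.real (Q k) ≤ volume.real P :=
      measureReal_mono (hQP k) hP.measure_lt_top.ne
    -- the contracted disc has radius at least `r / 2`, which costs a factor `4`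
    have hl2 : 1 / 4 ≤ lam ^ 2 := by nlinarith
    have hpr : 0 < Real.pi * r ^ 2 := by positivity
    rw [div_le_div_iff₀ (by positivity) hpr]
    have hv0 : 0 ≤ volume.real P := measureReal_nonneg
    calc volume.real (Q k) * (Real.pi * r ^ 2) ≤ volume.real P * (Real.pi * r ^ 2) := by gcongr
      _ ≤ volume.real P * (Real.pi * r ^ 2) * (4 * lam ^ 2) :=
          le_mul_of_one_le_right (by positivity) (by linarith)
      _ = _ := by ring
  -- the limit `k → ∞`
  have hQm : ∀ k, MeasurableSet (Q k) := fun k => (hQc k).measurableSet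
  have t1 := tendsto_setIntegral_of_eventually_mem hPm hQm hQP hQlim hWP.integrable_sq
  have t2 := tendsto_setIntegral_of_eventually_mem hPm hQm hQP hQlim
    (hWP.integrable (by norm_num))
  have t3 := tendsto_setIntegral_of_eventually_mem hPm hQm hQP hQlim (F := fun x => ∑ i, D i x ^ 2)
    (integrable_finsetSum _ fun i _ => (hDP i).integrable_sq)
  have t4 : Tendsto (fun k => volume.real (Q k)) atTop (𝓝 (volume.real P)) := by
    have := tendsto_setIntegral_of_eventually_mem hPm hQm hQP hQlim (F := fun _ => (1 : ℝ))
      (integrable_const _)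
    simpa using this
  have hvol : 0 < volume.real P := by
    refine ENNReal.toReal_pos ?_ hP.measure_lt_top.ne
    exact ((Metric.measure_ball_pos volume x₀ hr).trans_le (measure_mono hBP)).ne'
  exact le_of_tendsto_of_tendsto (t1.sub ((t2.pow 2).div t4 hvol.ne')) (t3.const_mul C)
    (Eventually.of_forall hk)

/-! ### Geometry of star-shaped polygons -/

theorem volume_segment_eq_zero (a b : E) : volume (segment ℝ a b) = 0 := by
  have hne : line[ℝ, a, b] ≠ ⊤ := by
    intro h
    have h1 : Module.finrank ℝ (vectorSpan ℝ ({a, b} : Set E)) ≤ 1 :=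
      collinear_iff_finrank_le_one.1 (collinear_pair ℝ a b)
    rw [← direction_affineSpan, h, AffineSubspace.direction_top, finrank_top] at h1
    simp at h1
  refine measure_mono_null ?_ (Measure.addHaar_affineSubspace volume _ hne)
  rw [← affineSegment_eq_segment]
  exact fun x hx => affineSegment_subset_affineSpan ℝ a b hx

/-- A segment determines its endpoints up to order. -/
theorem endpoints_eq_of_affineSegment_eq {a b a' b' : E} (hab : a ≠ b)
    (h : affineSegment ℝ a b = affineSegment ℝ a' b') : (a = a' ∧ b = b') ∨ (a = b' ∧ b = a') := by
  obtain ⟨s, hs, rfl⟩ : a ∈ affineSegment ℝ a' b' := h ▸ left_mem_affineSegment ℝ a b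
  obtain ⟨t, ht, rfl⟩ : b ∈ affineSegment ℝ a' b' := h ▸ right_mem_affineSegment ℝ _ b
  obtain ⟨s', hs', h1⟩ := h.symm ▸ left_mem_affineSegment ℝ a' b'
  obtain ⟨t', ht', h2⟩ := h.symm ▸ right_mem_affineSegment ℝ a' b'
  have hd1 := dist_lineMap_lineMap a' b' s t
  have hd2 := dist_lineMap_lineMap (AffineMap.lineMap a' b' s) (AffineMap.lineMap a' b' t) s' t'
  rw [h1, h2, hd1, Real.dist_eq, Real.dist_eq] at hd2
  have hpos : 0 < dist (AffineMap.lineMap a' b' s) (AffineMap.lineMap a' b' t) := dist_pos.2 hab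
  rw [hd1, Real.dist_eq] at hpos
  have hd0 : 0 < dist a' b' := by
    rcases (dist_nonneg (x := a') (y := b')).eq_or_lt with h0 | h0
    · rw [← h0] at hpos; simp at hpos
    · exact h0
  have hst1 : |s - t| ≤ 1 := abs_le.2 ⟨by linarith [hs.1, ht.2], by linarith [hs.2, ht.1]⟩
  have hst2 : |s' - t'| ≤ 1 := abs_le.2 ⟨by linarith [hs'.1, ht'.2], by linarith [hs'.2, ht'.1]⟩
  have h3 : 1 ≤ |s - t| := by
    have h4 : 1 = |s' - t'| * |s - t| := by
      apply mul_right_cancel₀ hd0.ne'; rw [one_mul, mul_assoc]; exact hd2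
    calc (1 : ℝ) = |s' - t'| * |s - t| := h4
      _ ≤ 1 * |s - t| := by gcongr
      _ = _ := one_mul _
  rcases le_abs'.1 h3 with h5 | h5
  · have e1 : s = 0 := by linarith [hs.1, ht.2]
    have e2 : t = 1 := by linarith [hs.1, ht.2]
    left; simp [e1, e2]
  · have e1 : s = 1 := by linarith [hs.2, ht.1]
    have e2 : t = 0 := by linarith [hs.2, ht.1]
    right; simp [e1, e2]

/-- Vectors with vanishing cross product are proportional. -/
theorem exists_smul_of_cross_eq_zero {x y : E} (h : cross x y = 0) (hx : x ≠ 0) :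
    ∃ c : ℝ, y = c • x := by
  by_cases h0 : x 0 = 0
  · have h1 : x 1 ≠ 0 := fun h1 => hx (by ext j; fin_cases j <;> simp [h0, h1])
    refine ⟨y 1 / x 1, ?_⟩
    simp only [cross, h0, zero_mul, zero_sub, neg_eq_zero, mul_eq_zero, h1, false_or] at h
    ext j; fin_cases j
    · simp [h0, h]
    · simp; field_simp
  · refine ⟨y 0 / x 0, ?_⟩
    simp only [cross] at h
    ext j; fin_cases j
    · simp; field_simp
    · simp; field_simp; linarith

theorem finRotate_ne_self {n : ℕ} (hn : 2 ≤ n) (i : Fin n) : finRotate n i ≠ i := by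
  obtain ⟨m, rfl⟩ : ∃ m, n = m + 2 := ⟨n - 2, by omega⟩
  rw [← Equiv.Perm.mem_support, support_finRotate]
  exact Finset.mem_univ _

/-- Cyclic induction. -/
theorem forall_of_finRotate {n : ℕ} (hn : 2 ≤ n) {P : Fin n → Prop}
    (hP : ∀ i, P i → P (finRotate n i)) {i : Fin n} (hi : P i) (j : Fin n) : P j := by
  obtain ⟨m, rfl⟩ : ∃ m, n = m + 2 := ⟨n - 2, by omega⟩
  obtain ⟨k, -, hk⟩ := ((isCycle_finRotate (n := m)).sameCycle (finRotate_ne_self hn i)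
    (finRotate_ne_self hn j)).exists_pow_eq'
  have key : ∀ k : ℕ, P ((finRotate (m + 2) ^ k) i) := fun k => by
    induction k with
    | zero => simpa using hi
    | succ k ih => rw [pow_succ', Equiv.Perm.mul_apply]; exact hP _ ih
  exact hk ▸ key k

namespace Poly

variable (T : Poly)

/-- The initial vertex of the edge `eᵢ`. -/
def tail (i : Fin T.N) : E := T.vert i

/-- The final vertex of the edge `eᵢ`. -/
def head (i : Fin T.N) : E := T.vert (finRotate T.N i)

theorem finRotate_ne (i : Fin T.N) : finRotate T.N i ≠ i :=
  finRotate_ne_self (by have := T.three_le; omega) i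

theorem tail_ne_head (i : Fin T.N) : T.tail i ≠ T.head i := fun h =>
  T.finRotate_ne i (T.injective h).symm

theorem len_eq (i : Fin T.N) : T.len i = dist (T.tail i) (T.head i) := rfl

theorem len_pos (i : Fin T.N) : 0 < T.len i := dist_pos.2 (T.tail_ne_head i)

theorem edge_eq (i : Fin T.N) : T.edge i = affineSegment ℝ (T.tail i) (T.head i) := rfl

theorem tail_mem_edge (i : Fin T.N) : T.tail i ∈ T.edge i := left_mem_affineSegment ℝ _ _

theorem head_mem_edge (i : Fin T.N) : T.head i ∈ T.edge i := right_mem_affineSegment ℝ _ _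

theorem edge_subset_frontier (i : Fin T.N) : T.edge i ⊆ frontier T.carrier := by
  rw [T.frontier_eq]; exact subset_iUnion (fun i => T.vert.edgeSet ℝ i) i

theorem edge_subset_carrier (i : Fin T.N) : T.edge i ⊆ T.carrier :=
  (T.edge_subset_frontier i).trans T.isCompact.isClosed.frontier_subset

theorem measurableSet_carrier : MeasurableSet T.carrier := T.isCompact.measurableSet

theorem volume_edge (i : Fin T.N) : volume (T.edge i) = 0 := by
  rw [edge_eq, affineSegment_eq_segment]; exact volume_segment_eq_zero _ _

theorem volume_frontier : volume (frontier T.carrier) = 0 := by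
  rw [T.frontier_eq]
  exact measure_iUnion_null fun i => T.volume_edge i

theorem interior_ae_eq : (interior T.carrier : Set E) =ᵐ[volume] T.carrier := by
  refine interior_subset.eventuallyLE.antisymm ?_
  rw [ae_le_set, T.isCompact.isClosed.frontier_eq.symm]
  exact T.volume_frontier

theorem notMem_interior_of_mem_edge {i : Fin T.N} {p : E} (hp : p ∈ T.edge i) :
    p ∉ interior T.carrier := (T.edge_subset_frontier i hp).2

/-- `T` is star-shaped with respect to the disc of radius `r` about `x₀`. -/
structure StarAbout (x₀ : E) (r : ℝ) : Prop where
  pos : 0 < r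
  star : ∀ y ∈ Metric.ball x₀ r, StarConvex ℝ y T.carrier

/-- Twice the signed area of the triangle spanned by `x` and the edge `eᵢ`. -/
def dblArea (x : E) (i : Fin T.N) : ℝ := cross (T.tail i - x) (T.head i - x)

variable {T} {x₀ : E} {r : ℝ}

namespace StarAbout

theorem ball_subset (h : T.StarAbout x₀ r) : Metric.ball x₀ r ⊆ T.carrier := fun y hy =>
  (h.star y hy).mem (T.interior_nonempty.mono interior_subset)

theorem center_mem_interior (h : T.StarAbout x₀ r) : x₀ ∈ interior T.carrier :=
  mem_interior.2 ⟨_, h.ball_subset, Metric.isOpen_ball, Metric.mem_ball_self h.pos⟩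

theorem of_mem_ball (h : T.StarAbout x₀ r) {y : E} (hy : y ∈ Metric.ball x₀ r) :
    ∃ r' > 0, T.StarAbout y r' := by
  refine ⟨r - dist y x₀, sub_pos.2 hy, sub_pos.2 hy, fun z hz => h.star z ?_⟩
  rw [Metric.mem_ball] at hz ⊢
  linarith [dist_triangle z y x₀]

theorem lineMap_mem (h : T.StarAbout x₀ r) {p : E} (hp : p ∈ T.carrier) {t : ℝ} (h0 : 0 ≤ t)
    (h1 : t < 1) : AffineMap.lineMap x₀ p t ∈ interior T.carrier :=
  lineMap_mem_interior h.pos h.star hp h0 h1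

/-- Every ray from the centre meets the boundary at most once. -/
theorem ray_unique (h : T.StarAbout x₀ r) {p q : E} (hp : p ∈ frontier T.carrier)
    (hq : q ∈ frontier T.carrier) {t : ℝ} (ht : 0 < t) (hpq : q = AffineMap.lineMap x₀ p t) :
    t = 1 := by
  have hfc := T.isCompact.isClosed.frontier_subset
  rcases lt_trichotomy t 1 with h1 | h1 | h1
  · exact absurd (hpq ▸ h.lineMap_mem (hfc hp) ht.le h1) hq.2
  · exact h1
  · have : p = AffineMap.lineMap x₀ q t⁻¹ := by
      rw [hpq]
      simp [AffineMap.lineMap_apply, smul_smul, inv_mul_cancel₀ ht.ne']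
    exact absurd (this ▸ h.lineMap_mem (hfc hq) (inv_nonneg.2 ht.le)
      (inv_lt_one_of_one_lt₀ h1)) hp.2

/-- The line through an edge misses the centre. -/
theorem dblArea_ne_zero (h : T.StarAbout x₀ r) (i : Fin T.N) : T.dblArea x₀ i ≠ 0 := by
  intro h0
  have ha := T.edge_subset_frontier i (T.tail_mem_edge i)
  have hb := T.edge_subset_frontier i (T.head_mem_edge i)
  have hax : T.tail i - x₀ ≠ 0 := by
    intro h1
    exact ha.2 (sub_eq_zero.1 h1 ▸ h.center_mem_interior)
  obtain ⟨c, hc⟩ := exists_smul_of_cross_eq_zero h0 hax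
  rcases le_or_gt c 0 with hc0 | hc0
  · -- the centre would lie on the edge
    have h1 : (0 : ℝ) < 1 - c := by linarith
    have hx : AffineMap.lineMap (T.tail i) (T.head i) (1 - c)⁻¹ = x₀ := by
      have hb' : T.head i = x₀ + c • (T.tail i - x₀) := by rw [← hc]; abel
      have : (1 - c) • (AffineMap.lineMap (T.tail i) (T.head i) (1 - c)⁻¹ : E) = (1 - c) • x₀ := by
        rw [AffineMap.lineMap_apply_module', smul_add, smul_inv_smul₀ h1.ne', hb']
        module
      exact smul_right_injective E h1.ne' this
    have hx0 : x₀ ∈ T.edge i :=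
      ⟨(1 - c)⁻¹, ⟨inv_nonneg.2 h1.le, inv_le_one_of_one_le₀ (by linarith)⟩, hx⟩
    exact T.notMem_interior_of_mem_edge hx0 h.center_mem_interior
  · have hb' : T.head i = AffineMap.lineMap x₀ (T.tail i) c := by
      rw [AffineMap.lineMap_apply_module', ← hc]; abel
    have := h.ray_unique ha hb hc0 hb'
    rw [this, AffineMap.lineMap_apply_one] at hb'
    exact T.tail_ne_head i hb'.symm

/-- If two consecutive edges were seen from the centre with opposite orientations, a ray close to
their common vertex would meet both of them. -/
theorem dblArea_mul_next_pos (h : T.StarAbout x₀ r) (i : Fin T.N) :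
    0 < T.dblArea x₀ i * T.dblArea x₀ (finRotate T.N i) := by
  set j := finRotate T.N i with hj
  by_contra hneg
  have hi0 := h.dblArea_ne_zero i
  have hj0 := h.dblArea_ne_zero j
  set u := T.tail i - x₀ with hu
  set p := T.head i - x₀ with hp
  set w := T.head j - x₀ with hw
  have hpj : T.tail j - x₀ = p := rfl
  set s := T.dblArea x₀ i with hs
  have hs' : s = cross u p := rfl
  have hsj : T.dblArea x₀ j = cross p w := rfl
  set y := - T.dblArea x₀ j / s with hy
  have hy0 : 0 < y := by
    have hlt : s * T.dblArea x₀ j < 0 := lt_of_le_of_ne (not_lt.1 hneg) (mul_ne_zero hi0 hj0)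
    have : y = -(s * T.dblArea x₀ j) / s ^ 2 := by rw [hy]; field_simp
    rw [this]; exact div_pos (by linarith) (by positivity)
  -- `u`, `p`, `w` are the three vertices seen from the centre; since the orientations differ, `w` lies
  -- on the same side of the line through `p` as `u`, that is, its coefficient `y` at `u` is positive
  obtain ⟨x, hx⟩ : ∃ x : ℝ, w = x • p + y • u := by
    refine ⟨cross u w / s, ?_⟩
    have h1 : s • w = cross u w • p + (- T.dblArea x₀ j) • u := by
      rw [hsj, hs']
      ext k
      fin_cases k <;> simp [cross] <;> ring
    rw [hy, div_eq_inv_mul, div_eq_inv_mul, mul_smul, mul_smul, ← smul_add, ← h1,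
      inv_smul_smul₀ hi0]
  -- a parameter `δ` close to the common vertex
  obtain ⟨δ, ⟨hθ, hε1⟩, hδ0, hδ1⟩ : ∃ δ : ℝ, (0 < 1 - δ + δ * x + δ * y ∧
      δ * y < 1 - δ + δ * x + δ * y) ∧ 0 < δ ∧ δ < 1 := by
    have c1 : ∀ᶠ δ : ℝ in 𝓝[>] 0, 0 < 1 - δ + δ * x + δ * y := by
      have hc : Continuous fun δ : ℝ => 1 - δ + δ * x + δ * y := by fun_prop
      exact (hc.continuousAt (x := 0)).eventually (lt_mem_nhds (by norm_num))
        |>.filter_mono nhdsWithin_le_nhds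
    have c2 : ∀ᶠ δ : ℝ in 𝓝[>] 0, 0 < 1 - δ + δ * x := by
      have hc : Continuous fun δ : ℝ => 1 - δ + δ * x := by fun_prop
      exact (hc.continuousAt (x := 0)).eventually (lt_mem_nhds (by norm_num))
        |>.filter_mono nhdsWithin_le_nhds
    have c3 : ∀ᶠ δ : ℝ in 𝓝[>] 0, δ < 1 :=
      (gt_mem_nhds (zero_lt_one)).filter_mono nhdsWithin_le_nhds
    obtain ⟨δ, ⟨⟨a1, a2⟩, a3⟩, a4⟩ := (((c1.and c2).and c3).and self_mem_nhdsWithin).exists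
    exact ⟨δ, ⟨a1, by linarith⟩, a4, a3⟩
  set θ := 1 - δ + δ * x + δ * y with hθd
  set ε := δ * y / θ with hε
  have hε0 : 0 < ε := by positivity
  have hεlt : ε < 1 := (div_lt_one hθ).2 hε1
  -- the points of the two edges on a common ray; they coincide, which contradicts simplicity
  set q₁ : E := AffineMap.lineMap (T.head i) (T.tail i) ε with hq₁
  set q₂ : E := AffineMap.lineMap (T.tail j) (T.head j) δ with hq₂
  have m1 : q₁ ∈ T.edge i := by
    rw [edge_eq, affineSegment_comm]
    exact ⟨ε, ⟨hε0.le, hεlt.le⟩, rfl⟩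
  have m2 : q₂ ∈ T.edge j := ⟨δ, ⟨hδ0.le, hδ1.le⟩, rfl⟩
  have e1 : q₁ - x₀ = p + ε • (u - p) := by
    rw [hq₁, AffineMap.lineMap_apply_module', hu, hp]; module
  have e2 : q₂ - x₀ = p + δ • (w - p) := by
    rw [hq₂, AffineMap.lineMap_apply_module', hw, ← hpj]; module
  have hray : q₂ = AffineMap.lineMap x₀ q₁ θ := by
    have hθε : θ * ε = δ * y := by rw [hε]; field_simp
    have : q₂ - x₀ = θ • (q₁ - x₀) := by
      rw [e1, e2, hx, smul_add, smul_smul, hθε, hθd]; module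
    rw [AffineMap.lineMap_apply_module', ← this]; abel
  have hθ1 := h.ray_unique (T.edge_subset_frontier i m1) (T.edge_subset_frontier j m2) hθ hray
  rw [hθ1, AffineMap.lineMap_apply_one] at hray
  have hne : i ≠ j := (T.finRotate_ne i).symm
  rcases T.simple i j hne q₁ ⟨m1, hray ▸ m2⟩ with ⟨_, h1⟩ | ⟨_, h1⟩
  · have h2 : q₁ = T.head i := h1
    rw [hq₁, AffineMap.lineMap_eq_left_iff] at h2
    rcases h2 with h2 | h2
    · exact T.tail_ne_head i h2.symm
    · exact hε0.ne' h2
  · have h2 : q₁ = T.tail i := h1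
    rw [hq₁, AffineMap.lineMap_eq_right_iff] at h2
    rcases h2 with h2 | h2
    · exact T.tail_ne_head i h2.symm
    · exact hεlt.ne h2

theorem sum_dblArea (x : E) : ∑ i, T.dblArea x i
    = ∑ i, (T.vert i 0 * T.vert (finRotate T.N i) 1 - T.vert (finRotate T.N i) 0 * T.vert i 1) := by
  have e : ∀ i, T.dblArea x i
      = (T.vert i 0 * T.vert (finRotate T.N i) 1 - T.vert (finRotate T.N i) 0 * T.vert i 1)
        + (cross x (T.vert i) - cross x (T.vert (finRotate T.N i))) := fun i => by
    simp only [dblArea, tail, head, cross, PiLp.sub_apply]; ring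
  have h2 := Equiv.sum_comp (finRotate T.N) fun i => cross x (T.vert i)
  rw [Finset.sum_congr rfl fun i _ => e i, Finset.sum_add_distrib,
    Finset.sum_sub_distrib (fun i => cross x (T.vert i)), h2, sub_self, add_zero]

/-- All edges are seen counterclockwise from the centre: consecutive edges are seen with the same
orientation, and the sum of the signed areas is positive. -/
theorem dblArea_pos (h : T.StarAbout x₀ r) (i : Fin T.N) : 0 < T.dblArea x₀ i := by
  by_contra hi
  have hn : 2 ≤ T.N := by have := T.three_le; omega
  have hneg : T.dblArea x₀ i < 0 := lt_of_le_of_ne (not_lt.1 hi) (h.dblArea_ne_zero i)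
  have hall : ∀ j, T.dblArea x₀ j < 0 := forall_of_finRotate hn
    (P := fun j => T.dblArea x₀ j < 0) (fun j hj => by
      by_contra hj'
      exact absurd (h.dblArea_mul_next_pos j)
        (not_lt.2 (mul_nonpos_of_nonpos_of_nonneg hj.le (not_lt.1 hj')))) hneg
  have hsum : ∑ j, T.dblArea x₀ j ≤ 0 := Finset.sum_nonpos fun j _ => (hall j).le
  rw [sum_dblArea] at hsum
  exact absurd T.ccw (not_lt.2 hsum)

theorem cross_eq_len_mul_inner_normal (i : Fin T.N) (v : E) :
    cross v (T.head i - T.tail i) = T.len i * inner ℝ v (T.normal i) := by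
  have hl := (T.len_pos i).ne'
  simp only [normal, cross, head, tail, PiLp.sub_apply, inner_smul_right]
  rw [mul_inv_cancel_left₀ hl, PiLp.inner_apply]
  simp [Fin.sum_univ_two]
  ring

theorem len_mul_normal_zero (i : Fin T.N) :
    T.len i * T.normal i 0 = T.head i 1 - T.tail i 1 := by
  simp [normal, head, tail, mul_inv_cancel_left₀ (T.len_pos i).ne']

theorem len_mul_normal_one (i : Fin T.N) :
    T.len i * T.normal i 1 = T.tail i 0 - T.head i 0 := by
  simp [normal, head, tail, mul_inv_cancel_left₀ (T.len_pos i).ne']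

theorem norm_normal (i : Fin T.N) : ‖T.normal i‖ = 1 := by
  have h0 := len_mul_normal_zero i
  have h1 := len_mul_normal_one i
  have hl := T.len_pos i
  have h2 : T.len i ^ 2 = (T.tail i 0 - T.head i 0) ^ 2 + (T.tail i 1 - T.head i 1) ^ 2 := by
    rw [len_eq, dist_eq_norm, EuclideanSpace.norm_sq_eq]
    simp
  have h3 : ‖T.normal i‖ ^ 2 = 1 := by
    rw [EuclideanSpace.norm_sq_eq, Fin.sum_univ_two]
    simp only [Real.norm_eq_abs, sq_abs]
    apply mul_left_cancel₀ (pow_ne_zero 2 hl.ne')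
    calc _ = (T.len i * T.normal i 0) ^ 2 + (T.len i * T.normal i 1) ^ 2 := by ring
      _ = _ := by rw [h0, h1, h2]; ring
  exact (pow_eq_one_iff_of_nonneg (norm_nonneg _) two_ne_zero).1 h3

theorem abs_normal_le (i : Fin T.N) (j : Fin 2) : |T.normal i j| ≤ 1 := by

  have := PiLp.norm_apply_le (T.normal i) j
  rwa [norm_normal] at this

/-- The lines through the edges miss the whole disc, so their distance to the centre is at least
the radius. -/
theorem radius_mul_len_le (h : T.StarAbout x₀ r) (i : Fin T.N) :
    r * T.len i ≤ T.dblArea x₀ i := by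
  have hl := T.len_pos i
  refine le_of_forall_lt fun c hc => ?_
  rw [← div_lt_iff₀ hl] at hc
  obtain ⟨τ, hτ, hτr⟩ := exists_between (max_lt hc h.pos)
  have hτ0 : 0 < τ := (le_max_right _ _).trans_lt hτ
  have hy : x₀ + τ • T.normal i ∈ Metric.ball x₀ r := by
    rw [Metric.mem_ball, dist_eq_norm, add_sub_cancel_left, norm_smul, norm_normal, mul_one,
      Real.norm_of_nonneg hτ0.le]
    exact hτr
  obtain ⟨r', -, h'⟩ := h.of_mem_ball hy
  have h1 := h'.dblArea_pos i
  have h2 : T.dblArea (x₀ + τ • T.normal i) i = T.dblArea x₀ i - τ * T.len i := by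
    have e : T.dblArea (x₀ + τ • T.normal i) i = T.dblArea x₀ i
        - τ * cross (T.normal i) (T.head i - T.tail i) := by
      simp only [dblArea, cross, PiLp.sub_apply, PiLp.add_apply, PiLp.smul_apply, smul_eq_mul]; ring
    rw [e, cross_eq_len_mul_inner_normal, real_inner_self_eq_norm_sq, norm_normal]; ring
  rw [h2] at h1
  have h3 : c < τ * T.len i := by
    rw [← div_lt_iff₀ hl]; exact (le_max_left _ _).trans_lt hτ
  linarith

theorem exists_of_mem_tri (h : T.StarAbout x₀ r) {i : Fin T.N} {x : E}
    (hx : x ∈ tri x₀ (T.tail i) (T.head i)) : ∃ s ∈ Ioo (0 : ℝ) 1, ∃ t ∈ Ioo (0 : ℝ) 1,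
      x = AffineMap.lineMap x₀ (AffineMap.lineMap (T.tail i) (T.head i) s : E) t := by
  rw [← tri_eq_image (h.dblArea_pos i)] at hx
  obtain ⟨z, ⟨hs, ht⟩, rfl⟩ := hx
  exact ⟨z 0, hs, z 1, ht, by rw [AffineMap.lineMap_apply_module', triParam, add_comm]⟩

theorem lineMap_mem_edge (i : Fin T.N) {s : ℝ} (hs : s ∈ Icc (0 : ℝ) 1) :
    AffineMap.lineMap (T.tail i) (T.head i) s ∈ T.edge i := ⟨s, hs, rfl⟩

theorem tri_subset_interior (h : T.StarAbout x₀ r) (i : Fin T.N) :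
    tri x₀ (T.tail i) (T.head i) ⊆ interior T.carrier := by
  intro x hx
  obtain ⟨s, hs, t, ht, rfl⟩ := h.exists_of_mem_tri hx
  exact h.lineMap_mem (T.edge_subset_carrier i (lineMap_mem_edge i (Ioo_subset_Icc_self hs)))
    ht.1.le ht.2

theorem disjoint_tri (h : T.StarAbout x₀ r) {i j : Fin T.N} (hij : i ≠ j) :
    Disjoint (tri x₀ (T.tail i) (T.head i)) (tri x₀ (T.tail j) (T.head j)) := by
  rw [Set.disjoint_left]
  intro x hi hj
  obtain ⟨s, hs, t, ht, rfl⟩ := h.exists_of_mem_tri hi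
  obtain ⟨s', hs', t', ht', hx⟩ := h.exists_of_mem_tri hj
  set q : E := AffineMap.lineMap (T.tail i) (T.head i) s with hq
  set q' : E := AffineMap.lineMap (T.tail j) (T.head j) s' with hq'
  have mq : q ∈ T.edge i := lineMap_mem_edge i (Ioo_subset_Icc_self hs)
  have mq' : q' ∈ T.edge j := lineMap_mem_edge j (Ioo_subset_Icc_self hs')
  have hray : q' = AffineMap.lineMap x₀ q (t / t') := by
    rw [AffineMap.lineMap_apply_module', AffineMap.lineMap_apply_module', add_left_inj] at hx
    have : q' - x₀ = (t / t') • (q - x₀) := by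
      rw [div_eq_inv_mul, mul_smul, hx, inv_smul_smul₀ ht'.1.ne']
    rw [AffineMap.lineMap_apply_module', ← this]; abel
  have h1 := h.ray_unique (T.edge_subset_frontier i mq) (T.edge_subset_frontier j mq')
    (div_pos ht.1 ht'.1) hray
  rw [h1, AffineMap.lineMap_apply_one] at hray
  rcases T.simple i j hij q ⟨mq, hray ▸ mq'⟩ with ⟨hj', h2⟩ | ⟨_, h2⟩
  · have h3 : q = T.head i := by rw [h2, hj']; rfl
    rw [hq, AffineMap.lineMap_eq_right_iff] at h3
    exact h3.elim (T.tail_ne_head i) hs.2.ne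
  · have h3 : q = T.tail i := h2
    rw [hq, AffineMap.lineMap_eq_left_iff] at h3
    exact h3.elim (T.tail_ne_head i) hs.1.ne'

/-- Up to a null set, a star-shaped polygon is the union of the triangles spanned by its centre and
its edges. -/
theorem iUnion_tri_ae_eq (h : T.StarAbout x₀ r) :
    (⋃ i, tri x₀ (T.tail i) (T.head i) : Set E) =ᵐ[volume] T.carrier := by
  refine (iUnion_subset fun i => (h.tri_subset_interior i).trans
    interior_subset).eventuallyLE.antisymm
    ?_
  have hnull : volume ({x₀} ∪ frontier T.carrier ∪ ⋃ i, (segment ℝ x₀ (T.tail i)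
      ∪ segment ℝ x₀ (T.head i))) = 0 := by
    refine measure_union_null (measure_union_null (measure_singleton _) T.volume_frontier)
      (measure_iUnion_null fun i => measure_union_null (volume_segment_eq_zero _ _)
        (volume_segment_eq_zero _ _))
  rw [ae_le_set]
  refine measure_mono_null ?_ hnull
  rintro x ⟨hxT, hx⟩
  by_contra hn
  simp only [mem_union, mem_singleton_iff, mem_iUnion, not_or, not_exists] at hn hx
  obtain ⟨⟨hx0, hxf⟩, hxs⟩ := hn
  -- the last point of the ray through `x` that belongs to the polygon
  set S : Set ℝ := (fun t : ℝ => (AffineMap.lineMap x₀ x t : E)) ⁻¹' T.carrier ∩ Ici 1 with hS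
  have hlc : Continuous fun t : ℝ => (AffineMap.lineMap x₀ x t : E) := AffineMap.lineMap_continuous
  have hSc : IsClosed S := (T.isCompact.isClosed.preimage hlc).inter isClosed_Ici
  have h1S : (1 : ℝ) ∈ S := ⟨by simpa using hxT, self_mem_Ici⟩
  have hd : 0 < dist x₀ x := dist_pos.2 fun e => hx0 e.symm
  have hSb : BddAbove S := by
    obtain ⟨R, hR⟩ := T.isCompact.isBounded.subset_closedBall x₀
    refine ⟨R / dist x₀ x, fun t ht => ?_⟩
    have h2 := hR ht.1
    rw [Metric.mem_closedBall, dist_lineMap_left, Real.norm_of_nonneg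
      (zero_le_one.trans ht.2)] at h2
    rwa [le_div_iff₀ hd]
  set t := sSup S with ht
  have htS : t ∈ S := hSc.csSup_mem ⟨1, h1S⟩ hSb
  have ht1 : 1 ≤ t := htS.2
  set q : E := AffineMap.lineMap x₀ x t with hq
  have hqf : q ∈ frontier T.carrier := by
    rw [T.isCompact.isClosed.frontier_eq]
    refine ⟨htS.1, fun hint => ?_⟩
    have hev : ∀ᶠ u in 𝓝[>] t, (AffineMap.lineMap x₀ x u : E) ∈ T.carrier :=
      ((hlc.continuousAt (x := t)).eventually (isOpen_interior.mem_nhds hint)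
        |>.mono fun u hu => interior_subset hu).filter_mono nhdsWithin_le_nhds
    obtain ⟨u, hu1, hu2⟩ := (hev.and self_mem_nhdsWithin).exists
    exact absurd (le_csSup hSb ⟨hu1, ht1.trans hu2.le⟩) (not_le.2 hu2)
  obtain ⟨i, hqi⟩ : ∃ i, q ∈ T.edge i := by
    have := hqf; rw [T.frontier_eq] at this
    exact mem_iUnion.1 this
  obtain ⟨s, hs, hsq⟩ := hqi
  have ht0 : 0 < t := by linarith
  have hxq : x = AffineMap.lineMap x₀ q t⁻¹ := by
    rw [hq]; simp [AffineMap.lineMap_apply, smul_smul, inv_mul_cancel₀ ht0.ne']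
  have hti : t⁻¹ ∈ Icc (0 : ℝ) 1 := ⟨inv_nonneg.2 ht0.le, inv_le_one_of_one_le₀ ht1⟩
  have hseg : x ∈ segment ℝ x₀ q := by
    rw [← affineSegment_eq_segment]; exact ⟨t⁻¹, hti, hxq.symm⟩
  have hsq' : AffineMap.lineMap (T.tail i) (T.head i) s = q := hsq
  -- degenerate positions of `x` belong to the exceptional null set
  have hs0 : s ≠ 0 := by
    rintro rfl
    rw [AffineMap.lineMap_apply_zero] at hsq'
    exact (hxs i).1 (hsq' ▸ hseg)
  have hs1 : s ≠ 1 := by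
    rintro rfl
    rw [AffineMap.lineMap_apply_one] at hsq'
    exact (hxs i).2 (hsq' ▸ hseg)
  have ht1' : t⁻¹ ≠ 1 := by
    intro h1
    rw [h1, AffineMap.lineMap_apply_one] at hxq
    exact hxf (hxq ▸ hqf)
  refine hx i ?_
  rw [← tri_eq_image (h.dblArea_pos i)]
  refine ⟨!₂[s, t⁻¹], ⟨⟨?_, ?_⟩, ?_, ?_⟩, ?_⟩
  · simpa using lt_of_le_of_ne hs.1 hs0.symm
  · simpa using lt_of_le_of_ne hs.2 hs1
  · simpa using ht0
  · simpa using lt_of_le_of_ne hti.2 ht1'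
  · conv_rhs => rw [hxq, ← hsq', AffineMap.lineMap_apply_module', add_comm]
    simp [triParam]

theorem setIntegral_carrier (h : T.StarAbout x₀ r) {F : E → ℝ} (hF : IntegrableOn F T.carrier) :
    ∫ x in T.carrier, F x = ∑ i, ∫ x in tri x₀ (T.tail i) (T.head i), F x := by
  rw [← setIntegral_congr_set h.iUnion_tri_ae_eq]
  exact integral_iUnion_fintype (fun i => measurableSet_tri _ _ _)
    (fun i j hij => h.disjoint_tri hij)
    (fun i => hF.mono_set ((h.tri_subset_interior i).trans interior_subset))

end StarAbout

end Poly

/-! ### Edge averages of weakly differentiable functions -/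

/-- The average over the segment from `a` to `b` of a function `W` with weak gradient `D`, expressed
by the radial formula on the triangle with apex `x₀`, so that no trace has to be defined. -/
def edgeMean (x₀ a b : E) (W : E → ℝ) (D : Fin 2 → E → ℝ) : ℝ :=
  (cross (a - x₀) (b - x₀))⁻¹ * ∫ x in tri x₀ a b, (2 * W x + ∑ i, D i x * (x - x₀) i)

theorem edgeMean_eq_segAvg {x₀ a b : E} (hD : 0 < cross (a - x₀) (b - x₀)) {U : Set E}
    (hU : IsOpen U) (hsub : convexHull ℝ {x₀, a, b} ⊆ U) {W : E → ℝ} (hW : ContDiffOn ℝ 1 W U) :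
    edgeMean x₀ a b W (fun i => pderiv i W) = segAvg W a b := by
  have := setIntegral_tri_radial hD hU hsub hW
  simp only [fderiv_eq_sum_pderiv] at this
  rw [edgeMean, this, inv_mul_cancel_left₀ hD.ne']

theorem isBounded_tri (x₀ a b : E) : Bornology.IsBounded (tri x₀ a b) :=
  (isCompact_triangle x₀ a b).isBounded.subset tri_subset_convexHull

theorem volume_tri_lt_top (x₀ a b : E) : volume (tri x₀ a b) < ⊤ :=
    (isBounded_tri x₀ a b).measure_lt_top

theorem exists_bound_tri (x₀ a b : E) : ∃ C, ∀ x ∈ tri x₀ a b, ∀ i, |(x - x₀) i| ≤ C := by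
  obtain ⟨C, hC⟩ := (isBounded_tri x₀ a b).subset_closedBall x₀
  refine ⟨C, fun x hx i => ?_⟩
  have h1 : ‖x - x₀‖ ≤ C := by rw [← dist_eq_norm]; exact hC hx
  exact (PiLp.norm_apply_le (x - x₀) i).trans h1

theorem memLp_mul_coord {x₀ a b : E} {F : E → ℝ} (hF : MemLp F 2 (volume.restrict (tri x₀ a b)))
    (i : Fin 2) : MemLp (fun x => F x * (x - x₀) i) 2 (volume.restrict (tri x₀ a b)) := by
  obtain ⟨C, hC⟩ := exists_bound_tri x₀ a b
  have := memLp_bdd_mul (measurableSet_tri x₀ a b) (a := fun x => (x - x₀) i) (W := F) (A := C)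
    (by fun_prop) (fun x hx => hC x hx i) hF
  simpa [mul_comm] using this

theorem integrableOn_radial {x₀ a b : E} {W : E → ℝ} {D : Fin 2 → E → ℝ}
    (hW : MemLp W 2 (volume.restrict (tri x₀ a b)))
    (hD : ∀ i, MemLp (D i) 2 (volume.restrict (tri x₀ a b))) :
    IntegrableOn (fun x => 2 * W x + ∑ i, D i x * (x - x₀) i) (tri x₀ a b) := by
  have : IsFiniteMeasure (volume.restrict (tri x₀ a b)) := ⟨by simpa using volume_tri_lt_top x₀ a b⟩
  exact ((hW.integrable (by norm_num)).const_mul 2).add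
    (integrable_finsetSum _ fun i _ => (memLp_mul_coord (hD i) i).integrable (by norm_num))

theorem setIntegral_radial {x₀ a b : E} {W : E → ℝ} {D : Fin 2 → E → ℝ}
    (hW : MemLp W 2 (volume.restrict (tri x₀ a b)))
    (hD : ∀ i, MemLp (D i) 2 (volume.restrict (tri x₀ a b))) :
    ∫ x in tri x₀ a b, (2 * W x + ∑ i, D i x * (x - x₀) i)
      = 2 * (∫ x in tri x₀ a b, W x) + ∑ i, ∫ x in tri x₀ a b, D i x * (x - x₀) i := by
  have : IsFiniteMeasure (volume.restrict (tri x₀ a b)) := ⟨by simpa using volume_tri_lt_top x₀ a b⟩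
  have hi := fun i => (memLp_mul_coord (hD i) i).integrable (by norm_num)
  rw [integral_add ((hW.integrable (by norm_num)).const_mul 2)
    (integrable_finsetSum _ fun i _ => hi i),
    integral_const_mul, integral_finsetSum _ fun i _ => hi i]

/-- Edge averages are continuous with respect to `L²` convergence of the function and its gradient
on the triangle. -/
theorem tendsto_edgeMean {x₀ a b : E} {W : E → ℝ} {D : Fin 2 → E → ℝ} {w : ℕ → E → ℝ}
    {d : ℕ → Fin 2 → E → ℝ}
    (hW : MemLp W 2 (volume.restrict (tri x₀ a b)))
    (hD : ∀ i, MemLp (D i) 2 (volume.restrict (tri x₀ a b)))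
    (hw : ∀ n, MemLp (w n) 2 (volume.restrict (tri x₀ a b)))
    (hd : ∀ i n, MemLp (d n i) 2 (volume.restrict (tri x₀ a b)))
    (hwW : Tendsto (fun n => eLpNorm (w n - W) 2 (volume.restrict (tri x₀ a b))) atTop (𝓝 0))
    (hdD : ∀ i, Tendsto (fun n => eLpNorm (d n i - D i) 2 (volume.restrict (tri x₀ a b)))
      atTop (𝓝 0)) :
    Tendsto (fun n => edgeMean x₀ a b (w n) (d n)) atTop (𝓝 (edgeMean x₀ a b W D)) := by
  have : IsFiniteMeasure (volume.restrict (tri x₀ a b)) := ⟨by simpa using volume_tri_lt_top x₀ a b⟩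
  have hone : MemLp (fun _ : E => (1 : ℝ)) 2 (volume.restrict (tri x₀ a b)) := memLp_const 1
  simp only [edgeMean, setIntegral_radial hW hD, fun n => setIntegral_radial (hw n) fun i => hd i n]
  refine Tendsto.const_mul _ (((tendsto_integral_of_tendsto_eLpNorm_two hw hW hwW).const_mul 2).add
    (tendsto_finsetSum _ fun i _ => ?_))
  have hc : MemLp (fun x : E => (x - x₀) i) 2 (volume.restrict (tri x₀ a b)) := by
    simpa using memLp_mul_coord hone i
  exact tendsto_integral_mul_const (hd i) (hD i) hc (hdD i)

/-! ### Contracted triangles -/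

/-- Homothetic images of a triangle. -/
theorem mem_tri_lineMap_iff {c x₀ a b : E} {lam : ℝ} (hl : 0 < lam) (x : E) :
    x ∈ tri (AffineMap.lineMap c x₀ lam) (AffineMap.lineMap c a lam) (AffineMap.lineMap c b lam)
      ↔ AffineMap.lineMap c x lam⁻¹ ∈ tri x₀ a b := by
  have hx : x = AffineMap.lineMap c (AffineMap.lineMap c x lam⁻¹ : E) lam := by
    simp [AffineMap.lineMap_apply, smul_smul, mul_inv_cancel₀ hl.ne']
  set y : E := AffineMap.lineMap c x lam⁻¹
  have key : ∀ p q : E, cross (AffineMap.lineMap c p lam - x) (AffineMap.lineMap c q lam - x)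
      = lam ^ 2 * cross (p - y) (q - y) := fun p q => by
    rw [hx]
    simp only [cross, AffineMap.lineMap_apply_module', PiLp.sub_apply, PiLp.add_apply,
      PiLp.smul_apply, smul_eq_mul]
    ring
  have h2 : 0 < lam ^ 2 := by positivity
  simp only [tri, mem_ofPred_eq, key, mul_pos_iff_of_pos_left h2]

/-- The closed triangle, described by signed areas. -/
def ctri (x₀ a b : E) : Set E :=
  {x | 0 ≤ cross (a - x) (b - x) ∧ 0 ≤ cross (b - x) (x₀ - x) ∧ 0 ≤ cross (x₀ - x) (a - x)}

theorem cross_lineMap (p q c y : E) (t : ℝ) :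
    cross (p - AffineMap.lineMap c y t) (q - AffineMap.lineMap c y t)
      = (1 - t) * cross (p - c) (q - c) + t * cross (p - y) (q - y) := by
  simp only [cross, AffineMap.lineMap_apply_module', PiLp.sub_apply, PiLp.add_apply,
    PiLp.smul_apply, smul_eq_mul]
  ring

theorem convex_ctri (x₀ a b : E) : Convex ℝ (ctri x₀ a b) := by
  intro x hx y hy s t hs ht hst
  obtain rfl : s = 1 - t := by linarith
  rw [← AffineMap.lineMap_apply_module]
  refine ⟨?_, ?_, ?_⟩ <;> rw [cross_lineMap]
  · exact add_nonneg (mul_nonneg hs hx.1) (mul_nonneg ht hy.1)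
  · exact add_nonneg (mul_nonneg hs hx.2.1) (mul_nonneg ht hy.2.1)
  · exact add_nonneg (mul_nonneg hs hx.2.2) (mul_nonneg ht hy.2.2)

theorem vertices_mem_ctri {x₀ a b : E} (hD : 0 ≤ cross (a - x₀) (b - x₀)) :
    x₀ ∈ ctri x₀ a b ∧ a ∈ ctri x₀ a b ∧ b ∈ ctri x₀ a b := by
  simp only [ctri, mem_ofPred_eq, cross, PiLp.sub_apply] at *
  refine ⟨⟨?_, ?_, ?_⟩, ⟨?_, ?_, ?_⟩, ⟨?_, ?_, ?_⟩⟩ <;> linarith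

theorem convexHull_subset_ctri {x₀ a b : E} (hD : 0 ≤ cross (a - x₀) (b - x₀)) :
    convexHull ℝ {x₀, a, b} ⊆ ctri x₀ a b := by
  obtain ⟨h1, h2, h3⟩ := vertices_mem_ctri hD
  refine convexHull_min ?_ (convex_ctri x₀ a b)
  rintro x (rfl | rfl | rfl) <;> assumption

theorem lineMap_mem_tri {x₀ a b c y : E} (hc : c ∈ ctri x₀ a b) (hy : y ∈ tri x₀ a b) {t : ℝ}
    (h0 : 0 < t) (h1 : t ≤ 1) : AffineMap.lineMap c y t ∈ tri x₀ a b := by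
  have h1' : 0 ≤ 1 - t := by linarith
  refine ⟨?_, ?_, ?_⟩ <;> rw [cross_lineMap]
  · exact add_pos_of_nonneg_of_pos (mul_nonneg h1' hc.1) (mul_pos h0 hy.1)
  · exact add_pos_of_nonneg_of_pos (mul_nonneg h1' hc.2.1) (mul_pos h0 hy.2.1)
  · exact add_pos_of_nonneg_of_pos (mul_nonneg h1' hc.2.2) (mul_pos h0 hy.2.2)

theorem tri_lineMap_subset {x₀ a b c : E} (hc : c ∈ ctri x₀ a b) {lam : ℝ} (h0 : 0 < lam)
    (h1 : lam ≤ 1) : tri (AffineMap.lineMap c x₀ lam) (AffineMap.lineMap c a lam)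
      (AffineMap.lineMap c b lam) ⊆ tri x₀ a b := by
  intro x hx
  rw [mem_tri_lineMap_iff h0] at hx
  have e : x = AffineMap.lineMap c (AffineMap.lineMap c x lam⁻¹ : E) lam := by
    simp [AffineMap.lineMap_apply, smul_smul, mul_inv_cancel₀ h0.ne']
  rw [e]
  exact lineMap_mem_tri hc hx h0 h1

theorem tendsto_setIntegral_contracted_tri {x₀ a b c : E} (hc : c ∈ ctri x₀ a b) {F : E → ℝ}
    (hF : IntegrableOn F (tri x₀ a b)) :
    Tendsto (fun k => ∫ x in tri (AffineMap.lineMap c x₀ (dilationFactor k))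
      (AffineMap.lineMap c a (dilationFactor k)) (AffineMap.lineMap c b (dilationFactor k)), F x)
      atTop (𝓝 (∫ x in tri x₀ a b, F x)) := by
  refine tendsto_setIntegral_of_eventually_mem (measurableSet_tri _ _ _)
    (fun k => measurableSet_tri _ _ _)
    (fun k => tri_lineMap_subset hc (dilationFactor_pos k) (dilationFactor_lt_one k).le)
    (ae_of_all _ fun x hx => ?_) hF
  filter_upwards [eventually_homothety_mem
    (isOpen_tri x₀ a b) hx c tendsto_dilationFactor] with k hk
  exact (mem_tri_lineMap_iff (dilationFactor_pos k) x).2 hk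

theorem cross_lineMap_sub (c x₀ a b : E) (lam : ℝ) :
    cross (AffineMap.lineMap c a lam - AffineMap.lineMap c x₀ lam)
      (AffineMap.lineMap c b lam - AffineMap.lineMap c x₀ lam)
      = lam ^ 2 * cross (a - x₀) (b - x₀) := by
  simp only [cross, AffineMap.lineMap_apply_module', PiLp.sub_apply, PiLp.add_apply,
    PiLp.smul_apply, smul_eq_mul]
  ring

/-- The edge average depends continuously on the triangle when it is contracted towards one of its
points. -/
theorem tendsto_edgeMean_contracted {x₀ a b c : E} (hc : c ∈ ctri x₀ a b)
    (hD0 : 0 < cross (a - x₀) (b - x₀)) {W : E → ℝ} {D : Fin 2 → E → ℝ}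
    (hW : MemLp W 2 (volume.restrict (tri x₀ a b)))
    (hD : ∀ i, MemLp (D i) 2 (volume.restrict (tri x₀ a b))) :
    Tendsto (fun k => edgeMean (AffineMap.lineMap c x₀ (dilationFactor k))
      (AffineMap.lineMap c a (dilationFactor k)) (AffineMap.lineMap c b (dilationFactor k)) W D)
      atTop (𝓝 (edgeMean x₀ a b W D)) := by
  have hfin : IsFiniteMeasure (volume.restrict (tri x₀ a b)) :=
    ⟨by simpa using volume_tri_lt_top x₀ a b⟩
  set y : ℕ → E := fun k => AffineMap.lineMap c x₀ (dilationFactor k) with hy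
  set S : ℕ → Set E := fun k => tri (AffineMap.lineMap c x₀ (dilationFactor k))
      (AffineMap.lineMap c a (dilationFactor k)) (AffineMap.lineMap c b (dilationFactor k)) with hS
  have hSs : ∀ k, S k ⊆ tri x₀ a b := fun k =>
    tri_lineMap_subset hc (dilationFactor_pos k) (dilationFactor_lt_one k).le
  have hI := integrableOn_radial hW hD
  have hDI : ∀ i, IntegrableOn (D i) (tri x₀ a b) := fun i => (hD i).integrable (by norm_num)
  -- the apex moves, which contributes a correction that tends to zero
  have hform : ∀ k, edgeMean (AffineMap.lineMap c x₀ (dilationFactor k))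
      (AffineMap.lineMap c a (dilationFactor k)) (AffineMap.lineMap c b (dilationFactor k)) W D
      = (dilationFactor k ^ 2 * cross (a - x₀) (b - x₀))⁻¹ *
        ((∫ x in S k, (2 * W x + ∑ i, D i x * (x - x₀) i))
          + ∑ i, (x₀ - y k) i * ∫ x in S k, D i x) := by
    intro k
    rw [edgeMean, cross_lineMap_sub]
    congr 1
    simp only [← integral_const_mul]
    rw [← integral_finsetSum _ fun i _ => ((hDI i).mono_set (hSs k)).const_mul _,
      ← integral_add (hI.mono_set (hSs k))
        (integrable_finsetSum _ fun i _ => ((hDI i).mono_set (hSs k)).const_mul _)]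
    refine integral_congr_ae (ae_of_all _ fun x => ?_)
    simp only [Fin.sum_univ_two, PiLp.sub_apply, hy]
    ring
  simp only [hform]
  have t1 := tendsto_setIntegral_contracted_tri hc hI
  have t2 : ∀ i, Tendsto (fun k => (x₀ - y k) i * ∫ x in S k, D i x) atTop (𝓝 0) := by
    intro i
    have hyl : Tendsto y atTop (𝓝 x₀) := by
      have := ((AffineMap.lineMap_continuous (R := ℝ) (p := c) (q := x₀)).tendsto 1).comp
        tendsto_dilationFactor
      rwa [AffineMap.lineMap_apply_one] at this
    have h1 : Tendsto (fun k => (x₀ - y k) i) atTop (𝓝 0) := by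
      have hci : Continuous fun z : E => (x₀ - z) i := by fun_prop
      have := (hci.tendsto x₀).comp hyl
      simpa [Function.comp_def] using this
    have := h1.mul (tendsto_setIntegral_contracted_tri hc (hDI i))
    rwa [zero_mul] at this
  have t3 := t1.add (tendsto_finsetSum Finset.univ fun i _ => t2 i)
  have t4 : Tendsto (fun k => (dilationFactor k ^ 2 * cross (a - x₀) (b - x₀))⁻¹) atTop
      (𝓝 (cross (a - x₀) (b - x₀))⁻¹) := by
    have := ((tendsto_dilationFactor.pow 2).mul_const (cross (a - x₀) (b - x₀))).inv₀
      (by simpa using hD0.ne')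
    simpa using this
  have := t4.mul t3
  simpa [edgeMean] using this

/-- The edge averages from the two sides of a segment in `Ω` agree. The triangles on both sides are
contracted towards the midpoint of the segment; they then lie in `Ω` with their closures, where
the function can be replaced by smooth ones. -/
theorem HasWeakGrad.edgeMean_eq {Ω : Set E} (hΩ : IsOpen Ω) {W : E → ℝ} {D : Fin 2 → E → ℝ}
    (h : HasWeakGrad Ω W D) {x₀ x₁ a b : E} (h₀ : 0 < cross (a - x₀) (b - x₀))
    (h₁ : 0 < cross (b - x₁) (a - x₁)) (hs₀ : tri x₀ a b ⊆ Ω) (hs₁ : tri x₁ b a ⊆ Ω)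
    (hab : ∀ s ∈ Ioo (0 : ℝ) 1, AffineMap.lineMap a b s ∈ Ω) :
    edgeMean x₀ a b W D = edgeMean x₁ b a W D := by
  obtain ⟨w, hw, hlim⟩ := h.exists_approx hΩ
  set m : E := AffineMap.lineMap a b (1 / 2 : ℝ) with hm
  -- contraction towards the midpoint of the side `p q`
  have main : ∀ y p q : E, 0 < cross (p - y) (q - y) → tri y p q ⊆ Ω →
      (∀ s ∈ Ioo (0 : ℝ) 1, AffineMap.lineMap p q s ∈ Ω) → m = AffineMap.lineMap p q (1 / 2 : ℝ) →
      m ∈ ctri y p q ∧ ∀ k, convexHull ℝ {AffineMap.lineMap m y (dilationFactor k),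
        AffineMap.lineMap m p (dilationFactor k),
        AffineMap.lineMap m q (dilationFactor k)} ⊆ Ω := by
    intro y p q hD htri hpq hmpq
    have c0 : cross (p - m) (q - m) = 0 := by
      rw [hmpq]
      simp only [cross, AffineMap.lineMap_apply_module', PiLp.sub_apply, PiLp.add_apply,
        PiLp.smul_apply, smul_eq_mul]
      ring
    have c1 : cross (q - m) (y - m) = cross (p - y) (q - y) / 2 := by
      rw [hmpq]
      simp only [cross, AffineMap.lineMap_apply_module', PiLp.sub_apply, PiLp.add_apply,
        PiLp.smul_apply, smul_eq_mul]
      ring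
    have c2 : cross (y - m) (p - m) = cross (p - y) (q - y) / 2 := by
      rw [hmpq]
      simp only [cross, AffineMap.lineMap_apply_module', PiLp.sub_apply, PiLp.add_apply,
        PiLp.smul_apply, smul_eq_mul]
      ring
    refine ⟨⟨c0.ge, by rw [c1]; positivity, by rw [c2]; positivity⟩, fun k => ?_⟩
    set lam := dilationFactor k
    have hl0 : 0 < lam := dilationFactor_pos k
    have hl1 : lam < 1 := dilationFactor_lt_one k
    intro x hx
    have hD' : 0 ≤ cross (AffineMap.lineMap m p lam - AffineMap.lineMap m y lam)
        (AffineMap.lineMap m q lam - AffineMap.lineMap m y lam) := by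
      rw [cross_lineMap_sub]; positivity
    have hx' := convexHull_subset_ctri hD' hx
    set z : E := AffineMap.lineMap m x lam⁻¹ with hz
    have hxz : x = AffineMap.lineMap m z lam := by
      simp [hz, AffineMap.lineMap_apply, smul_smul, mul_inv_cancel₀ hl0.ne']
    have key : ∀ u v : E, cross (AffineMap.lineMap m u lam - x) (AffineMap.lineMap m v lam - x)
        = lam ^ 2 * cross (u - z) (v - z) := fun u v => by
      rw [hxz]
      simp only [cross, AffineMap.lineMap_apply_module', PiLp.sub_apply, PiLp.add_apply,
        PiLp.smul_apply, smul_eq_mul]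
      ring
    simp only [ctri, mem_ofPred_eq, key] at hx'
    have hl2 : 0 < lam ^ 2 := by positivity
    obtain ⟨z0, z1, z2⟩ := hx'
    have z0 := nonneg_of_mul_nonneg_right z0 hl2
    have z1 := nonneg_of_mul_nonneg_right z1 hl2
    have z2 := nonneg_of_mul_nonneg_right z2 hl2
    have x1 : 0 < cross (q - x) (y - x) := by
      rw [hxz, cross_lineMap, c1]
      have : 0 < (1 - lam) * (cross (p - y) (q - y) / 2) := mul_pos (by linarith) (by linarith)
      linarith [mul_nonneg hl0.le z1]
    have x2 : 0 < cross (y - x) (p - x) := by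
      rw [hxz, cross_lineMap, c2]
      have : 0 < (1 - lam) * (cross (p - y) (q - y) / 2) := mul_pos (by linarith) (by linarith)
      linarith [mul_nonneg hl0.le z2]
    have x0 : 0 ≤ cross (p - x) (q - x) := by
      rw [hxz, cross_lineMap, c0, mul_zero, zero_add]
      exact mul_nonneg hl0.le z0
    rcases x0.eq_or_lt with h0 | h0
    · -- `x` lies on the side
      have hs := cross_add_cross_add_cross y p q x
      have hb := cross_smul_eq y p q x
      rw [← h0, zero_smul, zero_add] at hb
      have hxs : x = AffineMap.lineMap p q (cross (y - x) (p - x) / cross (p - y) (q - y)) := by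
        have h5 : cross (p - y) (q - y) • x = cross (p - y) (q - y) •
            (AffineMap.lineMap p q (cross (y - x) (p - x) / cross (p - y) (q - y)) : E) := by
          rw [hb, AffineMap.lineMap_apply_module', smul_add, smul_smul,
            mul_div_cancel₀ _ hD.ne']
          have : cross (q - x) (y - x) = cross (p - y) (q - y) - cross (y - x) (p - x) := by
            linarith
          rw [this]; module
        exact smul_right_injective E hD.ne' h5
      rw [hxs]
      exact hpq _ ⟨div_pos x2 hD, (div_lt_one hD).2 (by linarith)⟩
    · exact htri ⟨h0, x1, x2⟩
  obtain ⟨hc0, hk0⟩ := main x₀ a b h₀ hs₀ hab hm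
  obtain ⟨hc1, hk1⟩ := main x₁ b a h₁ hs₁
    (fun s hs => by
      rw [← AffineMap.lineMap_apply_one_sub]
      exact hab _ ⟨by linarith [hs.2], by linarith [hs.1]⟩)
    (by rw [hm, ← AffineMap.lineMap_apply_one_sub]; norm_num)
  have hr0 := Measure.restrict_mono_set (volume : Measure E) hs₀
  have hr1 := Measure.restrict_mono_set (volume : Measure E) hs₁
  have t0 := tendsto_edgeMean_contracted hc0 h₀ (h.memLp.mono_measure hr0)
    fun i => (h.memLp_grad i).mono_measure hr0
  have t1 := tendsto_edgeMean_contracted hc1 h₁ (h.memLp.mono_measure hr1)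
    fun i => (h.memLp_grad i).mono_measure hr1
  refine tendsto_nhds_unique t0 (t1.congr fun k => ?_)
  have hl2 : 0 < dilationFactor k ^ 2 := pow_pos (dilationFactor_pos k) 2
  -- on a triangle with closure in `Ω`, the edge average is the limit of the averages of the smooth
  -- approximations, which do not depend on the side
  have lim : ∀ y p q : E, 0 < cross (p - y) (q - y) → convexHull ℝ {y, p, q} ⊆ Ω →
      Tendsto (fun n => segAvg (w n) p q) atTop (𝓝 (edgeMean y p q W D)) := by
    intro y p q hD hsub
    obtain ⟨a1, a2, a3, a4⟩ := hlim _ _ (isCompact_triangle y p q) hsub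
      (tri_subset_convexHull (x₀ := y) (a := p) (b := q))
    have hr := Measure.restrict_mono_set (volume : Measure E)
      ((tri_subset_convexHull (x₀ := y) (a := p) (b := q)).trans hsub)
    refine (tendsto_edgeMean (h.memLp.mono_measure hr) (fun i => (h.memLp_grad i).mono_measure hr)
      a1 a2 a3 a4).congr fun n => ?_
    exact edgeMean_eq_segAvg hD hΩ hsub (hw n)
  have l0 := lim _ _ _ (by rw [cross_lineMap_sub]; positivity) (hk0 k)
  have l1 := lim _ _ _ (by rw [cross_lineMap_sub]; positivity) (hk1 k)
  exact tendsto_nhds_unique l1 (l0.congr fun n => segAvg_symm _ _ _)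

/-! ### Affine functions -/

theorem cross_smul_right (c : ℝ) (x y : E) : cross x (c • y) = c * cross x y := by
  simp only [cross, PiLp.smul_apply, smul_eq_mul]; ring

theorem hasFDerivAt_affine (p : E →ᵃ[ℝ] ℝ) (x : E) :
    HasFDerivAt p (LinearMap.toContinuousLinearMap p.linear) x := by
  have e : (p : E → ℝ) = fun x => LinearMap.toContinuousLinearMap p.linear x + p 0 := by
    ext x
    have := p.map_vadd 0 x
    simpa using this
  rw [e]
  exact (LinearMap.toContinuousLinearMap p.linear).hasFDerivAt.add_const _

theorem contDiff_affine (p : E →ᵃ[ℝ] ℝ) {n : WithTop ℕ∞} : ContDiff ℝ n p := by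
  have e : (p : E → ℝ) = fun x => LinearMap.toContinuousLinearMap p.linear x + p 0 := by
    ext x
    have := p.map_vadd 0 x
    simpa using this
  rw [e]
  exact (LinearMap.toContinuousLinearMap p.linear).contDiff.add contDiff_const

namespace Poly

variable {T : Poly} {x₀ : E} {r : ℝ}

/-! ### The divergence theorem on a star-shaped polygon -/

theorem restrict_carrier_le {Ω : Set E} (hTΩ : interior T.carrier ⊆ Ω) :
    (volume : Measure E).restrict T.carrier ≤ volume.restrict Ω := by
  rw [← Measure.restrict_congr_set T.interior_ae_eq]
  exact Measure.restrict_mono_set _ hTΩ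

theorem isFiniteMeasure_carrier (T : Poly) :
    IsFiniteMeasure ((volume : Measure E).restrict T.carrier) :=
  ⟨by simpa using T.isCompact.measure_lt_top⟩

namespace StarAbout

theorem convexHull_contracted_subset (h : T.StarAbout x₀ r) (i : Fin T.N) {lam : ℝ}
    (h0 : 0 ≤ lam) (h1 : lam < 1) :
    convexHull ℝ {x₀, AffineMap.lineMap x₀ (T.tail i) lam, AffineMap.lineMap x₀ (T.head i) lam}
      ⊆ interior T.carrier := by
  intro p hp
  rw [convexHull_insert (by simp), convexHull_pair, mem_convexJoin] at hp
  obtain ⟨y, rfl, q, hq, hp⟩ := hp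
  rw [← affineSegment_eq_segment] at hq hp
  obtain ⟨s, hs, rfl⟩ := hq
  obtain ⟨t, ht, rfl⟩ := hp
  have : AffineMap.lineMap y (AffineMap.lineMap (AffineMap.lineMap y (T.tail i) lam : E)
      (AffineMap.lineMap y (T.head i) lam) s : E) t
      = AffineMap.lineMap y (AffineMap.lineMap (T.tail i) (T.head i) s : E) (t * lam) := by
    simp only [AffineMap.lineMap_apply_module]
    module
  rw [this]
  exact h.lineMap_mem (T.edge_subset_carrier i (lineMap_mem_edge i hs)) (mul_nonneg ht.1 h0)
    (by nlinarith [ht.1, ht.2])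

theorem tri_subset_carrier (h : T.StarAbout x₀ r) (i : Fin T.N) :
    tri x₀ (T.tail i) (T.head i) ⊆ T.carrier :=
  (h.tri_subset_interior i).trans interior_subset

theorem _root_.SWG.Poly.cross_single_head_sub_tail (i : Fin T.N) (j : Fin 2) :
    cross (EuclideanSpace.single j 1) (T.head i - T.tail i) = T.len i * T.normal i j := by
  rw [cross_eq_len_mul_inner_normal]
  congr 1
  rw [EuclideanSpace.inner_single_left]
  simp

theorem center_mem_ctri (h : T.StarAbout x₀ r) (i : Fin T.N) :
    x₀ ∈ ctri x₀ (T.tail i) (T.head i) :=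
  (vertices_mem_ctri (h.dblArea_pos i).le).1

/-- The divergence theorem on a star-shaped polygon for weakly differentiable functions: the
contributions of the sides through the centre cancel in the sum over the triangles. -/
theorem setIntegral_grad {Ω : Set E} (hΩ : IsOpen Ω) (h : T.StarAbout x₀ r)
    (hTΩ : interior T.carrier ⊆ Ω) {W : E → ℝ} {D : Fin 2 → E → ℝ} (hW : HasWeakGrad Ω W D)
    (j : Fin 2) :
    ∫ x in T.carrier, D j x
      = ∑ i, T.len i * T.normal i j * edgeMean x₀ (T.tail i) (T.head i) W D := by
  have := T.isFiniteMeasure_carrier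
  have hres := restrict_carrier_le hTΩ
  have hDI : IntegrableOn (D j) T.carrier :=
    ((hW.memLp_grad j).mono_measure hres).integrable (by norm_num)
  rw [h.setIntegral_carrier hDI]
  have hrt : ∀ i, (volume : Measure E).restrict (tri x₀ (T.tail i) (T.head i))
      ≤ volume.restrict Ω := fun i =>
    Measure.restrict_mono_set _ ((h.tri_subset_interior i).trans hTΩ)
  obtain ⟨w, hw, hlim⟩ := hW.exists_approx hΩ
  -- the identity on a contracted polygon
  have hk : ∀ k, ∑ i, ∫ x in tri (AffineMap.lineMap x₀ x₀ (dilationFactor k))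
        (AffineMap.lineMap x₀ (T.tail i) (dilationFactor k))
        (AffineMap.lineMap x₀ (T.head i) (dilationFactor k)), D j x
      = ∑ i, dilationFactor k * (T.len i * T.normal i j) *
        edgeMean (AffineMap.lineMap x₀ x₀ (dilationFactor k))
        (AffineMap.lineMap x₀ (T.tail i) (dilationFactor k))
        (AffineMap.lineMap x₀ (T.head i) (dilationFactor k)) W D := by
    intro k
    set lam := dilationFactor k
    have hl0 : 0 < lam := dilationFactor_pos k
    set a : Fin T.N → E := fun i => AffineMap.lineMap x₀ (T.tail i) lam with ha
    set b : Fin T.N → E := fun i => AffineMap.lineMap x₀ (T.head i) lam with hb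
    have hx : AffineMap.lineMap x₀ x₀ lam = x₀ := AffineMap.lineMap_same_apply _ _
    rw [hx]
    have hsub : ∀ i, convexHull ℝ {x₀, a i, b i} ⊆ Ω := fun i =>
      (h.convexHull_contracted_subset i hl0.le (dilationFactor_lt_one k)).trans hTΩ
    have hD : ∀ i, 0 < cross (a i - x₀) (b i - x₀) := fun i => by
      have := cross_lineMap_sub x₀ x₀ (T.tail i) (T.head i) lam
      rw [hx] at this
      rw [ha, hb, this]
      exact mul_pos (pow_pos hl0 2) (h.dblArea_pos i)
    have hfin : ∀ i, IsFiniteMeasure ((volume : Measure E).restrict (tri x₀ (a i) (b i))) :=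
      fun i =>
      ⟨by simpa using volume_tri_lt_top x₀ (a i) (b i)⟩
    have hr : ∀ i, (volume : Measure E).restrict (tri x₀ (a i) (b i)) ≤ volume.restrict Ω :=
      fun i =>
      Measure.restrict_mono_set _ (tri_subset_convexHull.trans (hsub i))
    have hap := fun i => hlim _ _ (isCompact_triangle x₀ (a i) (b i)) (hsub i)
      (tri_subset_convexHull (x₀ := x₀) (a := a i) (b := b i))
    have t1 : Tendsto (fun n => ∑ i, ∫ x in tri x₀ (a i) (b i), pderiv j (w n) x) atTop
        (𝓝 (∑ i, ∫ x in tri x₀ (a i) (b i), D j x)) :=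
      tendsto_finsetSum _ fun i _ => tendsto_integral_of_tendsto_eLpNorm_two ((hap i).2.1 j)
        ((hW.memLp_grad j).mono_measure (hr i)) ((hap i).2.2.2 j)
    have t2 : Tendsto (fun n => ∑ i, lam * (T.len i * T.normal i j) *
        edgeMean x₀ (a i) (b i) (w n) (fun i => pderiv i (w n))) atTop
        (𝓝 (∑ i, lam * (T.len i * T.normal i j) * edgeMean x₀ (a i) (b i) W D)) :=
      tendsto_finsetSum _ fun i _ => (tendsto_edgeMean (hW.memLp.mono_measure (hr i))
        (fun l => (hW.memLp_grad l).mono_measure (hr i)) (hap i).1 (hap i).2.1 (hap i).2.2.1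
        (hap i).2.2.2).const_mul _
    -- both sides are limits of the same quantities for smooth functions, by the divergence theorem on
    -- each triangle
    refine tendsto_nhds_unique t1 (t2.congr fun n => ?_)
    have e1 : ∀ i, ∫ x in tri x₀ (a i) (b i), pderiv j (w n) x
        = lam * (T.len i * T.normal i j) * segAvg (w n) (a i) (b i)
          + (cross (EuclideanSpace.single j 1) (a i - x₀) * segAvg (w n) x₀ (a i)
            - cross (EuclideanSpace.single j 1) (b i - x₀) * segAvg (w n) x₀ (b i)) := by
      intro i
      have := setIntegral_tri_fderiv (hD i) hΩ (hsub i) (hw n) (EuclideanSpace.single j 1)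
      have hba : b i - a i = lam • (T.head i - T.tail i) := by
        simp only [ha, hb, AffineMap.lineMap_apply_module']; module
      have hc : cross (EuclideanSpace.single j 1) (b i - a i) = lam * (T.len i * T.normal i j) := by
        rw [← cross_single_head_sub_tail, hba, cross_smul_right]
      rw [hc] at this
      simp only [pderiv]
      rw [this]; ring
    have e2 : ∀ i, edgeMean x₀ (a i) (b i) (w n) (fun i => pderiv i (w n))
        = segAvg (w n) (a i) (b i) := fun i => edgeMean_eq_segAvg (hD i) hΩ (hsub i) (hw n)
    simp only [e1, e2, Finset.sum_add_distrib, Finset.sum_sub_distrib]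
    -- the contributions of the sides through the centre
    have e3 := Equiv.sum_comp (finRotate T.N)
      fun i => cross (EuclideanSpace.single j 1) (a i - x₀) * segAvg (w n) x₀ (a i)
    have e4 : ∀ i, b i = a (finRotate T.N i) := fun i => rfl
    simp only [e4] at *
    rw [e3, sub_self, add_zero]
  -- the limit of the contracted polygons
  have t1 := tendsto_finsetSum Finset.univ fun i _ =>
    tendsto_setIntegral_contracted_tri (h.center_mem_ctri i) (hDI.mono_set (h.tri_subset_carrier i))
  have t2 := tendsto_finsetSum Finset.univ fun i _ =>
    (tendsto_dilationFactor.mul_const (T.len i * T.normal i j)).mul (tendsto_edgeMean_contracted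
      (h.center_mem_ctri i) (h.dblArea_pos i) (hW.memLp.mono_measure (hrt i))
      fun l => (hW.memLp_grad l).mono_measure (hrt i))
  simp only [one_mul] at t2
  exact tendsto_nhds_unique t1 (t2.congr fun k => (hk k).symm)

theorem edgeMean_affine (h : T.StarAbout x₀ r) (p : E →ᵃ[ℝ] ℝ) (i : Fin T.N) :
    edgeMean x₀ (T.tail i) (T.head i) p (fun i => pderiv i p) = p (T.mid i) := by
  have hc : ContDiff ℝ 1 p := contDiff_affine p
  rw [edgeMean_eq_segAvg (h.dblArea_pos i) isOpen_univ (subset_univ _) hc.contDiffOn, segAvg]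
  have e : ∀ s : ℝ, p (AffineMap.lineMap (T.tail i) (T.head i) s)
      = p (T.tail i) + s * (p (T.head i) - p (T.tail i)) := fun s => by
    rw [AffineMap.apply_lineMap, AffineMap.lineMap_apply]
    simp; ring
  have em : p (T.mid i) = p (T.tail i) + 1 / 2 * (p (T.head i) - p (T.tail i)) := by
    rw [← e]; congr 1
    simp [mid, midpoint, tail, head]
  simp only [e]
  rw [intervalIntegral.integral_add (by simp) (by
    apply Continuous.intervalIntegrable; fun_prop), intervalIntegral.integral_mul_const, em]
  simp

/-- The constant gradient of an affine function. -/
theorem _root_.SWG.pderiv_affine (p : E →ᵃ[ℝ] ℝ) (j : Fin 2) (x : E) :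
    pderiv j p x = p.linear (EuclideanSpace.single j 1) := by
  rw [pderiv, (hasFDerivAt_affine p x).fderiv]
  simp

theorem area_pos (h : T.StarAbout x₀ r) : 0 < T.area := by
  refine ENNReal.toReal_pos ?_ T.isCompact.measure_lt_top.ne
  exact ((Metric.measure_ball_pos volume x₀ h.pos).trans_le (measure_mono h.ball_subset)).ne'

/-- The weak gradient of edge values that come from an affine function is its gradient. -/
theorem sum_affine_mid (h : T.StarAbout x₀ r) (p : E →ᵃ[ℝ] ℝ) (j : Fin 2) :
    ∑ i, T.len i * T.normal i j * p (T.mid i)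
      = T.area * p.linear (EuclideanSpace.single j 1) := by
  have hc : ContDiff ℝ 1 p := contDiff_affine p
  have hb : Bornology.IsBounded (interior T.carrier) := T.isCompact.isBounded.subset interior_subset
  have := h.setIntegral_grad isOpen_interior subset_rfl (HasWeakGrad.of_contDiff hb hc) j
  simp only [h.edgeMean_affine, pderiv_affine] at this
  rw [← this]
  simp [area]

/-- Twice the area is the sum of twice the areas of the triangles spanned by the centre and the
edges; this is the radial integration formula for a constant function. -/
theorem two_mul_area (h : T.StarAbout x₀ r) : 2 * T.area = ∑ i, T.dblArea x₀ i := by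
  have := T.isFiniteMeasure_carrier
  have h1 := h.setIntegral_carrier (F := fun _ => (2 : ℝ)) (integrable_const _)
  have h2 : ∀ i, ∫ x in tri x₀ (T.tail i) (T.head i), (2 : ℝ) = T.dblArea x₀ i := fun i => by
    have := setIntegral_tri_radial (h.dblArea_pos i) isOpen_univ (subset_univ _)
      (W := fun _ => (1 : ℝ)) contDiffOn_const
    simpa [segAvg, dblArea] using this
  simp only [h2] at h1
  rw [← h1]
  simp [area, mul_comm]

end StarAbout

end Poly

/-! ### Properties of the `L²` norm -/

theorem norm_toLp_eq_l2Norm {S : Set E} {f : E → ℝ} (hf : MemLp f 2 (volume.restrict S)) :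
    ‖hf.toLp f‖ = l2Norm S f := norm_toLp_eq_sqrt hf

theorem l2Norm_add_le {S : Set E} {f g : E → ℝ} (hf : MemLp f 2 (volume.restrict S))
    (hg : MemLp g 2 (volume.restrict S)) :
    l2Norm S (fun x => f x + g x) ≤ l2Norm S f + l2Norm S g := by
  have h := norm_add_le (hf.toLp f) (hg.toLp g)
  rw [← MemLp.toLp_add, norm_toLp_eq_l2Norm, norm_toLp_eq_l2Norm, norm_toLp_eq_l2Norm] at h
  exact h

theorem l2Norm_sub_le {S : Set E} {f g : E → ℝ} (hf : MemLp f 2 (volume.restrict S))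
    (hg : MemLp g 2 (volume.restrict S)) :
    l2Norm S (fun x => f x - g x) ≤ l2Norm S f + l2Norm S g := by
  have h := norm_sub_le (hf.toLp f) (hg.toLp g)
  rw [← MemLp.toLp_sub, norm_toLp_eq_l2Norm, norm_toLp_eq_l2Norm, norm_toLp_eq_l2Norm] at h
  exact h

theorem l2Norm_const (S : Set E) (c : ℝ) : l2Norm S (fun _ => c) = √(volume.real S) * |c| := by
  simp [l2Norm, Real.sqrt_sq_eq_abs]

theorem l2Norm_le_of_ae_abs_le {S : Set E} {f g : E → ℝ} {C : ℝ} (hC : 0 ≤ C)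
    (hg : MemLp g 2 (volume.restrict S)) (h : ∀ᵐ x ∂volume.restrict S, |f x| ≤ C * |g x|) :
    l2Norm S f ≤ C * l2Norm S g := by
  rw [l2Norm, l2Norm, ← Real.sqrt_sq hC, ← Real.sqrt_mul (sq_nonneg C), ← integral_const_mul]
  refine Real.sqrt_le_sqrt (integral_mono_of_nonneg (ae_of_all _ fun x => sq_nonneg _)
    (hg.integrable_sq.const_mul _) ?_)
  filter_upwards [h] with x hx
  rw [← sq_abs, ← sq_abs (g x), ← mul_pow]
  exact pow_le_pow_left₀ (abs_nonneg _) hx 2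

theorem l2Norm_le_of_abs_le {S : Set E} (hS : MeasurableSet S) {f g : E → ℝ} {C : ℝ} (hC : 0 ≤ C)
    (hg : MemLp g 2 (volume.restrict S)) (h : ∀ x ∈ S, |f x| ≤ C * |g x|) :
    l2Norm S f ≤ C * l2Norm S g :=
  l2Norm_le_of_ae_abs_le hC hg ((ae_restrict_iff' hS).2 (ae_of_all _ h))

namespace Poly

/-! ### Estimates on one element -/

/-- Shape regularity with a given centre, written with the reciprocal `K = ρ⁻¹ ≥ 1` of the shape
parameter. -/
structure Regular (T : Poly) (x₀ : E) (K : ℝ) : Prop where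
  one_le : 1 ≤ K
  diam_pos : 0 < T.diam
  star : T.StarAbout x₀ (K⁻¹ * T.diam)
  len_ge : ∀ i, T.diam ≤ K * T.len i

variable {T : Poly} {x₀ : E} {K : ℝ}

theorem dist_le_diam {x y : E} (hx : x ∈ T.carrier) (hy : y ∈ T.carrier) : dist x y ≤ T.diam :=
  Metric.dist_le_diam_of_mem T.isCompact.isBounded hx hy

theorem mid_mem (i : Fin T.N) : T.mid i ∈ T.carrier :=
  T.edge_subset_carrier i ⟨1 / 2, by norm_num, by simp [mid, midpoint]⟩

theorem len_le_diam (i : Fin T.N) : T.len i ≤ T.diam :=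
  dist_le_diam (T.edge_subset_carrier i (T.tail_mem_edge i))
    (T.edge_subset_carrier i (T.head_mem_edge i))

theorem diam_pos (T : Poly) : 0 < T.diam :=
  (T.len_pos ⟨0, by have := T.three_le; omega⟩).trans_le (len_le_diam _)

theorem ShapeRegular.exists_regular {ρ : ℝ} (hρ : 0 < ρ) (h : T.ShapeRegular ρ) :
    ∃ x₀, T.Regular x₀ ρ⁻¹ := by
  obtain ⟨⟨x₀, hx₀⟩, hl⟩ := h
  have hd := T.diam_pos
  refine ⟨x₀, ?_, hd, ?_, fun i => ?_⟩
  · have h1 := (hl ⟨0, by have := T.three_le; omega⟩).trans (len_le_diam _)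
    have : ρ ≤ 1 := by
      by_contra hlt
      nlinarith
    exact (one_le_inv₀ hρ).2 this
  · rw [inv_inv]
    exact ⟨mul_pos hρ hd, hx₀⟩
  · rw [← div_eq_inv_mul, le_div_iff₀ hρ, mul_comm]; exact hl i

namespace Regular

theorem K_pos (h : T.Regular x₀ K) : 0 < K := zero_lt_one.trans_le h.one_le

theorem center_mem (h : T.Regular x₀ K) : x₀ ∈ T.carrier :=
  interior_subset h.star.center_mem_interior

theorem diam_sq_le_dblArea (h : T.Regular x₀ K) (i : Fin T.N) :
    T.diam ^ 2 ≤ K ^ 2 * T.dblArea x₀ i := by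
  have h1 := h.star.radius_mul_len_le i
  have hK := h.K_pos
  calc T.diam ^ 2 = T.diam * T.diam := sq _
    _ ≤ T.diam * (K * T.len i) := mul_le_mul_of_nonneg_left (h.len_ge i) h.diam_pos.le
    _ = K ^ 2 * (K⁻¹ * T.diam * T.len i) := by field_simp
    _ ≤ _ := by gcongr

theorem diam_sq_le_area (h : T.Regular x₀ K) : T.diam ^ 2 ≤ K ^ 2 * T.area := by
  have h1 := h.star.two_mul_area
  have hK := h.K_pos
  have h2 : ∑ i : Fin T.N, T.diam ^ 2 ≤ K ^ 2 * (2 * T.area) := by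
    rw [h1, Finset.mul_sum]
    exact Finset.sum_le_sum fun i _ => h.diam_sq_le_dblArea i
  rw [Finset.sum_const, Finset.card_univ, Fintype.card_fin, nsmul_eq_mul] at h2
  have h3 : (3 : ℝ) ≤ T.N := by exact_mod_cast T.three_le
  nlinarith [sq_nonneg T.diam]

theorem area_le (h : T.Regular x₀ K) : T.area ≤ 4 * T.diam ^ 2 := by
  have hsub : T.carrier ⊆ Metric.closedBall x₀ T.diam := fun x hx =>
    dist_le_diam hx h.center_mem
  have h1 : T.area ≤ volume.real (Metric.closedBall x₀ T.diam) :=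
    measureReal_mono hsub (by exact (isCompact_closedBall x₀ T.diam).measure_lt_top.ne)
  have h2 : volume.real (Metric.closedBall x₀ T.diam) = T.diam ^ 2 * Real.pi := by
    rw [Measure.real, EuclideanSpace.volume_closedBall_fin_two, ENNReal.toReal_mul,
      ENNReal.toReal_pow, ENNReal.toReal_ofReal h.diam_pos.le]
    congr 1
    exact ENNReal.toReal_ofReal Real.pi_pos.le
  rw [h2] at h1
  nlinarith [Real.pi_le_four, sq_nonneg T.diam]

theorem sqrt_area_le (h : T.Regular x₀ K) : √T.area ≤ 2 * T.diam := by
  rw [Real.sqrt_le_left (by linarith [h.diam_pos])]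
  nlinarith [h.area_le]

theorem diam_le_sqrt_area (h : T.Regular x₀ K) : T.diam ≤ K * √T.area := by
  have h1 := Real.sqrt_le_sqrt h.diam_sq_le_area
  rwa [Real.sqrt_sq h.diam_pos.le, Real.sqrt_mul (sq_nonneg K), Real.sqrt_sq h.K_pos.le] at h1

theorem sum_len_le (h : T.Regular x₀ K) : ∑ i, T.len i ≤ 8 * K * T.diam := by
  have h1 : (K⁻¹ * T.diam) * ∑ i, T.len i ≤ 2 * T.area := by
    rw [h.star.two_mul_area, Finset.mul_sum]
    exact Finset.sum_le_sum fun i _ => h.star.radius_mul_len_le i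
  have h2 := h.area_le
  have hK := h.K_pos
  have hd := h.diam_pos
  have h3 : (K⁻¹ * T.diam) * ∑ i, T.len i ≤ (K⁻¹ * T.diam) * (8 * K * T.diam) := by
    calc _ ≤ 2 * (4 * T.diam ^ 2) := h1.trans (by linarith)
      _ = _ := by field_simp; ring
  exact le_of_mul_le_mul_left h3 (by positivity)

theorem memLp_const (c : ℝ) : MemLp (fun _ : E => c) 2 (volume.restrict T.carrier) :=
  have := T.isFiniteMeasure_carrier
  MeasureTheory.memLp_const c

theorem setIntegral_abs_le_diam (h : T.Regular x₀ K) {F : E → ℝ}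
    (hF : MemLp F 2 (volume.restrict T.carrier)) :
    ∫ x in T.carrier, |F x| ≤ 2 * T.diam * l2Norm T.carrier F :=
  (setIntegral_abs_le T.isCompact.measure_lt_top.ne hF).trans
    (mul_le_mul_of_nonneg_right h.sqrt_area_le (l2Norm_nonneg _ _))

/-- The local Poincaré inequality. -/
theorem l2Norm_sub_mean_le {Ω : Set E} (hΩ : IsOpen Ω) (h : T.Regular x₀ K)
    (hTΩ : interior T.carrier ⊆ Ω) {W : E → ℝ} {D : Fin 2 → E → ℝ} (hW : HasWeakGrad Ω W D) :
    l2Norm T.carrier (fun x => W x - T.area⁻¹ * ∫ y in T.carrier, W y)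
      ≤ 6 * K * T.diam * ∑ i, l2Norm T.carrier (D i) := by
  have hfin := T.isFiniteMeasure_carrier
  have hres := restrict_carrier_le hTΩ
  have hWm := hW.memLp.mono_measure hres
  have hDm := fun i => (hW.memLp_grad i).mono_measure hres
  -- the variance form of the Poincaré inequality, on the disc of radius `diam T / K`
  have hA := h.star.area_pos
  have hK := h.K_pos
  have hd := h.diam_pos
  have hp := hW.poincare hΩ h.star.pos T.isCompact h.star.ball_subset h.star.star
    (fun x hx y hy => dist_le_diam hx hy) hTΩ T.volume_frontier
  set m := T.area⁻¹ * ∫ y in T.carrier, W y with hm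
  have hI : Integrable W (volume.restrict T.carrier) := hWm.integrable (by norm_num)
  have e : ∫ x in T.carrier, (W x - m) ^ 2
      = (∫ x in T.carrier, W x ^ 2) - (∫ x in T.carrier, W x) ^ 2 / volume.real T.carrier := by
    have e1 : ∀ x, (W x - m) ^ 2 = W x ^ 2 - 2 * m * W x + m ^ 2 := fun x => by ring
    simp only [e1]
    rw [integral_add (f := fun x => W x ^ 2 - 2 * m * W x) (hWm.integrable_sq.sub (hI.const_mul _))
      (integrable_const _), integral_sub hWm.integrable_sq (hI.const_mul _), integral_const_mul]
    simp only [integral_const, measureReal_restrict_apply, MeasurableSet.univ, univ_inter,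
      smul_eq_mul]
    have : volume.real T.carrier = T.area := rfl
    rw [this, hm]
    field_simp
    ring
  have hC : 4 * T.diam ^ 2 * (1 + 4 * volume.real T.carrier / (Real.pi * (K⁻¹ * T.diam) ^ 2))
      ≤ (6 * K * T.diam) ^ 2 := by
    have h1 : 4 * volume.real T.carrier / (Real.pi * (K⁻¹ * T.diam) ^ 2) ≤ 16 / 3 * K ^ 2 := by
      have : volume.real T.carrier = T.area := rfl
      rw [this, div_le_iff₀ (by positivity)]
      have h3 := Real.pi_gt_three
      calc 4 * T.area ≤ 16 * T.diam ^ 2 := by linarith [h.area_le]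
        _ ≤ 16 / 3 * (Real.pi * T.diam ^ 2) := by nlinarith [sq_nonneg T.diam]
        _ = _ := by field_simp
    have h2 : 1 ≤ K ^ 2 := one_le_pow₀ h.one_le
    calc _ ≤ 4 * T.diam ^ 2 * (K ^ 2 + 16 / 3 * K ^ 2) := by gcongr
      _ ≤ _ := by nlinarith [sq_nonneg (K * T.diam)]
  have hsum : ∫ x in T.carrier, ∑ i, D i x ^ 2 ≤ (∑ i, l2Norm T.carrier (D i)) ^ 2 := by
    rw [integral_finsetSum _ fun i _ => (hDm i).integrable_sq]
    simp only [Fin.sum_univ_two, ← l2Norm_sq]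
    nlinarith [l2Norm_nonneg T.carrier (D 0), l2Norm_nonneg T.carrier (D 1)]
  have hs0 : 0 ≤ ∑ i, l2Norm T.carrier (D i) := Finset.sum_nonneg fun i _ => l2Norm_nonneg _ _
  rw [l2Norm, e]
  refine Real.sqrt_le_iff.2 ⟨by positivity, hp.trans ?_⟩
  rw [mul_pow (6 * K * T.diam)]
  exact mul_le_mul hC hsum (integral_nonneg fun x => Finset.sum_nonneg fun i _ => sq_nonneg _)
    (by positivity)

/-- The trace inequality for edge averages. -/
theorem abs_edgeMean_le (h : T.Regular x₀ K) {W : E → ℝ} {D : Fin 2 → E → ℝ}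
    (hW : MemLp W 2 (volume.restrict T.carrier))
    (hD : ∀ i, MemLp (D i) 2 (volume.restrict T.carrier))
    (i : Fin T.N) :
    T.diam * |edgeMean x₀ (T.tail i) (T.head i) W D|
      ≤ 4 * K ^ 2 * (l2Norm T.carrier W + T.diam * ∑ j, l2Norm T.carrier (D j)) := by
  have hfin := T.isFiniteMeasure_carrier
  have hd := h.diam_pos
  have hK := h.K_pos
  have hts := h.star.tri_subset_carrier i
  have hA := h.star.dblArea_pos i
  have hWI : IntegrableOn (fun x => |W x|) T.carrier := (hW.integrable (by norm_num)).abs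
  have hDI : ∀ j, IntegrableOn (fun x => |D j x|) T.carrier := fun j =>
    ((hD j).integrable (by norm_num)).abs
  have hBI : IntegrableOn (fun x => 2 * |W x| + T.diam * ∑ j, |D j x|) T.carrier :=
    (hWI.const_mul 2).add ((integrable_finsetSum _ fun j _ => hDI j).const_mul _)
  -- the radial formula, with `|x - x₀| ≤ diam T`
  have h1 : |∫ x in tri x₀ (T.tail i) (T.head i), (2 * W x + ∑ j, D j x * (x - x₀) j)|
      ≤ ∫ x in T.carrier, (2 * |W x| + T.diam * ∑ j, |D j x|) := by
    calc _ ≤ ∫ x in tri x₀ (T.tail i) (T.head i), (2 * |W x| + T.diam * ∑ j, |D j x|) := by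
          rw [← Real.norm_eq_abs]
          refine norm_integral_le_of_norm_le (hBI.mono_set hts)
            ((ae_restrict_iff' (measurableSet_tri _ _ _)).2 (ae_of_all _ fun x hx => ?_))
          have hxd : ‖x - x₀‖ ≤ T.diam := by
            rw [← dist_eq_norm]; exact dist_le_diam (hts hx) h.center_mem
          have hxj : ∀ j : Fin 2, |(x - x₀) j| ≤ T.diam := fun j =>
            (PiLp.norm_apply_le (x - x₀) j).trans hxd
          rw [Real.norm_eq_abs]
          refine (abs_add_le _ _).trans (add_le_add (by rw [abs_mul]; simp) ?_)
          rw [Finset.mul_sum]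
          refine (Finset.abs_sum_le_sum_abs _ _).trans (Finset.sum_le_sum fun j _ => ?_)
          rw [abs_mul, mul_comm]
          exact mul_le_mul_of_nonneg_right (hxj j) (abs_nonneg _)
      _ ≤ _ := setIntegral_mono_set hBI (ae_of_all _ fun x => by
            have : 0 ≤ ∑ j, |D j x| := Finset.sum_nonneg fun j _ => abs_nonneg _
            simp only [Pi.zero_apply]
            positivity) hts.eventuallyLE
  have h2 : ∫ x in T.carrier, (2 * |W x| + T.diam * ∑ j, |D j x|)
      ≤ 4 * T.diam * (l2Norm T.carrier W + T.diam * ∑ j, l2Norm T.carrier (D j)) := by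
    rw [integral_add (hWI.const_mul 2) ((integrable_finsetSum _ fun j _ => hDI j).const_mul _),
      integral_const_mul, integral_const_mul, integral_finsetSum _ fun j _ => hDI j]
    have a1 := h.setIntegral_abs_le_diam hW
    have a2 : ∑ j, ∫ x in T.carrier, |D j x| ≤ 2 * T.diam * ∑ j, l2Norm T.carrier (D j) := by
      rw [Finset.mul_sum]
      exact Finset.sum_le_sum fun j _ => h.setIntegral_abs_le_diam (hD j)
    have a3 : 0 ≤ ∑ j, l2Norm T.carrier (D j) := Finset.sum_nonneg fun i _ => l2Norm_nonneg _ _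
    have a4 := mul_le_mul_of_nonneg_left a2 hd.le
    nlinarith [mul_nonneg (mul_nonneg hd.le hd.le) a3]
  have h3 := h1.trans h2
  set B := l2Norm T.carrier W + T.diam * ∑ j, l2Norm T.carrier (D j) with hB
  have hB0 : 0 ≤ B := add_nonneg (l2Norm_nonneg _ _)
    (mul_nonneg hd.le (Finset.sum_nonneg fun i _ => l2Norm_nonneg _ _))
  have h4 := h.diam_sq_le_dblArea i
  rw [edgeMean, abs_mul, abs_inv]
  have h5 : |cross (T.tail i - x₀) (T.head i - x₀)| = T.dblArea x₀ i := abs_of_pos hA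
  rw [h5, ← mul_assoc, ← div_eq_mul_inv, div_mul_eq_mul_div, div_le_iff₀ hA]
  calc _ ≤ T.diam * (4 * T.diam * B) := mul_le_mul_of_nonneg_left h3 hd.le
    _ = 4 * B * T.diam ^ 2 := by ring
    _ ≤ 4 * B * (K ^ 2 * T.dblArea x₀ i) := mul_le_mul_of_nonneg_left h4 (by positivity)
    _ = _ := by ring

/-- The increments of an affine function are controlled by its gradient. -/
theorem _root_.SWG.affine_sub_eq (p : E →ᵃ[ℝ] ℝ) (x y : E) :
    p x - p y = ∑ j, p.linear (EuclideanSpace.single j 1) * (x - y) j := by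
  have h := fderiv_eq_sum_pderiv p x (x - y)
  rw [(hasFDerivAt_affine p x).fderiv] at h
  simp only [pderiv_affine] at h
  rw [← h]
  have := p.linearMap_vsub x y
  simpa using this.symm

theorem abs_affine_sub_le {p : E →ᵃ[ℝ] ℝ} {x y : E} (hx : x ∈ T.carrier) (hy : y ∈ T.carrier) :
    |p x - p y| ≤ T.diam * ∑ j, |p.linear (EuclideanSpace.single j 1)| := by
  rw [affine_sub_eq, Finset.mul_sum]
  refine (Finset.abs_sum_le_sum_abs _ _).trans (Finset.sum_le_sum fun j _ => ?_)
  rw [abs_mul, mul_comm]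
  refine mul_le_mul_of_nonneg_right ((PiLp.norm_apply_le (x - y) j).trans ?_) (abs_nonneg _)
  rw [← dist_eq_norm]; exact dist_le_diam hx hy

theorem diam_sq_mul_le_area_mul (h : T.Regular x₀ K) {a : ℝ} (ha : 0 ≤ a) :
    T.diam ^ 2 * a ≤ K ^ 2 * (T.area * a) := by
  rw [← mul_assoc]; exact mul_le_mul_of_nonneg_right h.diam_sq_le_area ha

/-- Affine functions are controlled by their values at the edge midpoints. -/
theorem abs_affine_le (h : T.Regular x₀ K) {p : E →ᵃ[ℝ] ℝ} {B : ℝ} (hB : ∀ i, |p (T.mid i)| ≤ B)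
    {x : E} (hx : x ∈ T.carrier) : |p x| ≤ 17 * K ^ 3 * B := by
  have hd := h.diam_pos
  have hK := h.K_pos
  have i0 : Fin T.N := ⟨0, by have := T.three_le; omega⟩
  have hB0 : 0 ≤ B := (abs_nonneg _).trans (hB i0)
  -- the gradient of `p` is its weak gradient, a sum of the values at the midpoints
  have hg : ∀ j, T.diam * |p.linear (EuclideanSpace.single j 1)| ≤ 8 * K ^ 3 * B := by
    intro j
    have h1 := h.star.sum_affine_mid p j
    have h2 : |T.area * p.linear (EuclideanSpace.single j 1)| ≤ 8 * K * T.diam * B := by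
      rw [← h1]
      refine (Finset.abs_sum_le_sum_abs _ _).trans ?_
      calc _ ≤ ∑ i, T.len i * B := by
            refine Finset.sum_le_sum fun i _ => ?_
            rw [abs_mul, abs_mul, abs_of_pos (T.len_pos i)]
            refine mul_le_mul ?_ (hB i) (abs_nonneg _) (T.len_pos i).le
            exact mul_le_of_le_one_right (T.len_pos i).le (StarAbout.abs_normal_le i j)
        _ = (∑ i, T.len i) * B := (Finset.sum_mul _ _ _).symm
        _ ≤ _ := mul_le_mul_of_nonneg_right h.sum_len_le hB0
    rw [abs_mul, abs_of_pos h.star.area_pos] at h2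
    have h3 := h.diam_sq_mul_le_area_mul (abs_nonneg (p.linear (EuclideanSpace.single j 1)))
    have h4 : T.diam * (T.diam * |p.linear (EuclideanSpace.single j 1)|)
        ≤ T.diam * (8 * K ^ 3 * B) := by
      calc _ = T.diam ^ 2 * |p.linear (EuclideanSpace.single j 1)| := by ring
        _ ≤ K ^ 2 * (8 * K * T.diam * B) := h3.trans (mul_le_mul_of_nonneg_left h2 (sq_nonneg K))
        _ = _ := by ring
    exact le_of_mul_le_mul_left h4 hd
  have h5 := abs_affine_sub_le (p := p) hx (mid_mem i0)
  have h6 : |p x| ≤ |p x - p (T.mid i0)| + |p (T.mid i0)| := by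
    have := abs_add_le (p x - p (T.mid i0)) (p (T.mid i0))
    rwa [sub_add_cancel] at this
  have hs : T.diam * ∑ j, |p.linear (EuclideanSpace.single j 1)| ≤ 16 * K ^ 3 * B := by
    rw [Fin.sum_univ_two, mul_add]
    linarith [hg 0, hg 1]
  have hK3 : 1 ≤ K ^ 3 := one_le_pow₀ h.one_le
  nlinarith [hB i0, mul_le_mul_of_nonneg_right hK3 hB0]

end Regular

end Poly

/-! ### Local approximation and consistency -/

theorem HasWeakGrad.mono {U V : Set E} {W : E → ℝ} {D : Fin 2 → E → ℝ} (h : HasWeakGrad V W D)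
    (hUV : U ⊆ V) : HasWeakGrad U W D := by
  obtain ⟨w, hw, hlim⟩ := h.approx
  exact ⟨h.memLp.mono_measure (Measure.restrict_mono_set _ hUV),
    fun i => (h.memLp_grad i).mono_measure (Measure.restrict_mono_set _ hUV), w,
    fun n => (hw n).mono hUV, fun K hK hKU => hlim K hK (hKU.trans hUV)⟩

theorem HasWeakGrad.sub_affine {U : Set E} (hU : IsOpen U) (hb : Bornology.IsBounded U) {W : E → ℝ}
    {D : Fin 2 → E → ℝ} (h : HasWeakGrad U W D) (p : E →ᵃ[ℝ] ℝ) :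
    HasWeakGrad U (fun x => W x - p x)
      (fun i x => D i x - p.linear (EuclideanSpace.single i 1)) := by
  simpa only [pderiv_affine] using h.sub hU (HasWeakGrad.of_contDiff hb (contDiff_affine p))

theorem HasWeakGrad.sub_const {U : Set E} (hU : IsOpen U) (hb : Bornology.IsBounded U) {W : E → ℝ}
    {D : Fin 2 → E → ℝ} (h : HasWeakGrad U W D) (m : ℝ) :
    HasWeakGrad U (fun x => W x - m) D := by
  simpa using h.sub_affine hU hb (AffineMap.const ℝ E m)

theorem HasWeakGrad.affine_mul {U : Set E} (hU : IsOpen U) (hb : Bornology.IsBounded U) {W : E → ℝ}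
    {D : Fin 2 → E → ℝ} (h : HasWeakGrad U W D) (p : E →ᵃ[ℝ] ℝ) :
    HasWeakGrad U (fun x => p x * W x)
      (fun i x => p x * D i x + p.linear (EuclideanSpace.single i 1) * W x) := by
  obtain ⟨A, hA⟩ := hb.isCompact_closure.exists_bound_of_continuousOn
    (contDiff_affine p (n := 0)).continuous.continuousOn
  have hA1 : ∀ x ∈ U, |p x| ≤ A + ∑ i, |p.linear (EuclideanSpace.single i 1)| := fun x hx =>
    (hA x (subset_closure hx)).trans
      (le_add_of_nonneg_right (Finset.sum_nonneg fun i _ => abs_nonneg _))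
  have hA2 : ∀ i, ∀ x ∈ U, |pderiv i p x| ≤ A + ∑ i, |p.linear (EuclideanSpace.single i 1)| := by
    intro i x hx
    rw [pderiv_affine]
    have h0 : 0 ≤ A := (norm_nonneg _).trans (hA x (subset_closure hx))
    have := Finset.single_le_sum (f := fun i : Fin 2 => |p.linear (EuclideanSpace.single i 1)|)
      (fun i _ => abs_nonneg _) (Finset.mem_univ i)
    linarith
  simpa only [pderiv_affine] using h.mul hU (contDiff_affine p).contDiffOn hA1 hA2

theorem edgeMean_sub {x₀ a b : E} {W V : E → ℝ} {D F : Fin 2 → E → ℝ}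
    (hW : MemLp W 2 (volume.restrict (tri x₀ a b)))
    (hD : ∀ i, MemLp (D i) 2 (volume.restrict (tri x₀ a b)))
    (hV : MemLp V 2 (volume.restrict (tri x₀ a b)))
    (hF : ∀ i, MemLp (F i) 2 (volume.restrict (tri x₀ a b))) :
    edgeMean x₀ a b (fun x => W x - V x) (fun i x => D i x - F i x)
      = edgeMean x₀ a b W D - edgeMean x₀ a b V F := by
  rw [edgeMean, edgeMean, edgeMean, ← mul_sub, ← integral_sub (integrableOn_radial hW hD)
    (integrableOn_radial hV hF)]
  congr 2
  ext x
  simp only [Fin.sum_univ_two]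
  ring

theorem edgeMean_const_mul (x₀ a b : E) (W : E → ℝ) (D : Fin 2 → E → ℝ) (c : ℝ) :
    edgeMean x₀ a b (fun x => c * W x) (fun i x => c * D i x) = c * edgeMean x₀ a b W D := by
  rw [edgeMean, edgeMean, mul_left_comm, ← integral_const_mul c]
  congr 2
  ext x
  simp only [Fin.sum_univ_two]
  ring

namespace Poly

variable {T : Poly} {x₀ : E} {K : ℝ}

theorem isBounded_interior (T : Poly) : Bornology.IsBounded (interior T.carrier) :=
  T.isCompact.isBounded.subset interior_subset

theorem memLp_carrier {f : E → ℝ} (hf : MemLp f 2 (volume.restrict (interior T.carrier))) :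
    MemLp f 2 (volume.restrict T.carrier) := by
  rwa [Measure.restrict_congr_set T.interior_ae_eq] at hf

theorem memLp_affine (T : Poly) (p : E →ᵃ[ℝ] ℝ) : MemLp p 2 (volume.restrict T.carrier) :=
  memLp_of_continuousOn (Ω := univ) (contDiff_affine p (n := 0)).continuous.continuousOn
    T.isCompact (subset_univ _) subset_rfl

theorem ext_spec (v : Fin T.N → ℝ) : T.IsLinExt v (T.ext v) := (T.exists_isLinExt v).choose_spec

/-- The weighted least-squares fit minimizes the distance to the edge values. -/
theorem IsLinExt.sum_sq {v : Fin T.N → ℝ} {p : E →ᵃ[ℝ] ℝ} (h : T.IsLinExt v p) (q : E →ᵃ[ℝ] ℝ) :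
    ∑ i, T.len i * (q (T.mid i) - v i) ^ 2
      = ∑ i, T.len i * (q (T.mid i) - p (T.mid i)) ^ 2
        + ∑ i, T.len i * (p (T.mid i) - v i) ^ 2 := by
  have := h (q - p)
  rw [← Finset.sum_add_distrib, ← sub_eq_zero, ← Finset.sum_sub_distrib]
  rw [← mul_zero (2 : ℝ), ← this, Finset.mul_sum]
  refine Finset.sum_congr rfl fun i _ => ?_
  simp only [AffineMap.coe_sub, Pi.sub_apply]
  ring

namespace Regular

theorem memLp_tri (h : T.Regular x₀ K) {f : E → ℝ} (hf : MemLp f 2 (volume.restrict T.carrier))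
    (i : Fin T.N) : MemLp f 2 (volume.restrict (tri x₀ (T.tail i) (T.head i))) :=
  hf.mono_measure (Measure.restrict_mono_set _ (h.star.tri_subset_carrier i))

/-- The affine extension is unique, because an affine function that vanishes at the edge midpoints
vanishes on the polygon. -/
theorem eqOn_of_isLinExt (h : T.Regular x₀ K) {v : Fin T.N → ℝ} {p q : E →ᵃ[ℝ] ℝ}
    (hp : T.IsLinExt v p) (hq : T.IsLinExt v q) {x : E} (hx : x ∈ T.carrier) : p x = q x := by
  have h1 := hp.sum_sq q
  have h2 := hq.sum_sq p
  have h3 : ∑ i, T.len i * (q (T.mid i) - p (T.mid i)) ^ 2 = 0 := by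
    have e : ∑ i, T.len i * (p (T.mid i) - q (T.mid i)) ^ 2
        = ∑ i, T.len i * (q (T.mid i) - p (T.mid i)) ^ 2 :=
      Finset.sum_congr rfl fun i _ => by ring
    linarith
  rw [Finset.sum_eq_zero_iff_of_nonneg fun i _ => mul_nonneg (T.len_pos i).le (sq_nonneg _)] at h3
  have h4 : ∀ i, |(p - q) (T.mid i)| ≤ 0 := fun i => by
    have := h3 i (Finset.mem_univ i)
    rw [mul_eq_zero, or_iff_right (T.len_pos i).ne', sq_eq_zero_iff] at this
    rw [abs_nonpos_iff, AffineMap.coe_sub, Pi.sub_apply]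
    linarith
  have h5 := h.abs_affine_le h4 hx
  rw [mul_zero, abs_nonpos_iff, AffineMap.coe_sub, Pi.sub_apply] at h5
  linarith

theorem ext_add (h : T.Regular x₀ K) (v w : Fin T.N → ℝ) {x : E} (hx : x ∈ T.carrier) :
    T.ext (v + w) x = T.ext v x + T.ext w x := by
  have : T.IsLinExt (v + w) (T.ext v + T.ext w) := fun φ => by
    have := congrArg₂ (· + ·) (T.ext_spec v φ) (T.ext_spec w φ)
    simp only [← Finset.sum_add_distrib, add_zero] at this
    rw [← this]
    refine Finset.sum_congr rfl fun i _ => ?_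
    simp only [AffineMap.coe_add, Pi.add_apply]
    ring
  exact h.eqOn_of_isLinExt (T.ext_spec _) this hx

theorem ext_smul (h : T.Regular x₀ K) (c : ℝ) (v : Fin T.N → ℝ) {x : E} (hx : x ∈ T.carrier) :
    T.ext (c • v) x = c * T.ext v x := by
  have : T.IsLinExt (c • v) (c • T.ext v) := fun φ => by
    have := congrArg (c * ·) (T.ext_spec v φ)
    simp only [Finset.mul_sum, mul_zero] at this
    rw [← this]
    refine Finset.sum_congr rfl fun i _ => ?_
    simp only [AffineMap.coe_smul, Pi.smul_apply, smul_eq_mul]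
    ring
  exact h.eqOn_of_isLinExt (T.ext_spec _) this hx

/-- The weak gradient of the edge averages is the mean of the gradient. -/
theorem area_mul_weakGrad (h : T.Regular x₀ K) (v : Fin T.N → ℝ) (j : Fin 2) :
    T.area * T.weakGrad v j = ∑ i, T.len i * T.normal i j * v i := by
  have : T.weakGrad v j = T.area⁻¹ * ∑ i, v i * T.len i * T.normal i j := by
    simp [weakGrad]
  rw [this, mul_inv_cancel_left₀ h.star.area_pos.ne']
  exact Finset.sum_congr rfl fun i _ => by ring

/-- The weak gradient of the edge averages is the mean of the gradient. -/
theorem weakGrad_edgeMean (h : T.Regular x₀ K) {W : E → ℝ} {D : Fin 2 → E → ℝ}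
    (hW : HasWeakGrad (interior T.carrier) W D) (j : Fin 2) :
    T.weakGrad (fun i => edgeMean x₀ (T.tail i) (T.head i) W D) j
      = T.area⁻¹ * ∫ x in T.carrier, D j x := by
  rw [eq_inv_mul_iff_mul_eq₀ h.star.area_pos.ne', h.area_mul_weakGrad,
    h.star.setIntegral_grad isOpen_interior subset_rfl hW]

theorem exists_affine (h : T.Regular x₀ K) {W : E → ℝ}
    (hW : MemLp W 2 (volume.restrict T.carrier)) (m : Fin 2 → ℝ) :
    ∃ p : E →ᵃ[ℝ] ℝ, (∀ j, p.linear (EuclideanSpace.single j 1) = m j) ∧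
      T.area⁻¹ * ∫ x in T.carrier, (W x - p x) = 0 := by
  have := T.isFiniteMeasure_carrier
  let L : E →ᵃ[ℝ] ℝ := (∑ j, m j • (EuclideanSpace.proj (𝕜 := ℝ) j : E →L[ℝ] ℝ) :
    E →L[ℝ] ℝ).toLinearMap.toAffineMap
  refine ⟨L + AffineMap.const ℝ E (T.area⁻¹ * ∫ x in T.carrier, (W x - L x)), fun j => ?_, ?_⟩
  · simp only [AffineMap.add_linear, AffineMap.const_linear, add_zero, L,
      LinearMap.toAffineMap_linear]
    fin_cases j <;> simp [Fin.sum_univ_two]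
  · have hI : Integrable (fun x => W x - L x) (volume.restrict T.carrier) :=
      (hW.sub (T.memLp_affine L)).integrable (by norm_num)
    simp only [AffineMap.coe_add, Pi.add_apply, AffineMap.const_apply, ← sub_sub]
    rw [integral_sub hI (integrable_const _), integral_const]
    simp only [measureReal_restrict_apply, MeasurableSet.univ, univ_inter, smul_eq_mul]
    have e : volume.real T.carrier = T.area := rfl
    rw [e, mul_inv_cancel_left₀ h.star.area_pos.ne', sub_self, mul_zero]

/-- Approximation of a twice weakly differentiable function by the affine extension of its edge
averages: the distance in `L²`, and the distance to the edge averages. -/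
theorem l2Norm_sub_ext_edgeMean_le (h : T.Regular x₀ K) {u : E → ℝ} {D : Fin 2 → E → ℝ}
    {F : Fin 2 → Fin 2 → E → ℝ} (hu : HasWeakGrad (interior T.carrier) u D)
    (hD : ∀ i, HasWeakGrad (interior T.carrier) (D i) (F i)) {q : Fin T.N → ℝ}
    (hq : ∀ i, q i = edgeMean x₀ (T.tail i) (T.head i) u D) :
    l2Norm T.carrier (fun x => u x - T.ext q x)
        ≤ 17172 * K ^ 8 * T.diam ^ 2 * ∑ i, ∑ j, l2Norm T.carrier (F i j) ∧
      ∑ i, T.len i * (T.ext q (T.mid i) - q i) ^ 2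
        ≤ T.diam ^ 3 * (476 * K ^ 5 * ∑ i, ∑ j, l2Norm T.carrier (F i j)) ^ 2 := by
  have hfin := T.isFiniteMeasure_carrier
  have hd := h.diam_pos
  have hK := h.K_pos
  have hK1 := h.one_le
  set H := T.diam with hH
  set X := ∑ i, ∑ j, l2Norm T.carrier (F i j) with hX
  have hX0 : 0 ≤ X := Finset.sum_nonneg fun i _ => Finset.sum_nonneg fun j _ => l2Norm_nonneg _ _
  have hum := memLp_carrier hu.memLp
  have hDm := fun i => memLp_carrier (hu.memLp_grad i)
  -- `ℓ` is affine with the mean gradient and the mean value of `u`, so the Poincaré inequality applies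
  -- to `u - ℓ` and to its gradient
  obtain ⟨ℓ, hℓ, hmean⟩ := h.exists_affine hum fun j => T.area⁻¹ * ∫ x in T.carrier, D j x
  have hr := hu.sub_affine isOpen_interior T.isBounded_interior ℓ
  simp only [hℓ] at hr
  -- the remainder `u - ℓ` and its gradient
  have hr1 : ∑ j, l2Norm T.carrier (fun x => D j x - T.area⁻¹ * ∫ y in T.carrier, D j y)
      ≤ 6 * K * H * X := by
    rw [hX, Finset.mul_sum]
    exact Finset.sum_le_sum fun j _ => h.l2Norm_sub_mean_le isOpen_interior subset_rfl (hD j)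
  have hr0 : l2Norm T.carrier (fun x => u x - ℓ x) ≤ 36 * K ^ 2 * H ^ 2 * X := by
    have := h.l2Norm_sub_mean_le isOpen_interior subset_rfl hr
    rw [hmean] at this
    simp only [sub_zero] at this
    calc _ ≤ 6 * K * H * (6 * K * H * X) := this.trans (by gcongr)
      _ = _ := by ring
  set b := 168 * K ^ 4 * H * X with hb
  have hb0 : 0 ≤ b := by positivity
  -- `ℓ (Mᵢ) - qᵢ` is an edge average of the remainder, estimated by the trace inequality
  have hA : ∀ i, |ℓ (T.mid i) - q i| ≤ b := by
    intro i
    have h1 := h.abs_edgeMean_le (memLp_carrier hr.memLp) (fun j => memLp_carrier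
      (hr.memLp_grad j)) i
    have h2 : edgeMean x₀ (T.tail i) (T.head i) (fun x => u x - ℓ x)
        (fun j x => D j x - T.area⁻¹ * ∫ y in T.carrier, D j y) = q i - ℓ (T.mid i) := by
      have := edgeMean_sub (V := ℓ) (F := fun j x => pderiv j ℓ x) (h.memLp_tri hum i)
        (fun j => h.memLp_tri (hDm j) i)
        (h.memLp_tri (T.memLp_affine ℓ) i) (fun j => by
          simp only [pderiv_affine]; exact h.memLp_tri (memLp_const _) i)
      rw [h.star.edgeMean_affine, ← hq i] at this
      simpa only [pderiv_affine, hℓ] using this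
    rw [h2, abs_sub_comm] at h1
    have h3 : H * |ℓ (T.mid i) - q i| ≤ H * b := by
      calc _ ≤ 4 * K ^ 2 * (36 * K ^ 2 * H ^ 2 * X + H * (6 * K * H * X)) := h1.trans (by gcongr)
        _ ≤ 4 * K ^ 2 * (36 * K ^ 2 * H ^ 2 * X + H * (6 * (K * K) * H * X)) := by
            have : K ≤ K * K := le_mul_of_one_le_left hK.le hK1
            gcongr
        _ = _ := by rw [hb]; ring
    exact le_of_mul_le_mul_left h3 hd
  have hsum : ∑ i, T.len i * (ℓ (T.mid i) - q i) ^ 2 ≤ 8 * K * H * b ^ 2 := by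
    calc _ ≤ ∑ i, T.len i * b ^ 2 := by
          refine Finset.sum_le_sum fun i _ => mul_le_mul_of_nonneg_left ?_ (T.len_pos i).le
          rw [← sq_abs]
          exact pow_le_pow_left₀ (abs_nonneg _) (hA i) 2
      _ = (∑ i, T.len i) * b ^ 2 := (Finset.sum_mul _ _ _).symm
      _ ≤ _ := mul_le_mul_of_nonneg_right h.sum_len_le (sq_nonneg _)
  -- the least-squares extension of `q` is at least as close to `q` as `ℓ`
  have hpy := (T.ext_spec q).sum_sq ℓ
  have hn1 : 0 ≤ ∑ i, T.len i * (ℓ (T.mid i) - T.ext q (T.mid i)) ^ 2 :=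
    Finset.sum_nonneg fun i _ => mul_nonneg (T.len_pos i).le (sq_nonneg _)
  have hn2 : 0 ≤ ∑ i, T.len i * (T.ext q (T.mid i) - q i) ^ 2 :=
    Finset.sum_nonneg fun i _ => mul_nonneg (T.len_pos i).le (sq_nonneg _)
  refine ⟨?_, ?_⟩
  · have h1 : ∀ i, |(ℓ - T.ext q) (T.mid i)| ≤ 3 * K * b := by
      intro i
      have h2 := Finset.single_le_sum
        (f := fun i => T.len i * (ℓ (T.mid i) - T.ext q (T.mid i)) ^ 2)
        (fun i _ => mul_nonneg (T.len_pos i).le (sq_nonneg _)) (Finset.mem_univ i)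
      have h3 : H * (ℓ (T.mid i) - T.ext q (T.mid i)) ^ 2 ≤ H * (8 * K ^ 2 * b ^ 2) := by
        calc _ ≤ K * T.len i * (ℓ (T.mid i) - T.ext q (T.mid i)) ^ 2 :=
              mul_le_mul_of_nonneg_right (h.len_ge i) (sq_nonneg _)
          _ = K * (T.len i * (ℓ (T.mid i) - T.ext q (T.mid i)) ^ 2) := by ring
          _ ≤ K * (8 * K * H * b ^ 2) := mul_le_mul_of_nonneg_left (by linarith) hK.le
          _ = _ := by ring
      have h4 := le_of_mul_le_mul_left h3 hd
      rw [AffineMap.coe_sub, Pi.sub_apply]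
      refine abs_le_of_sq_le_sq ?_ (by positivity)
      nlinarith [mul_nonneg (sq_nonneg K) (sq_nonneg b)]
    have h2 : l2Norm T.carrier (fun x => ℓ x - T.ext q x) ≤ 102 * K ^ 4 * H * b := by
      have h5 := l2Norm_le_of_abs_le T.measurableSet_carrier zero_le_one
        (f := fun x => ℓ x - T.ext q x) (memLp_const (T := T) (17 * K ^ 3 * (3 * K * b)))
        (fun x hx => by
          rw [one_mul, abs_of_nonneg (by positivity : 0 ≤ 17 * K ^ 3 * (3 * K * b))]
          exact h.abs_affine_le h1 hx)
      rw [one_mul, l2Norm_const, abs_of_nonneg (by positivity)] at h5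
      calc _ ≤ √T.area * (17 * K ^ 3 * (3 * K * b)) := h5
        _ ≤ 2 * H * (17 * K ^ 3 * (3 * K * b)) :=
            mul_le_mul_of_nonneg_right h.sqrt_area_le (by positivity)
        _ = _ := by ring
    have h3 := l2Norm_add_le (hum.sub (T.memLp_affine ℓ))
      ((T.memLp_affine ℓ).sub (T.memLp_affine (T.ext q)))
    simp only [Pi.sub_apply, sub_add_sub_cancel] at h3
    have hK6 : 1 ≤ K ^ 6 := one_le_pow₀ hK1
    calc _ ≤ 36 * K ^ 2 * H ^ 2 * X + 102 * K ^ 4 * H * b := h3.trans (add_le_add hr0 h2)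
      _ = 36 * K ^ 2 * H ^ 2 * X * 1 + 17136 * K ^ 8 * H ^ 2 * X := by rw [hb]; ring
      _ ≤ 36 * K ^ 2 * H ^ 2 * X * K ^ 6 + 17136 * K ^ 8 * H ^ 2 * X := by gcongr
      _ = _ := by ring
  · calc _ ≤ 8 * K * H * b ^ 2 := by linarith
      _ = H ^ 3 * (225792 * (K * K ^ 8) * X ^ 2) := by rw [hb]; ring
      _ ≤ H ^ 3 * (226576 * (K ^ 2 * K ^ 8) * X ^ 2) := by
          have : K ≤ K ^ 2 := by nlinarith
          gcongr
          norm_num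
      _ = _ := by ring

set_option maxHeartbeats 1000000 in
/-- The local consistency identity. Against functions with weak gradient `D`, the gradient of the
affine extension `p` of edge values `v` differs from the weak gradient of `v` by a sum over the
edges, plus averages of `(p - vᵢ)(W - W̄)`, which are estimated by the trace and Poincaré inequalities. -/
theorem abs_consistency_le (h : T.Regular x₀ K) {W : E → ℝ} {D : Fin 2 → E → ℝ}
    (hW : HasWeakGrad (interior T.carrier) W D) (v : Fin T.N → ℝ) (j : Fin 2) {η : ℝ}
    (hη : T.diam ≤ η) :
    |(∫ x in T.carrier, D j x * T.ext v x) + (∫ x in T.carrier, W x * T.weakGrad v j)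
        - ∑ i, T.len i * T.normal i j * (v i * edgeMean x₀ (T.tail i) (T.head i) W D)|
      ≤ 3168 * K ^ 7 * η * (∑ k, l2Norm T.carrier (D k)) *
        ((∑ k, √T.area * |T.weakGrad v k|)
          + √(η⁻¹ * ∑ i, T.len i * (T.ext v (T.mid i) - v i) ^ 2)) := by
  have hfin := T.isFiniteMeasure_carrier
  have hd := h.diam_pos
  have hη0 : 0 < η := hd.trans_le hη
  have hK := h.K_pos
  have hK1 := h.one_le
  have hA := h.star.area_pos
  set H := T.diam with hH
  set p := T.ext v with hp
  set d := ∑ k, l2Norm T.carrier (D k) with hdd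
  have hd0 : 0 ≤ d := Finset.sum_nonneg fun i _ => l2Norm_nonneg _ _
  have hWm := memLp_carrier hW.memLp
  have hDm := fun i => memLp_carrier (hW.memLp_grad i)
  set m := T.area⁻¹ * ∫ y in T.carrier, W y with hm
  have hY := hW.sub_const isOpen_interior T.isBounded_interior m
  have hYm := memLp_carrier hY.memLp
  have hpoin : l2Norm T.carrier (fun x => W x - m) ≤ 6 * K * H * d :=
    h.l2Norm_sub_mean_le isOpen_interior subset_rfl hW
  have hYI : Integrable (fun x => W x - m) (volume.restrict T.carrier) :=
    hYm.integrable (by norm_num)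
  have hWI : Integrable W (volume.restrict T.carrier) := hWm.integrable (by norm_num)
  have hY0 : ∫ x in T.carrier, (W x - m) = 0 := by
    rw [integral_sub hWI (integrable_const _), integral_const]
    simp only [measureReal_restrict_apply, MeasurableSet.univ, univ_inter, smul_eq_mul]
    have e : volume.real T.carrier = T.area := rfl
    rw [e, hm, mul_inv_cancel_left₀ hA.ne', sub_self]
  set A : Fin T.N → (E → ℝ) → (Fin 2 → E → ℝ) → ℝ := fun i => edgeMean x₀ (T.tail i) (T.head i)
    with hAdef
  set g : Fin 2 → ℝ := fun k => p.linear (EuclideanSpace.single k 1) with hg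
  -- the products `(p - vᵢ)(W - m)`
  have hZ : ∀ i, HasWeakGrad (interior T.carrier) (fun x => (p x - v i) * (W x - m))
      (fun k x => (p x - v i) * D k x + g k * (W x - m)) := by
    intro i
    have := hY.affine_mul isOpen_interior T.isBounded_interior (p - AffineMap.const ℝ E (v i))
    simpa [AffineMap.coe_sub] using this
  have hpY := hY.affine_mul isOpen_interior T.isBounded_interior p
  -- the exact identity: the divergence theorem for `p (W - m)`, where the term with the gradient of
  -- `p` vanishes because `W - m` has mean zero
  have hid : (∫ x in T.carrier, D j x * p x) + (∫ x in T.carrier, W x * T.weakGrad v j)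
        - ∑ i, T.len i * T.normal i j * (v i * A i W D)
      = ∑ i, T.len i * T.normal i j * A i (fun x => (p x - v i) * (W x - m))
          (fun k x => (p x - v i) * D k x + g k * (W x - m)) := by
    have e1 : ∫ x in T.carrier, D j x * p x
        = ∑ i, T.len i * T.normal i j * A i (fun x => p x * (W x - m))
          (fun k x => p x * D k x + g k * (W x - m)) := by
      rw [← h.star.setIntegral_grad isOpen_interior subset_rfl hpY j, integral_add,
        integral_const_mul,
        hY0, mul_zero, add_zero]
      · simp only [mul_comm]
      · have := (hDm j).integrable_mul (T.memLp_affine p)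
        refine this.congr (ae_of_all _ fun x => mul_comm _ _)
      · exact hYI.const_mul _
    have e2 : ∫ x in T.carrier, W x * T.weakGrad v j = ∑ i, T.len i * T.normal i j * (v i * m) := by
      rw [integral_mul_const]
      have : ∫ x in T.carrier, W x = T.area * m := by rw [hm, mul_inv_cancel_left₀ hA.ne']
      rw [this, mul_right_comm, h.area_mul_weakGrad, Finset.sum_mul]
      exact Finset.sum_congr rfl fun i _ => by ring
    rw [e1, e2, ← Finset.sum_add_distrib, ← Finset.sum_sub_distrib]
    refine Finset.sum_congr rfl fun i _ => ?_
    have e3 : A i (fun x => W x - m) D = A i W D - m := by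
      have := edgeMean_sub (V := AffineMap.const ℝ E m)
        (F := fun k x => pderiv k (AffineMap.const ℝ E m) x) (h.memLp_tri hWm i)
        (fun k => h.memLp_tri (hDm k) i) (h.memLp_tri (T.memLp_affine _) i) (fun k => by
          simp only [pderiv_affine]; exact h.memLp_tri (memLp_const _) i)
      rw [h.star.edgeMean_affine] at this
      simp only [pderiv_affine, AffineMap.const_linear, LinearMap.zero_apply, sub_zero,
        AffineMap.const_apply] at this
      exact this
    have e4 : A i (fun x => (p x - v i) * (W x - m))
          (fun k x => (p x - v i) * D k x + g k * (W x - m))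
        = A i (fun x => p x * (W x - m)) (fun k x => p x * D k x + g k * (W x - m))
          - v i * A i (fun x => W x - m) D := by
      rw [hAdef]
      simp only
      rw [← edgeMean_const_mul, ← edgeMean_sub (h.memLp_tri (memLp_carrier hpY.memLp) i)
        (fun k => h.memLp_tri (memLp_carrier (hpY.memLp_grad k)) i)
        ((h.memLp_tri hYm i).const_mul _) fun k => (h.memLp_tri (hDm k) i).const_mul _]
      congr 1
      · ext x; ring
      · ext k x; ring
    rw [e4, e3]
    ring
  rw [hid]
  set Γ := ∑ k, |T.weakGrad v k| with hΓ
  have hΓ0 : 0 ≤ Γ := Finset.sum_nonneg fun i _ => abs_nonneg _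
  set Δ := ∑ i, T.len i * |p (T.mid i) - v i| with hΔ
  have hΔ0 : 0 ≤ Δ := Finset.sum_nonneg fun i _ => mul_nonneg (T.len_pos i).le (abs_nonneg _)
  set S := η⁻¹ * ∑ i, T.len i * (p (T.mid i) - v i) ^ 2 with hS
  have hS0 : 0 ≤ S := mul_nonneg (inv_nonneg.2 hη0.le)
    (Finset.sum_nonneg fun i _ => mul_nonneg (T.len_pos i).le (sq_nonneg _))
  -- the distance of `p` to the edge values is controlled by the stabilizer
  have hΔS : Δ ≤ 3 * K * η * √S := by
    have h1 : Δ ^ 2 ≤ (∑ i, T.len i) * ∑ i, T.len i * (p (T.mid i) - v i) ^ 2 := by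
      refine Finset.sum_sq_le_sum_mul_sum_of_sq_le_mul _ (fun i _ => (T.len_pos i).le)
        (fun i _ => mul_nonneg (T.len_pos i).le (sq_nonneg _)) fun i _ => le_of_eq ?_
      rw [mul_pow, sq_abs]; ring
    have h2 : ∑ i, T.len i * (p (T.mid i) - v i) ^ 2 = η * S := by
      rw [hS, mul_inv_cancel_left₀ hη0.ne']
    rw [h2] at h1
    refine (abs_le_of_sq_le_sq' ?_ (by positivity)).2
    calc Δ ^ 2 ≤ 8 * K * η * (η * S) := h1.trans (mul_le_mul_of_nonneg_right
            (h.sum_len_le.trans (by gcongr)) (by positivity))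
      _ = 8 * (K * (η ^ 2 * S)) := by ring
      _ ≤ 9 * (K * K * (η ^ 2 * S)) := by
          have : K ≤ K * K := le_mul_of_one_le_left hK.le hK1
          gcongr
          norm_num
      _ = _ := by rw [mul_pow, Real.sq_sqrt hS0]; ring
  -- the gradient of `p` differs from the weak gradient of `v` by the same distance
  have hgk : ∀ k, H ^ 2 * |g k| ≤ H ^ 2 * Γ + K ^ 2 * Δ := by
    intro k
    have h1 : |T.area * (g k - T.weakGrad v k)| ≤ Δ := by
      rw [mul_sub, h.area_mul_weakGrad, ← h.star.sum_affine_mid p k, ← Finset.sum_sub_distrib]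
      refine (Finset.abs_sum_le_sum_abs _ _).trans (Finset.sum_le_sum fun i _ => ?_)
      rw [← mul_sub, abs_mul, abs_mul, abs_of_pos (T.len_pos i)]
      exact mul_le_mul_of_nonneg_right
        (mul_le_of_le_one_right (T.len_pos i).le (StarAbout.abs_normal_le i k)) (abs_nonneg _)
    rw [abs_mul, abs_of_pos hA] at h1
    have h2 := (h.diam_sq_mul_le_area_mul (abs_nonneg (g k - T.weakGrad v k))).trans
      (mul_le_mul_of_nonneg_left h1 (sq_nonneg K))
    have h3 : |g k| ≤ |T.weakGrad v k| + |g k - T.weakGrad v k| := by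
      have := abs_add_le (T.weakGrad v k) (g k - T.weakGrad v k)
      rwa [add_sub_cancel] at this
    have h4 : |T.weakGrad v k| ≤ Γ := Finset.single_le_sum
      (f := fun k => |T.weakGrad v k|) (fun i _ => abs_nonneg _) (Finset.mem_univ k)
    calc _ ≤ H ^ 2 * (Γ + |g k - T.weakGrad v k|) := by gcongr; linarith
      _ ≤ _ := by rw [mul_add]; linarith
  -- `H²` times a bound for the gradient of `p`, `H` times a bound for `p - vᵢ`
  set G := H ^ 2 * Γ + K ^ 2 * Δ with hG
  have hG0 : 0 ≤ G := by positivity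
  set Q := H ^ 2 * Γ * 2 + 3 * K ^ 2 * Δ with hQ
  have hQ0 : 0 ≤ Q := by positivity
  have hQb : ∀ i, ∀ x ∈ T.carrier, H * |p x - v i| ≤ Q := by
    intro i x hx
    have h1 := abs_affine_sub_le (p := p) hx (mid_mem i)
    have h2 : |p x - v i| ≤ |p x - p (T.mid i)| + |p (T.mid i) - v i| := by
      have := abs_add_le (p x - p (T.mid i)) (p (T.mid i) - v i)
      rwa [sub_add_sub_cancel] at this
    have h3 : H * |p (T.mid i) - v i| ≤ K ^ 2 * Δ := by
      have := Finset.single_le_sum (f := fun i => T.len i * |p (T.mid i) - v i|)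
        (fun i _ => mul_nonneg (T.len_pos i).le (abs_nonneg _)) (Finset.mem_univ i)
      calc _ ≤ K * T.len i * |p (T.mid i) - v i| :=
            mul_le_mul_of_nonneg_right (h.len_ge i) (abs_nonneg _)
        _ = K * (T.len i * |p (T.mid i) - v i|) := by ring
        _ ≤ K * Δ := mul_le_mul_of_nonneg_left this hK.le
        _ ≤ K ^ 2 * Δ := mul_le_mul_of_nonneg_right (by nlinarith) hΔ0
    have h4 : H * (H * ∑ k, |g k|) ≤ 2 * (H ^ 2 * Γ) + 2 * (K ^ 2 * Δ) := by
      rw [Fin.sum_univ_two]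
      nlinarith [hgk 0, hgk 1]
    calc _ ≤ H * (H * ∑ k, |g k| + |p (T.mid i) - v i|) := by gcongr; linarith
      _ ≤ _ := by rw [mul_add]; linarith
  -- the trace inequality for the products, then the Poincaré inequality for `W - m`
  have hAb : ∀ i, H * |A i (fun x => (p x - v i) * (W x - m))
      (fun k x => (p x - v i) * D k x + g k * (W x - m))| ≤ 4 * K ^ 3 * d * (7 * Q + 12 * G) := by
    intro i
    have hYn := l2Norm_nonneg T.carrier (fun x => W x - m)
    have hZm := memLp_carrier (hZ i).memLp
    have h1 := h.abs_edgeMean_le hZm (fun k => memLp_carrier ((hZ i).memLp_grad k)) i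
    have hmul : ∀ F : E → ℝ, MemLp F 2 (volume.restrict T.carrier) →
        H * l2Norm T.carrier (fun x => (p x - v i) * F x) ≤ Q * l2Norm T.carrier F := by
      intro F hF
      have := l2Norm_le_of_abs_le T.measurableSet_carrier (C := Q / H)
        (f := fun x => (p x - v i) * F x) (by positivity) hF (fun x hx => by
          rw [abs_mul]
          refine mul_le_mul_of_nonneg_right ?_ (abs_nonneg _)
          rw [le_div_iff₀ hd, mul_comm]
          exact hQb i x hx)
      calc _ ≤ H * (Q / H * l2Norm T.carrier F) := mul_le_mul_of_nonneg_left this hd.le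
        _ = _ := by field_simp
    have hgY : ∀ k, H ^ 2 * l2Norm T.carrier (fun x => g k * (W x - m))
        ≤ G * l2Norm T.carrier (fun x => W x - m) := by
      intro k
      have := l2Norm_le_of_abs_le T.measurableSet_carrier (C := |g k|)
        (f := fun x => g k * (W x - m)) (abs_nonneg _) hYm (fun x hx => by rw [abs_mul])
      calc _ ≤ H ^ 2 * (|g k| * l2Norm T.carrier (fun x => W x - m)) := by gcongr
        _ = (H ^ 2 * |g k|) * l2Norm T.carrier (fun x => W x - m) := by ring
        _ ≤ _ := mul_le_mul_of_nonneg_right (hgk k) hYn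
    have hk : ∀ k, H ^ 2 * l2Norm T.carrier (fun x => (p x - v i) * D k x + g k * (W x - m))
        ≤ H * Q * l2Norm T.carrier (D k) + G * l2Norm T.carrier (fun x => W x - m) := by
      intro k
      have hm1 : MemLp (fun x => (p x - v i) * D k x) 2 (volume.restrict T.carrier) := by
        refine memLp_bdd_mul T.measurableSet_carrier (A := Q / H)
          ((T.memLp_affine p).sub (memLp_const _)).1 (fun x hx => ?_) (hDm k)
        rw [le_div_iff₀ hd, mul_comm]
        exact hQb i x hx
      have h2 := l2Norm_add_le hm1 (hYm.const_mul (g k))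
      have h3 := hmul _ (hDm k)
      have h4 := hgY k
      calc _ ≤ H ^ 2 * (l2Norm T.carrier (fun x => (p x - v i) * D k x)
              + l2Norm T.carrier (fun x => g k * (W x - m))) := by gcongr
        _ = H * (H * l2Norm T.carrier (fun x => (p x - v i) * D k x))
              + H ^ 2 * l2Norm T.carrier (fun x => g k * (W x - m)) := by ring
        _ ≤ H * (Q * l2Norm T.carrier (D k)) + G * l2Norm T.carrier (fun x => W x - m) := by gcongr
        _ = _ := by ring
    have h5 : H * ((l2Norm T.carrier fun x => (p x - v i) * (W x - m))
        + H * ∑ k, l2Norm T.carrier (fun x => (p x - v i) * D k x + g k * (W x - m)))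
        ≤ K * H * d * (7 * Q + 12 * G) := by
      have h6 : ∑ k, H ^ 2 * l2Norm T.carrier (fun x => (p x - v i) * D k x + g k * (W x - m))
          ≤ H * Q * d + 2 * (G * l2Norm T.carrier (fun x => W x - m)) := by
        refine (Finset.sum_le_sum fun k _ => hk k).trans (le_of_eq ?_)
        rw [hdd, Fin.sum_univ_two, Fin.sum_univ_two]; ring
      calc _ = H * (l2Norm T.carrier fun x => (p x - v i) * (W x - m))
            + ∑ k, H ^ 2 * l2Norm T.carrier (fun x => (p x - v i) * D k x + g k * (W x - m)) := by
              rw [← Finset.mul_sum]; ring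
        _ ≤ Q * l2Norm T.carrier (fun x => W x - m)
            + (H * Q * d + 2 * (G * l2Norm T.carrier (fun x => W x - m))) :=
              add_le_add (hmul _ hYm) h6
        _ ≤ Q * (6 * K * H * d) + (H * Q * d * K + 2 * (G * (6 * K * H * d))) := by
              have : H * Q * d ≤ H * Q * d * K := le_mul_of_one_le_right (by positivity) hK1
              gcongr
        _ = _ := by ring
    have h7 : H * (H * |A i (fun x => (p x - v i) * (W x - m))
        (fun k x => (p x - v i) * D k x + g k * (W x - m))|)
        ≤ H * (4 * K ^ 3 * d * (7 * Q + 12 * G)) := by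
      calc _ ≤ H * (4 * K ^ 2 * ((l2Norm T.carrier fun x => (p x - v i) * (W x - m))
            + H * ∑ k, l2Norm T.carrier (fun x => (p x - v i) * D k x + g k * (W x - m)))) :=
            mul_le_mul_of_nonneg_left h1 hd.le
        _ = 4 * K ^ 2 * (H * ((l2Norm T.carrier fun x => (p x - v i) * (W x - m))
            + H * ∑ k, l2Norm T.carrier (fun x => (p x - v i) * D k x + g k * (W x - m)))) :=
              by ring
        _ ≤ 4 * K ^ 2 * (K * H * d * (7 * Q + 12 * G)) :=
          mul_le_mul_of_nonneg_left h5 (by positivity)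
        _ = _ := by ring
    exact le_of_mul_le_mul_left h7 hd
  set B := 4 * K ^ 3 * d * (7 * Q + 12 * G) with hB
  have hB0 : 0 ≤ B := by positivity
  have hsum : |∑ i, T.len i * T.normal i j * A i (fun x => (p x - v i) * (W x - m))
          (fun k x => (p x - v i) * D k x + g k * (W x - m))| ≤ 8 * K * B := by
    have h1 : H * |∑ i, T.len i * T.normal i j * A i (fun x => (p x - v i) * (W x - m))
          (fun k x => (p x - v i) * D k x + g k * (W x - m))| ≤ H * (8 * K * B) := by
      calc _ ≤ H * ∑ i, T.len i * |A i (fun x => (p x - v i) * (W x - m))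
              (fun k x => (p x - v i) * D k x + g k * (W x - m))| := by
            refine mul_le_mul_of_nonneg_left ((Finset.abs_sum_le_sum_abs _ _).trans
              (Finset.sum_le_sum fun i _ => ?_)) hd.le
            rw [abs_mul, abs_mul, abs_of_pos (T.len_pos i)]
            exact mul_le_mul_of_nonneg_right
              (mul_le_of_le_one_right (T.len_pos i).le (StarAbout.abs_normal_le i j)) (abs_nonneg _)
        _ ≤ ∑ i, T.len i * B := by
            rw [Finset.mul_sum]
            refine Finset.sum_le_sum fun i _ => ?_
            rw [mul_left_comm]
            exact mul_le_mul_of_nonneg_left (hAb i) (T.len_pos i).le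
        _ = (∑ i, T.len i) * B := (Finset.sum_mul _ _ _).symm
        _ ≤ 8 * K * H * B := mul_le_mul_of_nonneg_right h.sum_len_le hB0
        _ = _ := by ring
    exact le_of_mul_le_mul_left h1 hd
  have hΓa : H ^ 2 * Γ ≤ K * η * (√T.area * Γ) := by
    calc H ^ 2 * Γ = H * H * Γ := by ring
      _ ≤ η * (K * √T.area) * Γ := by
          have := h.diam_le_sqrt_area
          gcongr
      _ = _ := by ring
  have hK3 : K ≤ K ^ 3 := le_self_pow₀ hK1 (by norm_num)
  rw [← Finset.mul_sum, ← hΓ]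
  calc _ ≤ 8 * K * B := hsum
    _ = 32 * K ^ 4 * d * (26 * (H ^ 2 * Γ) + 33 * K ^ 2 * Δ) := by rw [hB, hQ, hG]; ring
    _ ≤ 32 * K ^ 4 * d * (99 * (K ^ 3 * η * (√T.area * Γ)) + 33 * K ^ 2 * (3 * K * η * √S)) := by
        have h1 : H ^ 2 * Γ ≤ K ^ 3 * η * (√T.area * Γ) := hΓa.trans (by gcongr)
        have h0 : 0 ≤ H ^ 2 * Γ := by positivity
        gcongr
        norm_num
    _ = _ := by ring

end Regular

end Poly

/-! ### Triangles on the two sides of an edge -/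

theorem cross_segment {a b x₀ : E} (s : ℝ) :
    cross (a - AffineMap.lineMap a b s) (b - AffineMap.lineMap a b s) = 0 ∧
    cross (b - AffineMap.lineMap a b s) (x₀ - AffineMap.lineMap a b s)
      = (1 - s) * cross (a - x₀) (b - x₀) ∧
    cross (x₀ - AffineMap.lineMap a b s) (a - AffineMap.lineMap a b s)
      = s * cross (a - x₀) (b - x₀) := by
  simp only [cross, AffineMap.lineMap_apply_module', PiLp.sub_apply, PiLp.add_apply,
    PiLp.smul_apply, smul_eq_mul]
  refine ⟨?_, ?_, ?_⟩ <;> ring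

theorem eventually_cross_pos {a b x₀ : E} (h : 0 < cross (a - x₀) (b - x₀)) {s : ℝ}
    (hs : s ∈ Ioo (0 : ℝ) 1) : ∀ᶠ w in 𝓝 (AffineMap.lineMap a b s : E),
      0 < cross (b - w) (x₀ - w) ∧ 0 < cross (x₀ - w) (a - w) := by
  have hc : ∀ p q : E, Continuous fun w : E => cross (p - w) (q - w) := fun p q =>
    continuous_cross (continuous_const.sub continuous_id) (continuous_const.sub continuous_id)
  obtain ⟨-, h1, h2⟩ := cross_segment (a := a) (b := b) (x₀ := x₀) s
  refine ((hc b x₀).tendsto _ |>.eventually_const_lt ?_).and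
    ((hc x₀ a).tendsto _ |>.eventually_const_lt ?_)
  · rw [h1]; exact mul_pos (by linarith [hs.2]) h
  · rw [h2]; exact mul_pos hs.1 h

/-- Two triangles on the same side of a common base overlap. -/
theorem tri_inter_nonempty {a b x y : E} (hx : 0 < cross (a - x) (b - x))
    (hy : 0 < cross (a - y) (b - y)) : (tri x a b ∩ tri y a b).Nonempty := by
  set m : E := AffineMap.lineMap a b (1 / 2 : ℝ) with hm
  have hs : (1 / 2 : ℝ) ∈ Ioo (0 : ℝ) 1 := by norm_num
  have ht : Tendsto (fun ε : ℝ => (AffineMap.lineMap m x ε : E)) (𝓝[>] 0) (𝓝 m) := by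
    have : Continuous fun ε : ℝ => (AffineMap.lineMap m x ε : E) := AffineMap.lineMap_continuous
    have := this.tendsto 0
    rw [AffineMap.lineMap_apply_zero] at this
    exact this.mono_left nhdsWithin_le_nhds
  obtain ⟨ε, ⟨⟨h1, h2⟩, h3, h4⟩, h5⟩ := ((ht.eventually (eventually_cross_pos hx hs)).and
    (ht.eventually (eventually_cross_pos hy hs)) |>.and self_mem_nhdsWithin).exists
  have h0 : 0 < cross (a - AffineMap.lineMap m x ε) (b - AffineMap.lineMap m x ε) := by
    rw [cross_lineMap, (cross_segment (a := a) (b := b) (x₀ := x) (1 / 2)).1, mul_zero, zero_add]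
    exact mul_pos h5 hx
  exact ⟨_, ⟨h0, h1, h2⟩, h0, h3, h4⟩

theorem cross_comm_neg (x y : E) : cross x y = - cross y x := by
  simp only [cross]; ring

theorem eq_lineMap_of_smul_eq {d r s : ℝ} {w a b : E} (hd : d ≠ 0) (hs : r + s = d)
    (h : d • w = r • a + s • b) : w = AffineMap.lineMap a b (s / d) := by
  rw [AffineMap.lineMap_apply_module, ← inv_smul_smul₀ hd w, h, smul_add, smul_smul, smul_smul,
    div_eq_inv_mul, ← hs]
  congr 2
  have : r + s ≠ 0 := hs ▸ hd
  field_simp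
  ring

/-- A point of the open common base of two triangles on opposite sides is interior to every set that
contains both triangles and the base. -/
theorem lineMap_mem_interior_of_tri_subset {a b x y : E} (hx : 0 < cross (a - x) (b - x))
    (hy : 0 < cross (b - y) (a - y)) {P : Set E} (h1 : tri x a b ⊆ P)
    (h2 : tri y b a ⊆ P) (hab : ∀ s ∈ Icc (0 : ℝ) 1, AffineMap.lineMap a b s ∈ P) {s : ℝ}
    (hs : s ∈ Ioo (0 : ℝ) 1) : AffineMap.lineMap a b s ∈ interior P := by
  rw [mem_interior_iff_mem_nhds]
  have hs' : 1 - s ∈ Ioo (0 : ℝ) 1 := ⟨by linarith [hs.2], by linarith [hs.1]⟩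
  have e2 := eventually_cross_pos hy hs'
  rw [AffineMap.lineMap_apply_one_sub] at e2
  filter_upwards [eventually_cross_pos hx hs, e2] with w hw hw'
  rcases lt_trichotomy 0 (cross (a - w) (b - w)) with h | h | h
  · exact h1 ⟨h, hw⟩
  · have e := cross_smul_eq x a b w
    have e' := cross_add_cross_add_cross x a b w
    rw [← h, zero_smul, zero_add] at e
    rw [← h, zero_add] at e'
    have := eq_lineMap_of_smul_eq hx.ne' e' e
    rw [this]
    exact hab _ ⟨div_nonneg hw.2.le hx.le, (div_le_one hx).2 (by linarith [hw.1])⟩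
  · refine h2 ⟨?_, hw'⟩
    rw [cross_comm_neg]
    linarith

namespace PolyMesh

/-! ### The edges of a partition -/

variable {Ω : Set E} {M : PolyMesh Ω} {x₀ : Fin M.card → E} {K : ℝ}

theorem carrier_subset (M : PolyMesh Ω) (t : Fin M.card) : (M.elem t).carrier ⊆ closure Ω :=
  M.cover ▸ subset_iUnion (fun t => (M.elem t).carrier) t

theorem interior_subset_domain (hΩ : interior (closure Ω) = Ω) (M : PolyMesh Ω) (t : Fin M.card) :
    interior (M.elem t).carrier ⊆ Ω :=
  (interior_mono (M.carrier_subset t)).trans hΩ.subset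

/-- An oriented edge belongs to one element only. -/
theorem eq_of_endpoints_eq (hM : ∀ t, (M.elem t).Regular (x₀ t) K)
    {t t' : Fin M.card} {i : Fin (M.elem t).N} {i' : Fin (M.elem t').N}
    (h1 : (M.elem t).tail i = (M.elem t').tail i') (h2 : (M.elem t).head i = (M.elem t').head i') :
    (⟨t, i⟩ : Σ t, Fin (M.elem t).N) = ⟨t', i'⟩ := by
  by_cases htt : t = t'
  · subst htt
    rw [(M.elem t).injective h1]
  · exfalso
    have p1 := (hM t).star.dblArea_pos i
    have p2 := (hM t').star.dblArea_pos i'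
    have s1 := (hM t).star.tri_subset_interior i
    have s2 := (hM t').star.tri_subset_interior i'
    rw [← h1, ← h2] at s2
    rw [Poly.dblArea, ← h1, ← h2] at p2
    obtain ⟨z, hz1, hz2⟩ := tri_inter_nonempty p1 p2
    exact Set.disjoint_left.1 (M.nonoverlapping t t' htt) (s1 hz1) (s2 hz2)

/-- The averages of a weakly differentiable function over an edge from its two sides agree. -/
theorem edgeMean_eq_of_reversed (hΩo : IsOpen Ω) (hΩ : interior (closure Ω) = Ω)
    (hM : ∀ t, (M.elem t).Regular (x₀ t) K) {W : E → ℝ} {D : Fin 2 → E → ℝ}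
    (hW : HasWeakGrad Ω W D) {t t' : Fin M.card} {i : Fin (M.elem t).N} {i' : Fin (M.elem t').N}
    (h1 : (M.elem t).tail i = (M.elem t').head i') (h2 : (M.elem t).head i = (M.elem t').tail i') :
    edgeMean (x₀ t) ((M.elem t).tail i) ((M.elem t).head i) W D
      = edgeMean (x₀ t') ((M.elem t').tail i') ((M.elem t').head i') W D := by
  have p1 := (hM t).star.dblArea_pos i
  have p2 := (hM t').star.dblArea_pos i'
  have s1 := ((hM t).star.tri_subset_interior i).trans (M.interior_subset_domain hΩ t)
  have s2 := ((hM t').star.tri_subset_interior i').trans (M.interior_subset_domain hΩ t')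
  rw [Poly.dblArea] at p1 p2
  rw [← h1, ← h2] at s2 p2 ⊢
  refine hW.edgeMean_eq hΩo p1 p2 s1 s2 fun s hs => ?_
  refine hΩ.subset ?_
  exact lineMap_mem_interior_of_tri_subset p1 p2 (s1.trans subset_closure)
    (s2.trans subset_closure) (fun s hs => M.carrier_subset t
      ((M.elem t).edge_subset_carrier i (Poly.StarAbout.lineMap_mem_edge i hs))) hs

theorem endpoints_of_edge_eq {t t' : Fin M.card} {i : Fin (M.elem t).N} {i' : Fin (M.elem t').N}
    (h : (M.elem t).edge i = (M.elem t').edge i') :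
    ((M.elem t).tail i = (M.elem t').tail i' ∧ (M.elem t).head i = (M.elem t').head i') ∨
    ((M.elem t).tail i = (M.elem t').head i' ∧ (M.elem t).head i = (M.elem t').tail i') :=
  endpoints_eq_of_affineSegment_eq ((M.elem t).tail_ne_head i) h

/-- The edge averages of a weakly differentiable function. -/
def edgeMeans (M : PolyMesh Ω) (x₀ : Fin M.card → E) (W : E → ℝ) (D : Fin 2 → E → ℝ) : M.EdgeFun :=
  fun t i => edgeMean (x₀ t) ((M.elem t).tail i) ((M.elem t).head i) W D

/-- Edge averages are single-valued. -/
theorem edgeMeans_mem_Wh (hΩo : IsOpen Ω) (hΩ : interior (closure Ω) = Ω)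
    (hM : ∀ t, (M.elem t).Regular (x₀ t) K) {W : E → ℝ} {D : Fin 2 → E → ℝ}
    (hW : HasWeakGrad Ω W D) : M.edgeMeans x₀ W D ∈ M.Wh := by
  intro t i t' i' h
  rcases endpoints_of_edge_eq h with ⟨h1, h2⟩ | ⟨h1, h2⟩
  · cases eq_of_endpoints_eq hM h1 h2
    rfl
  · exact edgeMean_eq_of_reversed hΩo hΩ hM hW h1 h2

theorem exists_neighbour (hM : ∀ t, (M.elem t).Regular (x₀ t) K) (a : Σ t, Fin (M.elem t).N)
    (ha : ¬ (M.elem a.1).edge a.2 ⊆ frontier Ω) : ∃ b : Σ t, Fin (M.elem t).N,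
      (M.elem b.1).edge b.2 = (M.elem a.1).edge a.2 ∧ (M.elem a.1).tail a.2
        = (M.elem b.1).head b.2 ∧
      (M.elem a.1).head a.2 = (M.elem b.1).tail b.2 := by
  obtain ⟨t', i', htt, he⟩ := (M.conforming a.1 a.2).resolve_left ha
  rcases endpoints_of_edge_eq he.symm with ⟨h1, h2⟩ | ⟨h1, h2⟩
  · have := eq_of_endpoints_eq hM h1 h2
    exact absurd (congrArg Sigma.fst this).symm htt
  · exact ⟨⟨t', i'⟩, he, h1, h2⟩

/-- The jumps across the edges cancel: on an interior edge the two normals are opposite, and the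
test function vanishes on boundary edges. -/
theorem sum_edges_eq_zero (hΩo : IsOpen Ω) (hΩ : interior (closure Ω) = Ω)
    (hM : ∀ t, (M.elem t).Regular (x₀ t) K) {W : E → ℝ} {D : Fin 2 → E → ℝ}
    (hW : HasWeakGrad Ω W D) {v : M.EdgeFun} (hv : v ∈ M.Wh0) (j : Fin 2) :
    ∑ t, ∑ i, (M.elem t).len i * (M.elem t).normal i j * (v t i *
      edgeMean (x₀ t) ((M.elem t).tail i) ((M.elem t).head i) W D) = 0 := by
  classical
  rw [Finset.sum_sigma']
  -- the terms are paired by the involution that maps an interior edge to the same edge of the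
  -- neighbouring element; the terms of boundary edges vanish
  let S : Set (Σ t, Fin (M.elem t).N) := {a | (M.elem a.1).edge a.2 ⊆ frontier Ω}
  have hex : ∀ a : Σ t, Fin (M.elem t).N, ∃ b : Σ t, Fin (M.elem t).N, (a ∈ S → b = a) ∧ (a ∉ S →
      (M.elem b.1).edge b.2 = (M.elem a.1).edge a.2 ∧ (M.elem a.1).tail a.2
        = (M.elem b.1).head b.2 ∧
      (M.elem a.1).head a.2 = (M.elem b.1).tail b.2) := fun a => by
    by_cases ha : a ∈ S
    · exact ⟨a, fun _ => rfl, fun h => absurd ha h⟩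
    · obtain ⟨b, hb⟩ := exists_neighbour hM a ha
      exact ⟨b, fun h => absurd h ha, fun _ => hb⟩
  choose g hgS hg using hex
  refine Finset.sum_involution (fun a _ => g a) (fun a _ => ?_)
    (fun a _ hne => ?_) (fun _ _ => Finset.mem_sigma.2 ⟨Finset.mem_univ _, Finset.mem_univ _⟩)
    (fun a _ => ?_)
  · by_cases ha : a ∈ S
    · rw [hgS a ha, hv.2 a.1 a.2 ha]
      simp
    · obtain ⟨hg1, hg2, hg3⟩ := hg a ha
      have e1 := edgeMean_eq_of_reversed hΩo hΩ hM hW hg2 hg3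
      have e2 := hv.1 _ _ _ _ hg1
      rw [← e1, e2, ← add_mul]
      convert zero_mul _
      fin_cases j
      · have h1 := Poly.StarAbout.len_mul_normal_zero (T := M.elem a.1) a.2
        have h2 := Poly.StarAbout.len_mul_normal_zero (T := M.elem (g a).1) (g a).2
        rw [← hg2, ← hg3] at h2
        simp only [Fin.zero_eta, h1, h2]
        ring
      · have h1 := Poly.StarAbout.len_mul_normal_one (T := M.elem a.1) a.2
        have h2 := Poly.StarAbout.len_mul_normal_one (T := M.elem (g a).1) (g a).2
        rw [← hg2, ← hg3] at h2
        simp only [Fin.mk_one, h1, h2]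
        ring
  · by_cases ha : a ∈ S
    · refine absurd ?_ hne
      rw [hv.2 a.1 a.2 ha]
      simp
    · intro h
      have := (hg a ha).2.1
      rw [h] at this
      exact (M.elem a.1).tail_ne_head a.2 this
  · by_cases ha : a ∈ S
    · rw [hgS a ha, hgS a ha]
    · obtain ⟨hg1, hg2, hg3⟩ := hg a ha
      have hga : g a ∉ S := by
        simp only [S, mem_ofPred_eq, hg1]
        exact ha
      obtain ⟨-, k2, k3⟩ := hg _ hga
      exact eq_of_endpoints_eq hM (k3.symm.trans hg2.symm) (k2.symm.trans hg3.symm)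

/-! ### Integration over the elements -/

theorem volume_frontier_eq_zero (hΩ : IsPolygonalDomain Ω) : volume (frontier Ω) = 0 := by
  obtain ⟨s, hs⟩ := hΩ.2.2.2.2
  exact measure_mono_null hs ((measure_biUnion_null_iff s.countable_toSet).2
    fun p _ => volume_segment_eq_zero p.1 p.2)

theorem iUnion_interior_ae_eq (hΩ : IsPolygonalDomain Ω) (M : PolyMesh Ω) :
    (⋃ t, interior (M.elem t).carrier : Set E) =ᵐ[volume] Ω := by
  have h1 : (⋃ t, interior (M.elem t).carrier : Set E) =ᵐ[volume] ⋃ t, (M.elem t).carrier :=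
    Filter.EventuallyEq.countable_iUnion fun t => (M.elem t).interior_ae_eq
  refine h1.trans ?_
  rw [M.cover, closure_eq_self_union_frontier]
  refine union_ae_eq_left_of_ae_eq_empty ?_
  exact ae_eq_empty.2 (volume_frontier_eq_zero hΩ)

theorem setIntegral_eq_sum (hΩ : IsPolygonalDomain Ω) (M : PolyMesh Ω) {F : E → ℝ}
    (hF : IntegrableOn F Ω) : ∫ x in Ω, F x = ∑ t, ∫ x in (M.elem t).carrier, F x := by
  rw [← setIntegral_congr_set (iUnion_interior_ae_eq hΩ M), integral_iUnion_fintype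
    (fun t => isOpen_interior.measurableSet) (fun t t' h => M.nonoverlapping t t' h)]
  · exact Finset.sum_congr rfl fun t _ => setIntegral_congr_set (M.elem t).interior_ae_eq
  · exact fun t => hF.mono_set (M.interior_subset_domain hΩ.2.2.2.1 t)

theorem diam_le_meshSize (M : PolyMesh Ω) (t : Fin M.card) : (M.elem t).diam ≤ M.meshSize :=
  le_ciSup (f := fun t => (M.elem t).diam) (Set.finite_range _).bddAbove t

theorem meshSize_pos (hne : Ω.Nonempty) (M : PolyMesh Ω) : 0 < M.meshSize := by
  obtain ⟨x, hx⟩ := hne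
  have := subset_closure hx
  rw [← M.cover, mem_iUnion] at this
  obtain ⟨t, -⟩ := this
  exact (M.elem t).diam_pos.trans_le (M.diam_le_meshSize t)

end PolyMesh

/-! ### Edge averages and boundary values -/

theorem MemH1.isWeakPartial {Ω : Set E} {u : E → ℝ} (h : MemH1 Ω u) (i : Fin 2) :
    IsWeakPartial Ω i u (weakPartial Ω i u) := by
  rw [weakPartial, dif_pos (h.2 i)]
  exact (h.2 i).choose_spec

theorem MemH1.hasWeakGrad {Ω : Set E} (hΩ : IsOpen Ω) {u : E → ℝ} (h : MemH1 Ω u) :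
    HasWeakGrad Ω u (fun i => weakPartial Ω i u) :=
  HasWeakGrad.of_isWeakPartial hΩ h.1 h.isWeakPartial

/-- Arc length on a segment, in terms of the affine parametrization. -/
theorem hausdorffMeasure_restrict_segment (a b : E) :
    (Measure.hausdorffMeasure 1).restrict (affineSegment ℝ a b)
      = nndist a b • (volume.restrict (Icc (0 : ℝ) 1)).map (AffineMap.lineMap a b) := by
  have hm : Measurable (AffineMap.lineMap a b : ℝ → E) := AffineMap.lineMap_continuous.measurable
  ext A hA
  rw [Measure.restrict_apply hA, Measure.smul_apply, Measure.map_apply hm hA,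
    Measure.restrict_apply (hm hA), ← hausdorffMeasure_real, ← hausdorffMeasure_lineMap_image,
    image_preimage_inter, affineSegment]

theorem edgeAvg_eq_segAvg (T : Poly) (g : E → ℝ) (hg : Continuous g) (i : Fin T.N) :
    T.edgeAvg g i = segAvg g (T.tail i) (T.head i) := by
  have hd : (nndist (T.tail i) (T.head i) : ℝ) ≠ 0 := by
    rw [coe_nndist]; exact (dist_pos.2 (T.tail_ne_head i)).ne'
  have hl : Continuous (AffineMap.lineMap (T.tail i) (T.head i) : ℝ → E) :=
    AffineMap.lineMap_continuous
  rw [Poly.edgeAvg, average, T.edge_eq, hausdorffMeasure_restrict_segment]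
  simp only [Measure.smul_apply, Measure.map_apply hl.measurable MeasurableSet.univ, preimage_univ,
    Measure.restrict_apply_univ, Real.volume_Icc, sub_zero, ENNReal.ofReal_one]
  rw [segAvg, intervalIntegral.integral_of_le zero_le_one, ← integral_Icc_eq_integral_Ioc]
  rw [integral_smul_measure, integral_smul_nnreal_measure, integral_map hl.aemeasurable
    hg.aestronglyMeasurable, NNReal.smul_def, smul_smul]
  convert one_smul ℝ _
  rw [ENNReal.toReal_inv, ENNReal.smul_def, smul_eq_mul, mul_one, ENNReal.coe_toReal,
    inv_mul_cancel₀ hd]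

theorem TendstoH1.tendsto_edgeMean {Ω : Set E} {u : E → ℝ} (hu : MemH1 Ω u)
    {w : ℕ → E → ℝ} (hw : ∀ n, ContDiff ℝ ∞ (w n)) (h : TendstoH1 Ω w u) {x₀ a b : E}
    (h0 : 0 < cross (a - x₀) (b - x₀)) (htri : tri x₀ a b ⊆ Ω) :
    Tendsto (fun n => segAvg (w n) a b) atTop
      (𝓝 (edgeMean x₀ a b u fun i => weakPartial Ω i u)) := by
  have hw1 : ∀ n, ContDiff ℝ 1 (w n) := fun n => (hw n).of_le (by exact_mod_cast le_top)
  have hres := Measure.restrict_mono_set (volume : Measure E) htri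
  have hg := fun n => HasWeakGrad.of_contDiff (isBounded_tri x₀ a b) (hw1 n)
  have := SWG.tendsto_edgeMean (hu.1.mono_measure hres)
    (fun i => (hu.isWeakPartial i).1.mono_measure hres) (fun n => (hg n).memLp)
    (fun i n => (hg n).memLp_grad i)
    (tendsto_of_tendsto_of_tendsto_of_le_of_le tendsto_const_nhds h.1 (fun _ => zero_le)
      fun n => eLpNorm_mono_measure _ hres)
    (fun i => tendsto_of_tendsto_of_tendsto_of_le_of_le tendsto_const_nhds (h.2 i)
      (fun _ => zero_le)
      fun n => eLpNorm_mono_measure _ hres)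
  refine this.congr fun n => ?_
  exact edgeMean_eq_segAvg h0 isOpen_univ (subset_univ _) (hw1 n).contDiffOn

/-- On a boundary edge the average given by the radial formula is the average of the trace. -/
theorem edgeMean_eq_edgeAvg {Ω : Set E} {u g : E → ℝ} (h : HasTrace Ω u g) {T : Poly} {x₀ : E}
    {r : ℝ} (hT : T.StarAbout x₀ r) (hTΩ : interior T.carrier ⊆ Ω) {i : Fin T.N}
    (hi : T.edge i ⊆ frontier Ω) :
    edgeMean x₀ (T.tail i) (T.head i) u (fun i => weakPartial Ω i u) = T.edgeAvg g i := by
  obtain ⟨hu, hg, w, hw, hlim, htr⟩ := h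
  have h1 := hlim.tendsto_edgeMean hu hw (hT.dblArea_pos i) ((hT.tri_subset_interior i).trans hTΩ)
  refine tendsto_nhds_unique h1 ?_
  have hres := Measure.restrict_mono_set (Measure.hausdorffMeasure 1 : Measure E) hi
  have hfin : IsFiniteMeasure ((Measure.hausdorffMeasure 1 : Measure E).restrict (T.edge i)) :=
    ⟨by
      rw [Measure.restrict_apply_univ, T.edge_eq, hausdorffMeasure_affineSegment]
      exact edist_lt_top _ _⟩
  have hwm : ∀ n, MemLp (w n) 2 ((Measure.hausdorffMeasure 1 : Measure E).restrict (T.edge i)) := by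
    intro n
    have hc := (hw n).continuous
    have hK : IsCompact (T.edge i) := by
      rw [T.edge_eq, affineSegment]
      exact isCompact_Icc.image AffineMap.lineMap_continuous
    obtain ⟨C, hC⟩ := hK.exists_bound_of_continuousOn hc.continuousOn
    exact MemLp.of_bound hc.aestronglyMeasurable C
      ((ae_restrict_iff' hK.measurableSet).2 (ae_of_all _ hC))
  have h2 := tendsto_integral_of_tendsto_eLpNorm_two hwm (hg.mono_measure hres)
    (tendsto_of_tendsto_of_tendsto_of_le_of_le tendsto_const_nhds htr (fun _ => zero_le)
      fun n => eLpNorm_mono_measure _ hres)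
  have h3 := h2.const_mul ((Measure.hausdorffMeasure 1 : Measure E).real (T.edge i))⁻¹
  have e : ∀ q : E → ℝ, T.edgeAvg q i =
      ((Measure.hausdorffMeasure 1 : Measure E).real (T.edge i))⁻¹ *
      ∫ x in T.edge i, q x ∂(Measure.hausdorffMeasure 1) := fun q => setAverage_eq _ _ _
  rw [e]
  refine h3.congr fun n => ?_
  rw [← e, edgeAvg_eq_segAvg T _ (hw n).continuous]

/-- Edge averages of functions in `H₀¹` vanish on boundary edges. -/
theorem edgeMean_eq_zero {Ω : Set E} (hΩ : IsOpen Ω) {u : E → ℝ} (h : MemH10 Ω u) {T : Poly}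
    {x₀ : E}
    {r : ℝ} (hT : T.StarAbout x₀ r) (hTΩ : interior T.carrier ⊆ Ω) {i : Fin T.N}
    (hi : T.edge i ⊆ frontier Ω) :
    edgeMean x₀ (T.tail i) (T.head i) u (fun i => weakPartial Ω i u) = 0 := by
  obtain ⟨hu, w, hw, hlim⟩ := h
  have h1 := hlim.tendsto_edgeMean hu (fun n => (hw n).1) (hT.dblArea_pos i)
    ((hT.tri_subset_interior i).trans hTΩ)
  refine tendsto_nhds_unique h1 (tendsto_const_nhds.congr fun n => ?_)
  rw [segAvg, eq_comm]
  refine intervalIntegral.integral_zero_ae (ae_of_all _ fun s hs => ?_)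
  rw [uIoc_of_le zero_le_one] at hs
  have hmem := hi (Poly.StarAbout.lineMap_mem_edge i (Ioc_subset_Icc_self hs))
  refine image_eq_zero_of_notMem_tsupport fun hx => ?_
  have := (hw n).2.2 hx
  rw [hΩ.frontier_eq] at hmem
  exact hmem.2 this

namespace PolyMesh

variable {Ω : Set E} {M : PolyMesh Ω} {x₀ : Fin M.card → E} {K : ℝ}

theorem edgeMeans_sub_mem_Wh0 (hΩ : IsPolygonalDomain Ω)
    (hM : ∀ t, (M.elem t).Regular (x₀ t) K) {u g : E → ℝ} (hu : HasTrace Ω u g) {ub : M.EdgeFun}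
    (hub : ub ∈ M.Wh)
    (hbd : ∀ t i, (M.elem t).edge i ⊆ frontier Ω → ub t i = (M.elem t).edgeAvg g i) :
    M.edgeMeans x₀ u (fun i => weakPartial Ω i u) - ub ∈ M.Wh0 := by
  refine ⟨fun t i t' i' h => ?_, fun t i h => ?_⟩
  · simp only [Pi.sub_apply]
    rw [edgeMeans_mem_Wh hΩ.1 hΩ.2.2.2.1 hM (hu.1.hasWeakGrad hΩ.1) t i t' i' h, hub t i t' i' h]
  · simp only [Pi.sub_apply]
    rw [hbd t i h, sub_eq_zero]
    exact edgeMean_eq_edgeAvg hu (hM t).star (M.interior_subset_domain hΩ.2.2.2.1 t) h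

theorem edgeMeans_mem_Wh0 (hΩ : IsPolygonalDomain Ω)
    (hM : ∀ t, (M.elem t).Regular (x₀ t) K) {u : E → ℝ} (hu : MemH10 Ω u) :
    M.edgeMeans x₀ u (fun i => weakPartial Ω i u) ∈ M.Wh0 :=
  ⟨edgeMeans_mem_Wh hΩ.1 hΩ.2.2.2.1 hM (hu.1.hasWeakGrad hΩ.1), fun t _ h =>
    edgeMean_eq_zero hΩ.1 hu (hM t).star (M.interior_subset_domain hΩ.2.2.2.1 t) h⟩

end PolyMesh

/-! ### Coefficients -/

theorem exists_bound_of_uniformContinuousOn {F : Type*} [NormedAddCommGroup F] {Ω : Set E}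
    (hb : Bornology.IsBounded Ω) {f : E → F} (hf : UniformContinuousOn f Ω) :
    ∃ A, ∀ x ∈ Ω, ‖f x‖ ≤ A := by
  obtain ⟨δ, hδ, h⟩ := Metric.uniformContinuousOn_iff.1 hf 1 one_pos
  obtain ⟨t, htΩ, htf, ht⟩ := Metric.finite_approx_of_totallyBounded
    (hb.isCompact_closure.totallyBounded.subset subset_closure) δ hδ
  obtain ⟨A, hA⟩ := (htf.image fun x => ‖f x‖).bddAbove
  refine ⟨A + 1, fun x hx => ?_⟩
  obtain ⟨y, hy, hxy⟩ := mem_iUnion₂.1 (ht hx)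
  have h1 := h x hx y (htΩ hy) hxy
  have h2 := hA (mem_image_of_mem _ hy)
  rw [dist_eq_norm] at h1
  have h3 := norm_add_le (f x - f y) (f y)
  rw [sub_add_cancel] at h3
  linarith

/-- The coefficients are bounded by `A`, together with the first derivatives of `α` and `β`. -/
structure CoeffBound (Ω : Set E) (α : E → ℝ) (β : E → E) (c : E → ℝ) (A : ℝ) : Prop where
  one_le : 1 ≤ A
  contDiffOn_α : ContDiffOn ℝ 1 α Ω
  α_le : ∀ x ∈ Ω, |α x| ≤ A
  pderiv_α_le : ∀ i, ∀ x ∈ Ω, |pderiv i α x| ≤ A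
  contDiffOn_β : ∀ j, ContDiffOn ℝ 1 (fun x => β x j) Ω
  β_le : ∀ j, ∀ x ∈ Ω, |β x j| ≤ A
  pderiv_β_le : ∀ j i, ∀ x ∈ Ω, |pderiv i (fun x => β x j) x| ≤ A
  c_meas : AEStronglyMeasurable c (volume.restrict Ω)
  c_le : ∀ᵐ x ∂volume.restrict Ω, |c x| ≤ A

theorem exists_coeffBound {Ω : Set E} (hΩ : IsOpen Ω) (hb : Bornology.IsBounded Ω) {α : E → ℝ}
    {β : E → E} {c : E → ℝ} (hα : IsC1Closure Ω α) (hβ : IsC1Closure Ω β)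
    (hc : MemLp c ⊤ (volume.restrict Ω)) : ∃ A, CoeffBound Ω α β c A := by
  obtain ⟨A₁, h1⟩ := exists_bound_of_uniformContinuousOn hb hα.2.1
  obtain ⟨A₂, h2⟩ := exists_bound_of_uniformContinuousOn hb hα.2.2
  obtain ⟨A₃, h3⟩ := exists_bound_of_uniformContinuousOn hb hβ.2.1
  obtain ⟨A₄, h4⟩ := exists_bound_of_uniformContinuousOn hb hβ.2.2
  have hc' : ∃ A₅ : ℝ, ∀ᵐ x ∂volume.restrict Ω, |c x| ≤ A₅ := by
    refine ⟨(eLpNormEssSup c (volume.restrict Ω)).toReal, ?_⟩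
    have hfin : eLpNormEssSup c (volume.restrict Ω) ≠ ⊤ := by
      rw [← eLpNorm_exponent_top]; exact hc.2.ne
    filter_upwards [ae_le_eLpNormEssSup (f := c) (μ := volume.restrict Ω)] with x hx
    rw [← ENNReal.ofReal_le_ofReal_iff ENNReal.toReal_nonneg, ENNReal.ofReal_toReal hfin]
    rwa [← Real.norm_eq_abs, ofReal_norm]
  obtain ⟨A₅, h5⟩ := hc'
  set A := 1 + |A₁| + |A₂| + |A₃| + |A₄| + |A₅| with hA
  have p1 := abs_nonneg A₁
  have p2 := abs_nonneg A₂
  have p3 := abs_nonneg A₃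
  have p4 := abs_nonneg A₄
  have p5 := abs_nonneg A₅
  have q1 := le_abs_self A₁
  have q2 := le_abs_self A₂
  have q3 := le_abs_self A₃
  have q4 := le_abs_self A₄
  have q5 := le_abs_self A₅
  have hfd : ∀ {F : Type} [NormedAddCommGroup F] [NormedSpace ℝ F] (L : E →L[ℝ] F) (i : Fin 2),
      ‖L (EuclideanSpace.single i 1)‖ ≤ ‖L‖ := fun L i => by
    simpa using L.le_opNorm (EuclideanSpace.single i (1 : ℝ))
  refine ⟨A, by linarith, hα.1, fun x hx => ?_, fun i x hx => ?_, contDiffOn_euclidean.1 hβ.1,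
    fun j x hx => ?_, fun j i x hx => ?_, hc.1, ?_⟩
  · have := h1 x hx
    rw [Real.norm_eq_abs] at this
    linarith
  · have := (hfd (fderiv ℝ α x) i).trans (h2 x hx)
    rw [Real.norm_eq_abs] at this
    rw [pderiv]
    linarith
  · have := (PiLp.norm_apply_le (β x) j).trans (h3 x hx)
    rw [Real.norm_eq_abs] at this
    linarith
  · have hd : DifferentiableAt ℝ β x :=
      (hβ.1.contDiffAt (hΩ.mem_nhds hx)).differentiableAt (by simp)
    have e : pderiv i (fun x => β x j) x = (fderiv ℝ β x (EuclideanSpace.single i 1)) j := by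
      have :=
        ((EuclideanSpace.proj (𝕜 := ℝ) j : E →L[ℝ] ℝ).hasFDerivAt.comp x hd.hasFDerivAt).fderiv
      rw [pderiv]
      change fderiv ℝ (⇑(EuclideanSpace.proj (𝕜 := ℝ) j : E →L[ℝ] ℝ) ∘ β) x _ = _
      rw [this]
      rfl
    rw [e]
    have := ((PiLp.norm_apply_le (fderiv ℝ β x (EuclideanSpace.single i 1)) j).trans
      (hfd (fderiv ℝ β x) i)).trans (h4 x hx)
    rw [Real.norm_eq_abs] at this
    linarith
  · filter_upwards [h5] with x hx
    linarith

namespace CoeffBound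

variable {Ω : Set E} {α : E → ℝ} {β : E → E} {c : E → ℝ} {A : ℝ}

theorem α_meas (h : CoeffBound Ω α β c A) (hΩ : IsOpen Ω) :
    AEStronglyMeasurable α (volume.restrict Ω) :=
  h.contDiffOn_α.continuousOn.aestronglyMeasurable hΩ.measurableSet

theorem β_meas (h : CoeffBound Ω α β c A) (hΩ : IsOpen Ω) (j : Fin 2) :
    AEStronglyMeasurable (fun x => β x j) (volume.restrict Ω) :=
  (h.contDiffOn_β j).continuousOn.aestronglyMeasurable hΩ.measurableSet

theorem ae_α_le (h : CoeffBound Ω α β c A) (hΩ : IsOpen Ω) :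
    ∀ᵐ x ∂volume.restrict Ω, |α x| ≤ A :=
  (ae_restrict_iff' hΩ.measurableSet).2 (ae_of_all _ h.α_le)

theorem ae_β_le (h : CoeffBound Ω α β c A) (hΩ : IsOpen Ω) (j : Fin 2) :
    ∀ᵐ x ∂volume.restrict Ω, |β x j| ≤ A :=
  (ae_restrict_iff' hΩ.measurableSet).2 (ae_of_all _ (h.β_le j))

end CoeffBound

theorem memLp_ae_bdd_mul {μ : Measure E} {a W : E → ℝ} {A : ℝ} (ha : AEStronglyMeasurable a μ)
    (hA : ∀ᵐ x ∂μ, |a x| ≤ A) (hW : MemLp W 2 μ) : MemLp (fun x => a x * W x) 2 μ :=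
  hW.of_le_mul (c := A) (ha.mul hW.1) (by
    filter_upwards [hA] with x hx
    rw [norm_mul]
    exact mul_le_mul_of_nonneg_right hx (norm_nonneg _))

/-! ### Equations in divergence form -/

theorem HasWeakGrad.add {Ω : Set E} (hΩ : IsOpen Ω) (hb : Bornology.IsBounded Ω) {W V : E → ℝ}
    {D F : Fin 2 → E → ℝ} (h : HasWeakGrad Ω W D) (h' : HasWeakGrad Ω V F) :
    HasWeakGrad Ω (fun x => W x + V x) (fun i x => D i x + F i x) := by
  have := h.sub hΩ (h'.affine_mul hΩ hb (AffineMap.const ℝ E (-1)))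
  simpa using this

/-- The equation `-∑ᵢ ∂ᵢ Wᵢ + R = f` in `Ω`, in weak form. -/
def DivForm (Ω : Set E) (W : Fin 2 → E → ℝ) (R f : E → ℝ) : Prop :=
  ∀ φ : E → ℝ, IsTest Ω φ →
    ∫ x in Ω, (∑ i, W i x * pderiv i φ x + R x * φ x) = ∫ x in Ω, f x * φ x

theorem IsTest.memLp {Ω : Set E} (hb : Bornology.IsBounded Ω) {φ : E → ℝ} (h : IsTest Ω φ) :
    MemLp φ 2 (volume.restrict Ω) ∧ ∀ i, MemLp (pderiv i φ) 2 (volume.restrict Ω) := by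
  have := HasWeakGrad.of_contDiff hb (h.1.of_le (n := ∞) (m := 1) (by exact_mod_cast le_top))
  exact ⟨this.memLp, this.memLp_grad⟩

/-- An equation in divergence form holds almost everywhere when the fluxes are weakly
differentiable. -/
theorem DivForm.ae_eq {Ω : Set E} (hΩ : IsOpen Ω) (hb : Bornology.IsBounded Ω)
    {W : Fin 2 → E → ℝ} {R f : E → ℝ} (h : DivForm Ω W R f) {D : Fin 2 → Fin 2 → E → ℝ}
    (hW : ∀ i, HasWeakGrad Ω (W i) (D i)) (hR : MemLp R 2 (volume.restrict Ω))
    (hf : MemLp f 2 (volume.restrict Ω)) :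
    f =ᵐ[volume.restrict Ω] fun x => R x - ∑ i, D i i x := by
  have hD : MemLp (fun x => ∑ i, D i i x) 2 (volume.restrict Ω) :=
    memLp_finsetSum _ fun i _ => (hW i).memLp_grad i
  have hF : MemLp (fun x => f x - (R x - ∑ i, D i i x)) 2 (volume.restrict Ω) := hf.sub (hR.sub hD)
  have hfin : IsFiniteMeasure ((volume : Measure E).restrict Ω) :=
    ⟨by simpa using hb.measure_lt_top⟩
  have hloc : LocallyIntegrableOn (fun x => f x - (R x - ∑ i, D i i x)) Ω volume :=
    IntegrableOn.locallyIntegrableOn (hF.integrable (by norm_num))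
  -- the difference of both sides annihilates all test functions
  have := hΩ.ae_eq_zero_of_integral_contDiff_smul_eq_zero hloc fun φ h1 h2 h3 => by
    have hφ : IsTest Ω φ := ⟨h1, h2, h3⟩
    obtain ⟨m1, m2⟩ := hφ.memLp hb
    have e := h φ hφ
    have eW := fun i => (hW i).integral_mul_pderiv hΩ hφ i
    have iW : ∀ i, Integrable (fun x => W i x * pderiv i φ x) (volume.restrict Ω) := fun i =>
      (hW i).memLp.integrable_mul (m2 i)
    have iD : ∀ i, Integrable (fun x => D i i x * φ x) (volume.restrict Ω) := fun i =>
      ((hW i).memLp_grad i).integrable_mul m1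
    have iR : Integrable (fun x => R x * φ x) (volume.restrict Ω) := hR.integrable_mul m1
    have i_f : Integrable (fun x => f x * φ x) (volume.restrict Ω) := hf.integrable_mul m1
    rw [integral_add (integrable_finsetSum _ fun i _ => iW i) iR,
      integral_finsetSum _ fun i _ => iW i] at e
    have e2 : ∫ x, φ x • (f x - (R x - ∑ i, D i i x))
        = ∫ x in Ω, φ x • (f x - (R x - ∑ i, D i i x)) := by
      refine (setIntegral_eq_integral_of_forall_compl_eq_zero fun x hx => ?_).symm
      rw [image_eq_zero_of_notMem_tsupport fun h => hx (h3 h), zero_smul]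
    have e3 : ∀ x, φ x • (f x - (R x - ∑ i, D i i x))
        = f x * φ x - (R x * φ x - ∑ i, D i i x * φ x) := fun x => by
      rw [← Finset.sum_mul, smul_eq_mul]; ring
    have iS : Integrable (fun x => ∑ i, D i i x * φ x) (volume.restrict Ω) :=
      integrable_finsetSum _ fun i _ => iD i
    have iRS : Integrable (fun x => R x * φ x - ∑ i, D i i x * φ x) (volume.restrict Ω) := iR.sub iS
    rw [e2]
    simp only [e3]
    rw [integral_sub i_f iRS, integral_sub iR iS, integral_finsetSum _ fun i _ => iD i, ← e]
    simp only [eW, Finset.sum_neg_distrib]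
    ring
  rw [EventuallyEq, ae_restrict_iff' hΩ.measurableSet]
  filter_upwards [this] with x hx hxΩ
  linarith [hx hxΩ]

/-- Functions in `H₀¹(Ω)` may be used as test functions. -/
theorem DivForm.of_memH10 {Ω : Set E} (hb : Bornology.IsBounded Ω)
    {W : Fin 2 → E → ℝ} {R f : E → ℝ} (h : DivForm Ω W R f)
    (hW : ∀ i, MemLp (W i) 2 (volume.restrict Ω)) (hR : MemLp R 2 (volume.restrict Ω))
    (hf : MemLp f 2 (volume.restrict Ω)) {Φ : E → ℝ} (hΦ : MemH10 Ω Φ) :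
    ∑ i, (∫ x in Ω, W i x * weakPartial Ω i Φ x) + ∫ x in Ω, R x * Φ x = ∫ x in Ω, f x * Φ x := by
  obtain ⟨hΦ1, w, hw, hlim, hlim'⟩ := hΦ
  have hwm := fun n => (hw n).memLp hb
  have hcomm : ∀ F G : E → ℝ, ∫ x in Ω, F x * G x = ∫ x in Ω, G x * F x := fun F G => by
    simp only [mul_comm]
  have t1 : ∀ F : E → ℝ, MemLp F 2 (volume.restrict Ω) →
      Tendsto (fun n => ∫ x in Ω, F x * w n x) atTop (𝓝 (∫ x in Ω, F x * Φ x)) := fun F hF => by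
    simp only [hcomm F]
    exact tendsto_integral_mul_const (fun n => (hwm n).1) hΦ1.1 hF hlim
  have t2 : ∀ i, ∀ F : E → ℝ, MemLp F 2 (volume.restrict Ω) →
      Tendsto (fun n => ∫ x in Ω, F x * pderiv i (w n) x) atTop
        (𝓝 (∫ x in Ω, F x * weakPartial Ω i Φ x)) := fun i F hF => by
    simp only [hcomm F]
    exact tendsto_integral_mul_const (fun n => (hwm n).2 i) (hΦ1.isWeakPartial i).1 hF (hlim' i)
  refine tendsto_nhds_unique ((tendsto_finsetSum _ fun i _ => t2 i _ (hW i)).add (t1 R hR))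
    ((t1 f hf).congr fun n => ?_)
  have iW : ∀ i, Integrable (fun x => W i x * pderiv i (w n) x) (volume.restrict Ω) := fun i =>
    (hW i).integrable_mul ((hwm n).2 i)
  have iR : Integrable (fun x => R x * w n x) (volume.restrict Ω) := hR.integrable_mul (hwm n).1
  rw [← h _ (hw n), integral_add (integrable_finsetSum _ fun i _ => iW i) iR,
    integral_finsetSum _ fun i _ => iW i]

theorem SolvesPDE.divForm {Ω : Set E} {α : E → ℝ} {β : E → E} {c f u : E → ℝ}
    (h : SolvesPDE Ω α β c f u) :
    DivForm Ω (fun i x => α x * weakPartial Ω i u x)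
      (fun x => ∑ i, β x i * weakPartial Ω i u x + c x * u x) f := fun φ hφ => by
  rw [← h φ hφ]
  refine integral_congr_ae (ae_of_all _ fun x => ?_)
  simp only [Fin.sum_univ_two]
  ring

theorem SolvesAdjoint.divForm {Ω : Set E} {α : E → ℝ} {β : E → E} {c χ Φ : E → ℝ}
    (h : SolvesAdjoint Ω α β c χ Φ) :
    DivForm Ω (fun i x => α x * weakPartial Ω i Φ x + β x i * Φ x) (fun x => c x * Φ x) χ :=
  fun φ hφ => by
    rw [← h φ hφ]
    refine integral_congr_ae (ae_of_all _ fun x => ?_)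
    simp only [Fin.sum_univ_two]
    ring

/-! ### The duality argument in Hilbert space -/

/-- A nonconforming discretization of a convection-diffusion-reaction form: discrete functions `V`
with a discrete gradient `G`, a reconstruction `σ`, a residual `τ` (for the stabilizer), and the
operators of multiplication by the coefficients. -/
structure Discretization (H H' V : Type*) [NormedAddCommGroup H] [InnerProductSpace ℝ H]
    [NormedAddCommGroup H'] [InnerProductSpace ℝ H'] [AddCommGroup V] [Module ℝ V] where
  /-- the stabilization parameter -/
  κ : ℝ
  /-- the diffusion coefficient -/
  a : H →ₗ[ℝ] H
  /-- the convection field -/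
  b : Fin 2 → H →ₗ[ℝ] H
  /-- the reaction coefficient -/
  c : H →ₗ[ℝ] H
  /-- the discrete gradient -/
  G : Fin 2 → V →ₗ[ℝ] H
  /-- the reconstruction in `H` -/
  σ : V →ₗ[ℝ] H
  /-- the residual, whose norm is the stabilizer -/
  τ : V →ₗ[ℝ] H'

namespace Discretization

variable {H H' V : Type*} [NormedAddCommGroup H] [InnerProductSpace ℝ H]
    [NormedAddCommGroup H'] [InnerProductSpace ℝ H'] [AddCommGroup V] [Module ℝ V]
    (S : Discretization H H' V)

/-- The continuous form, for functions `u`, `w` with gradients `d`, `k`. -/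
def cform (u : H) (d : Fin 2 → H) (w : H) (k : Fin 2 → H) : ℝ :=
  ∑ i, inner ℝ (S.a (d i)) (k i) + ∑ i, inner ℝ (S.b i (d i)) w + inner ℝ (S.c u) w

/-- The discrete form. -/
def form (v w : V) : ℝ :=
  S.κ * inner ℝ (S.τ v) (S.τ w) + S.cform (S.σ v) (fun i => S.G i v) (S.σ w) (fun i => S.G i w)

/-- The discrete energy norm. -/
def energy (v : V) : ℝ := ∑ i, ‖S.G i v‖ + ‖S.τ v‖

/-- Upper bounds `L` for the coefficients and lower bounds `μ` for diffusion and stabilization. -/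
structure Bounded (L μ : ℝ) : Prop where
  one_le : 1 ≤ L
  μ_pos : 0 < μ
  μ_le : μ ≤ S.κ
  κ_le : S.κ ≤ L
  a_le : ∀ x, ‖S.a x‖ ≤ L * ‖x‖
  b_le : ∀ i x, ‖S.b i x‖ ≤ L * ‖x‖
  c_le : ∀ x, ‖S.c x‖ ≤ L * ‖x‖
  coercive : ∀ x, μ * ‖x‖ ^ 2 ≤ inner ℝ (S.a x) x

/-- The discrete function `q` approximates `u` with gradient `d`, where `U` is the size of `u`. -/
structure Approx (L h U : ℝ) (q : V) (u : H) (d : Fin 2 → H) : Prop where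
  u_le : ‖u‖ ≤ U
  d_le : ∀ i, ‖d i‖ ≤ U
  σ_sub_le : ‖S.σ q - u‖ ≤ L * h ^ 2 * U
  G_sub_le : ∀ i, ‖S.G i q - d i‖ ≤ L * h * U
  τ_le : ‖S.τ q‖ ≤ L * h * U

variable {S} {L μ h U : ℝ} {q ub : V} {u f : H} {d : Fin 2 → H}

theorem energy_nonneg (v : V) : 0 ≤ S.energy v :=
  add_nonneg (Finset.sum_nonneg fun _ _ => norm_nonneg _) (norm_nonneg _)

theorem abs_inner_le {x y z : H} {X Y : ℝ} (hx : ‖x‖ ≤ L * ‖z‖) (hz : ‖z‖ ≤ X) (hy : ‖y‖ ≤ Y)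
    (hL : 0 ≤ L) : |inner ℝ x y| ≤ L * X * Y :=
  (abs_real_inner_le_norm _ _).trans (mul_le_mul (hx.trans (mul_le_mul_of_nonneg_left hz hL)) hy
    (norm_nonneg _) (mul_nonneg hL ((norm_nonneg _).trans hz)))

theorem form_sub (v w z : V) : S.form (v - w) z = S.form v z - S.form w z := by
  simp only [form, cform, map_sub, inner_sub_left, Finset.sum_sub_distrib]
  ring

/-- The energy estimate: the error in the energy norm is of first order, up to the error of the
reconstruction, since no coercivity is assumed for the lower order terms. -/
theorem energy_le (hS : S.Bounded L μ) (h0 : 0 < h) (h1 : h ≤ 1) (hq : S.Approx L h U q u d)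
    (hsch : S.form ub (q - ub) = inner ℝ f (S.σ (q - ub)))
    (hcons : |inner ℝ f (S.σ (q - ub)) - S.cform u d (S.σ (q - ub)) (fun i => S.G i (q - ub))|
      ≤ L * h * U * S.energy (q - ub)) :
    S.energy (q - ub) ≤ (1 + 18 * L ^ 2 / μ) * (h * U + ‖S.σ (q - ub)‖) := by
  have hL := hS.one_le
  have hμ := hS.μ_pos
  have hU : 0 ≤ U := (norm_nonneg _).trans hq.u_le
  set e := q - ub with he
  have hN0 := S.energy_nonneg e
  set N := S.energy e with hN
  set s := ‖S.σ e‖ with hs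
  have hs0 : 0 ≤ s := norm_nonneg _
  have hg : ∀ i, 0 ≤ ‖S.G i e‖ := fun i => norm_nonneg _
  have ht : 0 ≤ ‖S.τ e‖ := norm_nonneg _
  have hNe : N = ‖S.G 0 e‖ + ‖S.G 1 e‖ + ‖S.τ e‖ := by rw [hN, energy, Fin.sum_univ_two]
  have hL0 : 0 ≤ L := by linarith
  -- the residual
  have hres : S.form e e ≤ 3 * L ^ 2 * (h * U) * (N + s) := by
    have e1 : S.form e e = S.form q e - inner ℝ f (S.σ e) := by
      rw [← hsch, ← form_sub]
    have e2 : S.form q e - S.cform u d (S.σ e) (fun i => S.G i e)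
        = S.κ * inner ℝ (S.τ q) (S.τ e) + (∑ i, inner ℝ (S.a (S.G i q - d i)) (S.G i e)
          + ∑ i, inner ℝ (S.b i (S.G i q - d i)) (S.σ e) + inner ℝ (S.c (S.σ q - u)) (S.σ e)) := by
      simp only [form, cform, map_sub, inner_sub_left, Finset.sum_sub_distrib]
      ring
    have b1 : S.κ * inner ℝ (S.τ q) (S.τ e) ≤ L * (L * h * U * ‖S.τ e‖) := by
      have := (real_inner_le_norm (S.τ q) (S.τ e)).trans
        (mul_le_mul_of_nonneg_right hq.τ_le (norm_nonneg _))
      calc _ ≤ S.κ * (L * h * U * ‖S.τ e‖) :=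
            mul_le_mul_of_nonneg_left this (hμ.le.trans hS.μ_le)
        _ ≤ _ := mul_le_mul_of_nonneg_right hS.κ_le (by positivity)
    have b2 : ∀ i, inner ℝ (S.a (S.G i q - d i)) (S.G i e) ≤ L * (L * h * U) * ‖S.G i e‖ :=
      fun i => (le_abs_self _).trans (abs_inner_le (hS.a_le _) (hq.G_sub_le i) le_rfl hL0)
    have b3 : ∀ i, inner ℝ (S.b i (S.G i q - d i)) (S.σ e) ≤ L * (L * h * U) * s :=
      fun i => (le_abs_self _).trans (abs_inner_le (hS.b_le _ _) (hq.G_sub_le i) le_rfl hL0)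
    have b4 : inner ℝ (S.c (S.σ q - u)) (S.σ e) ≤ L * (L * h ^ 2 * U) * s :=
      (le_abs_self _).trans (abs_inner_le (hS.c_le _) hq.σ_sub_le le_rfl hL0)
    have b5 : L * (L * h ^ 2 * U) * s ≤ L ^ 2 * (h * U) * s := by
      have : h ^ 2 ≤ h := by nlinarith
      calc L * (L * h ^ 2 * U) * s ≤ L * (L * h * U) * s := by gcongr
        _ = _ := by ring
    have b6 : L * h * U * N ≤ L ^ 2 * (h * U) * N := by
      have : L ≤ L ^ 2 := by nlinarith
      calc L * h * U * N = L * (h * U) * N := by ring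
        _ ≤ _ := by gcongr
    have := (abs_le.1 hcons).1
    simp only [Fin.sum_univ_two] at e2
    have c0 := b2 0
    have c1 := b2 1
    have c2 := b3 0
    have c3 := b3 1
    have hp : 0 ≤ L ^ 2 * (h * U) * N := by positivity
    calc S.form e e = (S.form q e - S.cform u d (S.σ e) fun i => S.G i e)
          - (inner ℝ f (S.σ e) - S.cform u d (S.σ e) fun i => S.G i e) := by rw [e1]; ring
      _ ≤ (L ^ 2 * (h * U) * N + 3 * L ^ 2 * (h * U) * s) + L ^ 2 * (h * U) * N := by
          have : L ^ 2 * (h * U) * N = L * (L * h * U * ‖S.τ e‖) + L * (L * h * U) * ‖S.G 0 e‖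
            + L * (L * h * U) * ‖S.G 1 e‖ := by rw [hNe]; ring
          have : L * (L * h * U) * s = L ^ 2 * (h * U) * s := by ring
          rw [e2]
          linarith
      _ ≤ _ := by linarith
  -- the lower bound
  have hlow : μ / 3 * N ^ 2 - L * N * s - L * s ^ 2 ≤ S.form e e := by
    have b1 : μ * ‖S.τ e‖ ^ 2 ≤ S.κ * inner ℝ (S.τ e) (S.τ e) := by
      rw [real_inner_self_eq_norm_sq]
      exact mul_le_mul_of_nonneg_right hS.μ_le (sq_nonneg _)
    have b2 := fun i => hS.coercive (S.G i e)
    have b3 : ∀ i, -(L * ‖S.G i e‖ * s) ≤ inner ℝ (S.b i (S.G i e)) (S.σ e) := fun i =>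
      (abs_le.1 (abs_inner_le (hS.b_le i _) le_rfl le_rfl hL0)).1
    have b4 : -(L * s * s) ≤ inner ℝ (S.c (S.σ e)) (S.σ e) :=
      (abs_le.1 (abs_inner_le (hS.c_le _) le_rfl le_rfl hL0)).1
    have hN2 : N ^ 2 ≤ 3 * (‖S.G 0 e‖ ^ 2 + ‖S.G 1 e‖ ^ 2 + ‖S.τ e‖ ^ 2) := by
      rw [hNe]
      nlinarith [sq_nonneg (‖S.G 0 e‖ - ‖S.G 1 e‖), sq_nonneg (‖S.G 0 e‖ - ‖S.τ e‖),
        sq_nonneg (‖S.G 1 e‖ - ‖S.τ e‖)]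
    have b5 : μ / 3 * N ^ 2 ≤ μ * (‖S.G 0 e‖ ^ 2 + ‖S.G 1 e‖ ^ 2 + ‖S.τ e‖ ^ 2) := by
      nlinarith
    have b6 : L * ‖S.G 0 e‖ * s + L * ‖S.G 1 e‖ * s ≤ L * N * s := by
      rw [hNe]
      have : 0 ≤ L * ‖S.τ e‖ * s := by positivity
      linarith
    have c0 := b2 0
    have c1 := b2 1
    have c2 := b3 0
    have c3 := b3 1
    simp only [form, cform, Fin.sum_univ_two]
    have c4 : L * s ^ 2 = L * s * s := by ring
    linarith
  -- it remains to solve a quadratic inequality for `N`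
  set X := h * U + s with hX
  have hX0 : 0 ≤ X := by positivity
  have hLL : L ≤ L ^ 2 := by nlinarith
  have hsX : s ≤ X := by
    have : 0 ≤ h * U := by positivity
    linarith
  have hkey : μ / 3 * N ^ 2 ≤ 3 * L ^ 2 * ((N + X) * X) := by
    have p1 : L * N * s + L * s ^ 2 ≤ L ^ 2 * (N + s) * s := by
      calc L * N * s + L * s ^ 2 = L * ((N + s) * s) := by ring
        _ ≤ L ^ 2 * ((N + s) * s) := by gcongr
        _ = _ := by ring
    have p2 : 0 ≤ L ^ 2 * (N + s) * s := by positivity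
    calc μ / 3 * N ^ 2 ≤ 3 * L ^ 2 * (h * U) * (N + s) + L ^ 2 * (N + s) * s := by linarith
      _ ≤ 3 * L ^ 2 * ((N + s) * X) := by rw [hX]; linarith
      _ ≤ _ := by gcongr
  rcases le_total N X with hNX | hNX
  · have : 0 ≤ 18 * L ^ 2 / μ * X := by positivity
    linarith
  · have h2 : μ / 3 * N ^ 2 ≤ 6 * L ^ 2 * (N * X) := by
      calc _ ≤ 3 * L ^ 2 * ((N + X) * X) := hkey
        _ ≤ 3 * L ^ 2 * ((N + N) * X) := by gcongr
        _ = _ := by ring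
    rcases hN0.eq_or_lt with hz | hpos
    · rw [← hz]; positivity
    · have h3 : N * (μ * N) ≤ N * (18 * L ^ 2 * X) := by linarith
      have h4 := le_of_mul_le_mul_left h3 hpos
      have h5 : N ≤ 18 * L ^ 2 / μ * X := by
        rw [div_mul_eq_mul_div, le_div_iff₀ hμ]; linarith
      linarith

set_option maxHeartbeats 1000000 in
/-- The duality argument: the dual problem with the reconstruction of the error as right-hand side
gains one order, and the factor `h` in front of the error is absorbed. -/
theorem error_le (hS : S.Bounded L μ) (h0 : 0 < h) (hq : S.Approx L h U q u d)
    (hh : 50 * L ^ 4 * (1 + 18 * L ^ 2 / μ) * h ≤ 1) (hf : ‖f‖ ≤ L * U)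
    (hsch : S.form ub (q - ub) = inner ℝ f (S.σ (q - ub)))
    (hcons : |inner ℝ f (S.σ (q - ub)) - S.cform u d (S.σ (q - ub)) (fun i => S.G i (q - ub))|
      ≤ L * h * U * S.energy (q - ub))
    {P : ℝ} {qΦ : V} {Φ : H} {k : Fin 2 → H} (hqΦ : S.Approx L h P qΦ Φ k)
    (hschΦ : S.form ub qΦ = inner ℝ f (S.σ qΦ)) (hP : P ≤ L * ‖S.σ (q - ub)‖)
    (hcons' : |inner ℝ (S.σ (q - ub)) (S.σ (q - ub))
        - S.cform (S.σ (q - ub)) (fun i => S.G i (q - ub)) Φ k| ≤ L * h * P * S.energy (q - ub))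
    (hweak : S.cform u d Φ k = inner ℝ f Φ)
    (ha : ∀ i, |inner ℝ (S.a (S.G i q - d i)) (k i)| ≤ L * h ^ 2 * U * P)
    (hb : ∀ i, |inner ℝ (S.b i (S.G i q - d i)) Φ| ≤ L * h ^ 2 * U * P)
    (ha' : ∀ i, |inner ℝ (S.a (d i)) (S.G i qΦ - k i)| ≤ L * h ^ 2 * U * P) :
    ‖S.σ ub - u‖ ≤ 51 * L ^ 4 * (1 + 18 * L ^ 2 / μ) * h ^ 2 * U := by
  have hL := hS.one_le
  have hL0 : 0 ≤ L := by linarith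
  have hμ := hS.μ_pos
  have hU : 0 ≤ U := (norm_nonneg _).trans hq.u_le
  have hP0 : 0 ≤ P := (norm_nonneg _).trans hqΦ.u_le
  set L₁ := 1 + 18 * L ^ 2 / μ with hL₁
  have hL₁1 : 1 ≤ L₁ := by
    have : 0 ≤ 18 * L ^ 2 / μ := by positivity
    linarith
  have hL4 : 1 ≤ L ^ 4 := one_le_pow₀ hL
  have h1 : h ≤ 1 := by
    have : 1 ≤ L ^ 4 * L₁ := one_le_mul_of_one_le_of_one_le hL4 hL₁1
    nlinarith
  have hN := energy_le hS h0 h1 hq hsch hcons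
  set e := q - ub with he
  have hN0 := S.energy_nonneg e
  set N := S.energy e with hNdef
  set s := ‖S.σ e‖ with hs
  have hs0 : 0 ≤ s := norm_nonneg _
  have hNe : N = ‖S.G 0 e‖ + ‖S.G 1 e‖ + ‖S.τ e‖ := by rw [hNdef, energy, Fin.sum_univ_two]
  have hhh : h ^ 2 ≤ h := by nlinarith
  have hκ0 : 0 ≤ S.κ := hμ.le.trans hS.μ_le
  have hτ : ∀ (x y : H') (X Y : ℝ), ‖x‖ ≤ X → ‖y‖ ≤ Y → |S.κ * inner ℝ x y| ≤ L * X * Y := by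
    intro x y X Y hx hy
    rw [abs_mul, abs_of_nonneg hκ0, mul_assoc]
    exact mul_le_mul hS.κ_le ((abs_real_inner_le_norm _ _).trans
      (mul_le_mul hx hy (norm_nonneg _) ((norm_nonneg _).trans hx))) (abs_nonneg _) hL0
  -- the dual problem tested with the error
  have hdual : s ^ 2 ≤ S.form e qΦ + 4 * L ^ 2 * h * P * (N + s) := by
    have e1 : s ^ 2 - S.form e qΦ
        = (inner ℝ (S.σ e) (S.σ e) - S.cform (S.σ e) (fun i => S.G i e) Φ k)
          - (S.κ * inner ℝ (S.τ e) (S.τ qΦ) + (inner ℝ (S.a (S.G 0 e)) (S.G 0 qΦ - k 0)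
            + inner ℝ (S.a (S.G 1 e)) (S.G 1 qΦ - k 1) + inner ℝ (S.b 0 (S.G 0 e)) (S.σ qΦ - Φ)
            + inner ℝ (S.b 1 (S.G 1 e)) (S.σ qΦ - Φ) + inner ℝ (S.c (S.σ e)) (S.σ qΦ - Φ))) := by
      rw [real_inner_self_eq_norm_sq]
      simp only [form, cform, inner_sub_right, Fin.sum_univ_two]
      ring
    have b0 := (abs_le.1 hcons').2
    have b1 := (abs_le.1 (hτ _ _ _ _ (le_refl ‖S.τ e‖) hqΦ.τ_le)).1
    have b2 := fun i => (abs_le.1 (abs_inner_le (hS.a_le (S.G i e)) le_rfl (hqΦ.G_sub_le i) hL0)).1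
    have b3 := fun i => (abs_le.1 (abs_inner_le (hS.b_le i (S.G i e)) le_rfl hqΦ.σ_sub_le hL0)).1
    have b4 := (abs_le.1 (abs_inner_le (hS.c_le (S.σ e)) le_rfl hqΦ.σ_sub_le hL0)).1
    have p1 : ∀ x : ℝ, 0 ≤ x → L * x * (L * h ^ 2 * P) ≤ L ^ 2 * h * P * x := by
      intro x hx
      calc L * x * (L * h ^ 2 * P) ≤ L * x * (L * h * P) := by gcongr
        _ = _ := by ring
    have p2 := p1 _ (norm_nonneg (S.G 0 e))
    have p3 := p1 _ (norm_nonneg (S.G 1 e))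
    have p4 := p1 _ hs0
    have p5 : L * h * P * N ≤ L ^ 2 * h * P * N := by
      have : L ≤ L ^ 2 := by nlinarith
      gcongr
    have c0 := b2 0
    have c1 := b2 1
    have c2 := b3 0
    have c3 := b3 1
    have p6 : L ^ 2 * h * P * N = L * ‖S.τ e‖ * (L * h * P) + L * ‖S.G 0 e‖ * (L * h * P)
        + L * ‖S.G 1 e‖ * (L * h * P) := by rw [hNe]; ring
    have p7 : L ^ 2 * h * P * ‖S.G 0 e‖ + L ^ 2 * h * P * ‖S.G 1 e‖ ≤ L ^ 2 * h * P * N := by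
      rw [hNe]
      have : 0 ≤ L ^ 2 * h * P * ‖S.τ e‖ := by positivity
      linarith
    have p8 : 0 ≤ L ^ 2 * h * P * N := by positivity
    have p9 : 0 ≤ L ^ 2 * h * P * s := by positivity
    linarith
  -- the residual on the interpolant of the dual solution
  have hprim : S.form e qΦ ≤ 17 * L ^ 3 * (h ^ 2 * U * P) := by
    have e1 : S.form e qΦ = S.κ * inner ℝ (S.τ q) (S.τ qΦ)
        + (∑ i, (inner ℝ (S.a (S.G i q - d i)) (S.G i qΦ - k i)
            + inner ℝ (S.a (S.G i q - d i)) (k i)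
            + inner ℝ (S.a (d i)) (S.G i qΦ - k i))
          + ∑ i, (inner ℝ (S.b i (S.G i q - d i)) (S.σ qΦ - Φ) + inner ℝ (S.b i (S.G i q - d i)) Φ
            + inner ℝ (S.b i (d i)) (S.σ qΦ - Φ))
          + (inner ℝ (S.c (S.σ q - u)) (S.σ qΦ - Φ) + inner ℝ (S.c (S.σ q - u)) Φ
            + inner ℝ (S.c u) (S.σ qΦ - Φ))) - inner ℝ f (S.σ qΦ - Φ) := by
      rw [he, form_sub, hschΦ, inner_sub_right f, ← hweak]
      simp only [form, cform, map_sub, inner_sub_left, inner_sub_right, Fin.sum_univ_two]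
      ring
    -- each of these terms is of second order, and those with a gradient error of first order only are
    -- covered by the hypotheses `ha`, `hb`, `ha'`
    set Y := h ^ 2 * U * P with hY
    have hY0 : 0 ≤ Y := by positivity
    have hL13 : L * Y ≤ L ^ 3 * Y :=
      mul_le_mul_of_nonneg_right (le_self_pow₀ hL (by norm_num)) hY0
    have hL23 : L ^ 2 * Y ≤ L ^ 3 * Y :=
      mul_le_mul_of_nonneg_right (pow_le_pow_right₀ hL (by norm_num)) hY0
    have hh3 : ∀ m : ℕ, 2 ≤ m → L ^ 3 * (h ^ m * U * P) ≤ L ^ 3 * Y := fun m hm => by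
      have : h ^ m ≤ h ^ 2 := pow_le_pow_of_le_one h0.le h1 hm
      rw [hY]; gcongr
    have t0 : S.κ * inner ℝ (S.τ q) (S.τ qΦ) ≤ L ^ 3 * Y := by
      refine ((abs_le.1 (hτ _ _ _ _ hq.τ_le hqΦ.τ_le)).2).trans (le_of_eq ?_)
      rw [hY]; ring
    have t1 : ∀ i, inner ℝ (S.a (S.G i q - d i)) (S.G i qΦ - k i) ≤ L ^ 3 * Y := fun i => by
      refine ((abs_le.1 (abs_inner_le (hS.a_le _) (hq.G_sub_le i) (hqΦ.G_sub_le i) hL0)).2).trans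
        (le_of_eq ?_)
      rw [hY]; ring
    have t2 : ∀ i, inner ℝ (S.a (S.G i q - d i)) (k i) ≤ L ^ 3 * Y := fun i =>
      (abs_le.1 (ha i)).2.trans ((le_of_eq (by rw [hY]; ring)).trans hL13)
    have t3 : ∀ i, inner ℝ (S.a (d i)) (S.G i qΦ - k i) ≤ L ^ 3 * Y := fun i =>
      (abs_le.1 (ha' i)).2.trans ((le_of_eq (by rw [hY]; ring)).trans hL13)
    have t4 : ∀ i, inner ℝ (S.b i (S.G i q - d i)) (S.σ qΦ - Φ) ≤ L ^ 3 * Y := fun i => by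
      refine ((abs_le.1 (abs_inner_le (hS.b_le i _) (hq.G_sub_le i) hqΦ.σ_sub_le hL0)).2).trans
        ((le_of_eq ?_).trans (hh3 3 (by norm_num)))
      ring
    have t5 : ∀ i, inner ℝ (S.b i (S.G i q - d i)) Φ ≤ L ^ 3 * Y := fun i =>
      (abs_le.1 (hb i)).2.trans ((le_of_eq (by rw [hY]; ring)).trans hL13)
    have t6 : ∀ i, inner ℝ (S.b i (d i)) (S.σ qΦ - Φ) ≤ L ^ 3 * Y := fun i => by
      refine ((abs_le.1 (abs_inner_le (hS.b_le i _) (hq.d_le i) hqΦ.σ_sub_le hL0)).2).trans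
        ((le_of_eq ?_).trans hL23)
      rw [hY]; ring
    have t7 : inner ℝ (S.c (S.σ q - u)) (S.σ qΦ - Φ) ≤ L ^ 3 * Y := by
      refine ((abs_le.1 (abs_inner_le (hS.c_le _) hq.σ_sub_le hqΦ.σ_sub_le hL0)).2).trans
        ((le_of_eq ?_).trans (hh3 4 (by norm_num)))
      ring
    have t8 : inner ℝ (S.c (S.σ q - u)) Φ ≤ L ^ 3 * Y := by
      refine ((abs_le.1 (abs_inner_le (hS.c_le _) hq.σ_sub_le hqΦ.u_le hL0)).2).trans
        ((le_of_eq ?_).trans hL23)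
      rw [hY]; ring
    have t9 : inner ℝ (S.c u) (S.σ qΦ - Φ) ≤ L ^ 3 * Y := by
      refine ((abs_le.1 (abs_inner_le (hS.c_le _) hq.u_le hqΦ.σ_sub_le hL0)).2).trans
        ((le_of_eq ?_).trans hL23)
      rw [hY]; ring
    have t10 : -inner ℝ f (S.σ qΦ - Φ) ≤ L ^ 3 * Y := by
      rw [← inner_neg_left]
      refine (real_inner_le_norm _ _).trans ?_
      rw [norm_neg]
      calc _ ≤ L * U * (L * h ^ 2 * P) := mul_le_mul hf hqΦ.σ_sub_le (norm_nonneg _) (by positivity)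
        _ = L ^ 2 * Y := by rw [hY]; ring
        _ ≤ _ := hL23
    rw [e1]
    simp only [Fin.sum_univ_two]
    linarith [t1 0, t1 1, t2 0, t2 1, t3 0, t3 1, t4 0, t4 1, t5 0, t5 1, t6 0, t6 1]
  -- the energy estimate is inserted; the remaining multiple `8 L⁴ L₁ h ≤ 1/2` of `s` is absorbed
  have hs2 : s ≤ 50 * L ^ 4 * L₁ * (h ^ 2 * U) := by
    rcases hs0.eq_or_lt with hz | hpos
    · rw [← hz]; positivity
    · have hP1 : s * s ≤ s * (4 * L ^ 3 * h * (N + s) + 17 * L ^ 4 * (h ^ 2 * U)) := by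
        calc s * s = s ^ 2 := by ring
          _ ≤ 17 * L ^ 3 * (h ^ 2 * U * P) + 4 * L ^ 2 * h * P * (N + s) := by linarith
          _ = P * (17 * L ^ 3 * (h ^ 2 * U) + 4 * L ^ 2 * h * (N + s)) := by ring
          _ ≤ L * s * (17 * L ^ 3 * (h ^ 2 * U) + 4 * L ^ 2 * h * (N + s)) := by gcongr
          _ = _ := by ring
      have hP2 := le_of_mul_le_mul_left hP1 hpos
      have hNs : N + s ≤ 2 * L₁ * (h * U + s) := by
        have : s ≤ L₁ * (h * U + s) := by
          have h3 : 0 ≤ h * U := by positivity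
          calc s ≤ 1 * (h * U + s) := by linarith
            _ ≤ _ := mul_le_mul_of_nonneg_right hL₁1 (by positivity)
        linarith
      have h34 : L ^ 3 ≤ L ^ 4 := pow_le_pow_right₀ hL (by norm_num)
      have hX0 : 0 ≤ h * (h * U + s) := by positivity
      have : s ≤ 25 * L ^ 4 * L₁ * (h ^ 2 * U) + 8 * L ^ 4 * L₁ * h * s := by
        calc s ≤ 4 * L ^ 3 * h * (N + s) + 17 * L ^ 4 * (h ^ 2 * U) := hP2
          _ ≤ 4 * L ^ 4 * h * (2 * L₁ * (h * U + s)) + 17 * L ^ 4 * (h ^ 2 * U) * L₁ := by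
              have h4 : 17 * L ^ 4 * (h ^ 2 * U) ≤ 17 * L ^ 4 * (h ^ 2 * U) * L₁ :=
                le_mul_of_one_le_right (by positivity) hL₁1
              gcongr
          _ = _ := by ring
      have h5 : 8 * L ^ 4 * L₁ * h * s ≤ 1 / 2 * s := by
        refine mul_le_mul_of_nonneg_right ?_ hs0
        have : 0 ≤ L ^ 4 * L₁ * h := by positivity
        linarith
      linarith
  have e2 : S.σ ub - u = (S.σ q - u) - S.σ e := by rw [he, map_sub]; abel
  rw [e2]
  have hfin : L * h ^ 2 * U ≤ L ^ 4 * L₁ * (h ^ 2 * U) := by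
    have h6 : L ≤ L ^ 4 := le_self_pow₀ hL (by norm_num)
    have h7 : L ≤ L ^ 4 * L₁ := h6.trans (le_mul_of_one_le_right (by positivity) hL₁1)
    calc L * h ^ 2 * U = L * (h ^ 2 * U) := by ring
      _ ≤ _ := mul_le_mul_of_nonneg_right h7 (by positivity)
  calc _ ≤ ‖S.σ q - u‖ + ‖S.σ e‖ := norm_sub_le _ _
    _ ≤ L ^ 4 * L₁ * (h ^ 2 * U) + 50 * L ^ 4 * L₁ * (h ^ 2 * U) :=
        add_le_add (hq.σ_sub_le.trans hfin) hs2
    _ = _ := by ring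

end Discretization

/-! ### The discretization in `L²` -/

/-- Multiplication by a bounded function, on `L²`. -/
def mulOp {μ : Measure E} {a : E → ℝ} {A : ℝ} (ha : AEStronglyMeasurable a μ)
    (hA : ∀ᵐ x ∂μ, |a x| ≤ A) : Lp ℝ 2 μ →ₗ[ℝ] Lp ℝ 2 μ where
  toFun F := (memLp_ae_bdd_mul ha hA (Lp.memLp F)).toLp _
  map_add' F G := by
    rw [← MemLp.toLp_add]
    refine MemLp.toLp_congr _ _ ?_
    filter_upwards [Lp.coeFn_add F G] with x hx
    simp only [Pi.add_apply, hx]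
    ring
  map_smul' r F := by
    rw [RingHom.id_apply, ← MemLp.toLp_const_smul]
    refine MemLp.toLp_congr _ _ ?_
    filter_upwards [Lp.coeFn_smul r F] with x hx
    simp only [Pi.smul_apply, hx, smul_eq_mul]
    ring

theorem mulOp_toLp {μ : Measure E} {a : E → ℝ} {A : ℝ} (ha : AEStronglyMeasurable a μ)
    (hA : ∀ᵐ x ∂μ, |a x| ≤ A) {F : E → ℝ} (hF : MemLp F 2 μ) :
    mulOp ha hA (hF.toLp F) = (memLp_ae_bdd_mul ha hA hF).toLp _ := by
  refine MemLp.toLp_congr (memLp_ae_bdd_mul ha hA (Lp.memLp _)) _ ?_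
  filter_upwards [hF.coeFn_toLp] with x hx
  rw [hx]

theorem norm_mulOp_le {μ : Measure E} {a : E → ℝ} {A : ℝ} (ha : AEStronglyMeasurable a μ)
    (hA : ∀ᵐ x ∂μ, |a x| ≤ A) (F : Lp ℝ 2 μ) : ‖mulOp ha hA F‖ ≤ A * ‖F‖ := by
  refine Lp.norm_le_mul_norm_of_ae_le_mul ?_
  filter_upwards [(memLp_ae_bdd_mul ha hA (Lp.memLp F)).coeFn_toLp, hA] with x hx hx'
  rw [mulOp, LinearMap.coe_mk, AddHom.coe_mk, hx, norm_mul]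
  exact mul_le_mul_of_nonneg_right hx' (norm_nonneg _)

theorem inner_toLp {μ : Measure E} {F G : E → ℝ} (hF : MemLp F 2 μ) (hG : MemLp G 2 μ) :
    inner ℝ (hF.toLp F) (hG.toLp G) = ∫ x, F x * G x ∂μ := by
  rw [real_inner_comm, ← integral_mul_eq_inner_toLp hF hG]

namespace PolyMesh

variable {Ω : Set E} {M : PolyMesh Ω} {x₀ : Fin M.card → E} {K : ℝ}

/-- The function on the partition that equals `q t` on the element `t`; on the common boundaries of
elements, a null set, the values are added. -/
def glue (M : PolyMesh Ω) (q : Fin M.card → E → ℝ) (x : E) : ℝ :=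
  ∑ t, (M.elem t).carrier.indicator (q t) x

theorem glue_ae_eq (M : PolyMesh Ω) (q : Fin M.card → E → ℝ) (t : Fin M.card) :
    M.glue q =ᵐ[volume.restrict (M.elem t).carrier] q t := by
  rw [← Measure.restrict_congr_set (M.elem t).interior_ae_eq, EventuallyEq,
    ae_restrict_iff' isOpen_interior.measurableSet]
  have : ∀ᵐ x ∂(volume : Measure E), ∀ t', x ∉ frontier (M.elem t').carrier :=
    ae_all_iff.2 fun t' => measure_eq_zero_iff_ae_notMem.1 (M.elem t').volume_frontier
  filter_upwards [this] with x hx hxt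
  rw [glue, Finset.sum_eq_single t, indicator_of_mem (interior_subset hxt)]
  · intro t' _ htt
    refine indicator_of_notMem (fun hmem => ?_) _
    have : x ∈ interior (M.elem t').carrier := by
      by_contra h
      exact hx t' ⟨subset_closure hmem, h⟩
    exact Set.disjoint_left.1 (M.nonoverlapping t' t htt) this hxt
  · simp

theorem memLp_glue (M : PolyMesh Ω) {q : Fin M.card → E → ℝ}
    (hq : ∀ t, MemLp (q t) 2 (volume.restrict (M.elem t).carrier)) :
    MemLp (M.glue q) 2 (volume.restrict Ω) :=
  MemLp.mono_measure Measure.restrict_le_self (memLp_finsetSum _ fun t _ =>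
    (memLp_indicator_iff_restrict (M.elem t).measurableSet_carrier).2 (hq t))

theorem glue_add (M : PolyMesh Ω) {q q' q'' : Fin M.card → E → ℝ}
    (h : ∀ t, ∀ x ∈ (M.elem t).carrier, q t x = q' t x + q'' t x) :
    M.glue q = M.glue q' + M.glue q'' := by
  ext x
  simp only [glue, Pi.add_apply, ← Finset.sum_add_distrib]
  refine Finset.sum_congr rfl fun t _ => ?_
  by_cases hx : x ∈ (M.elem t).carrier
  · simp [hx, h t x hx]
  · simp [hx]

theorem glue_smul (M : PolyMesh Ω) {q q' : Fin M.card → E → ℝ} (r : ℝ)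
    (h : ∀ t, ∀ x ∈ (M.elem t).carrier, q t x = r * q' t x) :
    M.glue q = r • M.glue q' := by
  ext x
  simp only [glue, Pi.smul_apply, smul_eq_mul, Finset.mul_sum]
  refine Finset.sum_congr rfl fun t _ => ?_
  by_cases hx : x ∈ (M.elem t).carrier
  · simp [hx, h t x hx]
  · simp [hx]

theorem memLp_grad (M : PolyMesh Ω) (i : Fin 2) (v : M.EdgeFun) :
    MemLp (M.glue fun t _ => (M.elem t).weakGrad (v t) i) 2 (volume.restrict Ω) :=
  M.memLp_glue fun _ => Poly.Regular.memLp_const _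

theorem memLp_ext (M : PolyMesh Ω) (v : M.EdgeFun) :
    MemLp (M.glue fun t => (M.elem t).ext (v t)) 2 (volume.restrict Ω) :=
  M.memLp_glue fun t => (M.elem t).memLp_affine _

/-- The piecewise constant weak gradient. -/
def gradOp (M : PolyMesh Ω) (i : Fin 2) : M.EdgeFun →ₗ[ℝ] Lp ℝ 2 (volume.restrict Ω) where
  toFun v := (M.memLp_grad i v).toLp _
  map_add' v w := by
    rw [← MemLp.toLp_add]
    refine MemLp.toLp_congr _ _ (Eq.eventuallyEq (M.glue_add fun t x _ => ?_))
    simp [Poly.weakGrad, add_mul, add_smul, Finset.sum_add_distrib]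
  map_smul' r v := by
    rw [RingHom.id_apply, ← MemLp.toLp_const_smul]
    refine MemLp.toLp_congr _ _ (Eq.eventuallyEq (M.glue_smul r fun t x _ => ?_))
    simp only [Poly.weakGrad, PiLp.smul_apply, smul_eq_mul, WithLp.ofLp_sum,
      Finset.sum_apply, Pi.smul_apply, WithLp.ofLp_smul, Finset.mul_sum]
    exact Finset.sum_congr rfl fun i _ => by ring

/-- The piecewise affine extension. -/
def extOp (hM : ∀ t, (M.elem t).Regular (x₀ t) K) :
    M.EdgeFun →ₗ[ℝ] Lp ℝ 2 (volume.restrict Ω) where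
  toFun v := (M.memLp_ext v).toLp _
  map_add' v w := by
    rw [← MemLp.toLp_add]
    exact MemLp.toLp_congr _ _ (Eq.eventuallyEq (M.glue_add fun t x hx => (hM t).ext_add _ _ hx))
  map_smul' r v := by
    rw [RingHom.id_apply, ← MemLp.toLp_const_smul]
    exact MemLp.toLp_congr _ _ (Eq.eventuallyEq
      (M.glue_smul r fun t x hx => (hM t).ext_smul _ _ hx))

/-- The distance of the edge values to their affine extensions at the midpoints, with the weights
of the stabilizer. -/
def residualOp (hM : ∀ t, (M.elem t).Regular (x₀ t) K) :
    M.EdgeFun →ₗ[ℝ] EuclideanSpace ℝ (Σ t, Fin (M.elem t).N) where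
  toFun v := WithLp.toLp 2 fun a => √(M.meshSize⁻¹ * (M.elem a.1).len a.2) *
    ((M.elem a.1).ext (v a.1) ((M.elem a.1).mid a.2) - v a.1 a.2)
  map_add' v w := by
    ext a
    have := (hM a.1).ext_add (v a.1) (w a.1) (Poly.mid_mem a.2)
    simp only [Pi.add_apply, this, PiLp.add_apply]
    ring
  map_smul' r v := by
    ext a
    have := (hM a.1).ext_smul r (v a.1) (Poly.mid_mem a.2)
    simp only [Pi.smul_apply, this, PiLp.smul_apply, smul_eq_mul, RingHom.id_apply]
    ring

theorem inner_residualOp (hM : ∀ t, (M.elem t).Regular (x₀ t) K) (h0 : 0 ≤ M.meshSize)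
    (v w : M.EdgeFun) : inner ℝ (residualOp hM v) (residualOp hM w) = M.stab v w := by
  rw [PiLp.inner_apply, Fintype.sum_sigma, stab]
  refine Finset.sum_congr rfl fun t _ => ?_
  rw [Finset.mul_sum]
  refine Finset.sum_congr rfl fun i _ => ?_
  have hs := Real.mul_self_sqrt (mul_nonneg (inv_nonneg.2 h0) ((M.elem t).len_pos i).le)
  simp only [residualOp, LinearMap.coe_mk, AddHom.coe_mk, RCLike.inner_apply, conj_trivial]
  linear_combination ((M.elem t).ext (v t) ((M.elem t).mid i) - v t i) *
      ((M.elem t).ext (w t) ((M.elem t).mid i) - w t i) * hs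

/-- Integrals of products over the domain, element by element. -/
theorem setIntegral_mul_eq_sum (hΩ : IsPolygonalDomain Ω) (M : PolyMesh Ω) {F G : E → ℝ}
    (hF : MemLp F 2 (volume.restrict Ω)) (hG : MemLp G 2 (volume.restrict Ω)) :
    ∫ x in Ω, F x * G x = ∑ t, ∫ x in (M.elem t).carrier, F x * G x :=
  M.setIntegral_eq_sum hΩ (hF.integrable_mul hG)

variable {α : E → ℝ} {β : E → E} {c : E → ℝ} {A : ℝ}

/-- The simplified weak Galerkin discretization. -/
def disc (hΩ : IsOpen Ω) (hA : CoeffBound Ω α β c A) (hM : ∀ t, (M.elem t).Regular (x₀ t) K)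
    (κ : ℝ) : Discretization (Lp ℝ 2 (volume.restrict Ω))
      (EuclideanSpace ℝ (Σ t, Fin (M.elem t).N)) M.EdgeFun where
  κ := κ
  a := mulOp (hA.α_meas hΩ) (hA.ae_α_le hΩ)
  b := fun j => mulOp (hA.β_meas hΩ j) (hA.ae_β_le hΩ j)
  c := mulOp hA.c_meas hA.c_le
  G := M.gradOp
  σ := extOp hM
  τ := residualOp hM

theorem inner_extOp (hΩ : IsPolygonalDomain Ω) (hM : ∀ t, (M.elem t).Regular (x₀ t) K) {f : E → ℝ}
    (hf : MemLp f 2 (volume.restrict Ω)) (v : M.EdgeFun) :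
    inner ℝ (hf.toLp f) (extOp hM v) = ∑ t, ∫ x in (M.elem t).carrier,
      f x * (M.elem t).ext (v t) x := by
  rw [extOp, LinearMap.coe_mk, AddHom.coe_mk, inner_toLp, M.setIntegral_mul_eq_sum hΩ hf
    (M.memLp_ext v)]
  refine Finset.sum_congr rfl fun t _ => integral_congr_ae ?_
  filter_upwards [M.glue_ae_eq (fun t => (M.elem t).ext (v t)) t] with x hx
  rw [hx]

theorem form_disc (hΩ : IsPolygonalDomain Ω) (hA : CoeffBound Ω α β c A)
    (hM : ∀ t, (M.elem t).Regular (x₀ t) K) (κ : ℝ) (v w : M.EdgeFun) :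
    (disc hΩ.1 hA hM κ).form v w = κ * M.stab v w + M.bform α β c v w := by
  have h0 := (M.meshSize_pos hΩ.2.1.nonempty).le
  -- an integral of a product of glued functions with a coefficient
  have key : ∀ (a : E → ℝ) (ha : AEStronglyMeasurable a (volume.restrict Ω))
      (hA : ∀ᵐ x ∂volume.restrict Ω, |a x| ≤ A) (q q' : Fin M.card → E → ℝ)
      (hq : MemLp (M.glue q) 2 (volume.restrict Ω)) (hq' : MemLp (M.glue q') 2 (volume.restrict Ω)),
      inner ℝ (mulOp ha hA (hq.toLp _)) (hq'.toLp _)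
        = ∑ t, ∫ x in (M.elem t).carrier, a x * q t x * q' t x ∧
      ∀ t, IntegrableOn (fun x => a x * q t x * q' t x) (M.elem t).carrier := by
    intro a ha hA q q' hq hq'
    have e : ∀ t, (fun x => a x * M.glue q x * M.glue q' x)
        =ᵐ[volume.restrict (M.elem t).carrier] fun x => a x * q t x * q' t x := fun t => by
      filter_upwards [M.glue_ae_eq q t, M.glue_ae_eq q' t] with x h1 h2
      rw [h1, h2]
    refine ⟨?_, fun t => ?_⟩
    · rw [mulOp_toLp, inner_toLp, M.setIntegral_mul_eq_sum hΩ (memLp_ae_bdd_mul ha hA hq) hq']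
      exact Finset.sum_congr rfl fun t _ => integral_congr_ae (e t)
    · have hI : IntegrableOn (fun x => a x * M.glue q x * M.glue q' x) Ω :=
        (memLp_ae_bdd_mul ha hA hq).integrable_mul hq'
      exact Integrable.congr (Integrable.mono_measure hI (Poly.restrict_carrier_le
        (M.interior_subset_domain hΩ.2.2.2.1 t))) (e t)
  have ka := fun i => key α (hA.α_meas hΩ.1) (hA.ae_α_le hΩ.1) _ _ (M.memLp_grad i v)
    (M.memLp_grad i w)
  have kb := fun i => key _ (hA.β_meas hΩ.1 i) (hA.ae_β_le hΩ.1 i) _ _ (M.memLp_grad i v)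
    (M.memLp_ext w)
  have kc := key c hA.c_meas hA.c_le _ _ (M.memLp_ext v) (M.memLp_ext w)
  have ea : ∀ t, ∫ x in (M.elem t).carrier,
        α x * inner ℝ ((M.elem t).weakGrad (v t)) ((M.elem t).weakGrad (w t))
      = ∑ i, ∫ x in (M.elem t).carrier,
        α x * (M.elem t).weakGrad (v t) i * (M.elem t).weakGrad (w t) i := fun t => by
    rw [← integral_finsetSum _ fun i _ => (ka i).2 t]
    refine integral_congr_ae (ae_of_all _ fun x => ?_)
    simp only [PiLp.inner_apply, RCLike.inner_apply, conj_trivial, Finset.mul_sum]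
    exact Finset.sum_congr rfl fun i _ => by ring
  have eb : ∀ t, ∫ x in (M.elem t).carrier,
        inner ℝ (β x) ((M.elem t).weakGrad (v t)) * (M.elem t).ext (w t) x
      = ∑ i, ∫ x in (M.elem t).carrier,
        β x i * (M.elem t).weakGrad (v t) i * (M.elem t).ext (w t) x := fun t => by
    rw [← integral_finsetSum _ fun i _ => (kb i).2 t]
    refine integral_congr_ae (ae_of_all _ fun x => ?_)
    simp only [PiLp.inner_apply, RCLike.inner_apply, conj_trivial, Finset.sum_mul]
    exact Finset.sum_congr rfl fun i _ => by ring
  rw [Discretization.form, Discretization.cform, bform]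
  simp only [ea, eb, Finset.sum_add_distrib]
  rw [Finset.sum_comm (f := fun t i => ∫ x in (M.elem t).carrier,
      α x * (M.elem t).weakGrad (v t) i * (M.elem t).weakGrad (w t) i),
    Finset.sum_comm (f := fun t i => ∫ x in (M.elem t).carrier,
      β x i * (M.elem t).weakGrad (v t) i * (M.elem t).ext (w t) x), ← inner_residualOp hM h0]
  congr 1
  refine congrArg₂ _ (congrArg₂ _ (Finset.sum_congr rfl fun i _ => (ka i).1)
    (Finset.sum_congr rfl fun i _ => (kb i).1)) kc.1

end PolyMesh

/-! ### Estimates on the whole domain -/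

theorem l2Norm_congr_ae {S : Set E} {f g : E → ℝ} (h : f =ᵐ[volume.restrict S] g) :
    l2Norm S f = l2Norm S g := by
  rw [l2Norm, l2Norm]
  congr 1
  refine integral_congr_ae ?_
  filter_upwards [h] with x hx
  rw [hx]

theorem h2Norm_nonneg (Ω : Set E) (u : E → ℝ) : 0 ≤ h2Norm Ω u := Real.sqrt_nonneg _

theorem l2Norm_le_h2Norm (Ω : Set E) (u : E → ℝ) : l2Norm Ω u ≤ h2Norm Ω u ∧
    (∀ i, l2Norm Ω (weakPartial Ω i u) ≤ h2Norm Ω u) ∧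
    ∀ i j, l2Norm Ω (weakPartial Ω j (weakPartial Ω i u)) ≤ h2Norm Ω u := by
  have h1 : ∀ i, l2Norm Ω (weakPartial Ω i u) ^ 2 ≤ ∑ i, l2Norm Ω (weakPartial Ω i u) ^ 2 :=
    fun i =>
    Finset.single_le_sum (f := fun i => l2Norm Ω (weakPartial Ω i u) ^ 2) (fun _ _ => sq_nonneg _)
      (Finset.mem_univ i)
  have h2 : ∀ i j, l2Norm Ω (weakPartial Ω j (weakPartial Ω i u)) ^ 2
      ≤ ∑ i, ∑ j, l2Norm Ω (weakPartial Ω j (weakPartial Ω i u)) ^ 2 := fun i j =>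
    (Finset.single_le_sum (f := fun j => l2Norm Ω (weakPartial Ω j (weakPartial Ω i u)) ^ 2)
      (fun _ _ => sq_nonneg _) (Finset.mem_univ j)).trans
    (Finset.single_le_sum (f := fun i => ∑ j, l2Norm Ω (weakPartial Ω j (weakPartial Ω i u)) ^ 2)
      (fun _ _ => Finset.sum_nonneg fun _ _ => sq_nonneg _) (Finset.mem_univ i))
  have h3 : 0 ≤ ∑ i, l2Norm Ω (weakPartial Ω i u) ^ 2 := Finset.sum_nonneg fun _ _ => sq_nonneg _
  have h4 : 0 ≤ ∑ i, ∑ j, l2Norm Ω (weakPartial Ω j (weakPartial Ω i u)) ^ 2 :=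
    Finset.sum_nonneg fun _ _ => Finset.sum_nonneg fun _ _ => sq_nonneg _
  have h5 := sq_nonneg (l2Norm Ω u)
  exact ⟨Real.le_sqrt_of_sq_le (by linarith), fun i => Real.le_sqrt_of_sq_le (by linarith [h1 i]),
    fun i j => Real.le_sqrt_of_sq_le (by linarith [h2 i j])⟩

namespace PolyMesh

variable {Ω : Set E} {M : PolyMesh Ω} {x₀ : Fin M.card → E} {K : ℝ}

theorem sum_l2Norm_sq (hΩ : IsPolygonalDomain Ω) (M : PolyMesh Ω) {F : E → ℝ}
    (hF : MemLp F 2 (volume.restrict Ω)) :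
    ∑ t, l2Norm (M.elem t).carrier F ^ 2 = l2Norm Ω F ^ 2 := by
  simp only [l2Norm_sq]
  exact (M.setIntegral_eq_sum hΩ hF.integrable_sq).symm

theorem sum_sum_l2Norm_sq_le (hΩ : IsPolygonalDomain Ω) (M : PolyMesh Ω) {ι : Type*} [Fintype ι]
    {G : ι → E → ℝ} (hG : ∀ k, MemLp (G k) 2 (volume.restrict Ω)) {U : ℝ}
    (hU : ∀ k, l2Norm Ω (G k) ≤ U) :
    ∑ t, (∑ k, l2Norm (M.elem t).carrier (G k)) ^ 2 ≤ (Fintype.card ι * U) ^ 2 := by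
  calc _ ≤ ∑ t, (Fintype.card ι : ℝ) * ∑ k, l2Norm (M.elem t).carrier (G k) ^ 2 :=
        Finset.sum_le_sum fun t _ => sq_sum_le_card_mul_sum_sq
    _ = Fintype.card ι * ∑ k, l2Norm Ω (G k) ^ 2 := by
        rw [← Finset.mul_sum, Finset.sum_comm]
        simp only [fun k => M.sum_l2Norm_sq hΩ (hG k)]
    _ ≤ Fintype.card ι * ∑ _k : ι, U ^ 2 := by
        refine mul_le_mul_of_nonneg_left (Finset.sum_le_sum fun k _ => ?_) (Nat.cast_nonneg _)
        exact pow_le_pow_left₀ (l2Norm_nonneg _ _) (hU k) 2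
    _ = _ := by
        rw [Finset.sum_const, Finset.card_univ, nsmul_eq_mul]; ring

/-- Passing from an estimate on every element to the whole domain. -/
theorem l2Norm_le_of_forall (hΩ : IsPolygonalDomain Ω) (M : PolyMesh Ω) {ι : Type*} [Fintype ι]
    {F : E → ℝ} {G : ι → E → ℝ} (hF : MemLp F 2 (volume.restrict Ω))
    (hG : ∀ k, MemLp (G k) 2 (volume.restrict Ω)) {U C : ℝ} (hC : 0 ≤ C) (hU0 : 0 ≤ U)
    (hU : ∀ k, l2Norm Ω (G k) ≤ U)
    (h : ∀ t, l2Norm (M.elem t).carrier F ≤ C * ∑ k, l2Norm (M.elem t).carrier (G k)) :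
    l2Norm Ω F ≤ C * (Fintype.card ι * U) := by
  refine abs_le_of_sq_le_sq' ?_ (by positivity) |>.2
  rw [← M.sum_l2Norm_sq hΩ hF, mul_pow]
  refine (Finset.sum_le_sum fun t _ => pow_le_pow_left₀ (l2Norm_nonneg _ _) (h t) 2).trans ?_
  simp only [mul_pow C, ← Finset.mul_sum]
  exact mul_le_mul_of_nonneg_left (M.sum_sum_l2Norm_sq_le hΩ hG hU) (sq_nonneg C)

theorem hasWeakGrad_interior (hΩ : IsPolygonalDomain Ω) (M : PolyMesh Ω) {W : E → ℝ}
    {D : Fin 2 → E → ℝ} (hW : HasWeakGrad Ω W D) (t : Fin M.card) :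
    HasWeakGrad (interior (M.elem t).carrier) W D :=
  hW.mono (M.interior_subset_domain hΩ.2.2.2.1 t)

/-- The piecewise constant function of the means over the elements. -/
def means (M : PolyMesh Ω) (W : E → ℝ) : E → ℝ :=
  M.glue fun t _ => (M.elem t).area⁻¹ * ∫ y in (M.elem t).carrier, W y

theorem memLp_means (M : PolyMesh Ω) (W : E → ℝ) : MemLp (M.means W) 2 (volume.restrict Ω) :=
  M.memLp_glue fun _ => Poly.Regular.memLp_const _

theorem l2Norm_means_sub_elem_le (hΩ : IsPolygonalDomain Ω) (hM : ∀ t, (M.elem t).Regular (x₀ t) K)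
    {W : E → ℝ} {D : Fin 2 → E → ℝ} (hW : HasWeakGrad Ω W D) (t : Fin M.card) :
    l2Norm (M.elem t).carrier (fun x => M.means W x - W x)
      ≤ 6 * K * M.meshSize * ∑ i, l2Norm (M.elem t).carrier (D i) := by
  have h1 := (hM t).l2Norm_sub_mean_le isOpen_interior subset_rfl (M.hasWeakGrad_interior hΩ hW t)
  have e : l2Norm (M.elem t).carrier (fun x => M.means W x - W x)
      = l2Norm (M.elem t).carrier
        (fun x => W x - (M.elem t).area⁻¹ * ∫ y in (M.elem t).carrier, W y) := by
    rw [← l2Norm_abs, ← l2Norm_abs _ (fun x => W x - _)]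
    refine l2Norm_congr_ae ?_
    filter_upwards [M.glue_ae_eq (fun t _ => (M.elem t).area⁻¹ * ∫ y in (M.elem t).carrier, W y) t]
      with x hx
    rw [means, hx, abs_sub_comm]
  rw [e]
  refine h1.trans (mul_le_mul_of_nonneg_right ?_ (Finset.sum_nonneg fun _ _ => l2Norm_nonneg _ _))
  have := (hM t).K_pos
  have := M.diam_le_meshSize t
  gcongr

theorem l2Norm_means_sub_le (hΩ : IsPolygonalDomain Ω) (hM : ∀ t, (M.elem t).Regular (x₀ t) K)
    (hK : 0 ≤ K) {W : E → ℝ} {D : Fin 2 → E → ℝ} (hW : HasWeakGrad Ω W D) {U : ℝ} (hU0 : 0 ≤ U)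
    (hU : ∀ i, l2Norm Ω (D i) ≤ U) :
    l2Norm Ω (fun x => M.means W x - W x) ≤ 12 * K * M.meshSize * U := by
  have h0 := M.meshSize_pos hΩ.2.1.nonempty
  refine (M.l2Norm_le_of_forall hΩ ((M.memLp_means W).sub hW.memLp) hW.memLp_grad
    (by positivity) hU0
    hU fun t => l2Norm_means_sub_elem_le hΩ hM hW t).trans (le_of_eq ?_)
  rw [Fintype.card_fin]
  push_cast
  ring

/-- The error of the piecewise means is of second order against weakly differentiable functions. -/
theorem abs_inner_means_sub_le (hΩ : IsPolygonalDomain Ω) (hM : ∀ t, (M.elem t).Regular (x₀ t) K)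
    (hK : 0 ≤ K) {W Z : E → ℝ} {D F : Fin 2 → E → ℝ} (hW : HasWeakGrad Ω W D)
    (hZ : HasWeakGrad Ω Z F) {U P : ℝ} (hU0 : 0 ≤ U)
    (hU : ∀ i, l2Norm Ω (D i) ≤ U) (hP0 : 0 ≤ P) (hP : ∀ i, l2Norm Ω (F i) ≤ P) :
    |inner ℝ ((M.memLp_means W).toLp _ - hW.memLp.toLp W) (hZ.memLp.toLp Z)|
      ≤ 144 * K ^ 2 * M.meshSize ^ 2 * U * P := by
  have h0 := M.meshSize_pos hΩ.2.1.nonempty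
  have mW := (M.memLp_means W).sub hW.memLp
  have mZ := (M.memLp_means Z).sub hZ.memLp
  have hres := fun t => Poly.restrict_carrier_le (M.interior_subset_domain hΩ.2.2.2.1 t)
  -- the error of the means is orthogonal to piecewise constant functions
  have horth : ∫ x in Ω, (M.means W - W) x * M.means Z x = 0 := by
    rw [M.setIntegral_mul_eq_sum hΩ mW (M.memLp_means Z)]
    refine Finset.sum_eq_zero fun t _ => ?_
    set w := (M.elem t).area⁻¹ * ∫ y in (M.elem t).carrier, W y with hw
    set z := (M.elem t).area⁻¹ * ∫ y in (M.elem t).carrier, Z y with hz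
    have hfin := (M.elem t).isFiniteMeasure_carrier
    have e : ∫ x in (M.elem t).carrier, (M.means W - W) x * M.means Z x
        = ∫ x in (M.elem t).carrier, (w - W x) * z := by
      refine integral_congr_ae ?_
      filter_upwards [M.glue_ae_eq (fun t _ => (M.elem t).area⁻¹ * ∫ y in (M.elem t).carrier,
        W y) t,
        M.glue_ae_eq (fun t _ => (M.elem t).area⁻¹ * ∫ y in (M.elem t).carrier, Z y) t] with x h1 h2
      rw [Pi.sub_apply, means, h1, means, h2]
    have hWI : Integrable W (volume.restrict (M.elem t).carrier) :=
      (hW.memLp.mono_measure (hres t)).integrable (by norm_num)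
    rw [e, integral_mul_const, integral_sub (integrable_const _) hWI, integral_const]
    simp only [measureReal_restrict_apply, MeasurableSet.univ, univ_inter, smul_eq_mul]
    have e' : volume.real (M.elem t).carrier = (M.elem t).area := rfl
    rw [e', hw, mul_inv_cancel_left₀ (hM t).star.area_pos.ne', sub_self, zero_mul]
  have e1 : inner ℝ ((M.memLp_means W).toLp _ - hW.memLp.toLp W) (hZ.memLp.toLp Z)
      = -∫ x in Ω, (M.means W - W) x * (M.means Z - Z) x := by
    rw [← MemLp.toLp_sub, inner_toLp mW hZ.memLp]
    have : ∀ x, (M.means W - W) x * (M.means Z - Z) x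
        = (M.means W - W) x * M.means Z x - (M.means W - W) x * Z x := fun x => by
      rw [Pi.sub_apply (M.means Z)]; ring
    have i1 : Integrable (fun x => (M.means W - W) x * M.means Z x) (volume.restrict Ω) :=
      mW.integrable_mul (M.memLp_means Z)
    have i2 : Integrable (fun x => (M.means W - W) x * Z x) (volume.restrict Ω) :=
      mW.integrable_mul hZ.memLp
    simp only [this]
    rw [integral_sub i1 i2, horth]
    ring
  rw [e1, abs_neg]
  refine (abs_setIntegral_mul_le mW mZ).trans ?_
  calc _ ≤ (12 * K * M.meshSize * U) * (12 * K * M.meshSize * P) :=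
        mul_le_mul (l2Norm_means_sub_le hΩ hM hK hW hU0 hU) (l2Norm_means_sub_le hΩ hM hK hZ hP0 hP)
          (l2Norm_nonneg _ _) (by positivity)
    _ = _ := by ring

theorem gradOp_edgeMeans (hΩ : IsPolygonalDomain Ω) (hM : ∀ t, (M.elem t).Regular (x₀ t) K)
    {W : E → ℝ} {D : Fin 2 → E → ℝ} (hW : HasWeakGrad Ω W D) (i : Fin 2) :
    M.gradOp i (M.edgeMeans x₀ W D) = (M.memLp_means (D i)).toLp _ := by
  refine MemLp.toLp_congr (M.memLp_grad i _) _ (Eq.eventuallyEq ?_)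
  rw [means]
  congr 1
  ext t x
  exact (hM t).weakGrad_edgeMean (M.hasWeakGrad_interior hΩ hW t) i

theorem l2Norm_glue_const (M : PolyMesh Ω) (g : Fin M.card → ℝ) (t : Fin M.card) :
    l2Norm (M.elem t).carrier (M.glue fun t _ => g t) = √(M.elem t).area * |g t| := by
  rw [l2Norm_congr_ae (M.glue_ae_eq (fun t _ => g t) t), l2Norm_const]
  rfl

/-- The global consistency estimate: the sum over the edges that appears on every element
vanishes. -/
theorem abs_consistency_le (hΩ : IsPolygonalDomain Ω) (hM : ∀ t, (M.elem t).Regular (x₀ t) K)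
    (hK : 0 ≤ K) {W : E → ℝ} {D : Fin 2 → E → ℝ} (hW : HasWeakGrad Ω W D) {U : ℝ} (hU0 : 0 ≤ U)
    (hU : ∀ i, l2Norm Ω (D i) ≤ U) {v : M.EdgeFun} (hv : v ∈ M.Wh0) (j : Fin 2) :
    |inner ℝ ((hW.memLp_grad j).toLp (D j)) (extOp hM v)
        + inner ℝ (hW.memLp.toLp W) (M.gradOp j v)|
      ≤ 12672 * K ^ 7 * M.meshSize * U * (∑ k, ‖M.gradOp k v‖ + ‖residualOp hM v‖) := by
  have h0 := M.meshSize_pos hΩ.2.1.nonempty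
  set N := ∑ k, ‖M.gradOp k v‖ + ‖residualOp hM v‖ with hN
  have hN0 : 0 ≤ N := add_nonneg (Finset.sum_nonneg fun _ _ => norm_nonneg _) (norm_nonneg _)
  have e2 : inner ℝ (hW.memLp.toLp W) (M.gradOp j v)
      = ∑ t, ∫ x in (M.elem t).carrier, W x * (M.elem t).weakGrad (v t) j := by
    rw [gradOp, LinearMap.coe_mk, AddHom.coe_mk, inner_toLp, M.setIntegral_mul_eq_sum hΩ hW.memLp
      (M.memLp_grad j v)]
    refine Finset.sum_congr rfl fun t _ => integral_congr_ae ?_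
    filter_upwards [M.glue_ae_eq (fun t _ => (M.elem t).weakGrad (v t) j) t] with x hx
    rw [hx]
  -- the sums over the edges add up to zero and are subtracted before the local estimate
  have h3 := sum_edges_eq_zero hΩ.1 hΩ.2.2.2.1 hM hW hv j
  rw [inner_extOp hΩ hM, e2, ← sub_zero (_ + _), ← h3, ← Finset.sum_add_distrib,
    ← Finset.sum_sub_distrib]
  set a : Fin M.card → ℝ := fun t => ∑ k, l2Norm (M.elem t).carrier (D k) with ha
  set b : Fin M.card → ℝ := fun t => ∑ k, √(M.elem t).area * |(M.elem t).weakGrad (v t) k|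
    + √(M.meshSize⁻¹ * ∑ i, (M.elem t).len i *
      ((M.elem t).ext (v t) ((M.elem t).mid i) - v t i) ^ 2) with hb
  have hloc : ∀ t, |(∫ x in (M.elem t).carrier, D j x * (M.elem t).ext (v t) x)
      + (∫ x in (M.elem t).carrier, W x * (M.elem t).weakGrad (v t) j)
      - ∑ i, (M.elem t).len i * (M.elem t).normal i j * (v t i *
        edgeMean (x₀ t) ((M.elem t).tail i) ((M.elem t).head i) W D)|
      ≤ 3168 * K ^ 7 * M.meshSize * (a t * b t) := fun t => by
    rw [← mul_assoc]
    exact (hM t).abs_consistency_le (M.hasWeakGrad_interior hΩ hW t) (v t) j (M.diam_le_meshSize t)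
  have hsa : ∑ t, a t ^ 2 ≤ (2 * U) ^ 2 := by
    have := M.sum_sum_l2Norm_sq_le hΩ hW.memLp_grad hU
    rw [Fintype.card_fin] at this
    exact_mod_cast this
  have hsb : ∑ t, b t ^ 2 ≤ (2 * N) ^ 2 := by
    have hg : ∀ k, ∑ t, (√(M.elem t).area * |(M.elem t).weakGrad (v t) k|) ^ 2
        = ‖M.gradOp k v‖ ^ 2 := fun k => by
      rw [gradOp, LinearMap.coe_mk, AddHom.coe_mk, norm_toLp_eq_l2Norm,
        ← M.sum_l2Norm_sq hΩ (M.memLp_grad k v)]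
      exact Finset.sum_congr rfl fun t _ => by
        rw [M.l2Norm_glue_const (fun t => (M.elem t).weakGrad (v t) k)]
    have hS0 : ∀ t, 0 ≤ M.meshSize⁻¹ * ∑ i, (M.elem t).len i *
        ((M.elem t).ext (v t) ((M.elem t).mid i) - v t i) ^ 2 := fun t =>
      mul_nonneg (inv_nonneg.2 h0.le)
        (Finset.sum_nonneg fun i _ => mul_nonneg ((M.elem t).len_pos i).le (sq_nonneg _))
    have hτ : ∑ t, M.meshSize⁻¹ * ∑ i, (M.elem t).len i *
        ((M.elem t).ext (v t) ((M.elem t).mid i) - v t i) ^ 2 = ‖residualOp hM v‖ ^ 2 := by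
      rw [← real_inner_self_eq_norm_sq, inner_residualOp hM h0.le, stab]
      refine Finset.sum_congr rfl fun t _ => ?_
      congr 1
      exact Finset.sum_congr rfl fun i _ => by ring
    calc ∑ t, b t ^ 2 ≤ ∑ t, 3 * (∑ k, (√(M.elem t).area * |(M.elem t).weakGrad (v t) k|) ^ 2
          + M.meshSize⁻¹ * ∑ i, (M.elem t).len i *
            ((M.elem t).ext (v t) ((M.elem t).mid i) - v t i) ^ 2) := by
          refine Finset.sum_le_sum fun t _ => ?_
          rw [← Real.sq_sqrt (hS0 t)]
          simp only [hb, Fin.sum_univ_two]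
          set p := √(M.elem t).area * |(M.elem t).weakGrad (v t) 0|
          set q := √(M.elem t).area * |(M.elem t).weakGrad (v t) 1|
          set r := √(M.meshSize⁻¹ * ∑ i, (M.elem t).len i *
            ((M.elem t).ext (v t) ((M.elem t).mid i) - v t i) ^ 2)
          nlinarith [sq_nonneg (p - q), sq_nonneg (p - r), sq_nonneg (q - r)]
      _ = 3 * (∑ k, ‖M.gradOp k v‖ ^ 2 + ‖residualOp hM v‖ ^ 2) := by
          rw [← Finset.mul_sum, Finset.sum_add_distrib, Finset.sum_comm, hτ]
          simp only [hg]
      _ ≤ _ := by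
          rw [hN]
          simp only [Fin.sum_univ_two]
          have p1 := norm_nonneg (M.gradOp 0 v)
          have p2 := norm_nonneg (M.gradOp 1 v)
          have p3 := norm_nonneg (residualOp hM v)
          nlinarith [mul_nonneg p1 p2, mul_nonneg p1 p3, mul_nonneg p2 p3]
  -- the Cauchy–Schwarz inequality for the sum over the elements
  have hab : ∑ t, a t * b t ≤ 2 * U * (2 * N) := by
    refine (Real.sum_mul_le_sqrt_mul_sqrt _ _ _).trans (mul_le_mul ?_ ?_ (Real.sqrt_nonneg _)
      (by positivity))
    · exact Real.sqrt_le_iff.2 ⟨by positivity, hsa⟩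
    · exact Real.sqrt_le_iff.2 ⟨by positivity, hsb⟩
  calc _ ≤ ∑ t, 3168 * K ^ 7 * M.meshSize * (a t * b t) :=
        (Finset.abs_sum_le_sum_abs _ _).trans (Finset.sum_le_sum fun t _ => hloc t)
    _ = 3168 * K ^ 7 * M.meshSize * ∑ t, a t * b t := (Finset.mul_sum _ _ _).symm
    _ ≤ 3168 * K ^ 7 * M.meshSize * (2 * U * (2 * N)) :=
      mul_le_mul_of_nonneg_left hab (by positivity)
    _ = _ := by ring

variable {α : E → ℝ} {β : E → E} {c : E → ℝ} {A κ : ℝ}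

/-- The edge averages of a function in `H²` approximate it. -/
theorem approx_disc (hΩ : IsPolygonalDomain Ω) (hA : CoeffBound Ω α β c A)
    (hM : ∀ t, (M.elem t).Regular (x₀ t) K) (hK : 1 ≤ K) {u : E → ℝ} (hu : MemH2 Ω u) {L : ℝ}
    (hL : 68688 * K ^ 8 ≤ L) :
    (disc hΩ.1 hA hM κ).Approx L M.meshSize (h2Norm Ω u)
      (M.edgeMeans x₀ u fun i => weakPartial Ω i u) (hu.1.1.toLp u)
      (fun i => (hu.2 i).1.toLp (weakPartial Ω i u)) := by
  have h0 := M.meshSize_pos hΩ.2.1.nonempty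
  have hK0 : 0 ≤ K := by linarith
  set U := h2Norm Ω u with hU
  have hU0 : 0 ≤ U := h2Norm_nonneg _ _
  obtain ⟨n1, n2, n3⟩ := l2Norm_le_h2Norm Ω u
  have hg := hu.1.hasWeakGrad hΩ.1
  have hg2 := fun i => (hu.2 i).hasWeakGrad hΩ.1
  set q := M.edgeMeans x₀ u fun i => weakPartial Ω i u with hq
  set G : Fin 2 × Fin 2 → E → ℝ := fun k => weakPartial Ω k.2 (weakPartial Ω k.1 u) with hG
  have hGm : ∀ k, MemLp (G k) 2 (volume.restrict Ω) := fun k => ((hu.2 k.1).isWeakPartial k.2).1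
  have hGU : ∀ k, l2Norm Ω (G k) ≤ U := fun k => n3 k.1 k.2
  have hloc := fun t => (hM t).l2Norm_sub_ext_edgeMean_le (M.hasWeakGrad_interior hΩ hg t)
    (fun i => M.hasWeakGrad_interior hΩ (hg2 i) t) (q := q t) fun i => rfl
  have hGs : ∀ t, ∑ i, ∑ j, l2Norm (M.elem t).carrier (weakPartial Ω j (weakPartial Ω i u))
      = ∑ k, l2Norm (M.elem t).carrier (G k) := fun t => by
    rw [Fintype.sum_prod_type]
  simp only [hGs] at hloc
  have hpow : ∀ m : ℕ, m ≤ 8 → K ^ m ≤ K ^ 8 := fun m hm => pow_le_pow_right₀ hK hm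
  have hcard : (Fintype.card (Fin 2 × Fin 2) : ℝ) = 4 := by
    rw [Fintype.card_prod, Fintype.card_fin]; norm_num
  have hm := M.diam_le_meshSize
  have hdpos := fun t => (hM t).diam_pos
  refine ⟨by rw [norm_toLp_eq_l2Norm]; exact n1, fun i => by rw [norm_toLp_eq_l2Norm]; exact n2 i,
    ?_, fun i => ?_, ?_⟩
  · have e : (disc hΩ.1 hA hM κ).σ q - hu.1.1.toLp u = ((M.memLp_ext q).sub hu.1.1).toLp _ :=
      (MemLp.toLp_sub (M.memLp_ext q) hu.1.1).symm
    rw [e, norm_toLp_eq_l2Norm]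
    have := M.l2Norm_le_of_forall hΩ (C := 17172 * K ^ 8 * M.meshSize ^ 2)
      ((M.memLp_ext q).sub hu.1.1) hGm (by positivity) hU0 hGU fun t => by
        have e' : l2Norm (M.elem t).carrier ((M.glue fun t => (M.elem t).ext (q t)) - u)
            = l2Norm (M.elem t).carrier (fun x => u x - (M.elem t).ext (q t) x) := by
          rw [← l2Norm_abs, ← l2Norm_abs _ (fun x => u x - _)]
          refine l2Norm_congr_ae ?_
          filter_upwards [M.glue_ae_eq (fun t => (M.elem t).ext (q t)) t] with x hx
          rw [Pi.sub_apply, hx, abs_sub_comm]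
        rw [e']
        refine (hloc t).1.trans (mul_le_mul_of_nonneg_right ?_
          (Finset.sum_nonneg fun _ _ => l2Norm_nonneg _ _))
        have := hm t
        have := (hdpos t).le
        gcongr
    refine this.trans ?_
    rw [hcard]
    calc _ = 68688 * K ^ 8 * M.meshSize ^ 2 * U := by ring
      _ ≤ _ := by gcongr
  · have e : (disc hΩ.1 hA hM κ).G i q - (hu.2 i).1.toLp (weakPartial Ω i u)
        = ((M.memLp_means (weakPartial Ω i u)).sub (hu.2 i).1).toLp _ := by
      rw [MemLp.toLp_sub (M.memLp_means _) (hu.2 i).1]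
      congr 1
      exact gradOp_edgeMeans hΩ hM hg i
    rw [e, norm_toLp_eq_l2Norm]
    refine (l2Norm_means_sub_le hΩ hM hK0 (hg2 i) hU0 (n3 i)).trans ?_
    have : 12 * K ≤ L := by
      have := hpow 1 (by norm_num)
      linarith
    gcongr
  · have hS0 : ‖(disc hΩ.1 hA hM κ).τ q‖ ^ 2 ≤ (476 * K ^ 5 * M.meshSize * (4 * U)) ^ 2 := by
      have e : ‖(disc hΩ.1 hA hM κ).τ q‖ ^ 2 = M.stab q q := by
        rw [← real_inner_self_eq_norm_sq]
        exact inner_residualOp hM h0.le q q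
      rw [e, stab]
      calc _ ≤ ∑ t, M.meshSize ^ 2 * (476 * K ^ 5) ^ 2 *
              (∑ k, l2Norm (M.elem t).carrier (G k)) ^ 2 := by
            refine Finset.sum_le_sum fun t _ => ?_
            have h1 : ∑ i, ((M.elem t).ext (q t) ((M.elem t).mid i) - q t i) *
                ((M.elem t).ext (q t) ((M.elem t).mid i) - q t i) * (M.elem t).len i
                = ∑ i, (M.elem t).len i * ((M.elem t).ext (q t) ((M.elem t).mid i) - q t i) ^ 2 :=
              Finset.sum_congr rfl fun i _ => by ring
            rw [h1]
            have h2 : (M.elem t).diam ^ 3 ≤ M.meshSize * M.meshSize ^ 2 := by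
              have := hm t
              have := (hdpos t).le
              calc _ = (M.elem t).diam * (M.elem t).diam ^ 2 := by ring
                _ ≤ _ := by gcongr
            calc _ ≤ M.meshSize⁻¹ * ((M.elem t).diam ^ 3 *
                  (476 * K ^ 5 * ∑ k, l2Norm (M.elem t).carrier (G k)) ^ 2) :=
                  mul_le_mul_of_nonneg_left (hloc t).2 (inv_nonneg.2 h0.le)
              _ ≤ M.meshSize⁻¹ * (M.meshSize * M.meshSize ^ 2 *
                  (476 * K ^ 5 * ∑ k, l2Norm (M.elem t).carrier (G k)) ^ 2) := by gcongr
              _ = _ := by field_simp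
        _ = M.meshSize ^ 2 * (476 * K ^ 5) ^ 2 *
              ∑ t, (∑ k, l2Norm (M.elem t).carrier (G k)) ^ 2 := (Finset.mul_sum _ _ _).symm
        _ ≤ M.meshSize ^ 2 * (476 * K ^ 5) ^ 2 * (4 * U) ^ 2 := by
            have := M.sum_sum_l2Norm_sq_le hΩ hGm hGU
            rw [hcard] at this
            gcongr
        _ = _ := by ring
    refine (abs_le_of_sq_le_sq' hS0 (by positivity)).2.trans ?_
    have : 1904 * K ^ 5 ≤ L := by
      have := hpow 5 (by norm_num)
      have := hpow 0 (by norm_num)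
      have : 0 ≤ K ^ 5 := by positivity
      linarith
    calc _ = 1904 * K ^ 5 * M.meshSize * U := by ring
      _ ≤ _ := by gcongr

end PolyMesh

/-! ### The error estimate -/

theorem inner_mulOp_comm {μ : Measure E} {a : E → ℝ} {A : ℝ} (ha : AEStronglyMeasurable a μ)
    (hA : ∀ᵐ x ∂μ, |a x| ≤ A) (F G : Lp ℝ 2 μ) :
    inner ℝ (mulOp ha hA F) G = inner ℝ F (mulOp ha hA G) := by
  rw [← Lp.toLp_coeFn F (Lp.memLp F), ← Lp.toLp_coeFn G (Lp.memLp G), mulOp_toLp, mulOp_toLp,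
    inner_toLp, inner_toLp]
  refine integral_congr_ae (ae_of_all _ fun x => ?_)
  simp only
  ring

theorem l2Norm_bdd_mul_le {S : Set E} {a W : E → ℝ} {A U : ℝ} (hA0 : 0 ≤ A)
    (hA : ∀ᵐ x ∂volume.restrict S, |a x| ≤ A) (hW : MemLp W 2 (volume.restrict S))
    (hU : l2Norm S W ≤ U) : l2Norm S (fun x => a x * W x) ≤ A * U := by
  refine (l2Norm_le_of_ae_abs_le hA0 hW ?_).trans (mul_le_mul_of_nonneg_left hU hA0)
  filter_upwards [hA] with x hx
  rw [abs_mul]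
  exact mul_le_mul_of_nonneg_right hx (abs_nonneg _)

/-- The product of a weakly differentiable function and a `C¹` function, with a bound for its
gradient. -/
theorem HasWeakGrad.mul_bound {Ω : Set E} (hΩ : IsOpen Ω) {W : E → ℝ} {D : Fin 2 → E → ℝ}
    (h : HasWeakGrad Ω W D) {a : E → ℝ} {A U : ℝ} (ha : ContDiffOn ℝ 1 a Ω) (hA0 : 0 ≤ A)
    (hA : ∀ x ∈ Ω, |a x| ≤ A) (hA' : ∀ i, ∀ x ∈ Ω, |pderiv i a x| ≤ A) (hW : l2Norm Ω W ≤ U)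
    (hD : ∀ i, l2Norm Ω (D i) ≤ U) :
    HasWeakGrad Ω (fun x => a x * W x) (fun i x => a x * D i x + pderiv i a x * W x) ∧
      ∀ i, l2Norm Ω (fun x => a x * D i x + pderiv i a x * W x) ≤ 2 * A * U := by
  refine ⟨h.mul hΩ ha hA hA', fun i => ?_⟩
  have m1 := ha.continuousOn.aestronglyMeasurable (μ := volume) hΩ.measurableSet
  have m2 := (continuousOn_pderiv hΩ ha i).aestronglyMeasurable (μ := volume) hΩ.measurableSet
  have b1 : ∀ᵐ x ∂volume.restrict Ω, |a x| ≤ A :=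
    (ae_restrict_iff' hΩ.measurableSet).2 (ae_of_all _ hA)
  have b2 : ∀ᵐ x ∂volume.restrict Ω, |pderiv i a x| ≤ A :=
    (ae_restrict_iff' hΩ.measurableSet).2 (ae_of_all _ (hA' i))
  refine (l2Norm_add_le (memLp_ae_bdd_mul m1 b1 (h.memLp_grad i))
    (memLp_ae_bdd_mul m2 b2 h.memLp)).trans ?_
  have := l2Norm_bdd_mul_le hA0 b1 (h.memLp_grad i) (hD i)
  have := l2Norm_bdd_mul_le hA0 b2 h.memLp hW
  linarith

namespace PolyMesh

variable {Ω : Set E} {M : PolyMesh Ω} {x₀ : Fin M.card → E} {K : ℝ} {α : E → ℝ} {β : E → E}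
  {c : E → ℝ} {A κ : ℝ}

theorem l2Error_eq (hΩ : IsPolygonalDomain Ω) (hM : ∀ t, (M.elem t).Regular (x₀ t) K) {u : E → ℝ}
    (hu : MemLp u 2 (volume.restrict Ω)) (ub : M.EdgeFun) :
    M.l2Error u ub = ‖extOp hM ub - hu.toLp u‖ := by
  have e : extOp hM ub - hu.toLp u = ((M.memLp_ext ub).sub hu).toLp _ :=
    (MemLp.toLp_sub (M.memLp_ext ub) hu).symm
  rw [e, norm_toLp_eq_l2Norm, l2Norm, l2Error,
    M.setIntegral_eq_sum hΩ ((M.memLp_ext ub).sub hu).integrable_sq]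
  congr 1
  refine Finset.sum_congr rfl fun t _ => integral_congr_ae ?_
  filter_upwards [M.glue_ae_eq (fun t => (M.elem t).ext (ub t)) t] with x hx
  rw [Pi.sub_apply, hx]
  ring

/-- The bounds for the coefficients, as operators on `L²`. -/
theorem disc_bounded (hΩ : IsOpen Ω) (hA : CoeffBound Ω α β c A)
    (hM : ∀ t, (M.elem t).Regular (x₀ t) K) {L μ : ℝ} (hμ : 0 < μ) (hμκ : μ ≤ κ) (hκ : κ ≤ L)
    (hAL : A ≤ L) (hell : ∀ x ∈ Ω, μ ≤ α x) : (disc hΩ hA hM κ).Bounded L μ where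
  one_le := hA.one_le.trans hAL
  μ_pos := hμ
  μ_le := hμκ
  κ_le := hκ
  a_le F := (norm_mulOp_le (hA.α_meas hΩ) (hA.ae_α_le hΩ) F).trans
    (mul_le_mul_of_nonneg_right hAL (norm_nonneg _))
  b_le i F := (norm_mulOp_le (hA.β_meas hΩ i) (hA.ae_β_le hΩ i) F).trans
    (mul_le_mul_of_nonneg_right hAL (norm_nonneg _))
  c_le F := (norm_mulOp_le hA.c_meas hA.c_le F).trans (mul_le_mul_of_nonneg_right hAL
    (norm_nonneg _))
  coercive F := by
    change μ * ‖F‖ ^ 2 ≤ inner ℝ (mulOp (hA.α_meas hΩ) (hA.ae_α_le hΩ) F) F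
    have hF := Lp.memLp F
    have hm := memLp_ae_bdd_mul (hA.α_meas hΩ) (hA.ae_α_le hΩ) hF
    rw [← real_inner_self_eq_norm_sq, ← Lp.toLp_coeFn F hF, mulOp_toLp, inner_toLp hm hF,
      inner_toLp hF hF, ← integral_const_mul]
    refine integral_mono_ae ((hF.integrable_mul hF).const_mul μ) (hm.integrable_mul hF) ?_
    filter_upwards [ae_restrict_mem hΩ.measurableSet] with x hx
    calc μ * (F x * F x) ≤ α x * (F x * F x) :=
          mul_le_mul_of_nonneg_right (hell x hx) (mul_self_nonneg _)
      _ = _ := by ring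

/-- Consistency for an equation in divergence form with weakly differentiable fluxes. -/
theorem abs_divForm_le (hΩ : IsPolygonalDomain Ω) (hM : ∀ t, (M.elem t).Regular (x₀ t) K)
    (hK : 0 ≤ K) {W : Fin 2 → E → ℝ} {D : Fin 2 → Fin 2 → E → ℝ} {R f : E → ℝ}
    (h : DivForm Ω W R f) (hW : ∀ i, HasWeakGrad Ω (W i) (D i))
    (hR : MemLp R 2 (volume.restrict Ω)) (hf : MemLp f 2 (volume.restrict Ω)) {B : ℝ} (hB0 : 0 ≤ B)
    (hB : ∀ i k, l2Norm Ω (D i k) ≤ B) {v : M.EdgeFun} (hv : v ∈ M.Wh0) :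
    |inner ℝ (hf.toLp f) (extOp hM v) - (∑ i, inner ℝ ((hW i).memLp.toLp (W i)) (M.gradOp i v)
        + inner ℝ (hR.toLp R) (extOp hM v))|
      ≤ 25344 * K ^ 7 * M.meshSize * B * (∑ k, ‖M.gradOp k v‖ + ‖residualOp hM v‖) := by
  have e : hf.toLp f = hR.toLp R - ∑ i, ((hW i).memLp_grad i).toLp (D i i) := by
    rw [Fin.sum_univ_two, ← MemLp.toLp_add, ← MemLp.toLp_sub]
    refine MemLp.toLp_congr _ _ ?_
    filter_upwards [h.ae_eq hΩ.1 hΩ.2.2.1 hW hR hf] with x hx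
    rw [hx, Fin.sum_univ_two]
    rfl
  have h1 := abs_consistency_le hΩ hM hK (hW 0) hB0 (hB 0) hv 0
  have h2 := abs_consistency_le hΩ hM hK (hW 1) hB0 (hB 1) hv 1
  rw [e, inner_sub_left, Fin.sum_univ_two, Fin.sum_univ_two, inner_add_left]
  refine (le_of_eq ?_).trans ((abs_add_le _ _).trans ((add_le_add h1 h2).trans (le_of_eq ?_)))
  · rw [← abs_neg]
    congr 1
    ring
  · ring

set_option maxHeartbeats 1000000 in
/-- The error estimate on a given shape regular partition, with explicit constants. -/
theorem l2Error_le (hΩ : IsPolygonalDomain Ω) (hA : CoeffBound Ω α β c A)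
    (hM : ∀ t, (M.elem t).Regular (x₀ t) K) (hK : 1 ≤ K) {L μ C : ℝ} (hμ : 0 < μ) (hμκ : μ ≤ κ)
    (hell : ∀ x ∈ Ω, μ ≤ α x) (hκL : κ ≤ L) (hCL : C ≤ L) (hL : 110000 * A * K ^ 8 ≤ L)
    (hreg : ∀ χ : E → ℝ, MemLp χ 2 (volume.restrict Ω) →
      ∃ Φ : E → ℝ, MemH10 Ω Φ ∧ MemH2 Ω Φ ∧ SolvesAdjoint Ω α β c χ Φ ∧
        h2Norm Ω Φ ≤ C * l2Norm Ω χ)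
    (hh : 50 * L ^ 4 * (1 + 18 * L ^ 2 / μ) * M.meshSize ≤ 1) {u f g : E → ℝ} (hu : MemH2 Ω u)
    (hf : MemLp f 2 (volume.restrict Ω)) (hpde : SolvesPDE Ω α β c f u) (htr : HasTrace Ω u g)
    {ub : M.EdgeFun} (hub : M.IsSWGSolution κ α β c f g ub) :
    M.l2Error u ub ≤ 51 * L ^ 4 * (1 + 18 * L ^ 2 / μ) * M.meshSize ^ 2 * h2Norm Ω u := by
  have hA1 := hA.one_le
  have hA0 : 0 ≤ A := by linarith
  have hK0 : 0 ≤ K := by linarith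
  have h0 := M.meshSize_pos hΩ.2.1.nonempty
  set h := M.meshSize with hh'
  -- the constants
  have hK8 : ∀ m : ℕ, m ≤ 8 → K ^ m ≤ K ^ 8 := fun m hm => pow_le_pow_right₀ hK hm
  have hconst : ∀ (r : ℝ) (m : ℕ), 0 ≤ r → r ≤ 110000 → m ≤ 8 → r * A * K ^ m ≤ L := by
    intro r m h1 h2 h3
    refine le_trans ?_ hL
    have := hK8 m h3
    gcongr
  have hAL : A ≤ L := by simpa using hconst 1 0 (by norm_num) (by norm_num) (by norm_num)
  have hL8 : 68688 * K ^ 8 ≤ L := by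
    refine le_trans ?_ (hconst 68688 8 (by norm_num) (by norm_num) (by norm_num))
    have : 0 ≤ K ^ 8 := by positivity
    nlinarith
  have hL0 : 0 ≤ L := by linarith
  have hS := disc_bounded (κ := κ) hΩ.1 hA hM hμ hμκ hκL hAL hell
  set S := disc hΩ.1 hA hM κ with hSdef
  set U := h2Norm Ω u with hU
  have hU0 : 0 ≤ U := h2Norm_nonneg _ _
  obtain ⟨n1, n2, n3⟩ := l2Norm_le_h2Norm Ω u
  have hg2 := fun i => (hu.2 i).hasWeakGrad hΩ.1
  set q := M.edgeMeans x₀ u fun i => weakPartial Ω i u with hq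
  have hqa : S.Approx L h U q _ _ := approx_disc (κ := κ) hΩ hA hM hK hu hL8
  have heW : q - ub ∈ M.Wh0 := edgeMeans_sub_mem_Wh0 hΩ hM htr hub.1 hub.2.1
  have hsch : ∀ v ∈ M.Wh0, S.form ub v = inner ℝ (hf.toLp f) (S.σ v) := fun v hv => by
    rw [form_disc hΩ hA hM, hub.2.2 v hv]
    exact (inner_extOp hΩ hM hf v).symm
  -- the flux and the lower order terms of the solution
  have hW := fun i => (hg2 i).mul_bound hΩ.1 hA.contDiffOn_α hA0 hA.α_le hA.pderiv_α_le (n2 i)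
    (n3 i)
  have hbm := fun i => memLp_ae_bdd_mul (hA.β_meas hΩ.1 i) (hA.ae_β_le hΩ.1 i) (hu.2 i).1
  have hcm := memLp_ae_bdd_mul hA.c_meas hA.c_le hu.1.1
  have hsm : MemLp (fun x => ∑ i, β x i * weakPartial Ω i u x) 2 (volume.restrict Ω) :=
    memLp_finsetSum _ fun i _ => hbm i
  have hRm : MemLp (fun x => ∑ i, β x i * weakPartial Ω i u x + c x * u x) 2 (volume.restrict Ω) :=
    hsm.add hcm
  have hdiv := hpde.divForm
  have hR : hRm.toLp _ = ∑ i, S.b i ((hu.2 i).1.toLp (weakPartial Ω i u))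
      + S.c (hu.1.1.toLp u) := by
    have e1 : ∀ i, S.b i ((hu.2 i).1.toLp (weakPartial Ω i u)) = (hbm i).toLp _ := fun i =>
      mulOp_toLp (hA.β_meas hΩ.1 i) (hA.ae_β_le hΩ.1 i) (hu.2 i).1
    have e2 : S.c (hu.1.1.toLp u) = hcm.toLp _ := mulOp_toLp hA.c_meas hA.c_le hu.1.1
    rw [e2, Fin.sum_univ_two, e1, e1, ← MemLp.toLp_add, ← MemLp.toLp_add]
    refine MemLp.toLp_congr _ _ (ae_of_all _ fun x => ?_)
    simp [Fin.sum_univ_two]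
  have hWa : ∀ i, S.a ((hu.2 i).1.toLp (weakPartial Ω i u)) = (hW i).1.memLp.toLp _ := fun i =>
    mulOp_toLp (hA.α_meas hΩ.1) (hA.ae_α_le hΩ.1) (hu.2 i).1
  have hcform : ∀ (w : Lp ℝ 2 (volume.restrict Ω)) k, S.cform (hu.1.1.toLp u)
      (fun i => (hu.2 i).1.toLp (weakPartial Ω i u)) w k
      = ∑ i, inner ℝ ((hW i).1.memLp.toLp _) (k i) + inner ℝ (hRm.toLp _) w := fun w k => by
    rw [hR, inner_add_left, sum_inner, Discretization.cform]
    simp only [hWa]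
    ring
  have hcons : |inner ℝ (hf.toLp f) (S.σ (q - ub)) - S.cform (hu.1.1.toLp u)
      (fun i => (hu.2 i).1.toLp (weakPartial Ω i u)) (S.σ (q - ub)) (fun i => S.G i (q - ub))|
      ≤ L * h * U * S.energy (q - ub) := by
    rw [hcform]
    refine (abs_divForm_le hΩ hM hK0 hdiv (fun i => (hW i).1) hRm hf (by positivity)
      (fun i => (hW i).2) heW).trans ?_
    have : 50688 * A * K ^ 7 ≤ L := hconst 50688 7 (by norm_num) (by norm_num) (by norm_num)
    have hE := S.energy_nonneg (q - ub)
    calc _ = 50688 * A * K ^ 7 * h * U * S.energy (q - ub) := by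
          rw [Discretization.energy]
          change _ = 50688 * A * K ^ 7 * h * U
            * (∑ k, ‖M.gradOp k (q - ub)‖ + ‖residualOp hM (q - ub)‖)
          ring
      _ ≤ _ := by gcongr
  have hfn : ‖hf.toLp f‖ ≤ L * U := by
    have hae := hdiv.ae_eq hΩ.1 hΩ.2.2.1 (fun i => (hW i).1) hRm hf
    rw [norm_toLp_eq_l2Norm, l2Norm_congr_ae hae]
    have hDm := fun i => (hW i).1.memLp_grad i
    simp only [Fin.sum_univ_two]
    simp only [Fin.sum_univ_two] at hRm hsm
    have k1 := l2Norm_sub_le hRm ((hDm 0).add (hDm 1))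
    have k2 := l2Norm_add_le (hDm 0) (hDm 1)
    have k3 := l2Norm_add_le hsm hcm
    have k4 := l2Norm_add_le (hbm 0) (hbm 1)
    have k5 := (hW 0).2 0
    have k6 := (hW 1).2 1
    have k7 := l2Norm_bdd_mul_le hA0 (hA.ae_β_le hΩ.1 0) (hu.2 0).1 (n2 0)
    have k8 := l2Norm_bdd_mul_le hA0 (hA.ae_β_le hΩ.1 1) (hu.2 1).1 (n2 1)
    have k9 := l2Norm_bdd_mul_le hA0 hA.c_le hu.1.1 n1
    have : 7 * A ≤ L := by simpa using hconst 7 0 (by norm_num) (by norm_num) (by norm_num)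
    have k10 : 7 * A * U ≤ L * U := mul_le_mul_of_nonneg_right this hU0
    refine k1.trans ?_
    refine le_trans ?_ k10
    refine (add_le_add k3 k2).trans ?_
    linarith
  -- the dual problem
  obtain ⟨Φ, hΦ0, hΦ, hadj, hΦC⟩ := hreg _ (M.memLp_ext (q - ub))
  set P := h2Norm Ω Φ with hP
  have hP0 : 0 ≤ P := h2Norm_nonneg _ _
  obtain ⟨m1, m2, m3⟩ := l2Norm_le_h2Norm Ω Φ
  have hΦ1 := hΦ.1.hasWeakGrad hΩ.1
  have hΦ2 := fun i => (hΦ.2 i).hasWeakGrad hΩ.1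
  have hqΦ : S.Approx L h P (M.edgeMeans x₀ Φ fun i => weakPartial Ω i Φ) _ _ :=
    approx_disc (κ := κ) hΩ hA hM hK hΦ hL8
  have hqΦW : (M.edgeMeans x₀ Φ fun i => weakPartial Ω i Φ) ∈ M.Wh0 := edgeMeans_mem_Wh0 hΩ hM hΦ0
  have hPs : P ≤ L * ‖S.σ (q - ub)‖ := by
    have : ‖S.σ (q - ub)‖ = l2Norm Ω (M.glue fun t => (M.elem t).ext ((q - ub) t)) :=
      norm_toLp_eq_l2Norm (M.memLp_ext (q - ub))
    rw [this]
    exact hΦC.trans (mul_le_mul_of_nonneg_right hCL (l2Norm_nonneg _ _))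
  have hV := fun i => (hΦ2 i).mul_bound hΩ.1 hA.contDiffOn_α hA0 hA.α_le hA.pderiv_α_le (m2 i)
    (m3 i)
  have hZ := fun i => hΦ1.mul_bound hΩ.1 (hA.contDiffOn_β i) hA0 (hA.β_le i)
    (hA.pderiv_β_le i) m1 m2
  have hVZ := fun i => (hV i).1.add hΩ.1 hΩ.2.2.1 (hZ i).1
  have hcm' := memLp_ae_bdd_mul hA.c_meas hA.c_le hΦ.1.1
  have hVa : ∀ i, S.a ((hΦ.2 i).1.toLp (weakPartial Ω i Φ)) = (hV i).1.memLp.toLp _ := fun i =>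
    mulOp_toLp (hA.α_meas hΩ.1) (hA.ae_α_le hΩ.1) (hΦ.2 i).1
  have hZb : ∀ i, S.b i (hΦ.1.1.toLp Φ) = (hZ i).1.memLp.toLp _ := fun i =>
    mulOp_toLp (hA.β_meas hΩ.1 i) (hA.ae_β_le hΩ.1 i) hΦ.1.1
  have hcc : S.c (hΦ.1.1.toLp Φ) = hcm'.toLp _ := mulOp_toLp hA.c_meas hA.c_le hΦ.1.1
  have acomm : ∀ F G, inner ℝ (S.a F) G = inner ℝ F (S.a G) := fun F G =>
    inner_mulOp_comm (hA.α_meas hΩ.1) (hA.ae_α_le hΩ.1) F G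
  have bcomm : ∀ i F G, inner ℝ (S.b i F) G = inner ℝ F (S.b i G) := fun i F G =>
    inner_mulOp_comm (hA.β_meas hΩ.1 i) (hA.ae_β_le hΩ.1 i) F G
  have ccomm : ∀ F G, inner ℝ (S.c F) G = inner ℝ F (S.c G) := fun F G =>
    inner_mulOp_comm hA.c_meas hA.c_le F G
  have hcons' : |inner ℝ (S.σ (q - ub)) (S.σ (q - ub)) - S.cform (S.σ (q - ub))
      (fun i => S.G i (q - ub)) (hΦ.1.1.toLp Φ) (fun i => (hΦ.2 i).1.toLp (weakPartial Ω i Φ))|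
      ≤ L * h * P * S.energy (q - ub) := by
    have hb : ∀ i k, l2Norm Ω (fun x => (α x * weakPartial Ω k (weakPartial Ω i Φ) x
        + pderiv k α x * weakPartial Ω i Φ x)
        + (β x i * weakPartial Ω k Φ x + pderiv k (fun x => β x i) x * Φ x)) ≤ 4 * A * P := by
      intro i k
      have := l2Norm_add_le ((hV i).1.memLp_grad k) ((hZ i).1.memLp_grad k)
      have h1 := (hV i).2 k
      have h2 := (hZ i).2 k
      linarith
    have key := abs_divForm_le hΩ hM hK0 hadj.divForm hVZ hcm' (M.memLp_ext (q - ub))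
      (by positivity)
      hb heW
    have e : S.cform (S.σ (q - ub)) (fun i => S.G i (q - ub)) (hΦ.1.1.toLp Φ)
        (fun i => (hΦ.2 i).1.toLp (weakPartial Ω i Φ))
        = ∑ i, inner ℝ ((hVZ i).memLp.toLp _) (M.gradOp i (q - ub))
          + inner ℝ (hcm'.toLp _) (extOp hM (q - ub)) := by
      have e1 : ∀ i, (hVZ i).memLp.toLp _ = (hV i).1.memLp.toLp _ + (hZ i).1.memLp.toLp _ :=
        fun i => MemLp.toLp_add _ _
      rw [Discretization.cform]
      simp only [acomm, bcomm, ccomm, hVa, hZb, hcc, e1, inner_add_left, Finset.sum_add_distrib]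
      simp only [real_inner_comm]
      rfl
    rw [e]
    refine key.trans ?_
    have : 101376 * A * K ^ 7 ≤ L := hconst 101376 7 (by norm_num) (by norm_num) (by norm_num)
    have hE := S.energy_nonneg (q - ub)
    calc _ = 101376 * A * K ^ 7 * h * P * S.energy (q - ub) := by
          rw [Discretization.energy]
          change _ = 101376 * A * K ^ 7 * h * P
            * (∑ k, ‖M.gradOp k (q - ub)‖ + ‖residualOp hM (q - ub)‖)
          ring
      _ ≤ _ := by gcongr
  -- the weak equation for `u`, tested with the dual solution
  have hweak : S.cform (hu.1.1.toLp u) (fun i => (hu.2 i).1.toLp (weakPartial Ω i u))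
      (hΦ.1.1.toLp Φ) (fun i => (hΦ.2 i).1.toLp (weakPartial Ω i Φ))
      = inner ℝ (hf.toLp f) (hΦ.1.1.toLp Φ) := by
    rw [hcform, inner_toLp, inner_toLp, ← hdiv.of_memH10 hΩ.2.2.1
      (fun i => (hW i).1.memLp) hRm hf hΦ0]
    congr 1
    exact Finset.sum_congr rfl fun i _ => inner_toLp _ _
  have h288 : 288 * A * K ^ 2 ≤ L := hconst 288 2 (by norm_num) (by norm_num) (by norm_num)
  have hfinal : 144 * K ^ 2 * h ^ 2 * U * (2 * A * P) ≤ L * h ^ 2 * U * P := by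
    calc _ = 288 * A * K ^ 2 * h ^ 2 * U * P := by ring
      _ ≤ _ := by gcongr
  -- the weak gradient of the edge averages is the mean of the gradient, and the error of means is of
  -- second order against the weakly differentiable dual fluxes
  have ha : ∀ i, |inner ℝ (S.a (S.G i q - (hu.2 i).1.toLp (weakPartial Ω i u)))
      ((hΦ.2 i).1.toLp (weakPartial Ω i Φ))| ≤ L * h ^ 2 * U * P := fun i => by
    have e : S.G i q = _ := gradOp_edgeMeans hΩ hM (hu.1.hasWeakGrad hΩ.1) i
    rw [acomm, hVa, e]
    exact (abs_inner_means_sub_le hΩ hM hK0 (hg2 i) (hV i).1 hU0 (n3 i) (by positivity)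
      (hV i).2).trans hfinal
  have hb : ∀ i, |inner ℝ (S.b i (S.G i q - (hu.2 i).1.toLp (weakPartial Ω i u)))
      (hΦ.1.1.toLp Φ)| ≤ L * h ^ 2 * U * P := fun i => by
    have e : S.G i q = _ := gradOp_edgeMeans hΩ hM (hu.1.hasWeakGrad hΩ.1) i
    rw [bcomm, hZb, e]
    exact (abs_inner_means_sub_le hΩ hM hK0 (hg2 i) (hZ i).1 hU0 (n3 i) (by positivity)
      (hZ i).2).trans hfinal
  have ha' : ∀ i, |inner ℝ (S.a ((hu.2 i).1.toLp (weakPartial Ω i u)))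
      (S.G i (M.edgeMeans x₀ Φ fun i => weakPartial Ω i Φ) - (hΦ.2 i).1.toLp (weakPartial Ω i Φ))|
      ≤ L * h ^ 2 * U * P := fun i => by
    have e : S.G i (M.edgeMeans x₀ Φ fun i => weakPartial Ω i Φ) = _ := gradOp_edgeMeans hΩ hM hΦ1 i
    rw [hWa, e, real_inner_comm]
    refine (abs_inner_means_sub_le hΩ hM hK0 (hΦ2 i) (hW i).1 hP0 (m3 i) (by positivity)
      (hW i).2).trans (le_of_eq_of_le ?_ hfinal)
    ring
  rw [l2Error_eq hΩ hM hu.1.1]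
  exact Discretization.error_le hS h0 hqa hh hfn (hsch _ heW) hcons hqΦ (hsch _ hqΦW) hPs hcons'
    hweak ha hb ha'

end PolyMesh

end

end SWG

theorem mainTheorem4 (Ω : Set SWG.E) (hΩ : SWG.IsPolygonalDomain Ω)
    (α : SWG.E → ℝ) (β : SWG.E → SWG.E) (c : SWG.E → ℝ)
    (hα : SWG.IsC1Closure Ω α) (hβ : SWG.IsC1Closure Ω β)
    (hc : MemLp c ⊤ (volume.restrict Ω))
    (hpos : ∀ᵐ x ∂(volume.restrict Ω), 0 ≤ c x - (1 / 2 : ℝ) * SWG.divergence β x)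
    (α₀ : ℝ) (hα₀ : 0 < α₀) (hell : ∀ x ∈ Ω, α₀ ≤ α x)
    (hreg : SWG.AdjointH2Regular Ω α β c)
    (κ : ℝ) (hκ : 0 < κ) (ρ : ℝ) (hρ : 0 < ρ) :
    ∃ h₀ > (0 : ℝ), ∃ C > (0 : ℝ), ∀ M : SWG.PolyMesh Ω, M.ShapeRegular ρ → M.meshSize ≤ h₀ →
      ∀ u f g : SWG.E → ℝ, SWG.MemH2 Ω u → MemLp f 2 (volume.restrict Ω) →
        SWG.SolvesPDE Ω α β c f u → SWG.HasTrace Ω u g →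
        ∀ ub : M.EdgeFun, M.IsSWGSolution κ α β c f g ub →
          M.l2Error u ub ≤ C * M.meshSize ^ 2 * SWG.h2Norm Ω u := by
  obtain ⟨A, hA⟩ := SWG.exists_coeffBound hΩ.1 hΩ.2.2.1 hα hβ hc
  obtain ⟨C, hC⟩ := hreg
  have hA1 := hA.one_le
  have hK8 : 0 < ρ⁻¹ ^ 8 := by positivity
  have hAK : 0 < 110000 * A * ρ⁻¹ ^ 8 := by positivity
  have hC0 := abs_nonneg C
  have hC1 := le_abs_self C
  -- `L` bounds the constants of all estimates from above, `μ` the coercivity constants from below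
  obtain ⟨L, hL⟩ : ∃ L, L = 110000 * A * ρ⁻¹ ^ 8 + κ + |C| := ⟨_, rfl⟩
  have hL0 : 0 < L := by linarith
  obtain ⟨μ, hμ⟩ : ∃ μ, μ = min κ α₀ := ⟨_, rfl⟩
  have hμ0 : 0 < μ := hμ ▸ lt_min hκ hα₀
  have hL₁ : 0 < L ^ 4 * (1 + 18 * L ^ 2 / μ) := by positivity
  refine ⟨(50 * L ^ 4 * (1 + 18 * L ^ 2 / μ))⁻¹, by positivity,
    51 * L ^ 4 * (1 + 18 * L ^ 2 / μ), by positivity, ?_⟩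
  intro M hM hh u f g hu hf hpde htr ub hub
  choose x₀ hx₀ using fun t => (hM t).exists_regular hρ
  -- the edges have length at least `ρ` times the diameter, hence `ρ ≤ 1`; some element exists
  have hK : 1 ≤ ρ⁻¹ := by
    obtain ⟨x, hx⟩ := hΩ.2.1.nonempty
    have hx' := subset_closure hx
    rw [← M.cover, mem_iUnion] at hx'
    exact (hx₀ hx'.choose).one_le
  refine M.l2Error_le hΩ hA hx₀ hK hμ0 (hμ ▸ min_le_left _ _)
    (fun x hx => hμ ▸ (min_le_right κ α₀).trans (hell x hx)) (by linarith) (by linarith)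
    (by linarith) hC ?_ hu hf hpde htr hub
  have := mul_le_mul_of_nonneg_left hh (show 0 ≤ 50 * L ^ 4 * (1 + 18 * L ^ 2 / μ) by positivity)
  rwa [mul_inv_cancel₀ (by positivity)] at this
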